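/- Let $(M,\omega)$ be a compact symplectic manifold without boundary, of dimension $2n$, and let $L$ be a compact connected $n$-manifold without boundary. A smooth path of Lagrangian submanifolds is a family $t\mapsto\Lambda_t\subset M$ with $\Lambda_t=\iota_t(L)$ for some smooth map $\mathbb R\times L\to M$, $(t,q)\mapsto\iota_t(q)$, such that each $\iota_t$ is a Lagrangian embedding; its derivative is represented by the $1$-form $\alpha_t=\omega(\partial_t\iota_t,d\iota_t\,\cdot)$ on $L$. An exact Lagrangian loop is such a path with $\Lambda_{t+1}=\Lambda_t$ and all $\alpha_t$ exact; it is identified with the submanifold $\Lambda=\{(e^{2\pi it},z)\mid t\in\mathbb R,\ z\in\Lambda_t\}$ of $S^1\times M$. Its Hofer length is $\ell(\Lambda)=\int_0^1(\max h_t-\min h_t)\,dt$, where $dh_t=\alpha_t$. Two exact Lagrangian loops $\Lambda,\Lambda'$ are Hamiltonian isotopic, $\Lambda\sim\Lambda'$, if there is a smooth family $\Lambda_{s,t}=\iota_{s,t}(L)$, $0\le s\le1$, such that $t\mapsto\Lambda_{s,t}$ is an exact Lagrangian loop for every $s$, $\Lambda_{0,t}=\Lambda_t$, $\Lambda_{1,t}=\Lambda'_t$,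 and $\omega(\partial_s\iota_{s,t},d\iota_{s,t}\,\cdot)$ is exact for all $s,t$. Put $\nu(\Lambda)=\inf_{\Lambda'\sim\Lambda}\ell(\Lambda')$. Let $D\subset\mathbb C$ be the closed unit disc, with coordinate $x+iy$. Let $\mathcal T(\Lambda)$ be the set of $2$-forms on $D\times M$ of the form $$\tau=\omega+dF\wedge dx+dG\wedge dy+(\partial_xG-\partial_yF+c)\,dx\wedge dy$$ that vanish on $T\Lambda$, where $F,G:D\times M\to\mathbb R$ and $c:D\to\mathbb R$ are smooth, $dF,dG$ are the differentials along $M$, and $\int_MF_{x,y}\,\omega^n=\int_MG_{x,y}\,\omega^n=0$ for all $x+iy\in D$. The curvature of $\tau$ is $\Omega_\tau=\{F,G\}+\partial_yF-\partial_xG$, where $\{F,G\}=\omega(X_F,X_G)$ and $\iota(X_F)\omega=dF$, its Hofer norm is $\|\Omega_\tau\|=\int_D(\max_M\Omega_\tau-\min_M\Omega_\tau)\,dx\,dy$, and the relative K-area is $\chi(\Lambda)=\inf_{\tau\in\mathcal T(\Lambda)}\|\Omega_\tau\|$. Let $\sigma=\frac1\pi[dx\wedge dy]\in H^2(D\times M,\Lambda;\mathbb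 R)$. For $\tau_0\in\mathcal T(\Lambda)$ let $\varepsilon^+(\tau_0,\Lambda)\in[-\infty,\infty]$ be the infimum of all $s\in\mathbb R$ such that $[\tau_0]+s\sigma=[\tau]$ in $H^2(D\times M,\Lambda;\mathbb R)$ for some $\tau\in\mathcal T(\Lambda)$ with $\tau^{n+1}>0$, and let $\varepsilon^-(\tau_0,\Lambda)\in[-\infty,\infty]$ be the supremum of all $s\in\mathbb R$ such that $[\tau_0]+s\sigma=[\tau]$ for some $\tau\in\mathcal T(\Lambda)$ with $\tau^{n+1}<0$; here $\tau^{n+1}>0$ (resp. $<0$) means $\tau^{n+1}=f\,dx\wedge dy\wedge\omega^n$ with $f>0$ (resp. $f<0$) on $D\times M$. Then, for every exact Lagrangian loop $\Lambda$, $$\chi(\Lambda)=\nu(\Lambda),$$ and for every $\tau_0\in\mathcal T(\Lambda)$ one has $\varepsilon^+(\tau_0,\Lambda)<\infty$, $\varepsilon^-(\tau_0,\Lambda)>-\infty$, and the width $\varepsilon(\Lambda)=\varepsilon^+(\tau_0,\Lambda)-\varepsilon^-(\tau_0,\Lambda)$ of the nonsymplectic interval satisfies $$\varepsilon(\Lambda)\le\chi(\Lambda).$$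 -/

import Mathlib

open MeasureTheory Set
open scoped Manifold ContDiff Topology

noncomputable section

/-! ### Differential forms on manifolds without boundary -/

section Forms

/-- A (not necessarily smooth) differential `k`-form on the manifold `X`. -/
abbrev DForm {E H : Type*} [NormedAddCommGroup E] [NormedSpace ℝ E] [TopologicalSpace H]
    (J : ModelWithCorners ℝ E H) (X : Type*) [TopologicalSpace X] [ChartedSpace H X] (k : ℕ) :
    Type _ :=
  (x : X) → (TangentSpace J x) [⋀^Fin k]→L[ℝ] ℝ

variable {E H : Type*} [NormedAddCommGroup E] [NormedSpace ℝ E] [TopologicalSpace H]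
  {J : ModelWithCorners ℝ E H} {X : Type*} [TopologicalSpace X] [ChartedSpace H X]
  {E' H' : Type*} [NormedAddCommGroup E'] [NormedSpace ℝ E'] [TopologicalSpace H']
  {J' : ModelWithCorners ℝ E' H'} {Y : Type*} [TopologicalSpace Y] [ChartedSpace H' Y]

/-- The pullback `f^* θ` of a differential form. -/
def DForm.pullback {k : ℕ} (θ : DForm J' Y k) (f : X → Y) : DForm J X k :=
  fun x => (θ (f x)).compContinuousLinearMap (mfderiv J J' f x)

/-- The expression of a form in the preferred chart at `x₀`: the pullback under the inverse
chart. It is meaningful on the target of the chart. -/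
def DForm.inChart {k : ℕ} (θ : DForm J X k) (x₀ : X) (y : E) : E [⋀^Fin k]→L[ℝ] ℝ :=
  (θ ((extChartAt J x₀).symm y)).compContinuousLinearMap
    (mfderiv 𝓘(ℝ, E) J (extChartAt J x₀).symm y)

/-- A form is smooth if its expression in every chart is smooth. -/
def DForm.IsSmooth {k : ℕ} (θ : DForm J X k) : Prop :=
  ∀ x₀ : X, ContDiffOn ℝ ∞ (θ.inChart x₀) (extChartAt J x₀).target

/-- The exterior derivative, computed at `x` in the preferred chart at `x`. -/
def DForm.extd {k : ℕ} (θ : DForm J X k) : DForm J X (k + 1) :=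
  fun x => (extDeriv (θ.inChart x) (extChartAt J x x)).compContinuousLinearMap
    (mfderiv J 𝓘(ℝ, E) (extChartAt J x) x)

end Forms

section LinearAlgebra

variable {V : Type*} [AddCommGroup V] [Module ℝ V] [TopologicalSpace V]

/-- The wedge product `α ∧ β` of two covectors: `(u, v) ↦ α u * β v - α v * β u`. -/
def wedgeCovectors (α β : V →L[ℝ] ℝ) : V [⋀^Fin 2]→L[ℝ] ℝ :=
  { toFun := fun v => α (v 0) * β (v 1) - α (v 1) * β (v 0)
    map_update_add' := by
      intro _ v i x y
      fin_cases i <;> simp <;> ring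
    map_update_smul' := by
      intro _ v i c x
      fin_cases i <;> simp <;> ring
    cont := by fun_prop
    map_eq_zero_of_eq' := by
      intro v i j h hij
      have h01 : v 0 = v 1 := by
        fin_cases i <;> fin_cases j <;> simp_all
      simp [h01] }

/-- The value of the `k`-fold wedge power `θ ∧ ⋯ ∧ θ` of a 2-form on `2k` vectors. -/
def wedgePow (k : ℕ) (θ : V [⋀^Fin 2]→L[ℝ] ℝ) (v : Fin (2 * k) → V) : ℝ :=
  (1 / 2 ^ k) * ∑ π : Equiv.Perm (Fin (2 * k)), ((Equiv.Perm.sign π : ℤ) : ℝ) *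
    ∏ i : Fin k, θ ![v (π ⟨2 * i, by omega⟩), v (π ⟨2 * i + 1, by omega⟩)]

/-- A nondegenerate 2-form on a finite-dimensional space identifies vectors with covectors. -/
theorem exists_dual_of_nondegenerate [FiniteDimensional ℝ V] (θ : V [⋀^Fin 2]→L[ℝ] ℝ)
    (hθ : ∀ u, (∀ v, θ ![u, v] = 0) → u = 0) (a : V →ₗ[ℝ] ℝ) :
    ∃ u, ∀ v, θ ![u, v] = a v := by
  have add0 : ∀ u u' v, θ ![u + u', v] = θ ![u, v] + θ ![u', v] := fun u u' v =>
    θ.toMultilinearMap.cons_add ![v] u u'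
  have smul0 : ∀ (c : ℝ) u v, θ ![c • u, v] = c * θ ![u, v] := fun c u v =>
    θ.toMultilinearMap.cons_smul ![v] c u
  have swap : ∀ u v, θ ![u, v] = -θ ![v, u] := by
    intro u v
    have h := θ.toAlternatingMap.map_swap ![v, u] (show (0 : Fin 2) ≠ 1 by decide)
    have e : (![v, u] ∘ Equiv.swap (0 : Fin 2) 1) = ![u, v] := by
      funext i
      fin_cases i <;> simp
    rw [e] at h
    exact h
  let B : V →ₗ[ℝ] V →ₗ[ℝ] ℝ := LinearMap.mk₂ ℝ (fun u v => θ ![u, v]) add0 smul0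
    (fun u v v' => by rw [swap u, add0, swap u v, swap u v']; ring)
    (fun c u v => by rw [swap u, smul0, swap u v, smul_eq_mul]; ring)
  have inj : Function.Injective B := by
    rw [injective_iff_map_eq_zero]
    intro u hu
    exact hθ u fun v => LinearMap.congr_fun hu v
  have surj : Function.Surjective B :=
    (LinearMap.injective_iff_surjective_of_finrank_eq_finrank
      (Subspace.dual_finrank_eq (K := ℝ) (V := V)).symm).1 inj
  obtain ⟨u, hu⟩ := surj a
  exact ⟨u, fun v => LinearMap.congr_fun hu v⟩

end LinearAlgebra

/-- `max f - min f`, for a continuous function `f` on a nonempty compact space. -/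
def osc {X : Type*} (f : X → ℝ) : ℝ := (⨆ x, f x) - ⨅ x, f x

/-! ### Symplectic manifolds -/

/-- A symplectic form on a `2n`-dimensional manifold. -/
structure SymplecticForm (n : ℕ) (M : Type*) [TopologicalSpace M]
    [ChartedSpace (EuclideanSpace ℝ (Fin (2 * n))) M] where
  form : DForm (𝓡 (2 * n)) M 2
  smooth : form.IsSmooth
  closed : form.extd = 0
  nondegenerate : ∀ (m : M) (u : TangentSpace (𝓡 (2 * n)) m),
    (∀ v : TangentSpace (𝓡 (2 * n)) m, form m ![u, v] = 0) → u = 0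

section Symplectic

variable {n : ℕ} {M : Type*} [TopologicalSpace M]
  [ChartedSpace (EuclideanSpace ℝ (Fin (2 * n))) M]

theorem SymplecticForm.exists_dual (ω₀ : SymplecticForm n M) (m : M)
    (a : TangentSpace (𝓡 (2 * n)) m →L[ℝ] ℝ) :
    ∃ u : TangentSpace (𝓡 (2 * n)) m,
      ∀ v : TangentSpace (𝓡 (2 * n)) m, ω₀.form m ![u, v] = a v :=
  haveI : FiniteDimensional ℝ (TangentSpace (𝓡 (2 * n)) m) :=
    inferInstanceAs (FiniteDimensional ℝ (EuclideanSpace ℝ (Fin (2 * n))))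
  exists_dual_of_nondegenerate (ω₀.form m) (ω₀.nondegenerate m) a.toLinearMap

/-- The Hamiltonian vector field `X_f` of `f`, with the convention `ι(X_f) ω₀ = df`. -/
def SymplecticForm.hamVec (ω₀ : SymplecticForm n M) (f : M → ℝ) (m : M) :
    TangentSpace (𝓡 (2 * n)) m :=
  (ω₀.exists_dual m (mfderiv (𝓡 (2 * n)) 𝓘(ℝ, ℝ) f m)).choose

/-- The Poisson bracket `{f, g} = ω₀(X_f, X_g)`; it satisfies
`n df ∧ dg ∧ ω₀^(n-1) = {f, g} ω₀^n`. -/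
def SymplecticForm.poisson (ω₀ : SymplecticForm n M) (f g : M → ℝ) (m : M) : ℝ :=
  ω₀.form m ![ω₀.hamVec f m, ω₀.hamVec g m]

/-- The measure on `M` given by the volume form `ω₀^n`. In each chart it has the density
`|ω₀^n(∂₁, …, ∂₂ₙ)|` with respect to Lebesgue measure; these measures on the chart domains agree
on overlaps, and the measure on `M` is their supremum. -/
def SymplecticForm.liouville [MeasurableSpace M] (ω₀ : SymplecticForm n M) : Measure M :=
  ⨆ x₀ : M, Measure.map (extChartAt (𝓡 (2 * n)) x₀).symm
    ((volume.restrict (extChartAt (𝓡 (2 * n)) x₀).target).withDensity fun y =>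
      ENNReal.ofReal |wedgePow n (ω₀.form.inChart x₀ y)
        (fun i => EuclideanSpace.basisFun (Fin (2 * n)) ℝ i)|)

end Symplectic

/-! ### Lagrangian loops, exactness, Hofer length -/

section Loops

variable {n : ℕ} {M : Type*} [TopologicalSpace M]
  [ChartedSpace (EuclideanSpace ℝ (Fin (2 * n))) M] (ω₀ : SymplecticForm n M)
  (L : Type*) [TopologicalSpace L] [ChartedSpace (EuclideanSpace ℝ (Fin n)) L]

/-- `i : L → M` is a Lagrangian embedding. -/
structure IsLagrangianEmbedding {L : Type*} [TopologicalSpace L]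
    [ChartedSpace (EuclideanSpace ℝ (Fin n)) L] (i : L → M) : Prop where
  smooth : ContMDiff (𝓡 n) (𝓡 (2 * n)) ∞ i
  isEmbedding : Topology.IsEmbedding i
  immersive : ∀ q, Function.Injective (mfderiv (𝓡 n) (𝓡 (2 * n)) i q)
  isotropic : (ω₀.form.pullback i : DForm (𝓡 n) L 2) = 0

/-- `ι` is a smooth family of Lagrangian embeddings of `L` with images `Λ_t`. A path of
Lagrangian submanifolds is smooth if there is such a family. -/
structure IsLift {L : Type*} [TopologicalSpace L] [ChartedSpace (EuclideanSpace ℝ (Fin n)) L]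
    (Λ : ℝ → Set M) (ι : ℝ → L → M) : Prop where
  smooth : ContMDiff (𝓘(ℝ, ℝ).prod (𝓡 n)) (𝓡 (2 * n)) ∞ (fun p : ℝ × L => ι p.1 p.2)
  lagrangian : ∀ t, IsLagrangianEmbedding ω₀ (ι t)
  range_eq : ∀ t, range (ι t) = Λ t

/-- `h` is a smooth primitive of the 1-form `ω₀(∂_t ι_t, dι_t ·)` on `L`, which represents the
derivative of the path `t ↦ ι_t(L)`. -/
def IsPrimitiveOfVelocity {L : Type*} [TopologicalSpace L]
    [ChartedSpace (EuclideanSpace ℝ (Fin n)) L] (ι : ℝ → L → M) (t : ℝ) (h : L → ℝ) : Prop :=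
  ContMDiff (𝓡 n) 𝓘(ℝ, ℝ) ∞ h ∧
    ∀ (q : L) (v : TangentSpace (𝓡 n) q),
      (mfderiv (𝓡 n) 𝓘(ℝ, ℝ) h q v : ℝ) =
        ω₀.form (ι t q) ![mfderiv 𝓘(ℝ, ℝ) (𝓡 (2 * n)) (fun s => ι s q) t (1 : ℝ),
          mfderiv (𝓡 n) (𝓡 (2 * n)) (ι t) q v]

/-- `Λ` is a loop of Lagrangian submanifolds diffeomorphic to `L` whose derivative is exact at
all times. -/
structure IsExactLagrangianLoop (Λ : ℝ → Set M) : Prop where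
  periodic : ∀ t, Λ (t + 1) = Λ t
  exists_exact_lift : ∃ ι : ℝ → L → M, IsLift ω₀ Λ ι ∧
    ∀ t, ∃ h : L → ℝ, IsPrimitiveOfVelocity ω₀ ι t h

/-- Hamiltonian isotopy of exact Lagrangian loops: a smooth family `Λ_{s,t}`, `0 ≤ s ≤ 1`, of
exact Lagrangian loops from `Λ` to `Λ'` with `∂_s Λ_{s,t}` exact. -/
structure AreHamiltonianIsotopic (Λ Λ' : ℝ → Set M) : Prop where
  left : IsExactLagrangianLoop ω₀ L Λ
  right : IsExactLagrangianLoop ω₀ L Λ'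
  exists_isotopy : ∃ ι : ℝ → ℝ → L → M,
    ContMDiff (𝓘(ℝ, ℝ).prod (𝓘(ℝ, ℝ).prod (𝓡 n))) (𝓡 (2 * n)) ∞
      (fun p : ℝ × ℝ × L => ι p.1 p.2.1 p.2.2) ∧
    (∀ s ∈ Icc (0 : ℝ) 1, ∀ t, IsLagrangianEmbedding ω₀ (ι s t)) ∧
    (∀ t, range (ι 0 t) = Λ t) ∧
    (∀ t, range (ι 1 t) = Λ' t) ∧
    (∀ s ∈ Icc (0 : ℝ) 1, IsExactLagrangianLoop ω₀ L (fun t => range (ι s t))) ∧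
    ∀ s ∈ Icc (0 : ℝ) 1, ∀ t, ∃ h : L → ℝ, IsPrimitiveOfVelocity ω₀ (fun s' => ι s' t) s h

/-- The norm `‖∂_t Λ_t‖ = max h - min h`, where `h` is a primitive of `∂_t Λ_t`. For an exact
path and connected `L` the set below has exactly one element. -/
def velocityNorm (Λ : ℝ → Set M) (t : ℝ) : ℝ :=
  sSup {r | ∃ (ι : ℝ → L → M) (h : L → ℝ),
    IsLift ω₀ Λ ι ∧ IsPrimitiveOfVelocity ω₀ ι t h ∧ r = osc h}

/-- The Hofer length of an exact Lagrangian loop. -/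
def hoferLength (Λ : ℝ → Set M) : ℝ := ∫ t in (0 : ℝ)..1, velocityNorm ω₀ L Λ t

/-- The infimum of the Hofer length over the Hamiltonian isotopy class of `Λ`. -/
def minimalLength (Λ : ℝ → Set M) : EReal :=
  ⨅ (Λ' : ℝ → Set M) (_ : AreHamiltonianIsotopic ω₀ L Λ Λ'), (hoferLength ω₀ L Λ' : EReal)

/-- The parametrization `(t, q) ↦ (e^{2πit}, ι_t(q))` of the submanifold `Λ` of `ℂ × M`. -/
def traceMap {L : Type*} (ι : ℝ → L → M) (p : ℝ × L) : ℂ × M :=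
  (Complex.exp (2 * Real.pi * Complex.I * p.1), ι p.1 p.2)

/-- The form `θ` vanishes on `TΛ`, where `Λ = {(e^{2πit}, z) | z ∈ Λ_t}`. -/
def VanishesOn (Λ : ℝ → Set M) {k : ℕ} (θ : DForm (𝓘(ℝ, ℂ).prod (𝓡 (2 * n))) (ℂ × M) k) :
    Prop :=
  ∀ ι : ℝ → L → M, IsLift ω₀ Λ ι →
    (θ.pullback (traceMap ι) : DForm (𝓘(ℝ, ℝ).prod (𝓡 n)) (ℝ × L) k) = 0

end Loops

/-! ### Hamiltonian connections over the disc -/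

/-- The closed unit disc. -/
abbrev unitDisc : Set ℂ := Metric.closedBall 0 1

section Connections

variable {n : ℕ} {M : Type*} [TopologicalSpace M]
  [ChartedSpace (EuclideanSpace ℝ (Fin (2 * n))) M]

/-- The form `dx ∧ dy` on `ℂ × M`. -/
def baseAreaForm : DForm (𝓘(ℝ, ℂ).prod (𝓡 (2 * n))) (ℂ × M) 2 :=
  fun p => wedgeCovectors
    (Complex.reCLM ∘L mfderiv (𝓘(ℝ, ℂ).prod (𝓡 (2 * n))) 𝓘(ℝ, ℂ) Prod.fst p)
    (Complex.imCLM ∘L mfderiv (𝓘(ℝ, ℂ).prod (𝓡 (2 * n))) 𝓘(ℝ, ℂ) Prod.fst p)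

/-- The pullback of `ω₀` to `ℂ × M`. -/
def fibreForm (ω₀ : SymplecticForm n M) : DForm (𝓘(ℝ, ℂ).prod (𝓡 (2 * n))) (ℂ × M) 2 :=
  ω₀.form.pullback Prod.snd

/-- The fibrewise differential of `F`, extended to `ℂ × M` by zero on the base directions. -/
def fibreDiff (F : ℂ × M → ℝ) (p : ℂ × M) :
    TangentSpace (𝓘(ℝ, ℂ).prod (𝓡 (2 * n))) p →L[ℝ] ℝ :=
  mfderiv (𝓡 (2 * n)) 𝓘(ℝ, ℝ) (fun m => F (p.1, m)) p.2 ∘L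
    mfderiv (𝓘(ℝ, ℂ).prod (𝓡 (2 * n))) (𝓡 (2 * n)) Prod.snd p

/-- The partial derivative of `F` at `(x + iy, m)` in the base direction `w` (`w = 1` for `∂_x`,
`w = i` for `∂_y`). -/
def baseDeriv (F : ℂ × M → ℝ) (w : ℂ) (p : ℂ × M) : ℝ :=
  fderiv ℝ (fun z => F (z, p.2)) p.1 w

/-- The data `F, G, c` of a Hamiltonian connection 2-form on `D × M`, where `D` is the closed unit
disc. Smooth functions on `D × M` and `D` are given through smooth extensions to `ℂ × M`
and `ℂ`. -/
structure HamiltonianConnection [MeasurableSpace M] (ω₀ : SymplecticForm n M) where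
  F : ℂ × M → ℝ
  G : ℂ × M → ℝ
  c : ℂ → ℝ
  smooth_F : ContMDiff (𝓘(ℝ, ℂ).prod (𝓡 (2 * n))) 𝓘(ℝ, ℝ) ∞ F
  smooth_G : ContMDiff (𝓘(ℝ, ℂ).prod (𝓡 (2 * n))) 𝓘(ℝ, ℝ) ∞ G
  smooth_c : ContDiff ℝ ∞ c
  mean_F : ∀ z ∈ unitDisc, ∫ m, F (z, m) ∂ω₀.liouville = 0
  mean_G : ∀ z ∈ unitDisc, ∫ m, G (z, m) ∂ω₀.liouville = 0

variable [MeasurableSpace M] {ω₀ : SymplecticForm n M}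

/-- The connection 2-form `τ = ω₀ + dF ∧ dx + dG ∧ dy + (∂_x G - ∂_y F + c) dx ∧ dy`. -/
def HamiltonianConnection.form (τ : HamiltonianConnection ω₀) :
    DForm (𝓘(ℝ, ℂ).prod (𝓡 (2 * n))) (ℂ × M) 2 :=
  fun p => fibreForm ω₀ p
    + wedgeCovectors (fibreDiff τ.F p)
        (Complex.reCLM ∘L mfderiv (𝓘(ℝ, ℂ).prod (𝓡 (2 * n))) 𝓘(ℝ, ℂ) Prod.fst p)
    + wedgeCovectors (fibreDiff τ.G p)
        (Complex.imCLM ∘L mfderiv (𝓘(ℝ, ℂ).prod (𝓡 (2 * n))) 𝓘(ℝ, ℂ) Prod.fst p)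
    + (baseDeriv τ.G 1 p - baseDeriv τ.F Complex.I p + τ.c p.1) • baseAreaForm p

/-- The curvature `Ω_τ = {F, G} + ∂_y F - ∂_x G`. -/
def HamiltonianConnection.curvature (τ : HamiltonianConnection ω₀) (p : ℂ × M) : ℝ :=
  ω₀.poisson (fun m => τ.F (p.1, m)) (fun m => τ.G (p.1, m)) p.2
    + baseDeriv τ.F Complex.I p - baseDeriv τ.G 1 p

/-- The Hofer norm of the curvature: the integral over `D` of `max_M Ω_τ - min_M Ω_τ`. -/
def HamiltonianConnection.curvatureNorm (τ : HamiltonianConnection ω₀) : ℝ :=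
  ∫ z in unitDisc, osc (fun m => τ.curvature (z, m))

/-- `τ^(n+1) = f dx ∧ dy ∧ ω₀^n` at the points of `D × M`, up to the positive factor `n + 1` that
comes from `(ω₀ + dx ∧ dy)^(n+1) = (n+1) dx ∧ dy ∧ ω₀^n`. -/
def HamiltonianConnection.HasTopDensity (τ : HamiltonianConnection ω₀) (f : ℂ × M → ℝ) : Prop :=
  ∀ p : ℂ × M, p.1 ∈ unitDisc →
    ∀ v : Fin (2 * (n + 1)) → TangentSpace (𝓘(ℝ, ℂ).prod (𝓡 (2 * n))) p,
      wedgePow (n + 1) (τ.form p) v = f p * wedgePow (n + 1) (fibreForm ω₀ p + baseAreaForm p) v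

/-- `τ^(n+1) > 0`. -/
def HamiltonianConnection.IsPositive (τ : HamiltonianConnection ω₀) : Prop :=
  ∃ f : ℂ × M → ℝ, τ.HasTopDensity f ∧ ∀ p : ℂ × M, p.1 ∈ unitDisc → 0 < f p

/-- `τ^(n+1) < 0`. -/
def HamiltonianConnection.IsNegative (τ : HamiltonianConnection ω₀) : Prop :=
  ∃ f : ℂ × M → ℝ, τ.HasTopDensity f ∧ ∀ p : ℂ × M, p.1 ∈ unitDisc → f p < 0

variable (ω₀) (L : Type*) [TopologicalSpace L] [ChartedSpace (EuclideanSpace ℝ (Fin n)) L]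

/-- The set of Hamiltonian connection 2-forms on `D × M` that vanish on `TΛ`. -/
def connectionsPreserving (Λ : ℝ → Set M) : Set (HamiltonianConnection ω₀) :=
  {τ | VanishesOn ω₀ L Λ τ.form}

/-- The relative K-area of an exact Lagrangian loop. -/
def relativeKArea (Λ : ℝ → Set M) : EReal :=
  ⨅ τ ∈ connectionsPreserving ω₀ L Λ, (τ.curvatureNorm : EReal)

/-! ### The nonsymplectic interval -/

/-- Two 2-forms on `D × M` that are closed and vanish on `TΛ` represent the same class in the
relative de Rham cohomology `H²(D × M, Λ; ℝ)` (the cohomology of the complex of forms on `D × M`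
that vanish on `TΛ`). -/
def RelCohomologous (Λ : ℝ → Set M)
    (θ θ' : DForm (𝓘(ℝ, ℂ).prod (𝓡 (2 * n))) (ℂ × M) 2) : Prop :=
  ∃ η : DForm (𝓘(ℝ, ℂ).prod (𝓡 (2 * n))) (ℂ × M) 1,
    η.IsSmooth ∧ VanishesOn ω₀ L Λ η ∧
      ∀ p : ℂ × M, p.1 ∈ unitDisc → θ p - θ' p = η.extd p

/-- `[τ] = [τ₀] + s σ` in `H²(D × M, Λ; ℝ)`, where `σ = [dx ∧ dy / π]`. -/
def ClassesDifferBy (Λ : ℝ → Set M) (τ τ₀ : HamiltonianConnection ω₀) (s : ℝ) : Prop :=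
  RelCohomologous ω₀ L Λ τ.form (fun p => τ₀.form p + s • (Real.pi⁻¹ • baseAreaForm p))

/-- `ε⁺(τ₀, Λ)`: the infimum of the `s` such that `[τ₀] + s σ` is represented by a connection form
`τ` with `τ^(n+1) > 0`. -/
def epsPlus (Λ : ℝ → Set M) (τ₀ : HamiltonianConnection ω₀) : EReal :=
  ⨅ (s : ℝ) (_ : ∃ τ ∈ connectionsPreserving ω₀ L Λ, τ.IsPositive ∧ ClassesDifferBy ω₀ L Λ τ τ₀ s),
    (s : EReal)

/-- `ε⁻(τ₀, Λ)`: the supremum of the `s` such that `[τ₀] + s σ` is represented by a connection form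
`τ` with `τ^(n+1) < 0`. -/
def epsMinus (Λ : ℝ → Set M) (τ₀ : HamiltonianConnection ω₀) : EReal :=
  ⨆ (s : ℝ) (_ : ∃ τ ∈ connectionsPreserving ω₀ L Λ, τ.IsNegative ∧ ClassesDifferBy ω₀ L Λ τ τ₀ s),
    (s : EReal)

/-- The width `ε(Λ) = ε⁺(τ₀, Λ) - ε⁻(τ₀, Λ)` of the nonsymplectic interval, computed with the
reference connection form `τ₀`. -/
def nonsymplecticWidth (Λ : ℝ → Set M) (τ₀ : HamiltonianConnection ω₀) : EReal :=
  epsPlus ω₀ L Λ τ₀ - epsMinus ω₀ L Λ τ₀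

end Connections

end

/-!
A connection form `τ` with components `F`, `G` has in polar coordinates a radial component `K` and
an angular component `N`; its curvature satisfies `2πr Ω = ∂_t K - ∂_r N - {N, K}`
(`polar_curvature`). It vanishes on `TΛ` if and only if `N` at the radius `1` restricts to a
primitive of the velocity of every lift of `Λ` (`HamiltonianConnection.vanishesOn_iff`). These two
facts carry the argument.

**`ν ≤ χ`.** Transport `Λ_t` along the ray of angle `2πt` towards the origin by the Hamiltonian
flow of `K` (`exists_radial_transport`). At each radius this is an exact loop isotopic to `Λ`, and
the primitive of its velocity in `t` changes along the ray by `∂_t K`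
(`IsPrimitiveOfVelocity.evolve`).
Hence the difference between the primitive and `N` grows by `2πr Ω`. It is zero for `r = 1`, and
`N` is zero for `r = 0`, so the loop at the origin has the primitive `-∫ 2πr Ω dr`, and its length
is at most `‖Ω‖` (`exists_isotopic_hoferLength_le`).

**`χ ≤ ν`.** This reverses the construction. Let `Λ'` be isotopic to `Λ`. The isotopy extends to the
Hamiltonian flow on `M` of a family `K`, parametrised by the circle
(`AreHamiltonianIsotopic.exists_flow`), and `Λ'` is generated by functions `h` on `M` with the
oscillation of the velocity (`IsExactLagrangianLoop.exists_generating_function`). For a monotone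
cutoff `β` there is an angular component `N` for which the curvature, transported back by the flow,
is `-β'(r) h / (2πr)` (`exists_angular_component`). Its Hofer norm is the length of `Λ'`, since
`β` increases from `0` to `1`. The components of a connection form have mean value zero on the
fibres. This is achieved by subtracting functions of the base, which does not change the
oscillation of the curvature (`exists_normalized_connection`); the Liouville measure of a compact
manifold is finite (`SymplecticForm.isFiniteMeasure_liouville`).

**`ε ≤ χ`.** A connection form is pointwise the pullback of `ω₀ + dx ∧ dy` under a shear of
determinant `c - Ω`, so `τ^(n+1)` has the sign of `c - Ω`
(`HamiltonianConnection.hasTopDensity`). As `c` does not enter the boundary condition, it may be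
replaced by functions slightly above `max Ω` or slightly below `min Ω`, whose integrals differ by
little more than `‖Ω‖` (`HamiltonianConnection.exists_area_bounds`). For two connection forms that
vanish on `TΛ`, the angular components differ along `Λ_t` by a function `k(t)`, because `L` is
connected, and the classes differ by the multiple `∫ c - ∫ c₀ + ∫ k` of `σ`
(`classesDifferBy_of_angularHam_sub`). The terms `∫ c₀` and `∫ k` cancel in the difference of
`ε⁺` and `ε⁻` (`exists_eps_bounds`).

The analytic basis is the smoothness of flows of vector fields with parameters, obtained from the
implicit function theorem for the integral equation (`exists_smooth_flow`,
`exists_flow_of_compact`), and of primitives of families of exact 1-forms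
(`contMDiff_primitive_family`).
-/

noncomputable section

/-! ### Smooth flows of globally Lipschitz vector fields -/

section Nemytskii

universe u

variable {X : Type*} [TopologicalSpace X] [CompactSpace X]
  {E G : Type u} [NormedAddCommGroup E] [NormedSpace ℝ E] [NormedAddCommGroup G] [NormedSpace ℝ G]

/-- The continuous bilinear pairing that evaluates a continuous family of operators on a continuous
family of vectors. -/
def pointwiseApply : C(X, E →L[ℝ] G) →L[ℝ] C(X, E) →L[ℝ] C(X, G) :=
  LinearMap.mkContinuous₂ (LinearMap.mk₂ ℝ
    (fun (A : C(X, E →L[ℝ] G)) (y : C(X, E)) => (⟨fun x => A x (y x), by fun_prop⟩ : C(X, G)))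
    (fun _ _ _ => by ext; simp) (fun _ _ _ => by ext; simp)
    (fun _ _ _ => by ext; simp) (fun _ _ _ => by ext; simp)) 1 (by
    intro A y
    rw [ContinuousMap.norm_le _ (by positivity)]
    intro x
    refine (ContinuousLinearMap.le_opNorm _ _).trans ?_
    rw [one_mul]
    exact mul_le_mul (A.norm_coe_le_norm x) (y.norm_coe_le_norm x) (norm_nonneg _) (norm_nonneg A))

@[simp] theorem pointwiseApply_apply (A : C(X, E →L[ℝ] G)) (y : C(X, E)) (x : X) :
    pointwiseApply A y x = A x (y x) := rfl

theorem norm_pointwiseApply_le (A : C(X, E →L[ℝ] G)) : ‖pointwiseApply (X := X) A‖ ≤ ‖A‖ := by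
  refine ContinuousLinearMap.opNorm_le_bound _ (norm_nonneg A) fun y => ?_
  rw [ContinuousMap.norm_le _ (mul_nonneg (norm_nonneg A) (norm_nonneg y))]
  intro x
  refine (ContinuousLinearMap.le_opNorm _ _).trans ?_
  exact mul_le_mul (A.norm_coe_le_norm x) (y.norm_coe_le_norm x) (norm_nonneg _) (norm_nonneg A)

/-- The superposition operator `y ↦ f ∘ y` on continuous functions is differentiable when `f` is
continuously differentiable. -/
theorem hasFDerivAt_superposition {f : E → G} (hf : ContDiff ℝ 1 f) (y : C(X, E)) :
    HasFDerivAt (fun y : C(X, E) => (⟨f, hf.continuous⟩ : C(E, G)).comp y)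
      (pointwiseApply ((⟨fderiv ℝ f, hf.continuous_fderiv one_ne_zero⟩ :
        C(E, E →L[ℝ] G)).comp y)) y := by
  rw [hasFDerivAt_iff_isLittleO, Asymptotics.isLittleO_iff]
  intro ε hε
  set g : C(E, E →L[ℝ] G) := ⟨fderiv ℝ f, hf.continuous_fderiv one_ne_zero⟩
  have hcont : Continuous (fun z : C(X, E) => g.comp z) := ContinuousMap.continuous_postcomp g
  obtain ⟨δ, hδ, hδ'⟩ :=
    (Metric.continuous_iff (α := C(X, E)) (β := C(X, E →L[ℝ] G))).1 hcont y ε hε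
  filter_upwards [Metric.ball_mem_nhds y hδ] with z hz
  rw [ContinuousMap.norm_le _ (by positivity)]
  intro x
  have hzx : ‖z x - y x‖ < δ := by
    refine lt_of_le_of_lt ?_ (mem_ball_iff_norm.1 hz)
    exact (z - y).norm_coe_le_norm x
  have hb : ∀ w ∈ Metric.ball (y x) δ, ‖fderiv ℝ f w - fderiv ℝ f (y x)‖ ≤ ε := by
    intro w hw
    have h1 : dist (y + ContinuousMap.const X (w - y x)) y < δ := by
      rw [dist_eq_norm, add_sub_cancel_left]
      refine lt_of_le_of_lt ?_ (mem_ball_iff_norm.1 hw)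
      rw [ContinuousMap.norm_le _ (norm_nonneg _)]
      intro a
      simp
    have h2 := (hδ' _ h1).le
    have h3 := (ContinuousMap.dist_apply_le_dist x).trans h2
    rw [dist_eq_norm] at h3
    simpa [g] using h3
  have := (convex_ball (y x) δ).norm_image_sub_le_of_norm_hasFDerivWithin_le'
    (f := f) (f' := fderiv ℝ f) (φ := fderiv ℝ f (y x)) (C := ε)
    (fun w _ => ((hf.differentiable one_ne_zero) w).hasFDerivAt.hasFDerivWithinAt) hb
    (Metric.mem_ball_self hδ) (mem_ball_iff_norm.2 hzx)
  refine this.trans ?_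
  exact mul_le_mul_of_nonneg_left ((z - y).norm_coe_le_norm x) hε.le

theorem contDiff_superposition_nat (k : ℕ) {G : Type u} [NormedAddCommGroup G] [NormedSpace ℝ G]
    {f : E → G} (hf : ContDiff ℝ ∞ f) :
    ContDiff ℝ k (fun y : C(X, E) => (⟨f, hf.continuous⟩ : C(E, G)).comp y) := by
  induction k generalizing G with
  | zero =>
    exact contDiff_zero.2 (ContinuousMap.continuous_postcomp _)
  | succ k ih =>
    have h1 : ContDiff ℝ 1 f := hf.of_le (by exact_mod_cast le_top)
    have h2 : ContDiff ℝ ∞ (fderiv ℝ f) := (contDiff_infty_iff_fderiv.1 hf).2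
    rw [show ((k + 1 : ℕ) : ℕ∞ω) = (k : ℕ∞ω) + 1 by norm_cast]
    rw [contDiff_succ_iff_hasFDerivAt]
    have hP : ContDiff ℝ k (fun A : C(X, E →L[ℝ] G) => pointwiseApply (X := X) A) :=
      ContinuousLinearMap.contDiff _
    exact ⟨fun y => pointwiseApply ((⟨fderiv ℝ f, h2.continuous⟩ : C(E, E →L[ℝ] G)).comp y),
      hP.comp (ih h2),
      fun y => hasFDerivAt_superposition h1 y⟩

/-- The superposition operator `y ↦ f ∘ y` on continuous functions is smooth when `f` is. -/
theorem contDiff_superposition {f : E → G} (hf : ContDiff ℝ ∞ f) :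
    ContDiff ℝ ∞ (fun y : C(X, E) => (⟨f, hf.continuous⟩ : C(E, G)).comp y) :=
  contDiff_infty.2 fun k => contDiff_superposition_nat k hf

end Nemytskii

section Flow

theorem eq_of_integralCurves {E : Type*} [NormedAddCommGroup E] [NormedSpace ℝ E]
    {f : E → E} {K : NNReal} (hK : LipschitzWith K f) {γ γ' : ℝ → E}
    (h : ∀ t, HasDerivAt γ (f (γ t)) t) (h' : ∀ t, HasDerivAt γ' (f (γ' t)) t) {t₀ : ℝ}
    (h0 : γ t₀ = γ' t₀) : γ = γ' :=
  ODE_solution_unique_univ (v := fun _ => f) (s := fun _ => univ) (K := K)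
    (fun _ => hK.lipschitzOnWith) (fun t => ⟨h t, trivial⟩) (fun t => ⟨h' t, trivial⟩) h0

universe u

variable {E : Type u} [NormedAddCommGroup E] [NormedSpace ℝ E] [CompleteSpace E]

/-- Integration from `0` as an operator on `C([0, 1], E)`. -/
def primitiveCLM (E : Type*) [NormedAddCommGroup E] [NormedSpace ℝ E] [CompleteSpace E] :
    C(Icc (0 : ℝ) 1, E) →L[ℝ] C(Icc (0 : ℝ) 1, E) :=
  LinearMap.mkContinuous
    { toFun := fun y => ⟨fun τ => ∫ σ in (0 : ℝ)..τ, y (projIcc 0 1 zero_le_one σ), by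
        have : Continuous fun τ : ℝ => ∫ σ in (0 : ℝ)..τ, y (projIcc 0 1 zero_le_one σ) :=
          intervalIntegral.continuous_primitive
            (fun a b => (y.continuous.comp continuous_projIcc).intervalIntegrable a b) 0
        exact this.comp continuous_subtype_val⟩
      map_add' := by
        intro y z
        ext τ
        exact intervalIntegral.integral_add
          ((y.continuous.comp continuous_projIcc).intervalIntegrable _ _)
          ((z.continuous.comp continuous_projIcc).intervalIntegrable _ _)
      map_smul' := by
        intro c y
        ext τ
        exact intervalIntegral.integral_smul c _ } 1 (by
    intro y
    rw [ContinuousMap.norm_le _ (by positivity)]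
    intro τ
    have := intervalIntegral.norm_integral_le_of_norm_le_const (a := (0 : ℝ)) (b := τ)
      (f := fun σ => y (projIcc 0 1 zero_le_one σ)) (C := ‖y‖)
      (fun x _ => y.norm_coe_le_norm _)
    refine this.trans ?_
    rw [sub_zero, mul_comm, abs_of_nonneg τ.2.1]
    exact mul_le_mul_of_nonneg_right τ.2.2 (norm_nonneg _))

theorem norm_primitiveCLM_le : ‖primitiveCLM E‖ ≤ 1 :=
  LinearMap.mkContinuous_norm_le _ zero_le_one _

/-- A globally Lipschitz vector field has a global integral curve through each point. -/
theorem exists_integralCurve_of_lipschitz {f : E → E} {K : NNReal} (hf : ContDiff ℝ 1 f)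
    (hK : LipschitzWith K f) (x : E) :
    ∃ γ : ℝ → E, γ 0 = x ∧ ∀ t, HasDerivAt γ (f (γ t)) t := by
  classical
  have key : ∀ x : E, ∃ γ : ℝ → E, γ 0 = x ∧
      IsMIntegralCurveOn γ (I := 𝓘(ℝ, E)) f (Ioo (-(1 / (K + 1) / 2 : ℝ)) (1 / (K + 1) / 2)) := by
    intro x
    set T : ℝ := 1 / (K + 1) / 2 with hT
    have hT0 : 0 < T := by positivity
    have hpl : IsPicardLindelof (fun _ => f) (tmin := -T) (tmax := T)
        ⟨0, by constructor <;> linarith⟩ x ‖f x‖₊ 0 ((K + 1) * ‖f x‖₊) K := by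
      refine IsPicardLindelof.of_time_independent (fun y hy => ?_) hK.lipschitzOnWith ?_
      · have h1 := hK.dist_le_mul y x
        rw [dist_eq_norm] at h1
        have h2 : ‖f y‖ ≤ ‖f y - f x‖ + ‖f x‖ := by simpa using norm_add_le (f y - f x) (f x)
        have h3 : dist y x ≤ ‖f x‖ := hy
        push_cast
        have h4 : (K : ℝ) * dist y x ≤ K * ‖f x‖ := mul_le_mul_of_nonneg_left h3 K.2
        linarith
      · have : ((K : ℝ) + 1) * T = 1 / 2 := by
          have : (K : ℝ) + 1 ≠ 0 := by positivity
          rw [hT]; field_simp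
        push_cast
        simp only [sub_zero, zero_sub, neg_neg, max_self]
        nlinarith [norm_nonneg (f x)]
    obtain ⟨α, h0, h⟩ := hpl.exists_eq_forall_mem_Icc_hasDerivWithinAt₀
    refine ⟨α, h0, fun t ht => ?_⟩
    have h1 := (h t (Ioo_subset_Icc_self ht)).hasDerivAt (Icc_mem_nhds ht.1 ht.2)
    exact (hasMFDerivAt_iff_hasFDerivAt.2 h1.hasFDerivAt).hasMFDerivWithinAt
  obtain ⟨γ, h0, h⟩ := exists_isMIntegralCurve_of_isMIntegralCurveOn (I := 𝓘(ℝ, E)) (v := f)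
    (contMDiff_vectorSpace_iff_contDiff.2 hf) (ε := 1 / (K + 1) / 2) (by positivity) key x
  refine ⟨γ, h0, fun t => ?_⟩
  have h1 : HasFDerivAt γ (ContinuousLinearMap.smulRight (1 : ℝ →L[ℝ] ℝ) (f (γ t))) t :=
    hasMFDerivAt_iff_hasFDerivAt.1 (h t)
  simpa using h1.hasDerivAt

/-- Near time `0` the flow of a smooth Lipschitz vector field is smooth: the curve
`τ ↦ γ x (ε τ)` in `C([0, 1], E)` solves an equation to which the implicit function theorem
applies. -/
theorem contDiffAt_flow_of_small {f : E → E} {K : NNReal} (hf : ContDiff ℝ ∞ f)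
    (hK : LipschitzWith K f) {γ : E → ℝ → E} (h0 : ∀ x, γ x 0 = x)
    (h : ∀ x t, HasDerivAt (γ x) (f (γ x t)) t) {ε₀ : ℝ} (hε : |ε₀| * K < 1) (x₀ : E) :
    ContDiffAt ℝ ∞ (fun p : ℝ × E => γ p.2 p.1) (ε₀, x₀) := by
  let I := Icc (0 : ℝ) 1
  let N : C(I, E) → C(I, E) := fun y => (⟨f, hf.continuous⟩ : C(E, E)).comp y
  have hN : ContDiff ℝ ∞ N := contDiff_superposition hf
  have hγc : ∀ x, Continuous (γ x) := fun x =>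
    continuous_iff_continuousAt.2 fun t => (h x t).continuousAt
  let Φ : (ℝ × E) × C(I, E) → C(I, E) := fun p =>
    p.2 - ContinuousMap.const I p.1.2 - p.1.1 • primitiveCLM E (N p.2)
  let cst : E →L[ℝ] C(I, E) := ContinuousLinearMap.mk
    { toFun := fun x => ContinuousMap.const I x
      map_add' := fun _ _ => rfl
      map_smul' := fun _ _ => rfl } (by fun_prop)
  have hΦ : ContDiff ℝ ∞ Φ := by
    have h1 : ContDiff ℝ ∞ fun p : (ℝ × E) × C(I, E) => primitiveCLM E (N p.2) :=
      (primitiveCLM E).contDiff.comp (hN.comp contDiff_snd)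
    have h2 : ContDiff ℝ ∞ fun p : (ℝ × E) × C(I, E) => cst p.1.2 :=
      cst.contDiff.comp (contDiff_snd.comp contDiff_fst)
    exact (contDiff_snd.sub h2).sub ((contDiff_fst.comp contDiff_fst).smul h1)
  let Y : ℝ × E → C(I, E) := fun p => ⟨fun τ => γ p.2 (p.1 * τ),
    (hγc p.2).comp (continuous_const.mul continuous_subtype_val)⟩
  have hY : ∀ p, Φ (p, Y p) = 0 := by
    intro p
    ext τ
    have h1 : ∀ σ ∈ uIcc (0 : ℝ) τ, HasDerivAt (fun σ => γ p.2 (p.1 * σ))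
        (p.1 • f (γ p.2 (p.1 * σ))) σ := by
      intro σ _
      have := (h p.2 (p.1 * σ)).scomp σ ((hasDerivAt_id' σ).const_mul p.1)
      rw [mul_one] at this
      exact this
    have h2 := intervalIntegral.integral_eq_sub_of_hasDerivAt h1
      (Continuous.intervalIntegrable (by
        have := hγc p.2
        have := hf.continuous
        fun_prop) _ _)
    have h3 : ∫ σ in (0 : ℝ)..τ, f (Y p (projIcc 0 1 zero_le_one σ))
        = ∫ σ in (0 : ℝ)..τ, f (γ p.2 (p.1 * σ)) := by
      apply intervalIntegral.integral_congr
      intro σ hσ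
      rw [uIcc_of_le τ.2.1] at hσ
      have : projIcc (0 : ℝ) 1 zero_le_one σ = ⟨σ, hσ.1, hσ.2.trans τ.2.2⟩ :=
        projIcc_of_mem _ _
      simp only [this]
      rfl
    change γ p.2 (p.1 * τ) - p.2 - p.1 • (∫ σ in (0 : ℝ)..τ, f (Y p (projIcc 0 1 zero_le_one σ)))
      = 0
    rw [h3, ← intervalIntegral.integral_smul, h2]
    simp [h0]
  -- uniqueness of the solution of the equation for small times
  have huniq : ∀ p : ℝ × E, |p.1| * K < 1 → ∀ y, Φ (p, y) = 0 → y = Y p := by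
    intro p hp y hy
    have e1 : y - Y p = p.1 • primitiveCLM E (N y - N (Y p)) := by
      have h1 : Φ (p, y) - Φ (p, Y p) = 0 := by rw [hy, hY, sub_zero]
      simp only [Φ] at h1
      rw [map_sub, smul_sub, ← sub_eq_zero, ← h1]
      abel
    have e2 : ‖N y - N (Y p)‖ ≤ K * ‖y - Y p‖ := by
      rw [ContinuousMap.norm_le _ (by positivity)]
      intro x
      have := hK.dist_le_mul (y x) (Y p x)
      rw [dist_eq_norm, dist_eq_norm] at this
      exact this.trans (mul_le_mul_of_nonneg_left ((y - Y p).norm_coe_le_norm x) K.2)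
    have e3 : ‖y - Y p‖ ≤ (|p.1| * K) * ‖y - Y p‖ := by
      calc ‖y - Y p‖ = |p.1| * ‖primitiveCLM E (N y - N (Y p))‖ := by
            conv_lhs => rw [e1, norm_smul, Real.norm_eq_abs]
        _ ≤ |p.1| * (1 * ‖N y - N (Y p)‖) := by
            gcongr
            exact (primitiveCLM E).le_of_opNorm_le norm_primitiveCLM_le _
        _ ≤ |p.1| * (1 * (K * ‖y - Y p‖)) := by gcongr
        _ = _ := by ring
    have e4 : ‖y - Y p‖ = 0 := by nlinarith [norm_nonneg (y - Y p)]
    exact sub_eq_zero.1 (norm_eq_zero.1 e4)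
  have hinv : (fderiv ℝ Φ ((ε₀, x₀), Y (ε₀, x₀)) ∘L
      ContinuousLinearMap.inr ℝ (ℝ × E) C(I, E)).IsInvertible := by
    let y₀ := Y (ε₀, x₀)
    let A : C(I, E) →L[ℝ] C(I, E) := ε₀ • (primitiveCLM E ∘L pointwiseApply
      ((⟨fderiv ℝ f, (hf.of_le (by exact_mod_cast le_top)).continuous_fderiv one_ne_zero⟩ :
        C(E, E →L[ℝ] E)).comp y₀))
    have hA : ‖A‖ < 1 := by
      set D : C(I, E →L[ℝ] E) := (⟨fderiv ℝ f, (hf.of_le (by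
        exact_mod_cast le_top)).continuous_fderiv one_ne_zero⟩ : C(E, E →L[ℝ] E)).comp y₀
      have hD : ‖D‖ ≤ K := by
        exact (ContinuousMap.norm_le D K.2).2 fun x => norm_fderiv_le_of_lipschitz ℝ hK
      refine lt_of_le_of_lt (ContinuousLinearMap.opNorm_le_bound A
        (by positivity : 0 ≤ |ε₀| * (K : ℝ)) fun y => ?_) hε
      calc ‖A y‖ = |ε₀| * ‖primitiveCLM E (pointwiseApply D y)‖ := by
            rw [← Real.norm_eq_abs, ← norm_smul]; rfl
        _ ≤ |ε₀| * (1 * (K * ‖y‖)) := by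
            gcongr
            refine (ContinuousLinearMap.le_of_opNorm_le _ norm_primitiveCLM_le _).trans ?_
            gcongr
            exact ContinuousLinearMap.le_of_opNorm_le _ ((norm_pointwiseApply_le D).trans hD) _
        _ = _ := by ring
    have e1 : fderiv ℝ Φ ((ε₀, x₀), y₀) ∘L ContinuousLinearMap.inr ℝ (ℝ × E) C(I, E) = 1 - A := by
      have h1 : HasFDerivAt (fun y : C(I, E) => Φ ((ε₀, x₀), y)) (1 - A) y₀ := by
        have h2 := hasFDerivAt_superposition (X := I) (hf.of_le (by exact_mod_cast le_top)) y₀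
        have h3 := ((primitiveCLM E).hasFDerivAt.comp y₀ h2).const_smul ε₀
        exact ((hasFDerivAt_id y₀).sub_const (ContinuousMap.const I x₀)).sub h3
      have h4 : HasFDerivAt (fun y : C(I, E) => ((ε₀, x₀), y))
          (ContinuousLinearMap.inr ℝ (ℝ × E) C(I, E)) y₀ := hasFDerivAt_prodMk_right _ _
      have h5 := ((hΦ.differentiable (by simp)) ((ε₀, x₀), y₀)).hasFDerivAt.comp y₀ h4
      exact h5.unique h1
    rw [e1]
    obtain ⟨u, hu⟩ := isUnit_one_sub_of_norm_lt_one (x := A) hA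
    exact ⟨ContinuousLinearEquiv.ofUnit u, by ext1 y; rw [← hu]; rfl⟩
  have cdf : ContDiffAt ℝ ∞ Φ ((ε₀, x₀), Y (ε₀, x₀)) := hΦ.contDiffAt
  have hne : (∞ : ℕ∞ω) ≠ 0 := by simp
  have h1 := cdf.eventually_apply_implicitFunction hne hinv
  have h2 := cdf.contDiffAt_implicitFunction hne hinv
  have h3 : ∀ᶠ p : ℝ × E in 𝓝 (ε₀, x₀), |p.1| * K < 1 :=
    (isOpen_lt (by fun_prop) continuous_const).mem_nhds hε
  let ev : C(I, E) →L[ℝ] E := ContinuousMap.evalCLM ℝ (1 : I)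
  refine ((ev.contDiff.contDiffAt).comp _ h2).congr_of_eventuallyEq ?_
  filter_upwards [h1, h3] with p hp hp'
  rw [hY] at hp
  have := huniq p hp' _ hp
  simp only [Function.comp_apply, this]
  simp [ev, Y]

/-- **Smoothness of flows.** A smooth globally Lipschitz vector field has a smooth global flow. -/
theorem exists_smooth_flow {f : E → E} {K : NNReal} (hf : ContDiff ℝ ∞ f) (hK : LipschitzWith K f) :
    ∃ γ : E → ℝ → E, (∀ x, γ x 0 = x) ∧ (∀ x t, HasDerivAt (γ x) (f (γ x t)) t) ∧
      ContDiff ℝ ∞ (fun p : ℝ × E => γ p.2 p.1) := by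
  choose γ h0 h using exists_integralCurve_of_lipschitz (hf.of_le (by exact_mod_cast le_top)) hK
  refine ⟨γ, h0, h, ?_⟩
  have hhalf : ∀ x t, γ x t = γ (γ x (t / 2)) (t / 2) := by
    intro x t
    have : (fun s => γ x (s + t / 2)) = γ (γ x (t / 2)) := by
      refine eq_of_integralCurves hK (t₀ := 0) (fun s => ?_) (h _) (by simp [h0])
      exact (h x (s + t / 2)).comp_add_const s (t / 2)
    rw [← this]
    simp
  have hind : ∀ (k : ℕ) (t : ℝ) (x : E), |t| * K < 2 ^ k →
      ContDiffAt ℝ ∞ (fun p : ℝ × E => γ p.2 p.1) (t, x) := by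
    intro k
    induction k with
    | zero => exact fun t x ht => contDiffAt_flow_of_small hf hK h0 h (by simpa using ht) x
    | succ k ih =>
      intro t x ht
      have ht' : |t / 2| * K < 2 ^ k := by
        rw [abs_div, abs_two]
        rw [pow_succ] at ht
        linarith
      have e : (fun p : ℝ × E => γ p.2 p.1) =
          (fun p : ℝ × E => γ p.2 p.1) ∘ (fun p : ℝ × E => (p.1 / 2, γ p.2 (p.1 / 2))) :=
        funext fun p => hhalf _ _
      rw [e]
      have hi : ContDiffAt ℝ ∞ (fun p : ℝ × E => γ p.2 (p.1 / 2)) (t, x) :=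
        ContDiffAt.comp (t, x) (g := fun p : ℝ × E => γ p.2 p.1)
          (f := fun p : ℝ × E => (p.1 / 2, p.2)) (ih (t / 2) x ht')
          (by fun_prop)
      exact ContDiffAt.comp (t, x) (ih _ _ ht') ((by fun_prop : ContDiffAt ℝ ∞
        (fun p : ℝ × E => p.1 / 2) (t, x)).prodMk hi)
  rw [contDiff_iff_contDiffAt]
  rintro ⟨t, x⟩
  obtain ⟨k, hk⟩ := pow_unbounded_of_one_lt (|t| * K) one_lt_two
  exact hind k t x hk

end Flow

/-! ### Smooth dependence of integrals on parameters -/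

section ParametricIntegral

universe u

variable {E : Type u} [NormedAddCommGroup E] [NormedSpace ℝ E]
  {EX HX : Type*} [NormedAddCommGroup EX] [NormedSpace ℝ EX] [TopologicalSpace HX]
  {I : ModelWithCorners ℝ EX HX} {X : Type*} [TopologicalSpace X] [ChartedSpace HX X]

/-- The partial derivative in the vector space direction of a smooth function on `E × X` is
smooth. -/
theorem ContMDiffAt.fderiv_fst [IsManifold I 1 X] {G : Type*} [NormedAddCommGroup G]
    [NormedSpace ℝ G] {F : E × X → G} {p : E × X}
    (hF : ContMDiffAt (𝓘(ℝ, E).prod I) 𝓘(ℝ, G) ∞ F p) :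
    ContMDiffAt (𝓘(ℝ, E).prod I) 𝓘(ℝ, E →L[ℝ] G) ∞
      (fun p => fderiv ℝ (fun z => F (z, p.2)) p.1) p := by
  have h1 : ContMDiffAt ((𝓘(ℝ, E).prod I).prod 𝓘(ℝ, E)) 𝓘(ℝ, G) ∞
      (Function.uncurry fun (p : E × X) (z : E) => F (z, p.2)) (p, p.1) := by
    have : ContMDiffAt ((𝓘(ℝ, E).prod I).prod 𝓘(ℝ, E)) (𝓘(ℝ, E).prod I) ∞
        (fun a : (E × X) × E => (a.2, a.1.2)) (p, p.1) :=
      contMDiffAt_snd.prodMk (contMDiffAt_snd.comp _ contMDiffAt_fst)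
    exact ContMDiffAt.comp (p, p.1) (g := F) (f := fun a : (E × X) × E => (a.2, a.1.2)) hF this
  have h2 := ContMDiffAt.mfderiv (fun (p : E × X) (z : E) => F (z, p.2)) Prod.fst h1
    contMDiffAt_fst (m := ∞) (by simp)
  have h3 := inTangentCoordinates_model_space (I := 𝓘(ℝ, E)) (I' := 𝓘(ℝ, G)) (Prod.fst : E × X → E)
    (fun p : E × X => F (p.1, p.2))
    (fun p : E × X => fderiv ℝ (fun z => F (z, p.2)) p.1) p
  simp only [mfderiv_eq_fderiv] at h2
  exact h3 ▸ h2

theorem ContMDiff.fderiv_fst [IsManifold I 1 X] {G : Type*} [NormedAddCommGroup G]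
    [NormedSpace ℝ G] {F : E × X → G} (hF : ContMDiff (𝓘(ℝ, E).prod I) 𝓘(ℝ, G) ∞ F) :
    ContMDiff (𝓘(ℝ, E).prod I) 𝓘(ℝ, E →L[ℝ] G) ∞
      (fun p : E × X => fderiv ℝ (fun z => F (z, p.2)) p.1) :=
  fun p => (hF p).fderiv_fst

theorem ContMDiffAt.slice_fst {G : Type*} [NormedAddCommGroup G]
    [NormedSpace ℝ G] {F : E × X → G} {z : E} {x : X}
    (hF : ContMDiffAt (𝓘(ℝ, E).prod I) 𝓘(ℝ, G) ∞ F (z, x)) :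
    ContDiffAt ℝ ∞ (fun z => F (z, x)) z :=
  (ContMDiffAt.comp z (f := fun z => (z, x)) hF
    (contMDiffAt_id.prodMk contMDiffAt_const)).contDiffAt

variable [FiniteDimensional ℝ E] [IsManifold I 1 X] [MeasurableSpace X] [OpensMeasurableSpace X]

theorem hasFDerivAt_setIntegral_of_contMDiffOn {G : Type*} [NormedAddCommGroup G] [NormedSpace ℝ G]
    {μ : Measure X} {C V : Set X} (hC : IsCompact C) (hCm : MeasurableSet C)
    (hμ : μ C ≠ ⊤) (hV : IsOpen V) (hCV : C ⊆ V) {U : Set E} (hU : IsOpen U) {F : E × X → G}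
    (hF : ContMDiffOn (𝓘(ℝ, E).prod I) 𝓘(ℝ, G) ∞ F (U ×ˢ V)) {z : E} (hz : z ∈ U) :
    HasFDerivAt (fun z => ∫ x in C, F (z, x) ∂μ)
      (∫ x in C, fderiv ℝ (fun z => F (z, x)) z ∂μ) z := by
  have hFat : ∀ z ∈ U, ∀ x ∈ V, ContMDiffAt (𝓘(ℝ, E).prod I) 𝓘(ℝ, G) ∞ F (z, x) :=
    fun z hz x hx => hF.contMDiffAt ((hU.prod hV).mem_nhds ⟨hz, hx⟩)
  have hF' : ContMDiffOn (𝓘(ℝ, E).prod I) 𝓘(ℝ, E →L[ℝ] G) ∞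
      (fun p => fderiv ℝ (fun z => F (z, p.2)) p.1) (U ×ˢ V) :=
    fun p hp => (hFat p.1 hp.1 p.2 hp.2).fderiv_fst.contMDiffWithinAt
  have : ProperSpace E := FiniteDimensional.proper ℝ E
  obtain ⟨ε, hε, hεU⟩ := Metric.nhds_basis_closedBall.mem_iff.1 (hU.mem_nhds hz)
  have hslice : ∀ z ∈ U, ContinuousOn (fun x => F (z, x)) C := fun z hz =>
    hF.continuousOn.comp (by fun_prop) (fun x hx => ⟨hz, hCV hx⟩)
  have hslice' : ContinuousOn (fun x => fderiv ℝ (fun z => F (z, x)) z) C :=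
    hF'.continuousOn.comp (f := fun x => (z, x)) (by fun_prop) (fun x hx => ⟨hz, hCV hx⟩)
  obtain ⟨B, hB⟩ := ((isCompact_closedBall z ε).prod hC).exists_bound_of_continuousOn
    (hF'.continuousOn.mono (prod_mono hεU hCV))
  have hfin : IsFiniteMeasure (μ.restrict C) := ⟨by
    rw [Measure.restrict_apply_univ]; exact hμ.lt_top⟩
  have hint : IntegrableOn (fun x => F (z, x)) C μ := by
    obtain ⟨B', hB'⟩ := hC.exists_bound_of_continuousOn (hslice z hz)
    exact Integrable.of_bound ((hslice z hz).aestronglyMeasurable_of_isCompact hC hCm) B'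
      ((ae_restrict_iff' hCm).2 (Filter.Eventually.of_forall hB'))
  refine hasFDerivAt_integral_of_dominated_of_fderiv_le (s := Metric.closedBall z ε)
    (F := fun z x => F (z, x)) (F' := fun z x => fderiv ℝ (fun z => F (z, x)) z)
    (bound := fun _ => B) (Metric.closedBall_mem_nhds z hε) ?_ hint
    (hslice'.aestronglyMeasurable_of_isCompact hC hCm) ?_ (integrable_const B) ?_
  · filter_upwards [hU.mem_nhds hz] with w hw
    exact (hslice w hw).aestronglyMeasurable_of_isCompact hC hCm
  · exact (ae_restrict_iff' hCm).2 (Filter.Eventually.of_forall fun x hx w hw => hB (w, x) ⟨hw, hx⟩)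
  · exact (ae_restrict_iff' hCm).2 (Filter.Eventually.of_forall fun x hx w hw =>
      ((hFat w (hεU hw) x (hCV hx)).slice_fst.differentiableAt (by simp)).hasFDerivAt)

theorem contDiffOn_setIntegral_nat (k : ℕ) {G : Type u} [NormedAddCommGroup G] [NormedSpace ℝ G]
    {μ : Measure X} {C V : Set X} (hC : IsCompact C) (hCm : MeasurableSet C)
    (hμ : μ C ≠ ⊤) (hV : IsOpen V) (hCV : C ⊆ V) {U : Set E} (hU : IsOpen U) {F : E × X → G}
    (hF : ContMDiffOn (𝓘(ℝ, E).prod I) 𝓘(ℝ, G) ∞ F (U ×ˢ V)) :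
    ContDiffOn ℝ k (fun z => ∫ x in C, F (z, x) ∂μ) U := by
  induction k generalizing G with
  | zero =>
    exact contDiffOn_zero.2 fun z hz => (hasFDerivAt_setIntegral_of_contMDiffOn hC hCm hμ hV hCV hU
      hF hz).continuousAt.continuousWithinAt
  | succ k ih =>
    rw [show ((k + 1 : ℕ) : ℕ∞ω) = (k : ℕ∞ω) + 1 by norm_cast,
      contDiffOn_succ_iff_fderiv_of_isOpen hU]
    refine ⟨fun z hz => (hasFDerivAt_setIntegral_of_contMDiffOn hC hCm hμ hV hCV hU
      hF hz).differentiableAt.differentiableWithinAt, by simp, ?_⟩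
    have hF' : ContMDiffOn (𝓘(ℝ, E).prod I) 𝓘(ℝ, E →L[ℝ] G) ∞
        (fun p => fderiv ℝ (fun z => F (z, p.2)) p.1) (U ×ˢ V) :=
      fun p hp => (hF.contMDiffAt ((hU.prod hV).mem_nhds hp)).fderiv_fst.contMDiffWithinAt
    exact (ih hF').congr fun z hz =>
      (hasFDerivAt_setIntegral_of_contMDiffOn hC hCm hμ hV hCV hU hF hz).fderiv

/-- The integral over a compact set of a smooth function depends smoothly on parameters. -/
theorem contDiffOn_setIntegral {G : Type u} [NormedAddCommGroup G] [NormedSpace ℝ G]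
    {μ : Measure X} {C V : Set X} (hC : IsCompact C) (hCm : MeasurableSet C)
    (hμ : μ C ≠ ⊤) (hV : IsOpen V) (hCV : C ⊆ V) {U : Set E} (hU : IsOpen U) {F : E × X → G}
    (hF : ContMDiffOn (𝓘(ℝ, E).prod I) 𝓘(ℝ, G) ∞ F (U ×ˢ V)) :
    ContDiffOn ℝ ∞ (fun z => ∫ x in C, F (z, x) ∂μ) U :=
  contDiffOn_infty.2 fun k => contDiffOn_setIntegral_nat k hC hCm hμ hV hCV hU hF

end ParametricIntegral

section IntervalIntegral

theorem contDiffOn_unitIntervalIntegral {E G : Type} [NormedAddCommGroup E] [NormedSpace ℝ E]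
    [FiniteDimensional ℝ E] [NormedAddCommGroup G] [NormedSpace ℝ G] {V : Set ℝ} (hV : IsOpen V)
    (hCV : Icc (0 : ℝ) 1 ⊆ V) {U : Set E} (hU : IsOpen U) {F : E × ℝ → G}
    (hF : ContDiffOn ℝ ∞ F (U ×ˢ V)) :
    ContDiffOn ℝ ∞ (fun z => ∫ τ in (0 : ℝ)..1, F (z, τ)) U := by
  have h1 : ContMDiffOn (𝓘(ℝ, E).prod 𝓘(ℝ, ℝ)) 𝓘(ℝ, G) ∞ F (U ×ˢ V) := by
    rw [← modelWithCornersSelf_prod, chartedSpaceSelf_prod]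
    exact hF.contMDiffOn
  have h2 := contDiffOn_setIntegral (μ := volume) isCompact_Icc measurableSet_Icc (by simp) hV hCV
    hU h1
  refine h2.congr fun z _ => ?_
  rw [intervalIntegral.integral_of_le zero_le_one, integral_Icc_eq_integral_Ioc]

variable {EW HW : Type} [NormedAddCommGroup EW] [NormedSpace ℝ EW] [FiniteDimensional ℝ EW]
  [TopologicalSpace HW] {I : ModelWithCorners ℝ EW HW} [I.Boundaryless] {W : Type*}
  [TopologicalSpace W] [ChartedSpace HW W] [IsManifold I ∞ W]

theorem contMDiff_unitIntervalIntegral {G : Type} [NormedAddCommGroup G] [NormedSpace ℝ G]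
    {F : W × ℝ → G} (hF : ContMDiff (I.prod 𝓘(ℝ, ℝ)) 𝓘(ℝ, G) ∞ F) :
    ContMDiff I 𝓘(ℝ, G) ∞ (fun w => ∫ τ in (0 : ℝ)..1, F (w, τ)) := by
  intro w₀
  let φ := extChartAt I w₀
  have h1 : ContDiffOn ℝ ∞ (fun a : EW × ℝ => F (φ.symm a.1, a.2)) (φ.target ×ˢ univ) := by
    have h2 : ContMDiffOn (𝓘(ℝ, EW).prod 𝓘(ℝ, ℝ)) 𝓘(ℝ, G) ∞
        (fun a : EW × ℝ => F (φ.symm a.1, a.2)) (φ.target ×ˢ univ) := by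
      refine hF.comp_contMDiffOn (f := fun a : EW × ℝ => (φ.symm a.1, a.2)) ?_
      refine ContMDiffOn.prodMk ?_ contMDiffOn_snd
      exact (contMDiffOn_extChartAt_symm w₀).comp contMDiffOn_fst fun a ha => ha.1
    rw [← modelWithCornersSelf_prod, chartedSpaceSelf_prod] at h2
    exact h2.contDiffOn
  have h3 := contDiffOn_unitIntervalIntegral isOpen_univ (subset_univ _)
    (isOpen_extChartAt_target w₀) h1
  have h4 : ContMDiffAt I 𝓘(ℝ, G) ∞
      ((fun y => ∫ τ in (0 : ℝ)..1, F (φ.symm y, τ)) ∘ φ) w₀ := by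
    refine ContMDiffAt.comp w₀ (ContDiffAt.contMDiffAt ?_) contMDiffAt_extChartAt
    exact h3.contDiffAt (extChartAt_target_mem_nhds w₀)
  refine h4.congr_of_eventuallyEq ?_
  filter_upwards [extChartAt_source_mem_nhds (I := I) w₀] with w hw
  have : φ.symm (φ w) = w := φ.left_inv hw
  simp only [Function.comp_apply, this]

end IntervalIntegral

/-! ### Charts of manifolds without boundary -/

section Charts

variable {EM HM : Type*} [NormedAddCommGroup EM] [NormedSpace ℝ EM]
  [TopologicalSpace HM] {J : ModelWithCorners ℝ EM HM} [J.Boundaryless] {M : Type*}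
  [TopologicalSpace M] [ChartedSpace HM M] [IsManifold J 1 M]

theorem mdifferentiableAt_extChartAt_symm {x : M} {y : EM} (hy : y ∈ (extChartAt J x).target) :
    MDifferentiableAt 𝓘(ℝ, EM) J (extChartAt J x).symm y := by
  have := mdifferentiableWithinAt_extChartAt_symm hy
  rwa [J.range_eq_univ, mdifferentiableWithinAt_univ] at this

theorem isInvertible_mfderiv_extChartAt_symm {x : M} {y : EM} (hy : y ∈ (extChartAt J x).target) :
    (mfderiv 𝓘(ℝ, EM) J (extChartAt J x).symm y).IsInvertible := by
  have := isInvertible_mfderivWithin_extChartAt_symm hy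
  rwa [J.range_eq_univ, mfderivWithin_univ] at this

theorem mfderiv_extChartAt_comp_symm {x : M} {y : EM} (hy : y ∈ (extChartAt J x).target) :
    mfderiv J 𝓘(ℝ, EM) (extChartAt J x) ((extChartAt J x).symm y) ∘L
      mfderiv 𝓘(ℝ, EM) J (extChartAt J x).symm y = ContinuousLinearMap.id ℝ _ := by
  have := mfderiv_extChartAt_comp_mfderivWithin_extChartAt_symm hy
  rwa [J.range_eq_univ, mfderivWithin_univ] at this

theorem mfderiv_extChartAt_symm_comp {x y : M} (hy : y ∈ (extChartAt J x).source) :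
    mfderiv 𝓘(ℝ, EM) J (extChartAt J x).symm (extChartAt J x y) ∘L
      mfderiv J 𝓘(ℝ, EM) (extChartAt J x) y = ContinuousLinearMap.id ℝ _ := by
  have := mfderivWithin_extChartAt_symm_comp_mfderiv_extChartAt' hy
  rwa [J.range_eq_univ, mfderivWithin_univ] at this

end Charts

/-! ### Families of immersions -/

section Immersions

variable {P : Type*} [NormedAddCommGroup P] [NormedSpace ℝ P] [FiniteDimensional ℝ P]
  {EL HL : Type*} [NormedAddCommGroup EL] [NormedSpace ℝ EL] [FiniteDimensional ℝ EL]
  [TopologicalSpace HL] {I : ModelWithCorners ℝ EL HL} [I.Boundaryless] {L : Type*}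
  [TopologicalSpace L] [ChartedSpace HL L] [IsManifold I ∞ L]
  {EM HM : Type*} [NormedAddCommGroup EM] [NormedSpace ℝ EM] [FiniteDimensional ℝ EM]
  [TopologicalSpace HM] {J : ModelWithCorners ℝ EM HM} {M : Type*}
  [TopologicalSpace M] [ChartedSpace HM M] [IsManifold J ∞ M]

/-- A smooth family of maps that is immersive at a point has, locally, a smooth family of left
inverses. -/
theorem exists_local_leftInverse {f : P × L → M} (hf : ContMDiff (𝓘(ℝ, P).prod I) J ∞ f)
    {p₀ : P} {q₀ : L} (hinj : Function.Injective (mfderiv I J (fun q => f (p₀, q)) q₀)) :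
    ∃ (r : P × M → L) (U : Set (P × M)), IsOpen U ∧
      ContMDiffOn (𝓘(ℝ, P).prod J) I ∞ r U ∧
      ∀ᶠ x in 𝓝 (p₀, q₀), (x.1, f x) ∈ U ∧ r (x.1, f x) = x.2 := by
  let m₀ := f (p₀, q₀)
  let φ := extChartAt I q₀
  let ψ := extChartAt J m₀
  let y₀ := φ q₀
  let g : P × EL → EM := fun a => ψ (f (a.1, φ.symm a.2))
  let O : Set (P × EL) := (univ ×ˢ φ.target) ∩ (fun a => f (a.1, φ.symm a.2)) ⁻¹' ψ.source
  have hin : ContMDiffOn (𝓘(ℝ, P).prod 𝓘(ℝ, EL)) J ∞ (fun a : P × EL => f (a.1, φ.symm a.2))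
      (univ ×ˢ φ.target) := by
    refine hf.comp_contMDiffOn (f := fun a : P × EL => (a.1, φ.symm a.2)) ?_
    refine ContMDiffOn.prodMk contMDiffOn_fst ?_
    exact (contMDiffOn_extChartAt_symm q₀).comp contMDiffOn_snd fun a ha => ha.2
  have hO : IsOpen O := hin.continuousOn.isOpen_inter_preimage
    (isOpen_univ.prod (isOpen_extChartAt_target q₀)) (isOpen_extChartAt_source m₀)
  have hg : ContDiffOn ℝ ∞ g O := by
    have : ContMDiffOn (𝓘(ℝ, P).prod 𝓘(ℝ, EL)) 𝓘(ℝ, EM) ∞ g O :=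
      contMDiffOn_extChartAt.comp (hin.mono inter_subset_left) fun a ha => by
        simpa [ψ] using ha.2
    rw [← modelWithCornersSelf_prod, chartedSpaceSelf_prod] at this
    exact this.contDiffOn
  have hy₀ : (p₀, y₀) ∈ O := by
    refine ⟨⟨mem_univ _, mem_extChartAt_target q₀⟩, ?_⟩
    simp only [mem_preimage]
    rw [show φ.symm y₀ = q₀ from extChartAt_to_inv q₀]
    exact mem_extChartAt_source m₀
  have hgd : DifferentiableAt ℝ g (p₀, y₀) :=
    (hg.contDiffAt (hO.mem_nhds hy₀)).differentiableAt (by simp)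
  -- the partial derivative of the chart expression is injective
  have hD : Function.Injective (fderiv ℝ g (p₀, y₀) ∘L ContinuousLinearMap.inr ℝ P EL) := by
    have hsrc : m₀ ∈ ψ.source := mem_extChartAt_source m₀
    have hq₀ : φ.symm y₀ = q₀ := extChartAt_to_inv q₀
    have hf₀ : MDifferentiableAt I J (fun q => f (p₀, q)) (φ.symm y₀) :=
      (hf.comp (contMDiff_const.prodMk contMDiff_id)).mdifferentiableAt (by simp)
    have hinj' : Function.Injective (mfderiv I J (fun q => f (p₀, q)) (φ.symm y₀)) := by
      rw [hq₀]; exact hinj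
    have hsymm : MDifferentiableAt 𝓘(ℝ, EL) I φ.symm y₀ :=
      mdifferentiableAt_extChartAt_symm (mem_extChartAt_target q₀)
    have hsrc' : f (p₀, φ.symm y₀) ∈ ψ.source := by rw [hq₀]; exact hsrc
    have hψ : MDifferentiableAt J 𝓘(ℝ, EM) ψ (f (p₀, φ.symm y₀)) :=
      mdifferentiableAt_extChartAt (by simpa [ψ] using hsrc')
    have e1 : fderiv ℝ g (p₀, y₀) ∘L ContinuousLinearMap.inr ℝ P EL =
        fderiv ℝ (fun y => g (p₀, y)) y₀ :=
      (hgd.hasFDerivAt.comp y₀ (hasFDerivAt_prodMk_right p₀ y₀)).fderiv.symm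
    have e2 := hψ.hasMFDerivAt.comp y₀ (hf₀.hasMFDerivAt.comp y₀ hsymm.hasMFDerivAt)
    have e3 : fderiv ℝ (fun y => g (p₀, y)) y₀ =
        mfderiv 𝓘(ℝ, EL) 𝓘(ℝ, EM) (ψ ∘ (fun q => f (p₀, q)) ∘ φ.symm) y₀ := mfderiv_eq_fderiv.symm
    rw [e1, e3, e2.mfderiv]
    exact (isInvertible_mfderiv_extChartAt hsrc').injective.comp (hinj'.comp
      (isInvertible_mfderiv_extChartAt_symm (mem_extChartAt_target q₀)).injective)
  obtain ⟨A₀, hA₀⟩ := (fderiv ℝ g (p₀, y₀) ∘L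
    ContinuousLinearMap.inr ℝ P EL).toLinearMap.exists_leftInverse_of_injective
    (LinearMap.ker_eq_bot.2 hD)
  let A : EM →L[ℝ] EL := LinearMap.toContinuousLinearMap A₀
  let G : P × EL → P × EL := fun a => (a.1, A (g a))
  have hG : ContDiffOn ℝ ∞ G O := contDiff_fst.contDiffOn.prodMk (A.contDiff.comp_contDiffOn hg)
  have hA : ∀ v : EL, A (fderiv ℝ g (p₀, y₀) (0, v)) = v := fun v =>
    LinearMap.congr_fun hA₀ v
  let G' : (P × EL) ≃L[ℝ] (P × EL) := ContinuousLinearEquiv.equivOfInverse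
    ((ContinuousLinearMap.fst ℝ P EL).prod (A ∘L fderiv ℝ g (p₀, y₀)))
    ((ContinuousLinearMap.fst ℝ P EL).prod (ContinuousLinearMap.snd ℝ P EL -
      A ∘L fderiv ℝ g (p₀, y₀) ∘L ContinuousLinearMap.inl ℝ P EL ∘L
        ContinuousLinearMap.fst ℝ P EL)) (by
      rintro ⟨u, v⟩
      have : fderiv ℝ g (p₀, y₀) (u, v) = fderiv ℝ g (p₀, y₀) (u, 0)
          + fderiv ℝ g (p₀, y₀) (0, v) := by rw [← map_add]; simp
      ext <;> simp [this, hA]) (by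
      rintro ⟨u, v⟩
      have : ∀ w, fderiv ℝ g (p₀, y₀) (u, w) = fderiv ℝ g (p₀, y₀) (u, 0)
          + fderiv ℝ g (p₀, y₀) (0, w) := fun w => by rw [← map_add]; simp
      ext <;> simp [this (v - _), hA])
  have hG' : HasFDerivAt G (G' : (P × EL) →L[ℝ] (P × EL)) (p₀, y₀) :=
    hasFDerivAt_fst.prodMk (A.hasFDerivAt.comp _ hgd.hasFDerivAt)
  have hGat : ContDiffAt ℝ ∞ G (p₀, y₀) := hG.contDiffAt (hO.mem_nhds hy₀)
  let Γ := hGat.toOpenPartialHomeomorph G hG' (by simp)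
  have hΓ : ∀ a, Γ a = G a := fun a => rfl
  let O' : Set (P × EL) := O ∩ (fderiv ℝ G) ⁻¹' (range ((↑) :
    ((P × EL) ≃L[ℝ] (P × EL)) → (P × EL) →L[ℝ] (P × EL)))
  have hO' : IsOpen O' := (hG.continuousOn_fderiv_of_isOpen hO (by simp)).isOpen_inter_preimage hO
    ContinuousLinearEquiv.isOpen
  have hy₀' : (p₀, y₀) ∈ O' := ⟨hy₀, G', hG'.fderiv.symm⟩
  let T : Set (P × EL) := Γ.target ∩ Γ.symm ⁻¹' O'
  have hT : IsOpen T := Γ.isOpen_inter_preimage_symm hO'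
  have hTs : ContDiffOn ℝ ∞ Γ.symm T := by
    intro z hz
    obtain ⟨hz1, B, hB⟩ := hz.2
    refine (Γ.contDiffAt_symm (f₀' := B) hz.1 ?_ (hG.contDiffAt (hO.mem_nhds hz1))).contDiffWithinAt
    rw [hB]
    exact ((hG.contDiffAt (hO.mem_nhds hz1)).differentiableAt (by simp)).hasFDerivAt
  let c : P × M → P × EL := fun x => (x.1, A (ψ x.2))
  have hc : ContMDiffOn (𝓘(ℝ, P).prod J) 𝓘(ℝ, P × EL) ∞ c (univ ×ˢ ψ.source) := by
    rw [modelWithCornersSelf_prod, ← chartedSpaceSelf_prod]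
    refine ContMDiffOn.prodMk contMDiffOn_fst ?_
    refine A.contMDiff.comp_contMDiffOn ?_
    exact contMDiffOn_extChartAt.comp contMDiffOn_snd fun a ha => by simpa [ψ] using ha.2
  let U : Set (P × M) := (univ ×ˢ ψ.source) ∩ c ⁻¹' T
  have hU : IsOpen U := hc.continuousOn.isOpen_inter_preimage
    (isOpen_univ.prod (isOpen_extChartAt_source m₀)) hT
  refine ⟨fun x => φ.symm (Γ.symm (c x)).2, U, hU, ?_, ?_⟩
  · refine (contMDiffOn_extChartAt_symm q₀).comp (t := φ.target)
      (f := fun x => (Γ.symm (c x)).2) ?_ ?_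
    · have h1 : ContMDiffOn (𝓘(ℝ, P).prod J) 𝓘(ℝ, P × EL) ∞ (fun x => Γ.symm (c x)) U :=
        hTs.contMDiffOn.comp (hc.mono inter_subset_left) fun x hx => hx.2
      exact contDiff_snd.contMDiff.comp_contMDiffOn h1
    · intro x hx
      exact hx.2.2.1.1.2
  · have hmem : ∀ᶠ x : P × L in 𝓝 (p₀, q₀), x.2 ∈ φ.source :=
      continuousAt_snd.eventually (extChartAt_source_mem_nhds q₀)
    have hcont : ContinuousAt (fun x : P × L => (x.1, φ x.2)) (p₀, q₀) :=
      continuousAt_fst.prodMk (ContinuousAt.comp (x := (p₀, q₀)) (g := φ)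
        (continuousAt_extChartAt q₀) continuousAt_snd)
    have hsrc : ∀ᶠ x : P × L in 𝓝 (p₀, q₀), (x.1, φ x.2) ∈ Γ.source ∩ O' :=
      hcont.eventually ((Γ.open_source.inter hO').mem_nhds
        ⟨hGat.mem_toOpenPartialHomeomorph_source hG' (by simp), hy₀'⟩)
    filter_upwards [hmem, hsrc] with x hx hxs
    have e1 : φ.symm (φ x.2) = x.2 := φ.left_inv hx
    have e2 : c (x.1, f x) = Γ (x.1, φ x.2) := by
      rw [hΓ]
      simp only [c, G, g, e1]
    have e3 : Γ.symm (c (x.1, f x)) = (x.1, φ x.2) := by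
      rw [e2, Γ.left_inv hxs.1]
    refine ⟨⟨⟨mem_univ _, ?_⟩, ?_, ?_⟩, ?_⟩
    · have := hxs.2.1.2
      simp only [mem_preimage, e1] at this
      exact this
    · rw [e2]; exact Γ.map_source hxs.1
    · rw [mem_preimage, e3]; exact hxs.2
    · simp only [e3, e1]

end Immersions

/-! ### Reparametrizations and extensions -/

/-- For a family of maps of a compact manifold the images of the points outside a neighbourhood
form a closed set. -/
theorem isClosed_image_family {P L M : Type*} [TopologicalSpace P]
    [TopologicalSpace L] [TopologicalSpace M] [CompactSpace L] [T2Space M]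
    {f : P × L → M} (hf : Continuous f)
    {S : Set (P × L)} (hS : IsClosed S) :
    IsClosed {x : P × M | ∃ q, (x.1, q) ∈ S ∧ f (x.1, q) = x.2} := by
  have h1 : IsClosed {a : (P × M) × L | (a.1.1, a.2) ∈ S ∧ f (a.1.1, a.2) = a.1.2} :=
    (hS.preimage (by fun_prop : Continuous fun a : (P × M) × L => (a.1.1, a.2))).inter
      (isClosed_eq (by fun_prop) (by fun_prop))
  have h2 := isClosedMap_fst_of_compactSpace _ h1
  convert h2 using 1
  ext x
  simp

section Immersions

variable {P : Type*} [NormedAddCommGroup P] [NormedSpace ℝ P] [FiniteDimensional ℝ P]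
  {EL HL : Type*} [NormedAddCommGroup EL] [NormedSpace ℝ EL] [FiniteDimensional ℝ EL]
  [TopologicalSpace HL] {I : ModelWithCorners ℝ EL HL} [I.Boundaryless] {L : Type*}
  [TopologicalSpace L] [ChartedSpace HL L] [IsManifold I ∞ L]
  {EM HM : Type*} [NormedAddCommGroup EM] [NormedSpace ℝ EM] [FiniteDimensional ℝ EM]
  [TopologicalSpace HM] {J : ModelWithCorners ℝ EM HM} {M : Type*}
  [TopologicalSpace M] [ChartedSpace HM M] [IsManifold J ∞ M]

/-- A smooth family of injective immersions of a compact manifold has, near each point of the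
image, a smooth family of left inverses, defined on the whole image. -/
theorem exists_local_retraction [CompactSpace L] [T2Space M] {f : P × L → M}
    (hf : ContMDiff (𝓘(ℝ, P).prod I) J ∞ f) {p₀ : P} (q₀ : L)
    (hfi : Function.Injective (fun q => f (p₀, q)))
    (hinj : Function.Injective (mfderiv I J (fun q => f (p₀, q)) q₀)) :
    ∃ (r : P × M → L) (U : Set (P × M)), IsOpen U ∧ (p₀, f (p₀, q₀)) ∈ U ∧
      ContMDiffOn (𝓘(ℝ, P).prod J) I ∞ r U ∧
      ∀ p q, (p, f (p, q)) ∈ U → r (p, f (p, q)) = q := by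
  obtain ⟨r, U, hU, hr, hev⟩ := exists_local_leftInverse hf hinj
  obtain ⟨V, hV, hVo, hVm⟩ := eventually_nhds_iff.1 hev
  have hcl := isClosed_image_family hf.continuous hVo.isClosed_compl
  refine ⟨r, U ∩ {x : P × M | ∃ q, (x.1, q) ∈ Vᶜ ∧ f (x.1, q) = x.2}ᶜ,
    hU.inter hcl.isOpen_compl, ⟨(hV _ hVm).1, ?_⟩, hr.mono inter_subset_left, ?_⟩
  · rintro ⟨q, hq, hq'⟩
    rw [hfi hq'] at hq
    exact hq hVm
  · intro p q hpq
    by_cases h : (p, q) ∈ V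
    · exact (hV _ h).2
    · exact (hpq.2 ⟨q, h, rfl⟩).elim

/-- Two smooth families of maps, the first of which consists of injective immersions of a compact
manifold and contains the images of the second, differ by a smooth family of maps. -/
theorem exists_smooth_reparametrization [CompactSpace L] [T2Space M]
    {EL' HL' : Type*} [NormedAddCommGroup EL'] [NormedSpace ℝ EL']
    [TopologicalSpace HL'] {I' : ModelWithCorners ℝ EL' HL'} {L' : Type*}
    [TopologicalSpace L'] [ChartedSpace HL' L'] {f : P × L → M} {f' : P × L' → M}
    (hf : ContMDiff (𝓘(ℝ, P).prod I) J ∞ f) (hf' : ContMDiff (𝓘(ℝ, P).prod I') J ∞ f')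
    (hfi : ∀ p, Function.Injective (fun q => f (p, q)))
    (hinj : ∀ p q, Function.Injective (mfderiv I J (fun q => f (p, q)) q))
    (hr : ∀ p q', ∃ q, f (p, q) = f' (p, q')) :
    ∃ φ : P × L' → L, ContMDiff (𝓘(ℝ, P).prod I') I ∞ φ ∧ ∀ p q, f (p, φ (p, q)) = f' (p, q) := by
  choose φ₀ hφ₀ using hr
  refine ⟨fun x => φ₀ x.1 x.2, ?_, fun p q => hφ₀ p q⟩
  rintro ⟨p, q'⟩
  obtain ⟨r, U, hU, hmem, hr, hrU⟩ := exists_local_retraction hf (φ₀ p q') (hfi p) (hinj p _)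
  rw [hφ₀] at hmem
  have hc : ContMDiff (𝓘(ℝ, P).prod I') (𝓘(ℝ, P).prod J) ∞ (fun x : P × L' => (x.1, f' x)) :=
    contMDiff_fst.prodMk hf'
  have h1 : ContMDiffAt (𝓘(ℝ, P).prod I') I ∞ (r ∘ (fun x : P × L' => (x.1, f' x))) (p, q') :=
    ContMDiffAt.comp (p, q') (hr.contMDiffAt (hU.mem_nhds hmem)) hc.contMDiffAt
  refine h1.congr_of_eventuallyEq ?_
  filter_upwards [hc.continuous.continuousAt.preimage_mem_nhds (hU.mem_nhds hmem)] with x hx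
  have := hrU x.1 (φ₀ x.1 x.2)
  rw [hφ₀] at this
  exact (this hx).symm

/-- Extension of a smooth function from a smooth family of compact submanifolds, with values in the
convex hulls of the original ranges. -/
theorem exists_extension_family [CompactSpace L] [T2Space M] [SigmaCompactSpace M] [Nonempty L]
    {G : Type*} [NormedAddCommGroup G] [NormedSpace ℝ G] {f : P × L → M}
    (hf : ContMDiff (𝓘(ℝ, P).prod I) J ∞ f)
    (hfi : ∀ p, Function.Injective (fun q => f (p, q)))
    (hinj : ∀ p q, Function.Injective (mfderiv I J (fun q => f (p, q)) q))
    {h : P × L → G} (hh : ContMDiff (𝓘(ℝ, P).prod I) 𝓘(ℝ, G) ∞ h) :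
    ∃ H : P × M → G, ContMDiff (𝓘(ℝ, P).prod J) 𝓘(ℝ, G) ∞ H ∧ (∀ p q, H (p, f (p, q)) = h (p, q)) ∧
      ∀ p m, H (p, m) ∈ convexHull ℝ (range fun q => h (p, q)) := by
  have : ProperSpace P := FiniteDimensional.proper ℝ P
  let t : P × M → Set G := fun x =>
    convexHull ℝ (range fun q => h (x.1, q)) ∩ {v | ∀ q, f (x.1, q) = x.2 → v = h (x.1, q)}
  have ht : ∀ x, Convex ℝ (t x) := by
    intro x
    refine (convex_convexHull ℝ _).inter ?_
    intro v hv w hw a b ha hb hab q hq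
    rw [hv q hq, hw q hq, ← add_smul, hab, one_smul]
  have hloc : ∀ x : P × M, ∃ U ∈ 𝓝 x, ∃ g : P × M → G,
      ContMDiffOn (𝓘(ℝ, P).prod J) 𝓘(ℝ, G) ∞ g U ∧ ∀ y ∈ U, g y ∈ t y := by
    rintro ⟨p, m⟩
    by_cases hm : ∃ q, f (p, q) = m
    · obtain ⟨q, rfl⟩ := hm
      obtain ⟨r, U, hU, hmem, hr, hrU⟩ := exists_local_retraction hf q (hfi p) (hinj p q)
      refine ⟨U, hU.mem_nhds hmem, fun x => h (x.1, r x),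
        hh.comp_contMDiffOn (contMDiffOn_fst.prodMk hr), ?_⟩
      rintro ⟨p', m'⟩ hx
      refine ⟨subset_convexHull ℝ _ ⟨_, rfl⟩, ?_⟩
      intro q' hq'
      change f (p', q') = m' at hq'
      subst hq'
      simp only [hrU p' q' hx]
    · have hcl := isClosed_image_family hf.continuous isClosed_univ
      obtain ⟨q⟩ := ‹Nonempty L›
      refine ⟨_, hcl.isOpen_compl.mem_nhds (x := (p, m)) ?_, fun x => h (x.1, q), ?_, ?_⟩
      · rintro ⟨q, -, hq⟩
        exact hm ⟨q, hq⟩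
      · exact (hh.comp (contMDiff_fst.prodMk contMDiff_const)).contMDiffOn
      · intro y hy
        refine ⟨subset_convexHull ℝ _ ⟨_, rfl⟩, fun q' hq' => (hy ⟨q', trivial, hq'⟩).elim⟩
  obtain ⟨g, hg⟩ := exists_contMDiffMap_forall_mem_convex_of_local (𝓘(ℝ, P).prod J) (n := ⊤) ht hloc
  exact ⟨g, g.contMDiff, fun p q => (hg (p, f (p, q))).2 q rfl, fun p m => (hg (p, m)).1⟩

end Immersions

/-- A smooth function with vanishing differential on a connected manifold is constant. -/
theorem eq_of_mfderiv_eq_zero {EL HL : Type*} [NormedAddCommGroup EL] [NormedSpace ℝ EL]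
    [TopologicalSpace HL] {I : ModelWithCorners ℝ EL HL} [I.Boundaryless] {L : Type*}
    [TopologicalSpace L] [ChartedSpace HL L] [IsManifold I ∞ L] [PreconnectedSpace L]
    {G : Type*} [NormedAddCommGroup G] [NormedSpace ℝ G] {h : L → G} (hh : ContMDiff I 𝓘(ℝ, G) ∞ h)
    (h0 : ∀ q, mfderiv I 𝓘(ℝ, G) h q = 0) (q q' : L) : h q = h q' := by
  have hlc : IsLocallyConstant h := by
    rw [IsLocallyConstant.iff_eventually_eq]
    intro q
    let φ := extChartAt I q
    have hd : ∀ y ∈ φ.target, HasFDerivAt (h ∘ φ.symm) (0 : EL →L[ℝ] G) y := by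
      intro y hy
      have h1 := (hh.mdifferentiableAt (x := φ.symm y) (by simp)).hasMFDerivAt.comp y
        (mdifferentiableAt_extChartAt_symm hy).hasMFDerivAt
      rw [h0] at h1
      exact hasMFDerivAt_iff_hasFDerivAt.1 (h1.congr_mfderiv (ContinuousLinearMap.zero_comp _))
    obtain ⟨ε, hε, hb⟩ := Metric.nhds_basis_ball.mem_iff.1 (extChartAt_target_mem_nhds (I := I) q)
    have h2 : ∀ᶠ q' in 𝓝 q, φ q' ∈ Metric.ball (φ q) ε :=
      (continuousAt_extChartAt q).preimage_mem_nhds (Metric.ball_mem_nhds _ hε)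
    filter_upwards [h2, extChartAt_source_mem_nhds (I := I) q] with q' h3 h4
    have h5 := (convex_ball (φ q) ε).is_const_of_fderivWithin_eq_zero (𝕜 := ℝ) (f := h ∘ φ.symm)
      (fun y hy => (hd y (hb hy)).differentiableAt.differentiableWithinAt)
      (fun y hy => by
        rw [fderivWithin_of_isOpen Metric.isOpen_ball hy]; exact (hd y (hb hy)).fderiv)
      h3 (Metric.mem_ball_self hε)
    have e1 : φ.symm (φ q') = q' := φ.left_inv h4
    have e2 : φ.symm (φ q) = q := extChartAt_to_inv q
    simpa only [Function.comp_apply, e1, e2] using h5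
  exact hlc.apply_eq_of_preconnectedSpace q q'

/-! ### Flows on compact manifolds -/

section Invariance

/-- The differential of a vector-valued function on a manifold, with values in the vector space
itself instead of its tangent space. -/
def vectorDiff {E H : Type*} [NormedAddCommGroup E] [NormedSpace ℝ E] [TopologicalSpace H]
    (I : ModelWithCorners ℝ E H) {X : Type*} [TopologicalSpace X] [ChartedSpace H X]
    {G : Type*} [NormedAddCommGroup G] [NormedSpace ℝ G] (h : X → G) (x : X) :
    TangentSpace I x →L[ℝ] G :=
  mfderiv I 𝓘(ℝ, G) h x

variable {EL HL : Type*} [NormedAddCommGroup EL] [NormedSpace ℝ EL] [FiniteDimensional ℝ EL]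
  [TopologicalSpace HL] {I : ModelWithCorners ℝ EL HL} [I.Boundaryless] {L : Type*}
  [TopologicalSpace L] [ChartedSpace HL L] [IsManifold I ∞ L] [CompactSpace L]
  {G : Type*} [NormedAddCommGroup G] [NormedSpace ℝ G] [FiniteDimensional ℝ G]

/-- An integral curve of a time-dependent vector field which is tangent to a moving compact
submanifold stays in the submanifold. The difference between the curve and its image under a local
retraction satisfies a Gronwall estimate. -/
theorem mem_range_of_integralCurve {j : ℝ × L → G}
    (hj : ContMDiff (𝓘(ℝ, ℝ).prod I) 𝓘(ℝ, G) ∞ j)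
    (hji : ∀ s, Function.Injective (fun q => j (s, q)))
    (hjd : ∀ s q, Function.Injective (mfderiv I 𝓘(ℝ, G) (fun q => j (s, q)) q))
    {V : ℝ × G → G} (hV : ContDiff ℝ ∞ V)
    (htan : ∀ s q, ∃ u : TangentSpace I q, V (s, j (s, q)) =
      deriv (fun s => j (s, q)) s + vectorDiff I (fun q => j (s, q)) q u)
    {c : ℝ → G} (hc : ∀ s, HasDerivAt c (V (s, c s)) s) {s₀ : ℝ} (h₀ : ∃ q, j (s₀, q) = c s₀)
    (s : ℝ) : ∃ q, j (s, q) = c s := by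
  have hcc : Continuous c := continuous_iff_continuousAt.2 fun s => (hc s).continuousAt
  have hclosed : IsClosed {s | ∃ q, j (s, q) = c s} := by
    have h1 := (isClosed_image_family hj.continuous isClosed_univ).preimage
      (by fun_prop : Continuous fun s => (s, c s))
    convert h1 using 1
    ext s
    simp
  have hopen : IsOpen {s | ∃ q, j (s, q) = c s} := by
    rw [isOpen_iff_mem_nhds]
    rintro s₀ ⟨q₀, hq₀⟩
    obtain ⟨r, U, hU, hmem, hr, hrU⟩ := exists_local_retraction hj q₀ (hji s₀) (hjd s₀ q₀)
    rw [hq₀] at hmem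
    let R : ℝ × G → G := fun x => j (x.1, r x)
    have hR : ContDiffOn ℝ ∞ R U := by
      have : ContMDiffOn (𝓘(ℝ, ℝ).prod 𝓘(ℝ, G)) 𝓘(ℝ, G) ∞ R U :=
        hj.comp_contMDiffOn (contMDiffOn_fst.prodMk hr)
      rw [← modelWithCornersSelf_prod, chartedSpaceSelf_prod] at this
      exact this.contDiffOn
    have hRd : ∀ x ∈ U, HasFDerivAt R (fderiv ℝ R x) x := fun x hx =>
      ((hR.contDiffAt (hU.mem_nhds hx)).differentiableAt (by simp)).hasFDerivAt
    let w : ℝ × G → G := fun x => V x - fderiv ℝ R x (1, V x)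
    have hw : ContDiffOn ℝ ∞ w U :=
      hV.contDiffOn.sub ((hR.fderiv_of_isOpen hU (by simp)).clm_apply
        (contDiffOn_const.prodMk hV.contDiffOn))
    have hRj : ∀ s q, (s, j (s, q)) ∈ U → R (s, j (s, q)) = j (s, q) := by
      intro s q h
      simp only [R, hrU s q h]
    -- the component of `V` transverse to the submanifold vanishes along the submanifold
    have hw0 : ∀ s q, (s, j (s, q)) ∈ U → w (s, j (s, q)) = 0 := by
      intro s q h
      obtain ⟨u, hu⟩ := htan s q
      have hcont : Continuous fun x : ℝ × L => (x.1, j x) := continuous_fst.prodMk hj.continuous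
      have hnear : ∀ᶠ x : ℝ × L in 𝓝 (s, q), R (x.1, j x) = j x := by
        filter_upwards [hcont.continuousAt.preimage_mem_nhds (hU.mem_nhds h)] with x hx
        exact hRj x.1 x.2 hx
      have d1 : HasDerivAt (fun s => j (s, q)) (deriv (fun s => j (s, q)) s) s :=
        (((hj.comp (contMDiff_id.prodMk contMDiff_const)).contDiff.differentiable
          (by simp)) s).hasDerivAt
      have e1 : fderiv ℝ R (s, j (s, q)) (1, deriv (fun s => j (s, q)) s) =
          deriv (fun s => j (s, q)) s := by
        have h1 := (hRd _ h).comp_hasDerivAt s ((hasDerivAt_id' s).prodMk d1)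
        refine h1.unique (d1.congr_of_eventuallyEq ?_)
        exact (by fun_prop : ContinuousAt (fun s : ℝ => (s, q)) s).eventually hnear
      have d2 : HasMFDerivAt I 𝓘(ℝ, G) (fun q => j (s, q)) q
          (mfderiv I 𝓘(ℝ, G) (fun q => j (s, q)) q) :=
        ((hj.comp (contMDiff_const.prodMk contMDiff_id)).mdifferentiableAt
          (by simp)).hasMFDerivAt
      have e2 : ∀ u, fderiv ℝ R (s, j (s, q)) (0, vectorDiff I (fun q => j (s, q)) q u) =
          vectorDiff I (fun q => j (s, q)) q u := by
        intro u
        have h0 : HasFDerivAt (fun y => R (s, y))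
            (fderiv ℝ R (s, j (s, q)) ∘L ContinuousLinearMap.inr ℝ ℝ G) (j (s, q)) :=
          (hRd _ h).comp _ (hasFDerivAt_prodMk_right s _)
        have h1 := (hasMFDerivAt_iff_hasFDerivAt.2 h0).comp q d2
        have h3 : ∀ᶠ q' in 𝓝 q, R (s, j (s, q')) = j (s, q') :=
          (by fun_prop : ContinuousAt (fun q : L => (s, q)) q).eventually hnear
        have h2 := hasMFDerivAt_unique h1 (d2.congr_of_eventuallyEq h3)
        exact congrArg (fun A => (A u : G)) h2
      have : (1, V (s, j (s, q))) = ((1, deriv (fun s => j (s, q)) s) : ℝ × G) +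
          (0, vectorDiff I (fun q => j (s, q)) q u) := by
        rw [hu]; simp
      simp only [w]
      rw [this, map_add, e1, e2, ← hu, sub_self]
    obtain ⟨K, t, ht, hK⟩ := ((hw.contDiffAt (hU.mem_nhds hmem)).of_le
      (by exact_mod_cast le_top : (1 : ℕ∞ω) ≤ ∞)).exists_lipschitzOnWith
    have hRc : ContinuousAt (fun s => R (s, c s)) s₀ :=
      ContinuousAt.comp (f := fun s => (s, c s)) (g := R)
        ((hR.contDiffAt (hU.mem_nhds hmem)).continuousAt) (by fun_prop)
    have hR0 : R (s₀, c s₀) = c s₀ := by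
      rw [← hq₀]; exact hRj _ _ (hq₀ ▸ hmem)
    have h1 : ∀ᶠ s in 𝓝 s₀, (s, c s) ∈ t ∩ U :=
      (by fun_prop : ContinuousAt (fun s => (s, c s)) s₀).eventually
        (Filter.inter_mem ht (hU.mem_nhds hmem))
    have h2 : ∀ᶠ s in 𝓝 s₀, (s, R (s, c s)) ∈ t ∩ U := by
      have : ContinuousAt (fun s => (s, R (s, c s))) s₀ := continuousAt_id.prodMk hRc
      refine this.eventually ?_
      change t ∩ U ∈ 𝓝 (s₀, R (s₀, c s₀))
      rw [hR0]
      exact Filter.inter_mem ht (hU.mem_nhds hmem)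
    obtain ⟨δ, hδ, hball⟩ := Metric.eventually_nhds_iff.1 (h1.and h2)
    let g : ℝ → G := fun s => c s - R (s, c s)
    have hg : ∀ s, dist s s₀ < δ → HasDerivAt g (w (s, c s)) s := by
      intro s hs
      have := (hRd _ (hball hs).1.2).comp_hasDerivAt s ((hasDerivAt_id' s).prodMk (hc s))
      exact (hc s).sub this
    have hb : ∀ s, dist s s₀ < δ → ‖w (s, c s)‖ ≤ K * ‖g s‖ := by
      intro s hs
      obtain ⟨a1, a2⟩ := hball hs
      have a3 : w (s, R (s, c s)) = 0 := hw0 s (r (s, c s)) a2.2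
      have := hK.dist_le_mul _ a1.1 _ a2.1
      rw [a3, dist_zero_right, Prod.dist_eq, dist_self, dist_eq_norm,
        max_eq_right (norm_nonneg _)] at this
      exact this
    have hg0 : g s₀ = 0 := by simp only [g, hR0, sub_self]
    have hzero : ∀ s, dist s s₀ < δ → g s = 0 := by
      intro s hs
      rw [Real.dist_eq] at hs
      rcases le_total s₀ s with hle | hle
      · rw [abs_of_nonneg (sub_nonneg.2 hle)] at hs
        have hd : ∀ x ∈ Icc s₀ s, dist x s₀ < δ := fun x hx => by
          rw [Real.dist_eq, abs_of_nonneg (sub_nonneg.2 hx.1)]; linarith [hx.2]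
        exact eq_zero_of_abs_deriv_le_mul_abs_self_of_eq_zero_right (f := g)
          (fun x hx => (hg x (hd x hx)).continuousAt.continuousWithinAt)
          (fun x hx => (hg x (hd x (Ico_subset_Icc_self hx))).hasDerivWithinAt) hg0
          (fun x hx => hb x (hd x (Ico_subset_Icc_self hx))) s ⟨hle, le_rfl⟩
      · rw [abs_of_nonpos (sub_nonpos.2 hle)] at hs
        have hd : ∀ x ∈ Icc s₀ (2 * s₀ - s), dist (2 * s₀ - x) s₀ < δ := fun x hx => by
          rw [Real.dist_eq, abs_of_nonpos (by linarith [hx.1])]; linarith [hx.2]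
        have hd' : ∀ x ∈ Icc s₀ (2 * s₀ - s), HasDerivAt (fun x => g (2 * s₀ - x))
            (-w (2 * s₀ - x, c (2 * s₀ - x))) x := fun x hx => by
          have := (hg _ (hd x hx)).scomp x ((hasDerivAt_id' x).const_sub (2 * s₀))
          rw [neg_one_smul] at this
          exact this
        have := eq_zero_of_abs_deriv_le_mul_abs_self_of_eq_zero_right (f := fun x => g (2 * s₀ - x))
          (fun x hx => (hd' x hx).continuousAt.continuousWithinAt)
          (fun x hx => (hd' x (Ico_subset_Icc_self hx)).hasDerivWithinAt)
          (by simp only [two_mul, add_sub_cancel_right, hg0])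
          (fun x hx => by
            rw [norm_neg]; exact hb _ (hd x (Ico_subset_Icc_self hx))) (2 * s₀ - s)
            ⟨by linarith, le_rfl⟩
        simpa using this
    filter_upwards [Metric.ball_mem_nhds s₀ hδ] with s hs
    exact ⟨r (s, c s), (sub_eq_zero.1 (hzero s hs)).symm⟩
  have huniv : {s | ∃ q, j (s, q) = c s} = univ :=
    IsClopen.eq_univ ⟨hclosed, hopen⟩ ⟨s₀, h₀⟩
  have : s ∈ {s | ∃ q, j (s, q) = c s} := huniv ▸ mem_univ s
  exact this

end Invariance

section VectorDiff

variable {EM HM : Type*} [NormedAddCommGroup EM] [NormedSpace ℝ EM]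
  [TopologicalSpace HM] {J : ModelWithCorners ℝ EM HM} {M : Type*}
  [TopologicalSpace M] [ChartedSpace HM M]

theorem vectorDiff_comp {W HW : Type*} [NormedAddCommGroup W] [NormedSpace ℝ W]
    [TopologicalSpace HW] {I : ModelWithCorners ℝ W HW} {L : Type*} [TopologicalSpace L]
    [ChartedSpace HW L] {G : Type*} [NormedAddCommGroup G]
    [NormedSpace ℝ G] {e : M → G} {c : L → M} {q : L} (he : MDifferentiableAt J 𝓘(ℝ, G) e (c q))
    (hc : MDifferentiableAt I J c q) (u : TangentSpace I q) :
    vectorDiff I (fun q => e (c q)) q u = vectorDiff J e (c q) (mfderiv I J c q u) := by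
  have := mfderiv_comp q he hc
  exact congrArg (fun A => (A u : G)) this

theorem hasDerivAt_comp_curve {G : Type*} [NormedAddCommGroup G] [NormedSpace ℝ G] {e : M → G}
    {c : ℝ → M} {s : ℝ} (he : MDifferentiableAt J 𝓘(ℝ, G) e (c s))
    (hc : MDifferentiableAt 𝓘(ℝ, ℝ) J c s) :
    HasDerivAt (fun s => e (c s)) (vectorDiff J e (c s) (mfderiv 𝓘(ℝ, ℝ) J c s (1 : ℝ))) s := by
  have h := hasMFDerivAt_iff_hasFDerivAt.1 (he.hasMFDerivAt.comp s hc.hasMFDerivAt)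
  have h' : HasFDerivAt (𝕜 := ℝ) (fun s => e (c s)) _ s := h
  exact h'.hasDerivAt

end VectorDiff

section ManifoldFlow

variable {P : Type} [NormedAddCommGroup P] [NormedSpace ℝ P] [FiniteDimensional ℝ P]
  {EM HM : Type*} [NormedAddCommGroup EM] [NormedSpace ℝ EM] [FiniteDimensional ℝ EM]
  [TopologicalSpace HM] {J : ModelWithCorners ℝ EM HM} [J.Boundaryless] {M : Type*}
  [TopologicalSpace M] [ChartedSpace HM M] [IsManifold J ∞ M]

/-- The flow of a time-dependent, parameter-dependent smooth vector field of compact support on a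
compact manifold. The vector field is smooth in the sense that its image under the differential of
each smooth map to a Euclidean space is smooth. Here `Θ ((s, t, p), m)` is the position at time `t`
of the integral curve for the parameter `p` which is at `m` at time `s`. -/
theorem exists_flow_of_compact [CompactSpace M] [T2Space M] [Nonempty M]
    (X : ∀ x : (ℝ × P) × M, TangentSpace J x.2)
    (hX : ∀ (N : ℕ) (e : M → EuclideanSpace ℝ (Fin N)), ContMDiff J 𝓘(ℝ, EuclideanSpace ℝ (Fin N))
      ∞ e → ContMDiff (𝓘(ℝ, ℝ × P).prod J) 𝓘(ℝ, EuclideanSpace ℝ (Fin N)) ∞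
        (fun x : (ℝ × P) × M => vectorDiff J e x.2 (X x)))
    {C : Set (ℝ × P)} (hC : IsCompact C) (hXC : ∀ a ∉ C, ∀ m, X (a, m) = 0) :
    ∃ Θ : (ℝ × ℝ × P) × M → M, ContMDiff (𝓘(ℝ, ℝ × ℝ × P).prod J) J ∞ Θ ∧
      (∀ s p m, Θ ((s, s, p), m) = m) ∧
      (∀ s t p m, mfderiv 𝓘(ℝ, ℝ) J (fun t => Θ ((s, t, p), m)) t (1 : ℝ) =
        X ((t, p), Θ ((s, t, p), m))) ∧
      (∀ (p : P) (c : ℝ → M), MDifferentiable 𝓘(ℝ, ℝ) J c →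
        (∀ t, mfderiv 𝓘(ℝ, ℝ) J c t (1 : ℝ) = X ((t, p), c t)) →
        ∀ s t, Θ ((s, t, p), c s) = c t) ∧
      (∀ s t t' p m, Θ ((t, t', p), Θ ((s, t, p), m)) = Θ ((s, t', p), m)) := by
  obtain ⟨N, e, he, hemb, hei⟩ := exists_embedding_euclidean_of_compact (I := J) (M := M)
  have hei' : ∀ m, Function.Injective (vectorDiff J e m) := hei
  obtain ⟨H, hH, hHe, -⟩ := exists_extension_family (P := ℝ × P) (I := J)
    (J := 𝓘(ℝ, EuclideanSpace ℝ (Fin N))) (f := fun x : (ℝ × P) × M => e x.2)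
    (he.comp contMDiff_snd) (fun _ => hemb.injective) (fun _ => hei) (hX N e he)
  rw [← modelWithCornersSelf_prod, chartedSpaceSelf_prod] at hH
  obtain ⟨R, hR⟩ := (hC.prod (isCompact_range hemb.continuous)).isBounded.subset_closedBall 0
  let b : ContDiffBump (0 : (ℝ × P) × EuclideanSpace ℝ (Fin N)) :=
    ⟨max R 1, max R 1 + 1, by positivity, by linarith⟩
  let V : (ℝ × P) × EuclideanSpace ℝ (Fin N) → EuclideanSpace ℝ (Fin N) := fun x => b x • H x
  have hV : ContDiff ℝ ∞ V := b.contDiff.smul hH.contDiff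
  have hVe : ∀ a m, V (a, e m) = vectorDiff J e m (X (a, m)) := by
    intro a m
    by_cases ha : a ∈ C
    · have : b (a, e m) = 1 := b.one_of_mem_closedBall
        (Metric.closedBall_subset_closedBall (le_max_left _ _) (hR ⟨ha, mem_range_self m⟩))
      simp only [V, this, one_smul, hHe]
    · simp only [V, hHe, hXC a ha m, map_zero, smul_zero]
  obtain ⟨K, hK⟩ := hV.lipschitzWith_of_hasCompactSupport
    (b.hasCompactSupport.smul_right (f' := H)) (by simp)
  let f : (ℝ × P) × EuclideanSpace ℝ (Fin N) → (ℝ × P) × EuclideanSpace ℝ (Fin N) :=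
    fun x => ((1, 0), V x)
  have hf : ContDiff ℝ ∞ f := contDiff_const.prodMk hV
  have hfK : LipschitzWith (max 0 K) f := (LipschitzWith.const _).prodMk hK
  obtain ⟨γ, hγ0, hγd, hγs⟩ := exists_smooth_flow hf hfK
  have hγ1 : ∀ a y t, (γ (a, y) t).1 = a + t • (1, 0) := by
    intro a y t
    have hd : ∀ t, HasDerivAt (fun t : ℝ => (γ (a, y) t).1 - t • ((1, 0) : ℝ × P)) 0 t := by
      intro t
      have h1 : HasDerivAt (fun t : ℝ => (γ (a, y) t).1) ((1, 0) : ℝ × P) t := by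
        have := (ContinuousLinearMap.fst ℝ (ℝ × P)
          (EuclideanSpace ℝ (Fin N))).hasFDerivAt.comp_hasDerivAt t (hγd (a, y) t)
        exact this
      have h2 := h1.sub ((hasDerivAt_id' t).smul_const ((1, 0) : ℝ × P))
      rw [one_smul, sub_self] at h2
      exact h2
    have := is_const_of_deriv_eq_zero (fun t => (hd t).differentiableAt) (fun t => (hd t).deriv)
      t 0
    simp only [hγ0, zero_smul, sub_zero] at this
    exact sub_eq_iff_eq_add.1 this
  have hcurve : ∀ s p y t, HasDerivAt (fun t => (γ ((s, p), y) (t - s)).2)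
      (V ((t, p), (γ ((s, p), y) (t - s)).2)) t := by
    intro s p y t
    have h1 : HasDerivAt (fun t : ℝ => (γ ((s, p), y) t).2) (f (γ ((s, p), y) (t - s))).2
        (t - s) := by
      have := (ContinuousLinearMap.snd ℝ (ℝ × P)
        (EuclideanSpace ℝ (Fin N))).hasFDerivAt.comp_hasDerivAt (t - s) (hγd ((s, p), y) (t - s))
      exact this
    have h2 := h1.comp_sub_const t s
    have h3 : γ ((s, p), y) (t - s) = ((t, p), (γ ((s, p), y) (t - s)).2) :=
      Prod.ext (by simp [hγ1]) rfl
    rw [← h3]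
    exact h2
  have hVp : ∀ p, ContDiff ℝ ∞ fun x : ℝ × EuclideanSpace ℝ (Fin N) => V ((x.1, p), x.2) :=
    fun p => hV.comp ((contDiff_fst.prodMk contDiff_const).prodMk contDiff_snd)
  have hrange : ∀ (x : ℝ × ℝ × P) m, ∃ m', e m' =
      (γ ((x.1, x.2.2), e m) (x.2.1 - x.1)).2 := by
    rintro ⟨s, t, p⟩ m
    refine mem_range_of_integralCurve (I := J) (j := fun x : ℝ × M => e x.2)
      (he.comp contMDiff_snd) (fun _ => hemb.injective) (fun _ => hei) (hVp p) ?_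
      (hcurve s p (e m)) (s₀ := s) ⟨m, ?_⟩ t
    · intro t m
      refine ⟨X ((t, p), m), ?_⟩
      simp only [deriv_const, zero_add]
      exact hVe _ _
    · simp [hγ0]
  have hf' : ContMDiff (𝓘(ℝ, ℝ × ℝ × P).prod J) 𝓘(ℝ, EuclideanSpace ℝ (Fin N)) ∞
      (fun x : (ℝ × ℝ × P) × M => (γ ((x.1.1, x.1.2.2), e x.2) (x.1.2.1 - x.1.1)).2) := by
    have h1 : ContDiff ℝ ∞ fun x : (ℝ × ℝ × P) × EuclideanSpace ℝ (Fin N) =>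
        (γ ((x.1.1, x.1.2.2), x.2) (x.1.2.1 - x.1.1)).2 :=
      contDiff_snd.comp (hγs.comp ((by fun_prop : ContDiff ℝ ∞
        fun x : (ℝ × ℝ × P) × EuclideanSpace ℝ (Fin N) =>
          (x.1.2.1 - x.1.1, ((x.1.1, x.1.2.2), x.2)))))
    exact h1.contMDiff.comp (contMDiff_fst.prodMk_space (he.comp contMDiff_snd))
  obtain ⟨Θ, hΘ, hΘe⟩ := exists_smooth_reparametrization (P := ℝ × ℝ × P) (I := J)
    (J := 𝓘(ℝ, EuclideanSpace ℝ (Fin N))) (f := fun x : (ℝ × ℝ × P) × M => e x.2)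
    (he.comp contMDiff_snd) hf' (fun _ => hemb.injective) (fun _ => hei) (fun x m => hrange x m)
  simp only [Prod.forall] at hΘe
  have hΘd : ∀ s p m, MDifferentiable 𝓘(ℝ, ℝ) J (fun t => Θ ((s, t, p), m)) := fun s p m =>
    (hΘ.comp ((contDiff_const.prodMk (contDiff_id.prodMk contDiff_const)).contMDiff.prodMk
      contMDiff_const)).mdifferentiable (by simp)
  have hed : MDifferentiable J 𝓘(ℝ, EuclideanSpace ℝ (Fin N)) e := he.mdifferentiable (by simp)
  have h1 : ∀ s p m, Θ ((s, s, p), m) = m := fun s p m => hemb.injective (by simp [hΘe, hγ0])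
  have h2 : ∀ s t p m, mfderiv 𝓘(ℝ, ℝ) J (fun t => Θ ((s, t, p), m)) t (1 : ℝ) =
        X ((t, p), Θ ((s, t, p), m)) := by
    intro s t p m
    apply hei'
    have e1 := hasDerivAt_comp_curve (hed _) (hΘd s p m t)
    have e2 := hcurve s p (e m) t
    simp only [← hΘe] at e2
    rw [e1.unique e2, hVe]
  have h3 : ∀ (p : P) (c : ℝ → M), MDifferentiable 𝓘(ℝ, ℝ) J c →
        (∀ t, mfderiv 𝓘(ℝ, ℝ) J c t (1 : ℝ) = X ((t, p), c t)) →
        ∀ s t, Θ ((s, t, p), c s) = c t := by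
    intro p c hc hc' s t
    apply hemb.injective
    have key : ∀ c : ℝ → M, MDifferentiable 𝓘(ℝ, ℝ) J c →
        (∀ t, mfderiv 𝓘(ℝ, ℝ) J c t (1 : ℝ) = X ((t, p), c t)) →
        ∀ t, HasDerivAt (fun t => ((t, p), e (c t))) (f ((t, p), e (c t))) t := by
      intro c hc hc' t
      have := hasDerivAt_comp_curve (hed _) (hc t)
      rw [hc', ← hVe] at this
      exact ((hasDerivAt_id' t).prodMk (hasDerivAt_const t p)).prodMk this
    have := eq_of_integralCurves hfK (t₀ := s) (key _ (hΘd s p (c s)) (fun t => h2 s t p _))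
      (key c hc hc') (by simp only [h1])
    exact congrArg Prod.snd (congrFun this t)
  exact ⟨Θ, hΘ, h1, h2, h3, fun s t t' p m => h3 p (fun t => Θ ((s, t, p), m)) (hΘd s p m)
    (fun t => h2 s t p m) t t'⟩

/-- Invariance of a moving compact submanifold under a vector field which is tangent to it. -/
theorem mem_range_of_integralCurve_manifold [CompactSpace M] [T2Space M] [Nonempty M]
    {EL HL : Type*} [NormedAddCommGroup EL] [NormedSpace ℝ EL] [FiniteDimensional ℝ EL]
    [TopologicalSpace HL] {I : ModelWithCorners ℝ EL HL} [I.Boundaryless] {L : Type*}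
    [TopologicalSpace L] [ChartedSpace HL L] [IsManifold I ∞ L] [CompactSpace L]
    {j : ℝ × L → M} (hj : ContMDiff (𝓘(ℝ, ℝ).prod I) J ∞ j)
    (hji : ∀ s, Function.Injective (fun q => j (s, q)))
    (hjd : ∀ s q, Function.Injective (mfderiv I J (fun q => j (s, q)) q))
    (X : ∀ x : ℝ × M, TangentSpace J x.2)
    (hX : ∀ (N : ℕ) (e : M → EuclideanSpace ℝ (Fin N)), ContMDiff J 𝓘(ℝ, EuclideanSpace ℝ (Fin N))
      ∞ e → ContMDiff (𝓘(ℝ, ℝ).prod J) 𝓘(ℝ, EuclideanSpace ℝ (Fin N)) ∞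
        (fun x : ℝ × M => vectorDiff J e x.2 (X x)))
    (htan : ∀ s q, ∃ u : TangentSpace I q, X (s, j (s, q)) =
      mfderiv 𝓘(ℝ, ℝ) J (fun s => j (s, q)) s (1 : ℝ) + mfderiv I J (fun q => j (s, q)) q u)
    {c : ℝ → M} (hc : MDifferentiable 𝓘(ℝ, ℝ) J c)
    (hc' : ∀ t, mfderiv 𝓘(ℝ, ℝ) J c t (1 : ℝ) = X (t, c t)) {s₀ : ℝ} (h₀ : ∃ q, j (s₀, q) = c s₀)
    (s : ℝ) : ∃ q, j (s, q) = c s := by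
  obtain ⟨N, e, he, hemb, hei⟩ := exists_embedding_euclidean_of_compact (I := J) (M := M)
  have hei' : ∀ m, Function.Injective (vectorDiff J e m) := hei
  have hed : MDifferentiable J 𝓘(ℝ, EuclideanSpace ℝ (Fin N)) e := he.mdifferentiable (by simp)
  obtain ⟨V, hV, hVe, -⟩ := exists_extension_family (P := ℝ) (I := J)
    (J := 𝓘(ℝ, EuclideanSpace ℝ (Fin N))) (f := fun x : ℝ × M => e x.2)
    (he.comp contMDiff_snd) (fun _ => hemb.injective) (fun _ => hei) (hX N e he)
  rw [← modelWithCornersSelf_prod, chartedSpaceSelf_prod] at hV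
  have hjs : ∀ s, MDifferentiable I J (fun q => j (s, q)) := fun s =>
    (hj.comp (contMDiff_const.prodMk contMDiff_id)).mdifferentiable (by simp)
  have hjq : ∀ q, MDifferentiable 𝓘(ℝ, ℝ) J (fun s => j (s, q)) := fun q =>
    (hj.comp (contMDiff_id.prodMk contMDiff_const)).mdifferentiable (by simp)
  obtain ⟨q, hq⟩ := mem_range_of_integralCurve (I := I) (j := fun x => e (j x)) (he.comp hj)
    (fun s => hemb.injective.comp (hji s))
    (fun s q => by
      have h : ∀ u, vectorDiff I (fun q => e (j (s, q))) q u = _ :=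
        fun u => vectorDiff_comp (hed _) (hjs s q) u
      intro u v huv
      refine hjd s q (hei' (j (s, q)) ?_)
      rw [← h, ← h]
      exact huv)
    hV.contDiff
    (fun s q => by
      obtain ⟨u, hu⟩ := htan s q
      refine ⟨u, ?_⟩
      rw [hVe, hu, map_add, (hasDerivAt_comp_curve (hed _) (hjq q s)).deriv,
        vectorDiff_comp (hed _) (hjs s q)])
    (c := fun s => e (c s))
    (fun s => by
      have := hasDerivAt_comp_curve (hed _) (hc s)
      rw [hc', ← hVe] at this
      exact this) (s₀ := s₀) (h₀.imp fun q hq => by rw [hq]) s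
  exact ⟨q, hemb.injective hq⟩

end ManifoldFlow

/-! ### Pullbacks of the symplectic form and Hamiltonian vector fields -/

section Pullback

variable {n : ℕ} {M : Type*} [TopologicalSpace M]
  [ChartedSpace (EuclideanSpace ℝ (Fin (2 * n))) M] (ω₀ : SymplecticForm n M)

theorem SymplecticForm.form_hamVec (f : M → ℝ) (m : M) (v : TangentSpace (𝓡 (2 * n)) m) :
    ω₀.form m ![ω₀.hamVec f m, v] = vectorDiff (𝓡 (2 * n)) f m v :=
  (ω₀.exists_dual m (mfderiv (𝓡 (2 * n)) 𝓘(ℝ, ℝ) f m)).choose_spec v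

/-- A 2-form is skew. -/
theorem form_swap {V : Type*} [AddCommGroup V] [Module ℝ V] [TopologicalSpace V]
    (θ : V [⋀^Fin 2]→L[ℝ] ℝ) (u v : V) : θ ![u, v] = -θ ![v, u] := by
  have h := θ.toAlternatingMap.map_swap ![v, u] (show (0 : Fin 2) ≠ 1 by decide)
  have e : (![v, u] ∘ Equiv.swap (0 : Fin 2) 1) = ![u, v] := by
    funext i
    fin_cases i <;> simp
  rw [e] at h
  exact h

theorem form_self {V : Type*} [AddCommGroup V] [Module ℝ V] [TopologicalSpace V]
    (θ : V [⋀^Fin 2]→L[ℝ] ℝ) (u : V) : θ ![u, u] = 0 := by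
  have := form_swap θ u u
  linarith

theorem comp_cons_two {V W : Type*} (A : V → W) (a b : V) : A ∘ ![a, b] = ![A a, A b] := by
  funext i
  fin_cases i <;> rfl

variable {E : Type*} [NormedAddCommGroup E] [NormedSpace ℝ E]

/-- The pullback of the symplectic form under a map of a vector space to `M`, as a function with
values in the alternating forms on the vector space. -/
def SymplecticForm.pull (u : E → M) (x : E) : E [⋀^Fin 2]→L[ℝ] ℝ :=
  ω₀.form.pullback (J := 𝓘(ℝ, E)) u x

theorem SymplecticForm.pull_apply (u : E → M) (x a b : E) :
    ω₀.pull u x ![a, b] =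
      ω₀.form (u x) ![mfderiv 𝓘(ℝ, E) (𝓡 (2 * n)) u x a, mfderiv 𝓘(ℝ, E) (𝓡 (2 * n)) u x b] := by
  have : ω₀.pull u x ![a, b] =
    ω₀.form (u x) (mfderiv 𝓘(ℝ, E) (𝓡 (2 * n)) u x ∘ ![a, b]) := rfl
  rw [this]
  exact congrArg _ (comp_cons_two _ a b)

/-- A 2-form on a Euclidean space as a bilinear map. -/
def bilinearOfForm {V : Type*} [NormedAddCommGroup V] [NormedSpace ℝ V] [FiniteDimensional ℝ V]
    (θ : V [⋀^Fin 2]→L[ℝ] ℝ) : V →L[ℝ] V →L[ℝ] ℝ :=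
  LinearMap.toContinuousBilinearMap (LinearMap.mk₂ ℝ (fun u v => θ ![u, v])
    (fun u u' v => θ.toMultilinearMap.cons_add ![v] u u')
    (fun c u v => θ.toMultilinearMap.cons_smul ![v] c u)
    (fun u v v' => by
      rw [form_swap, form_swap θ u v, form_swap θ u v', ← neg_add]
      exact congrArg _ (θ.toMultilinearMap.cons_add ![u] v v'))
    (fun c u v => by
      rw [form_swap, form_swap θ u v, smul_neg]
      exact congrArg _ (θ.toMultilinearMap.cons_smul ![u] c v)))

@[simp]
theorem bilinearOfForm_apply {V : Type*} [NormedAddCommGroup V] [NormedSpace ℝ V]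
    [FiniteDimensional ℝ V] (θ : V [⋀^Fin 2]→L[ℝ] ℝ) (u v : V) :
    bilinearOfForm θ u v = θ ![u, v] := rfl

theorem isInvertible_bilinearOfForm {V : Type*} [NormedAddCommGroup V] [NormedSpace ℝ V]
    [FiniteDimensional ℝ V] {θ : V [⋀^Fin 2]→L[ℝ] ℝ} (hθ : ∀ u, (∀ v, θ ![u, v] = 0) → u = 0) :
    (bilinearOfForm θ).IsInvertible := by
  have hinj : Function.Injective (bilinearOfForm θ).toLinearMap := by
    rw [injective_iff_map_eq_zero]
    exact fun v hv => hθ v fun w => congrArg (fun B => B w) hv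
  have hfr : Module.finrank ℝ V = Module.finrank ℝ (V →L[ℝ] ℝ) := by
    rw [LinearEquiv.finrank_eq (LinearMap.toContinuousLinearMap (𝕜 := ℝ) (E := V) (F' := ℝ)).symm]
    exact (Subspace.dual_finrank_eq (K := ℝ)).symm
  refine ⟨(LinearEquiv.ofInjectiveOfFinrankEq _ hinj hfr).toContinuousLinearEquiv, ?_⟩
  ext v w
  rfl

theorem nondegenerate_comp {V W : Type*} [AddCommGroup V] [Module ℝ V] [TopologicalSpace V]
    [AddCommGroup W] [Module ℝ W] [TopologicalSpace W] {θ : W [⋀^Fin 2]→L[ℝ] ℝ}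
    (hθ : ∀ u, (∀ v, θ ![u, v] = 0) → u = 0) (A : V ≃L[ℝ] W) (u : V)
    (hu : ∀ v, θ.compContinuousLinearMap (A : V →L[ℝ] W) ![u, v] = 0) : u = 0 := by
  refine (map_eq_zero_iff A A.injective).1 (hθ _ fun w => ?_)
  have h : θ (A ∘ ![u, A.symm w]) = 0 := hu (A.symm w)
  rwa [comp_cons_two, A.apply_symm_apply] at h

theorem SymplecticForm.contDiffOn_bilinear (m₀ : M) :
    ContDiffOn ℝ ∞ (fun y => bilinearOfForm (ω₀.form.inChart m₀ y))
      (extChartAt (𝓡 (2 * n)) m₀).target := by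
  rw [contDiffOn_clm_apply]
  intro a
  rw [contDiffOn_clm_apply]
  intro b
  simp only [bilinearOfForm_apply]
  exact (ContinuousAlternatingMap.apply ℝ _ ℝ ![a, b]).contDiff.comp_contDiffOn (ω₀.smooth m₀)

variable [IsManifold (𝓡 (2 * n)) ∞ M]

/-- The local expression of the pullback of the symplectic form. -/
theorem SymplecticForm.pull_eventuallyEq {u : E → M} {U : Set E} (hU : IsOpen U)
    (hu : ContMDiffOn 𝓘(ℝ, E) (𝓡 (2 * n)) ∞ u U) {p : E} (hp : p ∈ U) :
    ContDiffAt ℝ ∞ (fun x => extChartAt (𝓡 (2 * n)) (u p) (u x)) p ∧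
    ∀ᶠ x in 𝓝 p, ω₀.pull u x =
      (ω₀.form.inChart (u p) (extChartAt (𝓡 (2 * n)) (u p) (u x))).compContinuousLinearMap
        (fderiv ℝ (fun x => extChartAt (𝓡 (2 * n)) (u p) (u x)) x) := by
  set φ := extChartAt (𝓡 (2 * n)) (u p) with hφ
  have hcont : ContinuousAt u p := (hu.contMDiffAt (hU.mem_nhds hp)).continuousAt
  have hsrc : ∀ᶠ x in 𝓝 p, u x ∈ φ.source :=
    hcont.eventually (extChartAt_source_mem_nhds (I := 𝓡 (2 * n)) (u p))
  refine ⟨?_, ?_⟩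
  · exact ((contMDiffAt_extChartAt (I := 𝓡 (2 * n)) (n := ∞) (x := u p)).comp p
      (hu.contMDiffAt (hU.mem_nhds hp))).contDiffAt
  · filter_upwards [hsrc, hU.mem_nhds hp] with x hx hxU
    have hux : MDifferentiableAt 𝓘(ℝ, E) (𝓡 (2 * n)) u x :=
      (hu.contMDiffAt (hU.mem_nhds hxU)).mdifferentiableAt (by simp)
    have hφx : MDifferentiableAt (𝓡 (2 * n)) 𝓘(ℝ, EuclideanSpace ℝ (Fin (2 * n))) φ (u x) :=
      mdifferentiableAt_extChartAt (by rwa [hφ, extChartAt_source] at hx)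
    have h1 : fderiv ℝ (fun x => φ (u x)) x =
        mfderiv (𝓡 (2 * n)) 𝓘(ℝ, EuclideanSpace ℝ (Fin (2 * n))) φ (u x) ∘L
          mfderiv 𝓘(ℝ, E) (𝓡 (2 * n)) u x := by
      rw [← mfderiv_eq_fderiv]
      exact mfderiv_comp x hφx hux
    rw [h1]
    ext v
    have h2 : ∀ w, mfderiv 𝓘(ℝ, EuclideanSpace ℝ (Fin (2 * n))) (𝓡 (2 * n)) φ.symm (φ (u x))
        (mfderiv (𝓡 (2 * n)) 𝓘(ℝ, EuclideanSpace ℝ (Fin (2 * n))) φ (u x) w) = w := fun w =>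
      congrArg (fun A => A w) (mfderiv_extChartAt_symm_comp hx)
    have key : ∀ (m : M) (hm : m = u x) (v : Fin 2 → TangentSpace (𝓡 (2 * n)) (u x)),
        ω₀.form m v = ω₀.form (u x) v := by
      rintro m rfl v; rfl
    change ω₀.form (u x) (fun i => mfderiv 𝓘(ℝ, E) (𝓡 (2 * n)) u x (v i)) =
      ω₀.form (φ.symm (φ (u x))) (fun i =>
        mfderiv 𝓘(ℝ, EuclideanSpace ℝ (Fin (2 * n))) (𝓡 (2 * n)) φ.symm (φ (u x))
        (mfderiv (𝓡 (2 * n)) 𝓘(ℝ, EuclideanSpace ℝ (Fin (2 * n))) φ (u x)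
          (mfderiv 𝓘(ℝ, E) (𝓡 (2 * n)) u x (v i))))
    rw [← key _ (φ.left_inv hx)]
    congr 1
    funext i
    exact (h2 _).symm

theorem SymplecticForm.differentiableAt_pull {u : E → M} {U : Set E}
    (hU : IsOpen U)
    (hu : ContMDiffOn 𝓘(ℝ, E) (𝓡 (2 * n)) ∞ u U) {p : E} (hp : p ∈ U) :
    DifferentiableAt ℝ (ω₀.pull u) p := by
  obtain ⟨h1, h2⟩ := ω₀.pull_eventuallyEq hU hu hp
  have h3 : ContDiffAt ℝ ∞ (ω₀.form.inChart (u p)) (extChartAt (𝓡 (2 * n)) (u p) (u p)) :=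
    (ω₀.smooth (u p)).contDiffAt (extChartAt_target_mem_nhds (u p))
  have h4 := (DifferentiableAt.comp p (g := ω₀.form.inChart (u p))
    (f := fun x => extChartAt (𝓡 (2 * n)) (u p) (u x)) (h3.differentiableAt (by simp))
    (h1.differentiableAt (by simp))).hasFDerivAt
  have h5 := ((h1.fderiv_right (m := ∞) (by simp)).differentiableAt (by simp)).hasFDerivAt
  exact ((h4.continuousAlternatingMapCompContinuousLinearMap h5).congr_of_eventuallyEq
    h2).differentiableAt

theorem SymplecticForm.extDeriv_pull {u : E → M} {U : Set E}
    (hU : IsOpen U)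
    (hu : ContMDiffOn 𝓘(ℝ, E) (𝓡 (2 * n)) ∞ u U) {p : E} (hp : p ∈ U) :
    extDeriv (ω₀.pull u) p = 0 := by
  obtain ⟨h1, h2⟩ := ω₀.pull_eventuallyEq hU hu hp
  have h3 : ContDiffAt ℝ ∞ (ω₀.form.inChart (u p)) (extChartAt (𝓡 (2 * n)) (u p) (u p)) :=
    (ω₀.smooth (u p)).contDiffAt (extChartAt_target_mem_nhds (u p))
  have h5 : DifferentiableAt ℝ (ω₀.form.inChart (u p))
      ((fun x => extChartAt (𝓡 (2 * n)) (u p) (u x)) p) := h3.differentiableAt (by simp)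
  rw [Filter.EventuallyEq.extDeriv_eq h2]
  refine (extDeriv_pullback (f := fun x => extChartAt (𝓡 (2 * n)) (u p) (u x)) h5 h1
    (by simpa using WithTop.coe_le_coe.2 (le_top : (2 : ℕ∞) ≤ ⊤))).trans ?_
  have h4 : extDeriv (ω₀.form.inChart (u p)) (extChartAt (𝓡 (2 * n)) (u p) (u p)) = 0 := by
    have hc := congrFun ω₀.closed (u p)
    ext v
    have hinv := mfderiv_extChartAt_comp_symm (J := 𝓡 (2 * n))
      (mem_extChartAt_target (I := 𝓡 (2 * n)) (u p))
    rw [extChartAt_to_inv] at hinv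
    have h5 := congrArg (fun θ => θ (fun i => mfderiv 𝓘(ℝ, EuclideanSpace ℝ (Fin (2 * n)))
      (𝓡 (2 * n)) (extChartAt (𝓡 (2 * n)) (u p)).symm (extChartAt (𝓡 (2 * n)) (u p) (u p)) (v i)))
      hc
    have h6 : ∀ w, mfderiv (𝓡 (2 * n)) 𝓘(ℝ, EuclideanSpace ℝ (Fin (2 * n)))
        (extChartAt (𝓡 (2 * n)) (u p)) (u p) (mfderiv 𝓘(ℝ, EuclideanSpace ℝ (Fin (2 * n)))
        (𝓡 (2 * n)) (extChartAt (𝓡 (2 * n)) (u p)).symm (extChartAt (𝓡 (2 * n)) (u p) (u p)) w) =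
        w := fun w => congrArg (fun A => A w) hinv
    refine Eq.trans ?_ h5
    change _ = extDeriv (ω₀.form.inChart (u p)) (extChartAt (𝓡 (2 * n)) (u p) (u p)) _
    congr 1
    funext i
    exact (h6 _).symm
  rw [h4]
  rfl

/-- Closedness of the symplectic form, evaluated on three constant vector fields. -/
theorem SymplecticForm.pull_cyclic {u : E → M} {U : Set E} (hU : IsOpen U)
    (hu : ContMDiffOn 𝓘(ℝ, E) (𝓡 (2 * n)) ∞ u U) {p : E} (hp : p ∈ U) (a b c : E) :
    fderiv ℝ (fun x => ω₀.pull u x ![b, c]) p a = fderiv ℝ (fun x => ω₀.pull u x ![a, c]) p b -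
      fderiv ℝ (fun x => ω₀.pull u x ![a, b]) p c := by
  have h := (extDeriv_apply (ω₀.differentiableAt_pull hU hu hp) ![a, b, c]).trans
    (Fin.sum_univ_three _)
  rw [ω₀.extDeriv_pull hU hu hp] at h
  have e0 : (0 : Fin 3).removeNth ![a, b, c] = ![b, c] := by
    funext i; fin_cases i <;> rfl
  have e1 : (1 : Fin 3).removeNth ![a, b, c] = ![a, c] := by
    funext i; fin_cases i <;> rfl
  have e2 : (2 : Fin 3).removeNth ![a, b, c] = ![a, b] := by
    funext i; fin_cases i <;> rfl
  rw [e0, e1, e2] at h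
  have e3 : ![a, b, c] 2 = c := rfl
  norm_num [e3] at h
  linarith

theorem SymplecticForm.contDiffOn_pull_apply {u : E → M} {U : Set E}
    (hU : IsOpen U) (hu : ContMDiffOn 𝓘(ℝ, E) (𝓡 (2 * n)) ∞ u U) (a b : E) :
    ContDiffOn ℝ ∞ (fun x => ω₀.pull u x ![a, b]) U := by
  intro p hp
  obtain ⟨h1, h2⟩ := ω₀.pull_eventuallyEq hU hu hp
  have h3 : ContDiffAt ℝ ∞ (fun y => bilinearOfForm (ω₀.form.inChart (u p) y))
      (extChartAt (𝓡 (2 * n)) (u p) (u p)) :=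
    (ω₀.contDiffOn_bilinear (u p)).contDiffAt (extChartAt_target_mem_nhds (u p))
  have h4 := h1.fderiv_right (m := ∞) (by simp)
  have h5 := ((h3.comp p h1).clm_apply (h4.clm_apply (contDiffAt_const (c := a)))).clm_apply
    (h4.clm_apply (contDiffAt_const (c := b)))
  refine (h5.congr_of_eventuallyEq ?_).contDiffWithinAt
  filter_upwards [h2] with x hx
  rw [hx]
  exact congrArg (ω₀.form.inChart (u p) (extChartAt (𝓡 (2 * n)) (u p) (u x)))
    (comp_cons_two (fderiv ℝ (fun x => extChartAt (𝓡 (2 * n)) (u p) (u x)) x) a b)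

/-- The inverse of the symplectic form in a chart is smooth. -/
theorem SymplecticForm.contDiffOn_inverse (m₀ : M) :
    ContDiffOn ℝ ∞ (fun y => (bilinearOfForm (ω₀.form.inChart m₀ y)).inverse)
      (extChartAt (𝓡 (2 * n)) m₀).target ∧
    ∀ y ∈ (extChartAt (𝓡 (2 * n)) m₀).target,
      (bilinearOfForm (ω₀.form.inChart m₀ y)).IsInvertible := by
  have hinv : ∀ y ∈ (extChartAt (𝓡 (2 * n)) m₀).target,
      (bilinearOfForm (ω₀.form.inChart m₀ y)).IsInvertible := by
    intro y hy
    obtain ⟨A, hA⟩ := isInvertible_mfderiv_extChartAt_symm (J := 𝓡 (2 * n)) hy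
    have h := nondegenerate_comp (ω₀.nondegenerate ((extChartAt (𝓡 (2 * n)) m₀).symm y)) A
    rw [hA] at h
    exact isInvertible_bilinearOfForm h
  refine ⟨fun y hy => ?_, hinv⟩
  obtain ⟨A, hA⟩ := hinv y hy
  have h1 := contDiffAt_map_inverse (𝕜 := ℝ) (n := ∞) A
  rw [hA] at h1
  exact h1.comp_contDiffWithinAt y (ω₀.contDiffOn_bilinear m₀ y hy)

end Pullback

/-! ### Smoothness of Hamiltonian vector fields -/

section ChainRule

variable {EM HM : Type*} [NormedAddCommGroup EM] [NormedSpace ℝ EM]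
  [TopologicalSpace HM] {J : ModelWithCorners ℝ EM HM} {M : Type*}
  [TopologicalSpace M] [ChartedSpace HM M]
  {G : Type*} [NormedAddCommGroup G] [NormedSpace ℝ G]
  {P : Type*} [NormedAddCommGroup P] [NormedSpace ℝ P]
  {EW HW : Type*} [NormedAddCommGroup EW] [NormedSpace ℝ EW]
  [TopologicalSpace HW] {I : ModelWithCorners ℝ EW HW} {W : Type*}
  [TopologicalSpace W] [ChartedSpace HW W]

theorem vectorDiff_eq_fderiv (h : P → G) (x : P) : vectorDiff 𝓘(ℝ, P) h x = fderiv ℝ h x :=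
  mfderiv_eq_fderiv

theorem mfderiv_comp_hasFDerivAt {E : Type*} [NormedAddCommGroup E] [NormedSpace ℝ E] {u : E → M}
    {c : P → E} {c' : P →L[ℝ] E} {a : P} (hu : MDifferentiableAt 𝓘(ℝ, E) J u (c a))
    (hc : HasFDerivAt c c' a) (v : P) :
    mfderiv 𝓘(ℝ, P) J (fun a => u (c a)) a v = mfderiv 𝓘(ℝ, E) J u (c a) (c' v) := by
  have h := hu.hasMFDerivAt.comp a hc.hasMFDerivAt
  exact congrArg (fun A => A v) h.mfderiv

/-- The chain rule for a function of a parameter and a point of a manifold. -/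
theorem vectorDiff_comp_prod {F : P × M → G} {z : W → P} {u : W → M} {x : W}
    (hF : MDifferentiableAt (𝓘(ℝ, P).prod J) 𝓘(ℝ, G) F (z x, u x))
    (hz : MDifferentiableAt I 𝓘(ℝ, P) z x) (hu : MDifferentiableAt I J u x)
    (v : TangentSpace I x) :
    vectorDiff I (fun x => F (z x, u x)) x v =
      fderiv ℝ (fun p => F (p, u x)) (z x) (vectorDiff I z x v) +
        vectorDiff J (fun m => F (z x, m)) (u x) (mfderiv I J u x v) := by
  have h1 := hF.hasMFDerivAt.comp x (hz.hasMFDerivAt.prodMk hu.hasMFDerivAt)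
  have h2 : vectorDiff I (fun x => F (z x, u x)) x v =
      vectorDiff (𝓘(ℝ, P).prod J) F (z x, u x) (mfderiv I 𝓘(ℝ, P) z x v, mfderiv I J u x v) :=
    congrArg (fun A => (A v : G)) h1.mfderiv
  rw [h2, ← vectorDiff_eq_fderiv]
  exact mfderiv_prod_eq_add_apply hF

/-- A statement about tangent vectors may be checked in charts. -/
theorem forall_tangent_of_chart [I.Boundaryless] [IsManifold I 1 W]
    {p : ∀ q : W, TangentSpace I q → Prop}
    (h : ∀ q₀ : W, ∀ y ∈ (extChartAt I q₀).target, ∀ w : EW,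
      p ((extChartAt I q₀).symm y) (mfderiv 𝓘(ℝ, EW) I (extChartAt I q₀).symm y w))
    (q : W) (v : TangentSpace I q) : p q v := by
  have key : ∀ q' : W, q' = q → (∀ v : TangentSpace I q', p q' v) → p q v := by
    rintro _ rfl h; exact h v
  refine key _ (extChartAt_to_inv (I := I) q) fun v => ?_
  have hy := mem_extChartAt_target (I := I) q
  obtain ⟨A, hA⟩ := isInvertible_mfderiv_extChartAt_symm (J := I) hy
  have h1 := h q _ hy (A.symm v)
  rw [← hA] at h1
  have h2 : p _ (A (A.symm v)) := h1
  rwa [A.apply_symm_apply] at h2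

theorem contDiffOn_comp_extChartAt_symm [IsManifold J ∞ M] {f : P × M → G}
    (hf : ContMDiff (𝓘(ℝ, P).prod J) 𝓘(ℝ, G) ∞ f) (m₀ : M) :
    ContDiffOn ℝ ∞ (fun x : P × EM => f (x.1, (extChartAt J m₀).symm x.2))
      (univ ×ˢ (extChartAt J m₀).target) := by
  have h2 : ContMDiffOn (𝓘(ℝ, P).prod 𝓘(ℝ, EM)) 𝓘(ℝ, G) ∞
      (fun x : P × EM => f (x.1, (extChartAt J m₀).symm x.2))
      (univ ×ˢ (extChartAt J m₀).target) := by
    refine hf.comp_contMDiffOn (f := fun x : P × EM => (x.1, (extChartAt J m₀).symm x.2)) ?_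
    exact contMDiffOn_fst.prodMk ((contMDiffOn_extChartAt_symm m₀).comp contMDiffOn_snd
      fun x hx => hx.2)
  rw [← modelWithCornersSelf_prod, chartedSpaceSelf_prod] at h2
  exact h2.contDiffOn

theorem vectorDiff_extChartAt_symm [J.Boundaryless] [IsManifold J ∞ M] {f : P × M → G}
    (hf : ContMDiff (𝓘(ℝ, P).prod J) 𝓘(ℝ, G) ∞ f) {m₀ : M} (p : P) {y : EM}
    (hy : y ∈ (extChartAt J m₀).target) (w : EM) :
    vectorDiff J (fun m => f (p, m)) ((extChartAt J m₀).symm y)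
      (mfderiv 𝓘(ℝ, EM) J (extChartAt J m₀).symm y w) =
      fderiv ℝ (fun x : P × EM => f (x.1, (extChartAt J m₀).symm x.2)) (p, y) (0, w) := by
  have h1 := vectorDiff_comp (e := fun m => f (p, m)) (c := (extChartAt J m₀).symm) (q := y)
    ((hf.comp (contMDiff_const.prodMk contMDiff_id)).mdifferentiableAt (by simp))
    (mdifferentiableAt_extChartAt_symm hy) w
  rw [← h1, vectorDiff_eq_fderiv]
  have h2 : DifferentiableAt ℝ (fun x : P × EM => f (x.1, (extChartAt J m₀).symm x.2)) (p, y) :=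
    ((contDiffOn_comp_extChartAt_symm hf m₀).contDiffAt
      ((isOpen_univ.prod (isOpen_extChartAt_target m₀)).mem_nhds ⟨mem_univ _, hy⟩)).differentiableAt
      (by simp)
  have h3 := h2.hasFDerivAt.comp y (hasFDerivAt_prodMk_right p y)
  exact congrArg (fun A => A w) h3.fderiv

end ChainRule

section HamiltonianVectorFields

variable {n : ℕ} {M : Type*} [TopologicalSpace M]
  [ChartedSpace (EuclideanSpace ℝ (Fin (2 * n))) M] (ω₀ : SymplecticForm n M)

theorem SymplecticForm.hamVec_eq {f : M → ℝ} {m : M} {u : TangentSpace (𝓡 (2 * n)) m}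
    (h : ∀ v, ω₀.form m ![u, v] = vectorDiff (𝓡 (2 * n)) f m v) : ω₀.hamVec f m = u := by
  refine sub_eq_zero.1 (ω₀.nondegenerate m _ fun v => ?_)
  have h1 : ω₀.form m ![ω₀.hamVec f m - u, v] + ω₀.form m ![u, v] =
      ω₀.form m ![ω₀.hamVec f m, v] := by
    have := (ω₀.form m).toMultilinearMap.cons_add ![v] (ω₀.hamVec f m - u) u
    rw [sub_add_cancel] at this
    exact this.symm
  rw [ω₀.form_hamVec, h] at h1
  linarith

theorem SymplecticForm.hamVec_eq_zero {f : M → ℝ} {m : M} (h : ∀ m', f m' = 0) :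
    ω₀.hamVec f m = 0 := by
  refine ω₀.hamVec_eq fun v => ?_
  have : f = fun _ => 0 := funext h
  rw [this, (ω₀.form m).map_coord_zero (0 : Fin 2) (by rfl)]
  have h0 : vectorDiff (𝓡 (2 * n)) (fun _ : M => (0 : ℝ)) m = 0 := mfderiv_const
  rw [h0]
  rfl

variable [IsManifold (𝓡 (2 * n)) ∞ M]

variable {P : Type*} [NormedAddCommGroup P] [NormedSpace ℝ P]

/-- The derivative of a smooth family of functions along a smooth family of Hamiltonian vector
fields is smooth. -/
theorem SymplecticForm.contMDiff_vectorDiff_hamVec {G : Type*} [NormedAddCommGroup G]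
    [NormedSpace ℝ G] {e : P × M → G} (he : ContMDiff (𝓘(ℝ, P).prod (𝓡 (2 * n))) 𝓘(ℝ, G) ∞ e)
    {K : P × M → ℝ} (hK : ContMDiff (𝓘(ℝ, P).prod (𝓡 (2 * n))) 𝓘(ℝ, ℝ) ∞ K) :
    ContMDiff (𝓘(ℝ, P).prod (𝓡 (2 * n))) 𝓘(ℝ, G) ∞ (fun x : P × M =>
      vectorDiff (𝓡 (2 * n)) (fun m => e (x.1, m)) x.2
        (ω₀.hamVec (fun m => K (x.1, m)) x.2)) := by
  rintro ⟨p₀, m₀⟩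
  set φ := extChartAt (𝓡 (2 * n)) m₀ with hφ
  let B := fun y => (bilinearOfForm (ω₀.form.inChart m₀ y)).inverse
  let e' := fun x : P × EuclideanSpace ℝ (Fin (2 * n)) => e (x.1, φ.symm x.2)
  let K' := fun x : P × EuclideanSpace ℝ (Fin (2 * n)) => K (x.1, φ.symm x.2)
  let R : P × EuclideanSpace ℝ (Fin (2 * n)) → EuclideanSpace ℝ (Fin (2 * n)) := fun x =>
    B x.2 (fderiv ℝ K' x ∘L ContinuousLinearMap.inr ℝ P _)
  have hopen : IsOpen ((univ : Set P) ×ˢ φ.target) :=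
    isOpen_univ.prod (isOpen_extChartAt_target m₀)
  have hsmooth : ContDiffOn ℝ ∞ (fun x => fderiv ℝ e' x (0, R x)) (univ ×ˢ φ.target) := by
    have h1 := (contDiffOn_comp_extChartAt_symm he m₀).fderiv_of_isOpen (m := ∞) hopen (by simp)
    have h2 := (contDiffOn_comp_extChartAt_symm hK m₀).fderiv_of_isOpen (m := ∞) hopen (by simp)
    have h3 : ContDiffOn ℝ ∞ (fun x : P × EuclideanSpace ℝ (Fin (2 * n)) => B x.2)
        (univ ×ˢ φ.target) :=
      (ω₀.contDiffOn_inverse m₀).1.comp contDiffOn_snd fun x hx => hx.2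
    exact h1.clm_apply (contDiffOn_const.prodMk (h3.clm_apply (h2.clm_comp contDiffOn_const)))
  have hham : ∀ p, ∀ y ∈ φ.target, ω₀.hamVec (fun m => K (p, m)) (φ.symm y) =
      mfderiv 𝓘(ℝ, EuclideanSpace ℝ (Fin (2 * n))) (𝓡 (2 * n)) φ.symm y (R (p, y)) := by
    intro p y hy
    refine ω₀.hamVec_eq fun v => ?_
    obtain ⟨A, hA⟩ := isInvertible_mfderiv_extChartAt_symm (J := 𝓡 (2 * n)) hy
    obtain ⟨w, rfl⟩ := A.surjective v
    have hA' : A w = mfderiv 𝓘(ℝ, EuclideanSpace ℝ (Fin (2 * n))) (𝓡 (2 * n)) φ.symm y w := by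
      rw [← hA]; rfl
    rw [hA']
    refine Eq.trans ?_ (vectorDiff_extChartAt_symm hK p hy w).symm
    have h1 : bilinearOfForm (ω₀.form.inChart m₀ y) (R (p, y)) w = fderiv ℝ K' (p, y) (0, w) := by
      simp only [R, B]
      rw [((ω₀.contDiffOn_inverse m₀).2 y hy).self_apply_inverse]
      rfl
    refine Eq.trans ?_ h1
    exact congrArg (ω₀.form (φ.symm y)) (comp_cons_two _ _ _).symm
  have hsrc : (univ : Set P) ×ˢ φ.source ∈ 𝓝 (p₀, m₀) :=
    prod_mem_nhds Filter.univ_mem (extChartAt_source_mem_nhds m₀)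
  have hchart : ContMDiffAt (𝓘(ℝ, P).prod (𝓡 (2 * n)))
      𝓘(ℝ, P × EuclideanSpace ℝ (Fin (2 * n))) ∞ (fun x : P × M => (x.1, φ x.2)) (p₀, m₀) :=
    contMDiffAt_fst.prodMk_space
      (ContMDiffAt.comp (p₀, m₀) (contMDiffAt_extChartAt (x := m₀)) contMDiffAt_snd)
  have hcomp := ContMDiffAt.comp (p₀, m₀) (f := fun x : P × M => (x.1, φ x.2))
    (hsmooth.contDiffAt (hopen.mem_nhds ⟨mem_univ _, mem_extChartAt_target m₀⟩)).contMDiffAt hchart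
  refine hcomp.congr_of_eventuallyEq ?_
  filter_upwards [hsrc] with x hx
  have key : ∀ m, m = x.2 → vectorDiff (𝓡 (2 * n)) (fun m => e (x.1, m)) x.2
      (ω₀.hamVec (fun m => K (x.1, m)) x.2) = vectorDiff (𝓡 (2 * n)) (fun m => e (x.1, m)) m
      (ω₀.hamVec (fun m => K (x.1, m)) m) := by
    rintro _ rfl; rfl
  have hy : φ x.2 ∈ φ.target := φ.map_source hx.2
  rw [key _ (φ.left_inv hx.2), hham _ _ hy]
  exact vectorDiff_extChartAt_symm he _ hy _

end HamiltonianVectorFields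

/-! ### Evolution of Lagrangian families under a Hamiltonian flow -/

section Evolution

variable {n : ℕ} {M : Type*} [TopologicalSpace M]
  [ChartedSpace (EuclideanSpace ℝ (Fin (2 * n))) M] (ω₀ : SymplecticForm n M)

section Local

variable {F : Type*} [NormedAddCommGroup F] [NormedSpace ℝ F]

/-- If `∂_s u = X_K(u)`, the form `ω₀(∂_s u, du ·)` is the differential of `K ∘ u` minus the
partial differential of `K` in the parameters. -/
theorem SymplecticForm.pull_evolution {U : Set (ℝ × ℝ × F)} (hU : IsOpen U) {u : ℝ × ℝ × F → M}
    (hu : ContMDiffOn 𝓘(ℝ, ℝ × ℝ × F) (𝓡 (2 * n)) ∞ u U) {K : (ℝ × ℝ) × M → ℝ}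
    (hK : ContMDiff (𝓘(ℝ, ℝ × ℝ).prod (𝓡 (2 * n))) 𝓘(ℝ, ℝ) ∞ K)
    (hus : ∀ x ∈ U, mfderiv 𝓘(ℝ, ℝ × ℝ × F) (𝓡 (2 * n)) u x ((1, 0, 0) : ℝ × ℝ × F) =
      ω₀.hamVec (fun m => K ((x.1, x.2.1), m)) (u x)) {x : ℝ × ℝ × F} (hx : x ∈ U)
    (b : ℝ × ℝ × F) :
    ω₀.pull u x ![(1, 0, 0), b] = fderiv ℝ (fun x => K ((x.1, x.2.1), u x)) x b -
      fderiv ℝ (fun z => K (z, u x)) (x.1, x.2.1) (b.1, b.2.1) := by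
  have hux : MDifferentiableAt 𝓘(ℝ, ℝ × ℝ × F) (𝓡 (2 * n)) u x :=
    (hu.contMDiffAt (hU.mem_nhds hx)).mdifferentiableAt (by simp)
  have hz : HasFDerivAt (fun x : ℝ × ℝ × F => (x.1, x.2.1))
      ((ContinuousLinearMap.fst ℝ ℝ (ℝ × F)).prod
        (ContinuousLinearMap.fst ℝ ℝ F ∘L ContinuousLinearMap.snd ℝ ℝ (ℝ × F))) x :=
    ((ContinuousLinearMap.fst ℝ ℝ (ℝ × F)).prod
      (ContinuousLinearMap.fst ℝ ℝ F ∘L ContinuousLinearMap.snd ℝ ℝ (ℝ × F))).hasFDerivAt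
  have h := vectorDiff_comp_prod (I := 𝓘(ℝ, ℝ × ℝ × F)) (F := K)
    (z := fun x : ℝ × ℝ × F => (x.1, x.2.1)) (u := u) (x := x)
    (hK.mdifferentiableAt (by simp)) hz.differentiableAt.mdifferentiableAt hux b
  rw [vectorDiff_eq_fderiv, vectorDiff_eq_fderiv, hz.fderiv] at h
  rw [ω₀.pull_apply, hus x hx, ω₀.form_hamVec]
  exact eq_sub_of_add_eq' h.symm

variable [IsManifold (𝓡 (2 * n)) ∞ M]

theorem contDiffOn_parameter_derivative {U : Set (ℝ × ℝ × F)}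
    {u : ℝ × ℝ × F → M}
    (hu : ContMDiffOn 𝓘(ℝ, ℝ × ℝ × F) (𝓡 (2 * n)) ∞ u U) {K : (ℝ × ℝ) × M → ℝ}
    (hK : ContMDiff (𝓘(ℝ, ℝ × ℝ).prod (𝓡 (2 * n))) 𝓘(ℝ, ℝ) ∞ K) :
    ContDiffOn ℝ ∞ (fun x => K ((x.1, x.2.1), u x)) U ∧
    ContDiffOn ℝ ∞ (fun x => fderiv ℝ (fun z => K (z, u x)) (x.1, x.2.1)) U := by
  have h1 : ContMDiffOn 𝓘(ℝ, ℝ × ℝ × F) (𝓘(ℝ, ℝ × ℝ).prod (𝓡 (2 * n))) ∞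
      (fun x => ((x.1, x.2.1), u x)) U :=
    ((by fun_prop : ContDiff ℝ ∞ fun x : ℝ × ℝ × F => (x.1, x.2.1)).contMDiff.contMDiffOn).prodMk
      hu
  exact ⟨(hK.comp_contMDiffOn h1).contDiffOn, (hK.fderiv_fst.comp_contMDiffOn h1).contDiffOn⟩

/-- If `∂_s u = X_K(u)`, the function `ω₀(∂_t u, ∂_y u)` changes in `s` by the derivative of
`∂_t K ∘ u` along `y`. This is closedness of `ω₀`, combined with `SymplecticForm.pull_evolution`. -/
theorem SymplecticForm.hasDerivAt_pull_of_evolution {U : Set (ℝ × ℝ × F)} (hU : IsOpen U)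
    {u : ℝ × ℝ × F → M}
    (hu : ContMDiffOn 𝓘(ℝ, ℝ × ℝ × F) (𝓡 (2 * n)) ∞ u U) {K : (ℝ × ℝ) × M → ℝ}
    (hK : ContMDiff (𝓘(ℝ, ℝ × ℝ).prod (𝓡 (2 * n))) 𝓘(ℝ, ℝ) ∞ K)
    (hus : ∀ x ∈ U, mfderiv 𝓘(ℝ, ℝ × ℝ × F) (𝓡 (2 * n)) u x ((1, 0, 0) : ℝ × ℝ × F) =
      ω₀.hamVec (fun m => K ((x.1, x.2.1), m)) (u x)) {x : ℝ × ℝ × F} (hx : x ∈ U)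
    (r : ℝ) (v w : F) :
    fderiv ℝ (fun x => ω₀.pull u x ![(0, r, v), (0, 0, w)]) x (1, 0, 0) =
      fderiv ℝ (fun x => fderiv ℝ (fun z => K (z, u x)) (x.1, x.2.1) (0, r)) x (0, 0, w) := by
  obtain ⟨hf, hk⟩ := contDiffOn_parameter_derivative hu hK
  set f : ℝ × ℝ × F → ℝ := fun x => K ((x.1, x.2.1), u x)
  have hfx : ContDiffAt ℝ ∞ f x := hf.contDiffAt (hU.mem_nhds hx)
  have hkx : DifferentiableAt ℝ (fun x => fderiv ℝ (fun z => K (z, u x)) (x.1, x.2.1)) x :=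
    (hk.contDiffAt (hU.mem_nhds hx)).differentiableAt (by simp)
  have hdf : DifferentiableAt ℝ (fderiv ℝ f) x :=
    (hfx.fderiv_right (m := ∞) (by simp)).differentiableAt (by simp)
  rw [ω₀.pull_cyclic hU hu hx]
  have e1 : (fun x => ω₀.pull u x ![(1, 0, 0), (0, 0, w)]) =ᶠ[𝓝 x]
      fun x => fderiv ℝ f x (0, 0, w) := by
    filter_upwards [hU.mem_nhds hx] with y hy
    rw [ω₀.pull_evolution hU hu hK hus hy]
    have : (((0, 0, w) : ℝ × ℝ × F).1, ((0, 0, w) : ℝ × ℝ × F).2.1) = (0 : ℝ × ℝ) := rfl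
    rw [this, map_zero, sub_zero]
  have e2 : (fun x => ω₀.pull u x ![(1, 0, 0), (0, r, v)]) =ᶠ[𝓝 x]
      fun x => fderiv ℝ f x (0, r, v) -
        fderiv ℝ (fun z => K (z, u x)) (x.1, x.2.1) (0, r) := by
    filter_upwards [hU.mem_nhds hx] with y hy
    rw [ω₀.pull_evolution hU hu hK hus hy]
  have hsymm : fderiv ℝ (fderiv ℝ f) x (0, r, v) (0, 0, w) =
      fderiv ℝ (fderiv ℝ f) x (0, 0, w) (0, r, v) :=
    (hfx.isSymmSndFDerivAt (by simpa using WithTop.coe_le_coe.2 (le_top : (2 : ℕ∞) ≤ ⊤))).eq _ _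
  rw [e1.fderiv_eq, e2.fderiv_eq, fderiv_fun_sub (hdf.clm_apply (differentiableAt_const _))
    (hkx.clm_apply (differentiableAt_const _)), fderiv_clm_apply hdf (differentiableAt_const _),
    fderiv_clm_apply hdf (differentiableAt_const _)]
  simp [hsymm]

end Local

end Evolution

section FamilyChart

variable {EM HM : Type*} [NormedAddCommGroup EM] [NormedSpace ℝ EM]
  [TopologicalSpace HM] {J : ModelWithCorners ℝ EM HM} {N : Type*}
  [TopologicalSpace N] [ChartedSpace HM N]
  {EL HL : Type*} [NormedAddCommGroup EL] [NormedSpace ℝ EL]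
  [TopologicalSpace HL] {I : ModelWithCorners ℝ EL HL} {L : Type*}
  [TopologicalSpace L] [ChartedSpace HL L]

theorem isOpen_family_chart [I.Boundaryless] (q₀ : L) :
    IsOpen {x : ℝ × ℝ × EL | x.2.2 ∈ (extChartAt I q₀).target} :=
  (isOpen_extChartAt_target q₀).preimage (by fun_prop : Continuous fun x : ℝ × ℝ × EL => x.2.2)

variable [IsManifold I ∞ L]

theorem contMDiffOn_family_chart {u : ℝ → ℝ → L → N}
    (hu : ContMDiff (𝓘(ℝ, ℝ).prod (𝓘(ℝ, ℝ).prod I)) J ∞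
      (fun p : ℝ × ℝ × L => u p.1 p.2.1 p.2.2)) (q₀ : L) :
    ContMDiffOn 𝓘(ℝ, ℝ × ℝ × EL) J ∞
      (fun x : ℝ × ℝ × EL => u x.1 x.2.1 ((extChartAt I q₀).symm x.2.2))
      {x | x.2.2 ∈ (extChartAt I q₀).target} := by
  have h1 : ContMDiffOn 𝓘(ℝ, ℝ × ℝ × EL) I ∞
      (fun x : ℝ × ℝ × EL => (extChartAt I q₀).symm x.2.2)
      {x | x.2.2 ∈ (extChartAt I q₀).target} :=
    (contMDiffOn_extChartAt_symm q₀).comp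
      (by fun_prop : ContDiff ℝ ∞ fun x : ℝ × ℝ × EL =>
        x.2.2).contMDiff.contMDiffOn fun x hx => hx
  exact hu.comp_contMDiffOn (contDiff_fst.contMDiff.contMDiffOn.prodMk
    ((by fun_prop : ContDiff ℝ ∞ fun x : ℝ × ℝ × EL =>
        x.2.1).contMDiff.contMDiffOn.prodMk h1))

theorem mfderiv_family_chart [I.Boundaryless] {u : ℝ → ℝ → L → N}
    (hu : ContMDiff (𝓘(ℝ, ℝ).prod (𝓘(ℝ, ℝ).prod I)) J ∞
      (fun p : ℝ × ℝ × L => u p.1 p.2.1 p.2.2)) {q₀ : L} (s t : ℝ) {y : EL}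
    (hy : y ∈ (extChartAt I q₀).target) :
    (mfderiv 𝓘(ℝ, ℝ × ℝ × EL) J
      (fun x : ℝ × ℝ × EL => u x.1 x.2.1 ((extChartAt I q₀).symm x.2.2)) (s, t, y)
      ((1, 0, 0) : ℝ × ℝ × EL) =
        mfderiv 𝓘(ℝ, ℝ) J (fun s => u s t ((extChartAt I q₀).symm y)) s (1 : ℝ)) ∧
    (mfderiv 𝓘(ℝ, ℝ × ℝ × EL) J
      (fun x : ℝ × ℝ × EL => u x.1 x.2.1 ((extChartAt I q₀).symm x.2.2)) (s, t, y)
      ((0, 1, 0) : ℝ × ℝ × EL) =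
        mfderiv 𝓘(ℝ, ℝ) J (fun t => u s t ((extChartAt I q₀).symm y)) t (1 : ℝ)) ∧
    ∀ w : EL, (mfderiv 𝓘(ℝ, ℝ × ℝ × EL) J
      (fun x : ℝ × ℝ × EL => u x.1 x.2.1 ((extChartAt I q₀).symm x.2.2)) (s, t, y)
      ((0, 0, w) : ℝ × ℝ × EL) = mfderiv I J (u s t) ((extChartAt I q₀).symm y)
        (mfderiv 𝓘(ℝ, EL) I (extChartAt I q₀).symm y w)) := by
  have hd : MDifferentiableAt 𝓘(ℝ, ℝ × ℝ × EL) J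
      (fun x : ℝ × ℝ × EL => u x.1 x.2.1 ((extChartAt I q₀).symm x.2.2)) (s, t, y) :=
    ((contMDiffOn_family_chart hu q₀).contMDiffAt
      ((isOpen_family_chart q₀).mem_nhds hy)).mdifferentiableAt (by simp)
  refine ⟨?_, ?_, fun w => ?_⟩
  · exact (mfderiv_comp_hasFDerivAt (c := fun s : ℝ => (s, t, y)) (a := s) hd
      (hasFDerivAt_prodMk_left s (t, y)) (1 : ℝ)).symm
  · exact (mfderiv_comp_hasFDerivAt (c := fun t : ℝ => (s, t, y)) (a := t) hd
      ((hasFDerivAt_prodMk_right s (t, y)).comp t (hasFDerivAt_prodMk_left t y)) (1 : ℝ)).symm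
  · have h1 := mfderiv_comp_hasFDerivAt (c := fun y : EL => (s, t, y)) (a := y) hd
      ((hasFDerivAt_prodMk_right s (t, y)).comp y (hasFDerivAt_prodMk_right t y)) w
    refine h1.symm.trans ?_
    have h2 : MDifferentiableAt I J (u s t) ((extChartAt I q₀).symm y) :=
      (hu.comp (contMDiff_const.prodMk (contMDiff_const.prodMk contMDiff_id))).mdifferentiableAt
        (by simp)
    exact congrArg (fun A => A w)
      (mfderiv_comp y h2 (mdifferentiableAt_extChartAt_symm hy))

end FamilyChart

section GlobalEvolution

variable {n : ℕ} {M : Type*} [TopologicalSpace M]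
  [ChartedSpace (EuclideanSpace ℝ (Fin (2 * n))) M] [IsManifold (𝓡 (2 * n)) ∞ M]
  {ω₀ : SymplecticForm n M} {L : Type*} [TopologicalSpace L]
  [ChartedSpace (EuclideanSpace ℝ (Fin n)) L] [IsManifold (𝓡 n) ∞ L]

theorem hasDerivAt_along_first {F : Type*} [NormedAddCommGroup F] [NormedSpace ℝ F]
    {g : ℝ × F → ℝ} {s : ℝ} {y : F} (hg : DifferentiableAt ℝ g (s, y)) :
    HasDerivAt (fun s => g (s, y)) (fderiv ℝ g (s, y) (1, 0)) s :=
  hg.hasFDerivAt.comp_hasDerivAt s ((hasDerivAt_id' s).prodMk (hasDerivAt_const s y))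

/-- A Hamiltonian flow carries a path of Lagrangian submanifolds with primitive `a` of the velocity
to paths whose primitives evolve by the derivative of the Hamiltonian function in the path
parameter. -/
theorem IsPrimitiveOfVelocity.evolve {u : ℝ → ℝ → L → M}
    (hu : ContMDiff (𝓘(ℝ, ℝ).prod (𝓘(ℝ, ℝ).prod (𝓡 n))) (𝓡 (2 * n)) ∞
      (fun p : ℝ × ℝ × L => u p.1 p.2.1 p.2.2)) {K : (ℝ × ℝ) × M → ℝ}
    (hK : ContMDiff (𝓘(ℝ, ℝ × ℝ).prod (𝓡 (2 * n))) 𝓘(ℝ, ℝ) ∞ K)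
    (hus : ∀ s t q, mfderiv 𝓘(ℝ, ℝ) (𝓡 (2 * n)) (fun s => u s t q) s (1 : ℝ) =
      ω₀.hamVec (fun m => K ((s, t), m)) (u s t q)) {a : ℝ → ℝ → L → ℝ}
    (ha : ContMDiff (𝓘(ℝ, ℝ).prod (𝓘(ℝ, ℝ).prod (𝓡 n))) 𝓘(ℝ, ℝ) ∞
      (fun p : ℝ × ℝ × L => a p.1 p.2.1 p.2.2))
    (has : ∀ s t q, HasDerivAt (fun s => a s t q)
      (fderiv ℝ (fun z => K (z, u s t q)) (s, t) (0, 1)) s) {s₀ t : ℝ}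
    (h₀ : IsPrimitiveOfVelocity ω₀ (u s₀) t (a s₀ t)) (s : ℝ) :
    IsPrimitiveOfVelocity ω₀ (u s) t (a s t) := by
  refine ⟨ha.comp (contMDiff_const.prodMk (contMDiff_const.prodMk contMDiff_id)), ?_⟩
  refine forall_tangent_of_chart (I := 𝓡 n) fun q₀ y hy w => ?_
  set ψ := extChartAt (𝓡 n) q₀ with hψ
  let u' := fun x : ℝ × ℝ × EuclideanSpace ℝ (Fin n) => u x.1 x.2.1 (ψ.symm x.2.2)
  let a' := fun x : ℝ × ℝ × EuclideanSpace ℝ (Fin n) => a x.1 x.2.1 (ψ.symm x.2.2)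
  let U : Set (ℝ × ℝ × EuclideanSpace ℝ (Fin n)) := {x | x.2.2 ∈ ψ.target}
  have hU : IsOpen U := isOpen_family_chart q₀
  have hu' : ContMDiffOn 𝓘(ℝ, ℝ × ℝ × EuclideanSpace ℝ (Fin n)) (𝓡 (2 * n)) ∞ u' U :=
    contMDiffOn_family_chart hu q₀
  have ha' : ContDiffOn ℝ ∞ a' U := (contMDiffOn_family_chart ha q₀).contDiffOn
  have hus' : ∀ x ∈ U, mfderiv 𝓘(ℝ, ℝ × ℝ × EuclideanSpace ℝ (Fin n)) (𝓡 (2 * n)) u' x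
      ((1, 0, 0) : ℝ × ℝ × EuclideanSpace ℝ (Fin n)) =
      ω₀.hamVec (fun m => K ((x.1, x.2.1), m)) (u' x) := fun x hx =>
    (mfderiv_family_chart hu x.1 x.2.1 hx).1.trans (hus _ _ _)
  let g : ℝ × ℝ × EuclideanSpace ℝ (Fin n) → ℝ := fun x =>
    ω₀.pull u' x ![(0, 1, 0), (0, 0, w)] - fderiv ℝ a' x (0, 0, w)
  have hgd : ∀ σ, HasDerivAt (fun σ => g (σ, t, y)) 0 σ := by
    intro σ
    have hx : ((σ, t, y) : ℝ × ℝ × EuclideanSpace ℝ (Fin n)) ∈ U := hy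
    have hax : ContDiffAt ℝ ∞ a' (σ, t, y) := ha'.contDiffAt (hU.mem_nhds hx)
    have d1 : DifferentiableAt ℝ (fun x => ω₀.pull u' x ![(0, 1, 0), (0, 0, w)]) (σ, t, y) :=
      ((ω₀.contDiffOn_pull_apply hU hu' _ _).contDiffAt (hU.mem_nhds hx)).differentiableAt
        (by simp)
    have d2 : DifferentiableAt ℝ (fderiv ℝ a') (σ, t, y) :=
      (hax.fderiv_right (m := ∞) (by simp)).differentiableAt (by simp)
    have d3 : DifferentiableAt ℝ (fun x => fderiv ℝ a' x (0, 0, w)) (σ, t, y) :=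
      d2.clm_apply (differentiableAt_const _)
    have h1 := (hasDerivAt_along_first d1).sub (hasDerivAt_along_first d3)
    have hk : (fun x => fderiv ℝ (fun z => K (z, u' x)) (x.1, x.2.1) (0, 1)) =ᶠ[𝓝 (σ, t, y)]
        fun x => fderiv ℝ a' x (1, 0, 0) := by
      filter_upwards [hU.mem_nhds hx] with x hx
      have := hasDerivAt_along_first (g := a') (s := x.1) (y := x.2)
        ((ha'.contDiffAt (hU.mem_nhds hx)).differentiableAt (by simp))
      exact (has x.1 x.2.1 (ψ.symm x.2.2)).unique this
    have h2 : fderiv ℝ (fun x => ω₀.pull u' x ![(0, 1, 0), (0, 0, w)]) (σ, t, y) (1, 0) -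
        fderiv ℝ (fun x => fderiv ℝ a' x (0, 0, w)) (σ, t, y) (1, 0) = 0 := by
      have e1 := ω₀.hasDerivAt_pull_of_evolution hU hu' hK hus' hx 1 0 w
      rw [hk.fderiv_eq, fderiv_clm_apply d2 (differentiableAt_const _)] at e1
      have hsymm : fderiv ℝ (fderiv ℝ a') (σ, t, y) (1, 0, 0) (0, 0, w) =
          fderiv ℝ (fderiv ℝ a') (σ, t, y) (0, 0, w) (1, 0, 0) :=
        (hax.isSymmSndFDerivAt
          (by simpa using WithTop.coe_le_coe.2 (le_top : (2 : ℕ∞) ≤ ⊤))).eq _ _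
      rw [fderiv_clm_apply d2 (differentiableAt_const _), sub_eq_zero]
      refine e1.trans ?_
      rw [show ((1, 0) : ℝ × ℝ × EuclideanSpace ℝ (Fin n)) = (1, 0, 0) from rfl]
      simpa using hsymm.symm
    rw [h2] at h1
    exact h1
  have hconst : g (s, t, y) = g (s₀, t, y) :=
    is_const_of_deriv_eq_zero (fun σ => (hgd σ).differentiableAt) (fun σ => (hgd σ).deriv) s s₀
  have hform : ∀ σ, g (σ, t, y) = ω₀.form (u σ t (ψ.symm y))
      ![mfderiv 𝓘(ℝ, ℝ) (𝓡 (2 * n)) (fun t => u σ t (ψ.symm y)) t (1 : ℝ),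
        mfderiv (𝓡 n) (𝓡 (2 * n)) (u σ t) (ψ.symm y)
          (mfderiv 𝓘(ℝ, EuclideanSpace ℝ (Fin n)) (𝓡 n) ψ.symm y w)] -
      vectorDiff (𝓡 n) (a σ t) (ψ.symm y)
          (mfderiv 𝓘(ℝ, EuclideanSpace ℝ (Fin n)) (𝓡 n) ψ.symm y w) := by
    intro σ
    have e1 := mfderiv_family_chart hu (q₀ := q₀) σ t hy
    have e2 := (mfderiv_family_chart ha (q₀ := q₀) σ t hy).2.2 w
    rw [mfderiv_eq_fderiv] at e2
    simp only [g]
    rw [ω₀.pull_apply]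
    exact congrArg₂ (· - ·) (congrArg (ω₀.form (u σ t (ψ.symm y)))
      (by rw [← e1.2.1, ← e1.2.2 w])) e2
  have h1 := hform s₀
  rw [show vectorDiff (𝓡 n) (a s₀ t) (ψ.symm y) _ = _ from h₀.2 (ψ.symm y) _, sub_self] at h1
  have h2 := hform s
  rw [hconst, h1] at h2
  exact (sub_eq_zero.1 h2.symm).symm

/-- A Hamiltonian flow carries isotropic families to isotropic families. -/
theorem isotropic_evolve {u : ℝ → ℝ → L → M}
    (hu : ContMDiff (𝓘(ℝ, ℝ).prod (𝓘(ℝ, ℝ).prod (𝓡 n))) (𝓡 (2 * n)) ∞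
      (fun p : ℝ × ℝ × L => u p.1 p.2.1 p.2.2)) {K : (ℝ × ℝ) × M → ℝ}
    (hK : ContMDiff (𝓘(ℝ, ℝ × ℝ).prod (𝓡 (2 * n))) 𝓘(ℝ, ℝ) ∞ K)
    (hus : ∀ s t q, mfderiv 𝓘(ℝ, ℝ) (𝓡 (2 * n)) (fun s => u s t q) s (1 : ℝ) =
      ω₀.hamVec (fun m => K ((s, t), m)) (u s t q)) {s₀ t : ℝ}
    (h₀ : (ω₀.form.pullback (u s₀ t) : DForm (𝓡 n) L 2) = 0) (s : ℝ) :
    (ω₀.form.pullback (u s t) : DForm (𝓡 n) L 2) = 0 := by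
  have key : ∀ (q : L) (v w : TangentSpace (𝓡 n) q), ω₀.form (u s t q)
      ![mfderiv (𝓡 n) (𝓡 (2 * n)) (u s t) q v, mfderiv (𝓡 n) (𝓡 (2 * n)) (u s t) q w] = 0 := by
    refine forall_tangent_of_chart (I := 𝓡 n) fun q₀ y hy v w => ?_
    obtain ⟨A, hA⟩ := isInvertible_mfderiv_extChartAt_symm (J := 𝓡 n) hy
    obtain ⟨w, rfl⟩ := A.surjective w
    have hA' : A w = mfderiv 𝓘(ℝ, EuclideanSpace ℝ (Fin n)) (𝓡 n)
      (extChartAt (𝓡 n) q₀).symm y w := by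
      rw [← hA]; rfl
    rw [hA']
    set ψ := extChartAt (𝓡 n) q₀ with hψ
    let u' := fun x : ℝ × ℝ × EuclideanSpace ℝ (Fin n) => u x.1 x.2.1 (ψ.symm x.2.2)
    let U : Set (ℝ × ℝ × EuclideanSpace ℝ (Fin n)) := {x | x.2.2 ∈ ψ.target}
    have hU : IsOpen U := isOpen_family_chart q₀
    have hu' : ContMDiffOn 𝓘(ℝ, ℝ × ℝ × EuclideanSpace ℝ (Fin n)) (𝓡 (2 * n)) ∞ u' U :=
      contMDiffOn_family_chart hu q₀
    have hus' : ∀ x ∈ U, mfderiv 𝓘(ℝ, ℝ × ℝ × EuclideanSpace ℝ (Fin n)) (𝓡 (2 * n)) u' x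
        ((1, 0, 0) : ℝ × ℝ × EuclideanSpace ℝ (Fin n)) =
        ω₀.hamVec (fun m => K ((x.1, x.2.1), m)) (u' x) := fun x hx =>
      (mfderiv_family_chart hu x.1 x.2.1 hx).1.trans (hus _ _ _)
    let g : ℝ × ℝ × EuclideanSpace ℝ (Fin n) → ℝ := fun x =>
      ω₀.pull u' x ![(0, 0, v), (0, 0, w)]
    have hgd : ∀ σ, HasDerivAt (fun σ => g (σ, t, y)) 0 σ := by
      intro σ
      have hx : ((σ, t, y) : ℝ × ℝ × EuclideanSpace ℝ (Fin n)) ∈ U := hy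
      have d1 : DifferentiableAt ℝ g (σ, t, y) :=
        ((ω₀.contDiffOn_pull_apply hU hu' _ _).contDiffAt (hU.mem_nhds hx)).differentiableAt
          (by simp)
      have h1 := hasDerivAt_along_first d1
      have e1 := ω₀.hasDerivAt_pull_of_evolution hU hu' hK hus' hx 0 v w
      have hz : (fun x : ℝ × ℝ × EuclideanSpace ℝ (Fin n) =>
          fderiv ℝ (fun z => K (z, u' x)) (x.1, x.2.1) (0, 0)) = fun _ => 0 :=
        funext fun x => map_zero _
      rw [hz] at e1
      have h2 : fderiv ℝ g (σ, t, y) (1, 0) = 0 := e1.trans (by simp)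
      rwa [h2] at h1
    have hconst : g (s, t, y) = g (s₀, t, y) :=
      is_const_of_deriv_eq_zero (fun σ => (hgd σ).differentiableAt) (fun σ => (hgd σ).deriv) s s₀
    have hform : ∀ σ, g (σ, t, y) = ω₀.form.pullback (u σ t) (ψ.symm y)
        ![mfderiv 𝓘(ℝ, EuclideanSpace ℝ (Fin n)) (𝓡 n) ψ.symm y v,
          mfderiv 𝓘(ℝ, EuclideanSpace ℝ (Fin n)) (𝓡 n) ψ.symm y w] := by
      intro σ
      have e1 := mfderiv_family_chart hu (q₀ := q₀) σ t hy
      simp only [g]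
      rw [ω₀.pull_apply]
      refine congrArg (ω₀.form (u σ t (ψ.symm y))) ?_
      refine Eq.trans ?_ (comp_cons_two _ _ _).symm
      exact congrArg₂ (fun a b => ![a, b]) (e1.2.2 v) (e1.2.2 w)
    have h1 := hform s₀
    rw [h₀] at h1
    have h2 := hform s
    rw [hconst, h1] at h2
    refine Eq.trans ?_ h2.symm
    exact congrArg (ω₀.form (u s t (ψ.symm y))) (comp_cons_two _ _ _).symm
  funext q
  ext v
  have hv : v = ![v 0, v 1] := by
    funext i; fin_cases i <;> rfl
  rw [hv]
  exact (congrArg (ω₀.form (u s t q)) (comp_cons_two _ _ _)).trans (key q (v 0) (v 1))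

end GlobalEvolution

/-! ### Oscillation and smooth families of primitives -/

section Osc

variable {X : Type*}

theorem osc_add_const {X : Type*} [TopologicalSpace X] [CompactSpace X] [Nonempty X] {f : X → ℝ}
    (hf : Continuous f) (c : ℝ) : osc (fun x => f x + c) = osc f := by
  have hb := (isCompact_range hf)
  have h1 : (⨆ x, (f x + c)) = (⨆ x, f x) + c := (ciSup_add hb.bddAbove c).symm
  have h2 : (⨅ x, (f x + c)) = (⨅ x, f x) + c := (ciInf_add hb.bddBelow c).symm
  rw [osc, osc, h1, h2]
  ring

theorem osc_comp_surjective {X Y : Type*} (f : X → ℝ) {g : Y → X} (hg : Function.Surjective g) :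
    osc (fun y => f (g y)) = osc f := by
  rw [osc, osc, hg.iSup_comp, hg.iInf_comp]

theorem sub_le_osc {X : Type*} [TopologicalSpace X] [CompactSpace X] {f : X → ℝ}
    (hf : Continuous f) (x y : X) : f x - f y ≤ osc f :=
  sub_le_sub (le_ciSup (isCompact_range hf).bddAbove x) (ciInf_le (isCompact_range hf).bddBelow y)

theorem osc_le {X : Type*} [Nonempty X] {f : X → ℝ} {C : ℝ} (h : ∀ x y, f x - f y ≤ C) :
    osc f ≤ C := by
  have h1 : ∀ y, (⨆ x, f x) ≤ C + f y := fun y => ciSup_le fun x => by linarith [h x y]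
  have h2 : (⨆ x, f x) - C ≤ ⨅ y, f y := le_ciInf fun y => by linarith [h1 y]
  rw [osc]
  linarith

theorem osc_nonneg {X : Type*} [TopologicalSpace X] [CompactSpace X] [Nonempty X] {f : X → ℝ}
    (hf : Continuous f) : 0 ≤ osc f := by
  obtain ⟨x⟩ := ‹Nonempty X›
  simpa using sub_le_osc hf x x

theorem osc_const_mul {X : Type*} [Nonempty X] [TopologicalSpace X] [CompactSpace X] {f : X → ℝ}
    (hf : Continuous f) (c : ℝ) : osc (fun x => c * f x) = |c| * osc f := by
  have key : ∀ (c : ℝ) (f : X → ℝ), Continuous f → osc (fun x => c * f x) ≤ |c| * osc f := by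
    intro c f hf
    refine osc_le fun x y => ?_
    rw [← mul_sub]
    refine (le_abs_self _).trans ?_
    rw [abs_mul]
    refine mul_le_mul_of_nonneg_left (abs_le.2 ⟨?_, sub_le_osc hf x y⟩) (abs_nonneg c)
    linarith [sub_le_osc hf y x]
  refine le_antisymm (key c f hf) ?_
  rcases eq_or_ne c 0 with rfl | hc
  · simpa using osc_nonneg (continuous_const (y := (0 : ℝ)))
  · have := key c⁻¹ (fun x => c * f x) (by fun_prop)
    simp only [inv_mul_cancel_left₀ hc, abs_inv] at this
    calc |c| * osc f ≤ |c| * (|c|⁻¹ * osc fun x => c * f x) :=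
          mul_le_mul_of_nonneg_left this (abs_nonneg c)
      _ = _ := by rw [mul_inv_cancel_left₀ (abs_ne_zero.2 hc)]

theorem continuous_osc {T X : Type*} [TopologicalSpace T] [TopologicalSpace X] [CompactSpace X]
    {h : T × X → ℝ} (hh : Continuous h) : Continuous fun t => osc (fun x => h (t, x)) := by
  have h1 := isCompact_univ.continuous_sSup (K := (univ : Set X)) (f := fun t x => h (t, x)) hh
  have h2 := isCompact_univ.continuous_sInf (K := (univ : Set X)) (f := fun t x => h (t, x)) hh
  simp only [image_univ] at h1 h2
  exact h1.sub h2

end Osc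

section PrimitiveFamily

variable {P : Type} [NormedAddCommGroup P] [NormedSpace ℝ P] [FiniteDimensional ℝ P]
  {EL : Type} [NormedAddCommGroup EL] [NormedSpace ℝ EL] [FiniteDimensional ℝ EL]
  {HL : Type*} [TopologicalSpace HL] {I : ModelWithCorners ℝ EL HL} [I.Boundaryless] {L : Type*}
  [TopologicalSpace L] [ChartedSpace HL L] [IsManifold I ∞ L]

/-- Primitives of a smooth family of exact 1-forms on a connected manifold, normalised at a point,
form a smooth family. In a chart the primitive is an integral over line segments, so smoothness in
the parameter at one point propagates to the whole manifold. -/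
theorem contMDiff_primitive_family [PreconnectedSpace L] {h : P → L → ℝ}
    (hh : ∀ p, ContMDiff I 𝓘(ℝ, ℝ) ∞ (h p))
    (hA : ∀ q₀ : L, ∃ A : P × EL → EL →L[ℝ] ℝ,
      ContDiffOn ℝ ∞ A (univ ×ˢ (extChartAt I q₀).target) ∧
      ∀ p, ∀ y ∈ (extChartAt I q₀).target,
        fderiv ℝ (fun y => h p ((extChartAt I q₀).symm y)) y = A (p, y)) (q₀ : L) :
    ContMDiff (𝓘(ℝ, P).prod I) 𝓘(ℝ, ℝ) ∞ (fun x : P × L => h x.1 x.2 - h x.1 q₀) := by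
  -- smoothness near `q₁`, if the function is smooth in the parameter at a nearby point
  have key : ∀ q₁ : L, ∃ V : Set L, IsOpen V ∧ q₁ ∈ V ∧ ∀ q' ∈ V,
      ContDiff ℝ ∞ (fun p => h p q' - h p q₀) →
      ContMDiffOn (𝓘(ℝ, P).prod I) 𝓘(ℝ, ℝ) ∞ (fun x : P × L => h x.1 x.2 - h x.1 q₀)
        (univ ×ˢ V) := by
    intro q₁
    obtain ⟨A, hA, hAd⟩ := hA q₁
    set φ := extChartAt I q₁ with hφ
    obtain ⟨ε, hε, hball⟩ := Metric.nhds_basis_ball.mem_iff.1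
      (extChartAt_target_mem_nhds (I := I) q₁)
    refine ⟨φ.source ∩ φ ⁻¹' Metric.ball (φ q₁) (ε / 4),
      (continuousOn_extChartAt q₁).isOpen_inter_preimage
      (isOpen_extChartAt_source q₁) Metric.isOpen_ball,
      ⟨mem_extChartAt_source q₁, Metric.mem_ball_self (by positivity)⟩, ?_⟩
    rintro q' ⟨hq's, hq'b⟩ hsm
    have hq'b : φ q' ∈ Metric.ball (φ q₁) (ε / 4) := hq'b
    let seg : (P × EL) × ℝ → EL := fun x => φ q' + x.2 • (x.1.2 - φ q')
    have hseg : ContDiff ℝ ∞ seg := by fun_prop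
    let V : Set (P × EL) := univ ×ˢ Metric.ball (φ q₁) (ε / 4)
    have hVo : IsOpen V := isOpen_univ.prod Metric.isOpen_ball
    -- the smaller radius leaves room for an open interval of times around the unit interval
    have hV : V ×ˢ Ioo (-1 : ℝ) 2 ⊆ seg ⁻¹' Metric.ball (φ q₁) ε := by
      rintro ⟨⟨p, y⟩, τ⟩ ⟨⟨-, hy⟩, hτ⟩
      have hy : y ∈ Metric.ball (φ q₁) (ε / 4) := hy
      rw [Metric.mem_ball, dist_eq_norm] at hy hq'b
      change seg ((p, y), τ) ∈ Metric.ball (φ q₁) ε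
      rw [Metric.mem_ball, dist_eq_norm]
      have e : seg ((p, y), τ) - φ q₁ = (1 - τ) • (φ q' - φ q₁) + τ • (y - φ q₁) := by
        simp only [seg]; module
      have h1 : |1 - τ| ≤ 2 := abs_le.2 ⟨by linarith [hτ.2], by linarith [hτ.1]⟩
      have h2 : |τ| ≤ 2 := abs_le.2 ⟨by linarith [hτ.1], by linarith [hτ.2]⟩
      rw [e]
      refine (norm_add_le _ _).trans_lt ?_
      rw [norm_smul, norm_smul, Real.norm_eq_abs, Real.norm_eq_abs]
      nlinarith [norm_nonneg (φ q' - φ q₁), norm_nonneg (y - φ q₁)]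
    have hIcc : Icc (0 : ℝ) 1 ⊆ Ioo (-1) 2 := fun τ hτ =>
      ⟨by linarith [hτ.1], by linarith [hτ.2]⟩
    -- derivative of the primitive along the segment
    have hderiv : ∀ p, ∀ y ∈ Metric.ball (φ q₁) (ε / 4), ∀ τ ∈ Icc (0 : ℝ) 1,
        HasDerivAt (fun τ => h p (φ.symm (seg ((p, y), τ)))) (A (p, seg ((p, y), τ)) (y - φ q'))
          τ := by
      intro p y hy τ hτ
      have hmem : seg ((p, y), τ) ∈ φ.target := hball (hV ⟨⟨mem_univ p, hy⟩, hIcc hτ⟩)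
      have hd : DifferentiableAt ℝ (fun y => h p (φ.symm y)) (seg ((p, y), τ)) := by
        have : ContMDiffOn 𝓘(ℝ, EL) 𝓘(ℝ, ℝ) ∞ (fun y => h p (φ.symm y)) φ.target :=
          (hh p).comp_contMDiffOn (contMDiffOn_extChartAt_symm q₁)
        exact (this.contDiffOn.contDiffAt ((isOpen_extChartAt_target q₁).mem_nhds
          hmem)).differentiableAt (by simp)
      have h1 : HasDerivAt (fun τ => seg ((p, y), τ)) (y - φ q') τ := by
        have := ((hasDerivAt_id' τ).smul_const (y - φ q')).const_add (φ q')
        rwa [one_smul] at this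
      have h2 := hd.hasFDerivAt.comp_hasDerivAt τ h1
      rw [hAd p _ hmem] at h2
      exact h2
    have hint : ∀ p, ∀ y ∈ Metric.ball (φ q₁) (ε / 4), h p (φ.symm y) - h p q' =
        ∫ τ in (0 : ℝ)..1, A (p, seg ((p, y), τ)) (y - φ q') := by
      intro p y hy
      have hc : ContinuousOn (fun τ : ℝ => A (p, seg ((p, y), τ)) (y - φ q')) (uIcc 0 1) := by
        rw [uIcc_of_le zero_le_one]
        refine ContinuousOn.clm_apply (hA.continuousOn.comp
          (by fun_prop : Continuous fun τ : ℝ => (p, seg ((p, y), τ))).continuousOn ?_)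
          continuousOn_const
        intro τ hτ
        exact ⟨mem_univ _, hball (hV ⟨⟨mem_univ p, hy⟩, hIcc hτ⟩)⟩
      rw [intervalIntegral.integral_eq_sub_of_hasDerivAt (fun τ hτ => hderiv p y hy τ
        (by rwa [uIcc_of_le zero_le_one] at hτ)) hc.intervalIntegrable]
      simp only [seg, one_smul, zero_smul, add_zero, add_sub_cancel]
      rw [φ.left_inv hq's]
    have hI : ContDiffOn ℝ ∞ (fun x : P × EL => ∫ τ in (0 : ℝ)..1,
        A (x.1, seg (x, τ)) (x.2 - φ q')) V := by
      refine contDiffOn_unitIntervalIntegral (F := fun x : (P × EL) × ℝ =>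
        A (x.1.1, seg x) (x.1.2 - φ q')) isOpen_Ioo hIcc hVo ?_
      refine ContDiffOn.clm_apply (hA.comp
        ((contDiff_fst.comp contDiff_fst).prodMk hseg).contDiffOn fun x hx =>
          ⟨mem_univ _, hball (hV hx)⟩) ?_
      exact ((contDiff_snd.comp contDiff_fst).sub contDiff_const).contDiffOn
    have hbig : ContDiffOn ℝ ∞ (fun x : P × EL => (∫ τ in (0 : ℝ)..1,
        A (x.1, seg (x, τ)) (x.2 - φ q')) + (h x.1 q' - h x.1 q₀)) V :=
      hI.add (hsm.comp contDiff_fst).contDiffOn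
    have hchart : ContMDiffOn (𝓘(ℝ, P).prod I) 𝓘(ℝ, P × EL) ∞ (fun x : P × L => (x.1, φ x.2))
        (univ ×ˢ (φ.source ∩ φ ⁻¹' Metric.ball (φ q₁) (ε / 4))) :=
      contMDiffOn_fst.prodMk_space ((contMDiffOn_extChartAt (x := q₁)).comp contMDiffOn_snd
        fun x hx => by rw [← extChartAt_source I]; exact hx.2.1)
    refine (hbig.contMDiffOn.comp hchart fun x hx => ⟨mem_univ _, hx.2.2⟩).congr ?_
    rintro ⟨p, q⟩ ⟨-, hqs, hqb⟩
    have := hint p (φ q) hqb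
    rw [φ.left_inv hqs] at this
    simp only [Function.comp]
    rw [← this]
    ring
  let S : Set L := {q | ContDiff ℝ ∞ (fun p => h p q - h p q₀)}
  have hslice : ∀ {V : Set L} (_ : ContMDiffOn (𝓘(ℝ, P).prod I) 𝓘(ℝ, ℝ) ∞
      (fun x : P × L => h x.1 x.2 - h x.1 q₀) (univ ×ˢ V)), V ⊆ S := by
    intro V hV q hq
    have : ContMDiffOn 𝓘(ℝ, P) 𝓘(ℝ, ℝ) ∞ (fun p => h p q - h p q₀) univ :=
      hV.comp (f := fun p => (p, q)) (contMDiffOn_id.prodMk contMDiffOn_const)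
        fun p _ => ⟨mem_univ p, hq⟩
    exact (contMDiffOn_univ.1 this).contDiff
  have hS : IsClopen S := by
    constructor
    · rw [isClosed_iff_nhds]
      intro q₁ hq₁
      obtain ⟨V, hVo, hV, hV'⟩ := key q₁
      obtain ⟨q', hq', hq'S⟩ := hq₁ V (hVo.mem_nhds hV)
      exact hslice (hV' q' hq' hq'S) hV
    · rw [isOpen_iff_mem_nhds]
      intro q₁ hq₁
      obtain ⟨V, hVo, hV, hV'⟩ := key q₁
      exact Filter.mem_of_superset (hVo.mem_nhds hV) (hslice (hV' q₁ hV hq₁))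
  have huniv : S = univ := hS.eq_univ ⟨q₀, by
    change ContDiff ℝ ∞ (fun p => h p q₀ - h p q₀)
    simp only [sub_self]
    exact contDiff_const⟩
  rintro ⟨p, q₁⟩
  obtain ⟨V, hVo, hV, hV'⟩ := key q₁
  have hq₁ : q₁ ∈ S := huniv ▸ mem_univ _
  exact (hV' q₁ hV hq₁).contMDiffAt ((isOpen_univ.prod hVo).mem_nhds ⟨mem_univ _, hV⟩)

end PrimitiveFamily

/-! ### Primitives of the velocity of a path -/

section LoopPrimitives

variable {n : ℕ} {M : Type*} [TopologicalSpace M]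
  [ChartedSpace (EuclideanSpace ℝ (Fin (2 * n))) M]
  {ω₀ : SymplecticForm n M} {L : Type*} [TopologicalSpace L]
  [ChartedSpace (EuclideanSpace ℝ (Fin n)) L]

/-- The chain rule for a smooth family, composed with a curve of parameters. -/
theorem mfderiv_family_comp {EM HM : Type*} [NormedAddCommGroup EM] [NormedSpace ℝ EM]
    [TopologicalSpace HM] {J : ModelWithCorners ℝ EM HM} {N : Type*}
    [TopologicalSpace N] [ChartedSpace HM N] {ι : ℝ → L → N}
    (hι : ContMDiff (𝓘(ℝ, ℝ).prod (𝓡 n)) J ∞ (fun p : ℝ × L => ι p.1 p.2))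
    {c : ℝ → L} (hc : MDifferentiable 𝓘(ℝ, ℝ) (𝓡 n) c) (t : ℝ) :
    mfderiv 𝓘(ℝ, ℝ) J (fun t => ι t (c t)) t (1 : ℝ) =
      mfderiv 𝓘(ℝ, ℝ) J (fun s => ι s (c t)) t (1 : ℝ) +
        mfderiv (𝓡 n) J (ι t) (c t) (mfderiv 𝓘(ℝ, ℝ) (𝓡 n) c t (1 : ℝ)) := by
  have hd : MDifferentiableAt (𝓘(ℝ, ℝ).prod (𝓡 n)) J (fun p : ℝ × L => ι p.1 p.2) (t, c t) :=
    hι.mdifferentiableAt (by simp)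
  have h1 := hd.hasMFDerivAt.comp t ((hasMFDerivAt_id t).prodMk (hc t).hasMFDerivAt)
  refine (congrArg (fun A => A (1 : ℝ)) h1.mfderiv).trans ?_
  exact mfderiv_prod_eq_add_apply hd

/-- A time-dependent change of the parametrization adds a tangential term to the velocity; as the
maps are isotropic, the primitive is merely composed with the reparametrization. -/
theorem IsPrimitiveOfVelocity.reparametrize {ι : ℝ → L → M}
    (hι : ContMDiff (𝓘(ℝ, ℝ).prod (𝓡 n)) (𝓡 (2 * n)) ∞ (fun p : ℝ × L => ι p.1 p.2)) {t : ℝ}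
    (hiso : (ω₀.form.pullback (ι t) : DForm (𝓡 n) L 2) = 0) {φ : ℝ × L → L}
    (hφ : ContMDiff (𝓘(ℝ, ℝ).prod (𝓡 n)) (𝓡 n) ∞ φ) {h : L → ℝ}
    (hh : IsPrimitiveOfVelocity ω₀ ι t h) :
    IsPrimitiveOfVelocity ω₀ (fun t q => ι t (φ (t, q))) t (fun q => h (φ (t, q))) := by
  have hφt : ContMDiff (𝓡 n) (𝓡 n) ∞ fun q => φ (t, q) :=
    hφ.comp (contMDiff_const.prodMk contMDiff_id)
  have hιt : ContMDiff (𝓡 n) (𝓡 (2 * n)) ∞ (ι t) :=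
    hι.comp (contMDiff_const.prodMk contMDiff_id)
  refine ⟨hh.1.comp hφt, fun q v => ?_⟩
  have hφq : MDifferentiable 𝓘(ℝ, ℝ) (𝓡 n) fun t => φ (t, q) :=
    (hφ.comp (contMDiff_id.prodMk contMDiff_const)).mdifferentiable (by simp)
  have e1 := mfderiv_family_comp hι hφq t
  have e2 : mfderiv (𝓡 n) (𝓡 (2 * n)) (fun q => ι t (φ (t, q))) q v =
      mfderiv (𝓡 n) (𝓡 (2 * n)) (ι t) (φ (t, q)) (mfderiv (𝓡 n) (𝓡 n) (fun q => φ (t, q)) q v) :=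
    congrArg (fun A => A v) (mfderiv_comp q (hιt.mdifferentiableAt (by simp))
      (hφt.mdifferentiableAt (by simp)))
  have e3 : vectorDiff (𝓡 n) (fun q => h (φ (t, q))) q v = vectorDiff (𝓡 n) h (φ (t, q))
      (mfderiv (𝓡 n) (𝓡 n) (fun q => φ (t, q)) q v) :=
    vectorDiff_comp (hh.1.mdifferentiableAt (by simp)) (hφt.mdifferentiableAt (by simp)) v
  have hz : ∀ a b : TangentSpace (𝓡 n) (φ (t, q)), ω₀.form (ι t (φ (t, q)))
      ![mfderiv (𝓡 n) (𝓡 (2 * n)) (ι t) (φ (t, q)) a,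
        mfderiv (𝓡 n) (𝓡 (2 * n)) (ι t) (φ (t, q)) b] = 0 := fun a b =>
    (congrArg (ω₀.form (ι t (φ (t, q)))) (comp_cons_two _ a b).symm).trans
      (congrArg (fun θ : DForm (𝓡 n) L 2 => θ (φ (t, q)) ![a, b]) hiso)
  refine e3.trans ((hh.2 _ _).trans ?_)
  rw [e1, e2]
  refine Eq.trans ?_ ((ω₀.form (ι t (φ (t, q)))).toMultilinearMap.cons_add _ _ _).symm
  exact (add_eq_left.2 (hz _ _)).symm

variable [IsManifold (𝓡 n) ∞ L]

/-- Two primitives of the same velocity differ by a constant. -/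
theorem IsPrimitiveOfVelocity.exists_eq_add_const [PreconnectedSpace L] {ι : ℝ → L → M}
    {t : ℝ} {h h' : L → ℝ} (hh : IsPrimitiveOfVelocity ω₀ ι t h)
    (hh' : IsPrimitiveOfVelocity ω₀ ι t h') (q₀ : L) (q : L) :
    h' q = h q + (h' q₀ - h q₀) := by
  have h1 : h' q - h q = h' q₀ - h q₀ := eq_of_mfderiv_eq_zero (I := 𝓡 n)
    (h := fun q => h' q - h q) (hh'.1.sub hh.1) (fun q => by
      have h1 := (hh'.1.mdifferentiableAt (x := q) (by simp)).hasMFDerivAt.sub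
        (hh.1.mdifferentiableAt (x := q) (by simp)).hasMFDerivAt
      refine h1.mfderiv.trans ?_
      ext v
      exact sub_eq_zero.2 ((hh'.2 q v).trans (hh.2 q v).symm)) q q₀
  linarith

variable [IsManifold (𝓡 (2 * n)) ∞ M]

/-- The velocities of a smooth two-parameter family, if they are exact, have primitives which
depend smoothly on the parameters. -/
theorem exists_smooth_primitives [PreconnectedSpace L] {u : ℝ → ℝ → L → M}
    (hu : ContMDiff (𝓘(ℝ, ℝ).prod (𝓘(ℝ, ℝ).prod (𝓡 n))) (𝓡 (2 * n)) ∞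
      (fun p : ℝ × ℝ × L => u p.1 p.2.1 p.2.2))
    (hex : ∀ s t, ∃ h, IsPrimitiveOfVelocity ω₀ (fun s' => u s' t) s h) (q₀ : L) :
    ∃ H : (ℝ × ℝ) × L → ℝ, ContMDiff (𝓘(ℝ, ℝ × ℝ).prod (𝓡 n)) 𝓘(ℝ, ℝ) ∞ H ∧
      ∀ s t, IsPrimitiveOfVelocity ω₀ (fun s' => u s' t) s (fun q => H ((s, t), q)) ∧
        H ((s, t), q₀) = 0 := by
  choose h hh using hex
  have hsm := contMDiff_primitive_family (P := ℝ × ℝ) (I := 𝓡 n) (L := L)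
    (h := fun p => h p.1 p.2) (fun p => (hh p.1 p.2).1) (fun q₁ => by
      set ψ := extChartAt (𝓡 n) q₁ with hψ
      let u' := fun x : ℝ × ℝ × EuclideanSpace ℝ (Fin n) => u x.1 x.2.1 (ψ.symm x.2.2)
      let U : Set (ℝ × ℝ × EuclideanSpace ℝ (Fin n)) := {x | x.2.2 ∈ ψ.target}
      have hU : IsOpen U := isOpen_family_chart q₁
      have hu' : ContMDiffOn 𝓘(ℝ, ℝ × ℝ × EuclideanSpace ℝ (Fin n)) (𝓡 (2 * n)) ∞ u' U :=
        contMDiffOn_family_chart hu q₁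
      let A : (ℝ × ℝ) × EuclideanSpace ℝ (Fin n) → EuclideanSpace ℝ (Fin n) →L[ℝ] ℝ := fun x =>
        bilinearOfForm (ω₀.pull u' (x.1.1, x.1.2, x.2)) (1, 0, 0) ∘L
          (ContinuousLinearMap.inr ℝ ℝ (ℝ × EuclideanSpace ℝ (Fin n)) ∘L
            ContinuousLinearMap.inr ℝ ℝ (EuclideanSpace ℝ (Fin n)))
      refine ⟨A, ?_, ?_⟩
      · rw [contDiffOn_clm_apply]
        intro w
        refine (ω₀.contDiffOn_pull_apply hU hu' (1, 0, 0) (0, 0, w)).comp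
          (by fun_prop : ContDiff ℝ ∞ fun x : (ℝ × ℝ) × EuclideanSpace ℝ (Fin n) =>
            (x.1.1, x.1.2, x.2)).contDiffOn fun x hx => hx.2
      · rintro ⟨s, t⟩ y hy
        ext w
        have e1 := mfderiv_family_chart hu (q₀ := q₁) s t hy
        have e2 : fderiv ℝ (fun y => h s t (ψ.symm y)) y w =
            vectorDiff (𝓡 n) (h s t) (ψ.symm y)
              (mfderiv 𝓘(ℝ, EuclideanSpace ℝ (Fin n)) (𝓡 n) ψ.symm y w) := by
          rw [← vectorDiff_eq_fderiv]
          exact vectorDiff_comp ((hh s t).1.mdifferentiableAt (by simp))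
            (mdifferentiableAt_extChartAt_symm hy) w
        refine e2.trans (((hh s t).2 _ _).trans ?_)
        change _ = ω₀.pull u' (s, t, y) ![(1, 0, 0), (0, 0, w)]
        rw [ω₀.pull_apply]
        exact congrArg (ω₀.form (u s t (ψ.symm y)))
          (congrArg₂ (fun a b => ![a, b]) e1.1.symm (e1.2.2 w).symm)) q₀
  refine ⟨_, hsm, fun s t => ⟨⟨?_, fun q v => ?_⟩, sub_self _⟩⟩
  · have h1 : ContMDiff (𝓡 n) 𝓘(ℝ, ℝ) ∞ fun q => h s t q - h s t q₀ :=
      (hh s t).1.sub contMDiff_const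
    exact h1
  · rw [← (hh s t).2 q v]
    have : vectorDiff (𝓡 n) (fun q => h s t q - h s t q₀) q = vectorDiff (𝓡 n) (h s t) q := by
      have h1 := (((hh s t).1.mdifferentiableAt (x := q) (by simp)).hasMFDerivAt).sub
        (hasMFDerivAt_const (I := 𝓡 n) (I' := 𝓘(ℝ, ℝ)) (h s t q₀) q)
      exact h1.mfderiv.trans (sub_zero _)
    exact congrArg (fun A => (A v : ℝ)) this

/-- The case of one parameter of `exists_smooth_primitives`. -/
theorem exists_smooth_primitive_path [PreconnectedSpace L] {ι : ℝ → L → M}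
    (hι : ContMDiff (𝓘(ℝ, ℝ).prod (𝓡 n)) (𝓡 (2 * n)) ∞ (fun p : ℝ × L => ι p.1 p.2))
    (hex : ∀ t, ∃ h, IsPrimitiveOfVelocity ω₀ ι t h) (q₀ : L) :
    ∃ H : ℝ × L → ℝ, ContMDiff (𝓘(ℝ, ℝ).prod (𝓡 n)) 𝓘(ℝ, ℝ) ∞ H ∧
      ∀ t, IsPrimitiveOfVelocity ω₀ ι t (fun q => H (t, q)) := by
  obtain ⟨H, hH, hH'⟩ := exists_smooth_primitives (ω₀ := ω₀) (u := fun s _ q => ι s q)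
    (hι.comp (contMDiff_fst.prodMk (contMDiff_snd.comp contMDiff_snd))) (fun s _ => hex s) q₀
  refine ⟨fun x => H ((x.1, 0), x.2), hH.comp ?_, fun t => (hH' t 0).1⟩
  exact ((contMDiff_fst.prodMk_space contMDiff_const).prodMk contMDiff_snd)

/-- Two lifts of a path of Lagrangian submanifolds differ by a smooth family of surjective
reparametrizations. -/
theorem IsLift.exists_reparametrization [CompactSpace L] [T2Space M] {Λ : ℝ → Set M}
    {ι ι' : ℝ → L → M} (h : IsLift ω₀ Λ ι) (h' : IsLift ω₀ Λ ι') :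
    ∃ φ : ℝ × L → L, ContMDiff (𝓘(ℝ, ℝ).prod (𝓡 n)) (𝓡 n) ∞ φ ∧
      (∀ t q, ι t (φ (t, q)) = ι' t q) ∧ ∀ t, Function.Surjective fun q => φ (t, q) := by
  obtain ⟨φ, hφ, hφ'⟩ := exists_smooth_reparametrization (P := ℝ) (I := 𝓡 n) (J := 𝓡 (2 * n))
    (f := fun p : ℝ × L => ι p.1 p.2) (f' := fun p : ℝ × L => ι' p.1 p.2) h.smooth h'.smooth
    (fun t => (h.lagrangian t).isEmbedding.injective) (fun t => (h.lagrangian t).immersive)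
    (fun t q => by
      have : ι' t q ∈ range (ι t) := by rw [h.range_eq, ← h'.range_eq]; exact mem_range_self q
      exact this)
  refine ⟨φ, hφ, hφ', fun t q => ?_⟩
  have : ι t q ∈ range (ι' t) := by rw [h'.range_eq, ← h.range_eq]; exact mem_range_self q
  obtain ⟨q', hq'⟩ := this
  exact ⟨q', (h.lagrangian t).isEmbedding.injective ((hφ' t q').trans hq')⟩

/-- The norm of the velocity is computed by any lift and any primitive. -/
theorem velocityNorm_eq [CompactSpace L] [PreconnectedSpace L] [Nonempty L] [T2Space M]
    {Λ : ℝ → Set M} {ι : ℝ → L → M} (h : IsLift ω₀ Λ ι) {t : ℝ} {f : L → ℝ}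
    (hf : IsPrimitiveOfVelocity ω₀ ι t f) : velocityNorm ω₀ L Λ t = osc f := by
  have : {r | ∃ (ι : ℝ → L → M) (h : L → ℝ),
    IsLift ω₀ Λ ι ∧ IsPrimitiveOfVelocity ω₀ ι t h ∧ r = osc h} = {osc f} := by
    refine Set.eq_singleton_iff_unique_mem.2 ⟨⟨ι, f, h, hf, rfl⟩, ?_⟩
    rintro r ⟨ι', f', h', hf', rfl⟩
    obtain ⟨φ, hφ, hφι, hsurj⟩ := h.exists_reparametrization h'
    have h1 := hf.reparametrize h.smooth (h.lagrangian t).isotropic hφ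
    simp only [hφι] at h1
    obtain ⟨q₀⟩ := ‹Nonempty L›
    have : Nonempty L := ⟨q₀⟩
    rw [show f' = fun q => f (φ (t, q)) + (f' q₀ - f (φ (t, q₀))) from
      funext (h1.exists_eq_add_const hf' q₀), osc_add_const h1.1.continuous]
    exact osc_comp_surjective f (hsurj t)
  rw [velocityNorm, this, csSup_singleton]

end LoopPrimitives

/-! ### Hamiltonian connections in polar coordinates -/

section Circle

/-- The point `e^{2πit}` of the unit circle. -/
def circlePt (t : ℝ) : ℂ := Complex.exp (2 * Real.pi * Complex.I * t)

theorem hasDerivAt_circlePt (t : ℝ) :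
    HasDerivAt circlePt (2 * Real.pi * Complex.I * circlePt t) t := by
  have h1 : HasDerivAt (fun t : ℝ => 2 * Real.pi * Complex.I * (t : ℂ))
      (2 * Real.pi * Complex.I) t := by
    simpa using (Complex.ofRealCLM.hasDerivAt (x := t)).const_mul (2 * Real.pi * Complex.I)
  have := h1.cexp
  rw [mul_comm (Complex.exp _)] at this
  exact this

theorem contDiff_circlePt : ContDiff ℝ ∞ circlePt :=
  (contDiff_const.mul Complex.ofRealCLM.contDiff).cexp

theorem circlePt_add_one (t : ℝ) : circlePt (t + 1) = circlePt t := by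
  simp only [circlePt]
  push_cast
  rw [mul_add, mul_one, Complex.exp_add, Complex.exp_two_pi_mul_I, mul_one]

theorem norm_circlePt (t : ℝ) : ‖circlePt t‖ = 1 := by
  have : circlePt t = Complex.exp ((2 * Real.pi * t : ℝ) * Complex.I) := by
    rw [circlePt]; congr 1; push_cast; ring
  rw [this, Complex.norm_exp_ofReal_mul_I]

theorem circlePt_re_sq_add_im_sq (t : ℝ) : (circlePt t).re ^ 2 + (circlePt t).im ^ 2 = 1 := by
  have := Complex.sq_norm (circlePt t)
  rw [norm_circlePt, Complex.normSq_apply] at this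
  linarith

theorem hasDerivAt_circlePt_re (t : ℝ) :
    HasDerivAt (fun t => (circlePt t).re) (-(2 * Real.pi * (circlePt t).im)) t := by
  have := Complex.reCLM.hasFDerivAt.comp_hasDerivAt t (hasDerivAt_circlePt t)
  refine this.congr_deriv ?_
  simp [mul_assoc]

theorem hasDerivAt_circlePt_im (t : ℝ) :
    HasDerivAt (fun t => (circlePt t).im) (2 * Real.pi * (circlePt t).re) t := by
  have := Complex.imCLM.hasFDerivAt.comp_hasDerivAt t (hasDerivAt_circlePt t)
  refine this.congr_deriv ?_
  simp [mul_assoc]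

end Circle

section Polar

variable {n : ℕ} {M : Type*} [TopologicalSpace M]
  [ChartedSpace (EuclideanSpace ℝ (Fin (2 * n))) M]

/-- The radial component of the Hamiltonian connection with components `F`, `G`, as a function of
`((r, t), m)` for the point `r e^{2πit}`. -/
def radialHam (F G : ℂ × M → ℝ) (x : (ℝ × ℝ) × M) : ℝ :=
  (circlePt x.1.2).re * F (x.1.1 • circlePt x.1.2, x.2) +
    (circlePt x.1.2).im * G (x.1.1 • circlePt x.1.2, x.2)

/-- The angular component of the Hamiltonian connection with components `F`, `G`, as a function of
`((r, t), m)` for the point `r e^{2πit}`. -/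
def angularHam (F G : ℂ × M → ℝ) (x : (ℝ × ℝ) × M) : ℝ :=
  2 * Real.pi * x.1.1 * (-((circlePt x.1.2).im * F (x.1.1 • circlePt x.1.2, x.2)) +
    (circlePt x.1.2).re * G (x.1.1 • circlePt x.1.2, x.2))

variable {F G : ℂ × M → ℝ}

theorem contMDiff_comp_polar (hF : ContMDiff (𝓘(ℝ, ℂ).prod (𝓡 (2 * n))) 𝓘(ℝ, ℝ) ∞ F) :
    ContMDiff (𝓘(ℝ, ℝ × ℝ).prod (𝓡 (2 * n))) 𝓘(ℝ, ℝ) ∞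
      (fun x : (ℝ × ℝ) × M => F (x.1.1 • circlePt x.1.2, x.2)) := by
  have h1 : ContDiff ℝ ∞ fun p : ℝ × ℝ => p.1 • circlePt p.2 :=
    contDiff_fst.smul (contDiff_circlePt.comp contDiff_snd)
  exact hF.comp ((h1.contMDiff.comp contMDiff_fst).prodMk contMDiff_snd)

theorem contMDiff_polar_coeff {f : ℝ × ℝ → ℝ} (hf : ContDiff ℝ ∞ f) :
    ContMDiff (𝓘(ℝ, ℝ × ℝ).prod (𝓡 (2 * n))) 𝓘(ℝ, ℝ) ∞ (fun x : (ℝ × ℝ) × M => f x.1) :=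
  hf.contMDiff.comp contMDiff_fst

theorem contDiff_circlePt_re : ContDiff ℝ ∞ fun p : ℝ × ℝ => (circlePt p.2).re :=
  Complex.reCLM.contDiff.comp (contDiff_circlePt.comp contDiff_snd)

theorem contDiff_circlePt_im : ContDiff ℝ ∞ fun p : ℝ × ℝ => (circlePt p.2).im :=
  Complex.imCLM.contDiff.comp (contDiff_circlePt.comp contDiff_snd)

theorem contMDiff_radialHam (hF : ContMDiff (𝓘(ℝ, ℂ).prod (𝓡 (2 * n))) 𝓘(ℝ, ℝ) ∞ F)
    (hG : ContMDiff (𝓘(ℝ, ℂ).prod (𝓡 (2 * n))) 𝓘(ℝ, ℝ) ∞ G) :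
    ContMDiff (𝓘(ℝ, ℝ × ℝ).prod (𝓡 (2 * n))) 𝓘(ℝ, ℝ) ∞ (radialHam F G) :=
  ((contMDiff_polar_coeff contDiff_circlePt_re).mul (contMDiff_comp_polar hF)).add
    ((contMDiff_polar_coeff contDiff_circlePt_im).mul (contMDiff_comp_polar hG))

theorem contMDiff_angularHam (hF : ContMDiff (𝓘(ℝ, ℂ).prod (𝓡 (2 * n))) 𝓘(ℝ, ℝ) ∞ F)
    (hG : ContMDiff (𝓘(ℝ, ℂ).prod (𝓡 (2 * n))) 𝓘(ℝ, ℝ) ∞ G) :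
    ContMDiff (𝓘(ℝ, ℝ × ℝ).prod (𝓡 (2 * n))) 𝓘(ℝ, ℝ) ∞ (angularHam F G) :=
  (contMDiff_polar_coeff (f := fun p => 2 * Real.pi * p.1) (by fun_prop)).mul
    ((((contMDiff_polar_coeff contDiff_circlePt_im).mul (contMDiff_comp_polar hF)).neg).add
      ((contMDiff_polar_coeff contDiff_circlePt_re).mul (contMDiff_comp_polar hG)))

theorem differentiable_slice (hF : ContMDiff (𝓘(ℝ, ℂ).prod (𝓡 (2 * n))) 𝓘(ℝ, ℝ) ∞ F) (m : M) :
    Differentiable ℝ fun z => F (z, m) := fun z =>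
  ((hF (z, m)).slice_fst).differentiableAt (by simp)

theorem fderiv_slice_apply {M : Type*} (F : ℂ × M → ℝ) (z ζ : ℂ) (m : M) :
    fderiv ℝ (fun z => F (z, m)) z ζ =
      ζ.re * baseDeriv F 1 (z, m) + ζ.im * baseDeriv F Complex.I (z, m) := by
  have : ζ = ζ.re • (1 : ℂ) + ζ.im • Complex.I := by
    simp [Complex.re_add_im]
  conv_lhs => rw [this]
  rw [map_add, map_smul, map_smul]
  rfl

theorem mdifferentiable_fibre (hF : ContMDiff (𝓘(ℝ, ℂ).prod (𝓡 (2 * n))) 𝓘(ℝ, ℝ) ∞ F) (z : ℂ) :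
    MDifferentiable (𝓡 (2 * n)) 𝓘(ℝ, ℝ) fun m => F (z, m) :=
  (hF.comp (contMDiff_const.prodMk contMDiff_id)).mdifferentiable (by simp)

theorem vectorDiff_linear_combination {f g : M → ℝ} {m : M}
    (hf : MDifferentiableAt (𝓡 (2 * n)) 𝓘(ℝ, ℝ) f m)
    (hg : MDifferentiableAt (𝓡 (2 * n)) 𝓘(ℝ, ℝ) g m) (a b : ℝ)
    (v : TangentSpace (𝓡 (2 * n)) m) :
    vectorDiff (𝓡 (2 * n)) (fun m => a * f m + b * g m) m v =
      a * vectorDiff (𝓡 (2 * n)) f m v + b * vectorDiff (𝓡 (2 * n)) g m v := by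
  have h1 := (hf.hasMFDerivAt.const_smul a).add (hg.hasMFDerivAt.const_smul b)
  have h2 := h1.mfderiv
  exact congrArg (fun A => (A v : ℝ)) h2

variable (ω₀ : SymplecticForm n M)

theorem SymplecticForm.poisson_eq (f g : M → ℝ) (m : M) :
    ω₀.poisson f g m = vectorDiff (𝓡 (2 * n)) f m (ω₀.hamVec g m) :=
  ω₀.form_hamVec f m _

theorem SymplecticForm.poisson_linear_combination {f g : M → ℝ} {m : M}
    (hf : MDifferentiableAt (𝓡 (2 * n)) 𝓘(ℝ, ℝ) f m)
    (hg : MDifferentiableAt (𝓡 (2 * n)) 𝓘(ℝ, ℝ) g m) (a b c d : ℝ) :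
    vectorDiff (𝓡 (2 * n)) (fun m => a * f m + b * g m) m
      (ω₀.hamVec (fun m => c * f m + d * g m) m) = (a * d - b * c) * ω₀.poisson f g m := by
  have hskew : ∀ f g : M → ℝ, vectorDiff (𝓡 (2 * n)) f m (ω₀.hamVec g m) =
      -vectorDiff (𝓡 (2 * n)) g m (ω₀.hamVec f m) := fun f g => by
    rw [← ω₀.form_hamVec, form_swap, ω₀.form_hamVec]
  rw [hskew, vectorDiff_linear_combination hf hg, hskew f, hskew g,
    vectorDiff_linear_combination hf hg, vectorDiff_linear_combination hf hg, ← ω₀.poisson_eq,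
    ← ω₀.poisson_eq, ← ω₀.poisson_eq, ← ω₀.poisson_eq]
  have h1 : ∀ f, ω₀.poisson f f m = 0 := fun f => form_self _ _
  have h2 : ω₀.poisson g f m = -ω₀.poisson f g m := form_swap _ _ _
  rw [h1, h1, h2]
  ring

/-- The curvature in polar coordinates: `2πr Ω = ∂_t K - ∂_r N - {N, K}` for the radial component
`K` and the angular component `N`. -/
theorem polar_curvature (hF : ContMDiff (𝓘(ℝ, ℂ).prod (𝓡 (2 * n))) 𝓘(ℝ, ℝ) ∞ F)
    (hG : ContMDiff (𝓘(ℝ, ℂ).prod (𝓡 (2 * n))) 𝓘(ℝ, ℝ) ∞ G) (r t : ℝ) (m : M) :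
    fderiv ℝ (fun p => radialHam F G (p, m)) (r, t) (0, 1) -
        fderiv ℝ (fun p => angularHam F G (p, m)) (r, t) (1, 0) -
        vectorDiff (𝓡 (2 * n)) (fun m => angularHam F G ((r, t), m)) m
          (ω₀.hamVec (fun m => radialHam F G ((r, t), m)) m) =
      2 * Real.pi * r * (ω₀.poisson (fun m => F (r • circlePt t, m))
        (fun m => G (r • circlePt t, m)) m + baseDeriv F Complex.I (r • circlePt t, m) -
          baseDeriv G 1 (r • circlePt t, m)) := by
  set c := (circlePt t).re with hc
  set s := (circlePt t).im with hs
  have hcs : c ^ 2 + s ^ 2 = 1 := circlePt_re_sq_add_im_sq t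
  have hzt : HasDerivAt (fun t => r • circlePt t) (r • (2 * Real.pi * Complex.I * circlePt t)) t :=
    (hasDerivAt_circlePt t).const_smul r
  have hzr : HasDerivAt (fun r : ℝ => r • circlePt t) (circlePt t) r := by
    simpa using (hasDerivAt_id' r).smul_const (circlePt t)
  have dt : ∀ {F : ℂ × M → ℝ}, ContMDiff (𝓘(ℝ, ℂ).prod (𝓡 (2 * n))) 𝓘(ℝ, ℝ) ∞ F →
      HasDerivAt (fun t => F (r • circlePt t, m)) (2 * Real.pi * r *
        (-(s * baseDeriv F 1 (r • circlePt t, m)) + c * baseDeriv F Complex.I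
          (r • circlePt t, m))) t := by
    intro F hF
    have := (differentiable_slice hF m (r • circlePt t)).hasFDerivAt.comp_hasDerivAt t hzt
    rw [fderiv_slice_apply] at this
    refine this.congr_deriv ?_
    simp [← hc, ← hs, mul_assoc]
    ring
  have dr : ∀ {F : ℂ × M → ℝ}, ContMDiff (𝓘(ℝ, ℂ).prod (𝓡 (2 * n))) 𝓘(ℝ, ℝ) ∞ F →
      HasDerivAt (fun r : ℝ => F (r • circlePt t, m)) (c * baseDeriv F 1 (r • circlePt t, m) +
        s * baseDeriv F Complex.I (r • circlePt t, m)) r := by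
    intro F hF
    have := (differentiable_slice hF m (r • circlePt t)).hasFDerivAt.comp_hasDerivAt r hzr
    rwa [fderiv_slice_apply] at this
  have hde1 : DifferentiableAt ℝ (fun p => radialHam F G (p, m)) (r, t) :=
    ((contMDiff_radialHam hF hG ((r, t), m)).slice_fst).differentiableAt (by simp)
  have h1e1 := hde1.hasFDerivAt.comp_hasDerivAt t ((hasDerivAt_const t r).prodMk (hasDerivAt_id' t))
  have h2e1 : HasDerivAt (fun t => radialHam F G ((r, t), m)) _ t :=
    ((hasDerivAt_circlePt_re t).mul (dt hF)).add
    ((hasDerivAt_circlePt_im t).mul (dt hG))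
  have e1 := h1e1.unique h2e1
  have hde2 : DifferentiableAt ℝ (fun p => angularHam F G (p, m)) (r, t) :=
    ((contMDiff_angularHam hF hG ((r, t), m)).slice_fst).differentiableAt (by simp)
  have h1e2 := hde2.hasFDerivAt.comp_hasDerivAt r ((hasDerivAt_id' r).prodMk (hasDerivAt_const r t))
  have h2e2 : HasDerivAt (fun r => angularHam F G ((r, t), m)) _ r :=
    ((hasDerivAt_id' r).const_mul (2 * Real.pi)).mul
    ((((dr hF).const_mul s).neg).add ((dr hG).const_mul c))
  have e2 := h1e2.unique h2e2
  have e3 : vectorDiff (𝓡 (2 * n)) (fun m => angularHam F G ((r, t), m)) m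
      (ω₀.hamVec (fun m => radialHam F G ((r, t), m)) m) =
      -(2 * Real.pi * r * ω₀.poisson (fun m => F (r • circlePt t, m))
        (fun m => G (r • circlePt t, m)) m) := by
    have h1 := ω₀.poisson_linear_combination (mdifferentiable_fibre hF (r • circlePt t) m)
      (mdifferentiable_fibre hG (r • circlePt t) m) (-(2 * Real.pi * r * s)) (2 * Real.pi * r * c)
      c s
    have h2 : (fun m => angularHam F G ((r, t), m)) = fun m =>
        -(2 * Real.pi * r * s) * F (r • circlePt t, m) +
          2 * Real.pi * r * c * G (r • circlePt t, m) := by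
      funext m; simp only [angularHam, ← hc, ← hs]; ring
    rw [h2]
    refine h1.trans ?_
    linear_combination (-(2 * Real.pi * r * ω₀.poisson (fun m => F (r • circlePt t, m))
        (fun m => G (r • circlePt t, m)) m)) * hcs
  rw [e1, e2, e3]
  simp only [← hc, ← hs]
  linear_combination (2 * Real.pi * r * (baseDeriv F Complex.I (r • circlePt t, m) -
          baseDeriv G 1 (r • circlePt t, m))) * hcs

end Polar

/-! ### Connection forms and their boundary values -/

section FormOfConnection

variable {n : ℕ} {M : Type*} [TopologicalSpace M]
  [ChartedSpace (EuclideanSpace ℝ (Fin (2 * n))) M]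

theorem fibreForm_apply (ω₀ : SymplecticForm n M) (p : ℂ × M) (ζ ζ' : ℂ)
    (u u' : TangentSpace (𝓡 (2 * n)) p.2) :
    fibreForm ω₀ p ![(ζ, u), (ζ', u')] = ω₀.form p.2 ![u, u'] := by
  have h : ∀ w : TangentSpace (𝓘(ℝ, ℂ).prod (𝓡 (2 * n))) p,
      mfderiv (𝓘(ℝ, ℂ).prod (𝓡 (2 * n))) (𝓡 (2 * n)) Prod.snd p w = w.2 := by
    intro w; rw [mfderiv_snd]; rfl
  refine (congrArg (ω₀.form p.2) (comp_cons_two _ _ _)).trans ?_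
  exact congrArg₂ (fun a b => ω₀.form p.2 ![a, b]) (h _) (h _)

theorem baseAreaForm_apply (p : ℂ × M) (ζ ζ' : ℂ) (u u' : TangentSpace (𝓡 (2 * n)) p.2) :
    baseAreaForm p ![(ζ, u), (ζ', u')] = ζ.re * ζ'.im - ζ'.re * ζ.im := by
  rw [baseAreaForm, mfderiv_fst]; rfl

variable {L : Type*} [TopologicalSpace L]
  [ChartedSpace (EuclideanSpace ℝ (Fin n)) L]

theorem mfderiv_traceMap {ι : ℝ → L → M}
    (hι : ContMDiff (𝓘(ℝ, ℝ).prod (𝓡 n)) (𝓡 (2 * n)) ∞ (fun p : ℝ × L => ι p.1 p.2)) (t : ℝ) (q : L)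
    (a : ℝ) (v : TangentSpace (𝓡 n) q) :
    mfderiv (𝓘(ℝ, ℝ).prod (𝓡 n)) (𝓘(ℝ, ℂ).prod (𝓡 (2 * n))) (traceMap ι) (t, q) (a, v) =
      (a • (2 * Real.pi * Complex.I * circlePt t),
        a • mfderiv 𝓘(ℝ, ℝ) (𝓡 (2 * n)) (fun s => ι s q) t (1 : ℝ) +
          mfderiv (𝓡 n) (𝓡 (2 * n)) (ι t) q v) := by
  have h1 : HasMFDerivAt 𝓘(ℝ, ℝ) 𝓘(ℝ, ℂ) circlePt t _ :=
    (hasDerivAt_circlePt t).hasFDerivAt.hasMFDerivAt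
  have h2 := h1.comp (t, q) (hasMFDerivAt_fst (I := 𝓘(ℝ, ℝ)) (I' := 𝓡 n) (x := (t, q)))
  have hd : MDifferentiableAt (𝓘(ℝ, ℝ).prod (𝓡 n)) (𝓡 (2 * n))
      (fun p : ℝ × L => ι p.1 p.2) (t, q) :=
    hι.mdifferentiableAt (by simp)
  have h3 := h2.prodMk hd.hasMFDerivAt
  refine (congrArg (fun A => A (a, v)) h3.mfderiv).trans ?_
  refine Prod.ext ?_ ?_
  · rfl
  · refine (mfderiv_prod_eq_add_apply hd).trans ?_
    have e : mfderiv 𝓘(ℝ, ℝ) (𝓡 (2 * n)) (fun s => ι s q) t a =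
        a • mfderiv 𝓘(ℝ, ℝ) (𝓡 (2 * n)) (fun s => ι s q) t (1 : ℝ) := by
      refine Eq.trans ?_ (ContinuousLinearMap.map_smul
        (mfderiv 𝓘(ℝ, ℝ) (𝓡 (2 * n)) (fun s => ι s q) t) a (1 : ℝ))
      exact congrArg _ (mul_one a).symm
    exact congrArg₂ (· + ·) e rfl

variable [MeasurableSpace M] {ω₀ : SymplecticForm n M}

theorem HamiltonianConnection.form_apply (τ : HamiltonianConnection ω₀) (p : ℂ × M) (ζ ζ' : ℂ)
    (u u' : TangentSpace (𝓡 (2 * n)) p.2) :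
    τ.form p ![(ζ, u), (ζ', u')] = ω₀.form p.2 ![u, u'] +
      (vectorDiff (𝓡 (2 * n)) (fun m => τ.F (p.1, m)) p.2 u * ζ'.re -
        vectorDiff (𝓡 (2 * n)) (fun m => τ.F (p.1, m)) p.2 u' * ζ.re) +
      (vectorDiff (𝓡 (2 * n)) (fun m => τ.G (p.1, m)) p.2 u * ζ'.im -
        vectorDiff (𝓡 (2 * n)) (fun m => τ.G (p.1, m)) p.2 u' * ζ.im) +
      (baseDeriv τ.G 1 p - baseDeriv τ.F Complex.I p + τ.c p.1) *
        (ζ.re * ζ'.im - ζ'.re * ζ.im) := by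
  rw [← fibreForm_apply ω₀ p ζ ζ', ← baseAreaForm_apply p ζ ζ' u u']
  have h1 : ∀ (F : ℂ × M → ℝ) (A : ℂ →L[ℝ] ℝ), wedgeCovectors (fibreDiff F p)
      (A ∘L mfderiv (𝓘(ℝ, ℂ).prod (𝓡 (2 * n))) 𝓘(ℝ, ℂ) Prod.fst p) ![(ζ, u), (ζ', u')] =
      vectorDiff (𝓡 (2 * n)) (fun m => F (p.1, m)) p.2 u * A ζ' -
        vectorDiff (𝓡 (2 * n)) (fun m => F (p.1, m)) p.2 u' * A ζ := by
    intro F A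
    rw [mfderiv_fst, fibreDiff, mfderiv_snd]; rfl
  have h2 := h1 τ.F Complex.reCLM
  have h3 := h1 τ.G Complex.imCLM
  exact congrArg₂ (· + ·) (congrArg₂ (· + ·) (congrArg₂ (· + ·) rfl h2) h3) rfl

/-- The value of the pullback of a connection form to the parametrization of `Λ` by a lift. -/
theorem HamiltonianConnection.pullback_traceMap_apply (τ : HamiltonianConnection ω₀)
    {ι : ℝ → L → M}
    (hι : ContMDiff (𝓘(ℝ, ℝ).prod (𝓡 n)) (𝓡 (2 * n)) ∞ (fun p : ℝ × L => ι p.1 p.2)) {t : ℝ}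
    (hiso : (ω₀.form.pullback (ι t) : DForm (𝓡 n) L 2) = 0) {h : L → ℝ}
    (hh : ∀ q, h q = angularHam τ.F τ.G ((1, t), ι t q)) (q : L)
    (a b : ℝ) (v w : TangentSpace (𝓡 n) q) :
    (τ.form.pullback (traceMap ι) : DForm (𝓘(ℝ, ℝ).prod (𝓡 n)) (ℝ × L) 2) (t, q)
      ![(a, v), (b, w)] =
      a * (ω₀.form (ι t q) ![mfderiv 𝓘(ℝ, ℝ) (𝓡 (2 * n)) (fun s => ι s q) t (1 : ℝ),
          mfderiv (𝓡 n) (𝓡 (2 * n)) (ι t) q w] - vectorDiff (𝓡 n) h q w) -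
      b * (ω₀.form (ι t q) ![mfderiv 𝓘(ℝ, ℝ) (𝓡 (2 * n)) (fun s => ι s q) t (1 : ℝ),
          mfderiv (𝓡 n) (𝓡 (2 * n)) (ι t) q v] - vectorDiff (𝓡 n) h q v) := by
  set Y := mfderiv 𝓘(ℝ, ℝ) (𝓡 (2 * n)) (fun s => ι s q) t (1 : ℝ) with hY
  set A := mfderiv (𝓡 n) (𝓡 (2 * n)) (ι t) q with hA
  have hd : MDifferentiableAt (𝓡 n) (𝓡 (2 * n)) (ι t) q :=
    (hι.comp (contMDiff_const.prodMk contMDiff_id)).mdifferentiableAt (by simp)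
  have hdh : ∀ w, vectorDiff (𝓡 n) h q w =
      -(2 * Real.pi * (circlePt t).im) *
        vectorDiff (𝓡 (2 * n)) (fun m => τ.F (circlePt t, m)) (ι t q) (A w) +
      2 * Real.pi * (circlePt t).re *
        vectorDiff (𝓡 (2 * n)) (fun m => τ.G (circlePt t, m)) (ι t q) (A w) := by
    intro w
    have e1 : h = fun q => (fun m => -(2 * Real.pi * (circlePt t).im) * τ.F (circlePt t, m) +
        2 * Real.pi * (circlePt t).re * τ.G (circlePt t, m)) (ι t q) := by
      funext q
      simp only [hh, angularHam, one_smul]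
      ring
    have hF := mdifferentiable_fibre τ.smooth_F (circlePt t) (ι t q)
    have hG := mdifferentiable_fibre τ.smooth_G (circlePt t) (ι t q)
    rw [e1, ← vectorDiff_linear_combination hF hG]
    exact vectorDiff_comp (((hF.hasMFDerivAt.const_smul _).add
      (hG.hasMFDerivAt.const_smul _)).mdifferentiableAt) hd w
  have hform : ∀ u v : TangentSpace (𝓘(ℝ, ℝ).prod (𝓡 n)) (t, q),
      (τ.form.pullback (traceMap ι) : DForm (𝓘(ℝ, ℝ).prod (𝓡 n)) (ℝ × L) 2) (t, q) ![u, v] =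
      τ.form (circlePt t, ι t q)
        ![mfderiv (𝓘(ℝ, ℝ).prod (𝓡 n)) (𝓘(ℝ, ℂ).prod (𝓡 (2 * n))) (traceMap ι) (t, q) u,
          mfderiv (𝓘(ℝ, ℝ).prod (𝓡 n)) (𝓘(ℝ, ℂ).prod (𝓡 (2 * n))) (traceMap ι) (t, q) v] :=
    fun u v => congrArg (τ.form (circlePt t, ι t q)) (comp_cons_two _ u v)
  have hz : ω₀.form (ι t q) ![A v, A w] = 0 :=
    (congrArg (ω₀.form (ι t q)) (comp_cons_two A v w).symm).trans
      (congrArg (fun θ : DForm (𝓡 n) L 2 => θ q ![v, w]) hiso)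
  have hbil : ω₀.form (ι t q) ![a • Y + A v, b • Y + A w] =
      a * ω₀.form (ι t q) ![Y, A w] - b * ω₀.form (ι t q) ![Y, A v] := by
    have add0 : ∀ u u' v, ω₀.form (ι t q) ![u + u', v] =
        ω₀.form (ι t q) ![u, v] + ω₀.form (ι t q) ![u', v] := fun u u' v =>
      (ω₀.form (ι t q)).toMultilinearMap.cons_add ![v] u u'
    have smul0 : ∀ (c : ℝ) u v, ω₀.form (ι t q) ![c • u, v] = c * ω₀.form (ι t q) ![u, v] :=
      fun c u v => (ω₀.form (ι t q)).toMultilinearMap.cons_smul ![v] c u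
    rw [add0, smul0, form_swap _ Y, form_swap _ (A v), add0, add0, smul0, smul0, form_self,
      form_swap _ (A w) (A v), hz, form_swap _ (A w) Y]
    ring
  refine (hform _ _).trans ?_
  rw [mfderiv_traceMap hι, mfderiv_traceMap hι]
  refine (τ.form_apply (circlePt t, ι t q) _ _ _ _).trans ?_
  rw [hdh, hdh]
  have lin : ∀ (f : M → ℝ) (c : ℝ) (X : TangentSpace (𝓡 (2 * n)) (ι t q)),
      vectorDiff (𝓡 (2 * n)) f (ι t q) (c • Y + X) =
      c * vectorDiff (𝓡 (2 * n)) f (ι t q) Y + vectorDiff (𝓡 (2 * n)) f (ι t q) X := by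
    intro f c X
    exact (map_add (vectorDiff (𝓡 (2 * n)) f (ι t q)) _ _).trans
      (congrArg₂ (· + ·) (map_smul (vectorDiff (𝓡 (2 * n)) f (ι t q)) _ _) rfl)
  have r1 : ∀ c : ℝ, (c • (2 * Real.pi * Complex.I * circlePt t)).re =
      -(c * (2 * Real.pi * (circlePt t).im)) := by intro c; simp [mul_assoc]
  have r2 : ∀ c : ℝ, (c • (2 * Real.pi * Complex.I * circlePt t)).im =
      c * (2 * Real.pi * (circlePt t).re) := by intro c; simp [mul_assoc]
  have e1 := congrArg₂ (fun x y => x * (b • (2 * Real.pi * Complex.I * circlePt t)).re -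
      y * (a • (2 * Real.pi * Complex.I * circlePt t)).re)
    (lin (fun m => τ.F (circlePt t, m)) a (A v)) (lin (fun m => τ.F (circlePt t, m)) b (A w))
  have e2 := congrArg₂ (fun x y => x * (b • (2 * Real.pi * Complex.I * circlePt t)).im -
      y * (a • (2 * Real.pi * Complex.I * circlePt t)).im)
    (lin (fun m => τ.G (circlePt t, m)) a (A v)) (lin (fun m => τ.G (circlePt t, m)) b (A w))
  refine (congrArg₂ (· + ·) (congrArg₂ (· + ·) (congrArg₂ (· + ·) hbil e1) e2) rfl).trans ?_
  rw [r1, r1, r2, r2]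
  ring

/-- A connection form vanishes on `TΛ` if and only if the boundary value of its angular component
generates the loop. -/
theorem HamiltonianConnection.vanishesOn_iff [IsManifold (𝓡 n) ∞ L]
    [IsManifold (𝓡 (2 * n)) ∞ M] [CompactSpace L] [T2Space M]
    (τ : HamiltonianConnection ω₀) {Λ : ℝ → Set M} {ι : ℝ → L → M} (hι : IsLift ω₀ Λ ι) :
    VanishesOn ω₀ L Λ τ.form ↔
      ∀ t, IsPrimitiveOfVelocity ω₀ ι t (fun q => angularHam τ.F τ.G ((1, t), ι t q)) := by
  constructor
  · intro h t
    refine ⟨?_, fun q w => ?_⟩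
    · have h1 : ContMDiff (𝓡 n) (𝓘(ℝ, ℝ × ℝ).prod (𝓡 (2 * n))) ∞
          (fun q => (((1, t) : ℝ × ℝ), ι t q)) :=
        contMDiff_const.prodMk (hι.lagrangian t).smooth
      exact (contMDiff_angularHam τ.smooth_F τ.smooth_G).comp h1
    · have h1 := τ.pullback_traceMap_apply hι.smooth (hι.lagrangian t).isotropic
        (fun q => rfl) q 1 0 0 w
      rw [h ι hι] at h1
      have h2 : (0 : ℝ) = _ := h1
      rw [zero_mul, sub_zero, one_mul] at h2
      exact (sub_eq_zero.1 h2.symm).symm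
  · intro h ι' hι'
    have hprim : ∀ t, IsPrimitiveOfVelocity ω₀ ι' t
        (fun q => angularHam τ.F τ.G ((1, t), ι' t q)) := by
      intro t
      obtain ⟨φ, hφ, hφι, -⟩ := hι.exists_reparametrization hι'
      have h1 := (h t).reparametrize hι.smooth (hι.lagrangian t).isotropic hφ
      simp only [hφι] at h1
      exact h1
    funext x
    obtain ⟨t, q⟩ := x
    ext ξ
    have hξ : ξ = ![((ξ 0).1, (ξ 0).2), ((ξ 1).1, (ξ 1).2)] := by
      funext i; fin_cases i <;> rfl
    rw [hξ]
    refine (τ.pullback_traceMap_apply hι'.smooth (hι'.lagrangian t).isotropic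
        (fun q => rfl) q _ _ _ _).trans ?_
    have e : ∀ w, ω₀.form (ι' t q) ![mfderiv 𝓘(ℝ, ℝ) (𝓡 (2 * n)) (fun s => ι' s q) t (1 : ℝ),
          mfderiv (𝓡 n) (𝓡 (2 * n)) (ι' t) q w] -
        vectorDiff (𝓡 n) (fun q => angularHam τ.F τ.G ((1, t), ι' t q)) q w = 0 := fun w =>
      sub_eq_zero.2 ((hprim t).2 q w).symm
    refine (congrArg₂ (fun x y => (ξ 0).1 * x - (ξ 1).1 * y) (e _) (e _)).trans ?_
    rw [mul_zero, mul_zero, sub_zero]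
    rfl

end FormOfConnection

section Curvature

variable {n : ℕ} {M : Type*} [TopologicalSpace M]
  [ChartedSpace (EuclideanSpace ℝ (Fin (2 * n))) M]

/-- The curvature `{F, G} + ∂_y F - ∂_x G` of the connection with components `F` and `G`, which
are not required to have mean value zero. -/
def hamCurvature (ω₀ : SymplecticForm n M) (F G : ℂ × M → ℝ) (p : ℂ × M) : ℝ :=
  ω₀.poisson (fun m => F (p.1, m)) (fun m => G (p.1, m)) p.2
    + baseDeriv F Complex.I p - baseDeriv G 1 p

theorem contMDiff_hamCurvature [IsManifold (𝓡 (2 * n)) ∞ M] (ω₀ : SymplecticForm n M)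
    {F G : ℂ × M → ℝ}
    (hF : ContMDiff (𝓘(ℝ, ℂ).prod (𝓡 (2 * n))) 𝓘(ℝ, ℝ) ∞ F)
    (hG : ContMDiff (𝓘(ℝ, ℂ).prod (𝓡 (2 * n))) 𝓘(ℝ, ℝ) ∞ G) :
    ContMDiff (𝓘(ℝ, ℂ).prod (𝓡 (2 * n))) 𝓘(ℝ, ℝ) ∞ (hamCurvature ω₀ F G) := by
  have h1 := ω₀.contMDiff_vectorDiff_hamVec hF hG
  have h2 : ∀ {F : ℂ × M → ℝ}, ContMDiff (𝓘(ℝ, ℂ).prod (𝓡 (2 * n))) 𝓘(ℝ, ℝ) ∞ F → ∀ w,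
      ContMDiff (𝓘(ℝ, ℂ).prod (𝓡 (2 * n))) 𝓘(ℝ, ℝ) ∞ (baseDeriv F w) := fun hF w =>
    hF.fderiv_fst.clm_apply contMDiff_const
  refine ((h1.add (h2 hF Complex.I)).sub (h2 hG 1)).congr fun p => ?_
  rw [hamCurvature, ω₀.poisson_eq]
  rfl

theorem HamiltonianConnection.contMDiff_curvature [IsManifold (𝓡 (2 * n)) ∞ M]
    [MeasurableSpace M] {ω₀ : SymplecticForm n M} (τ : HamiltonianConnection ω₀) :
    ContMDiff (𝓘(ℝ, ℂ).prod (𝓡 (2 * n))) 𝓘(ℝ, ℝ) ∞ τ.curvature :=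
  contMDiff_hamCurvature ω₀ τ.smooth_F τ.smooth_G

end Curvature

section PolarIntegral

/-- Integration over the unit disc in polar coordinates. -/
theorem integral_unitDisc_eq {f : ℂ → ℝ} (hf : Continuous f) :
    ∫ z in unitDisc, f z =
      ∫ t in (0 : ℝ)..1, ∫ r in (0 : ℝ)..1, 2 * Real.pi * r * f (r • circlePt t) := by
  let g : ℝ → ℝ := fun θ => ∫ r in (0 : ℝ)..1, r * f (r * (Real.cos θ + Real.sin θ * Complex.I))
  have h1 : ∫ z in unitDisc, f z = ∫ θ in (-Real.pi)..Real.pi, g θ := by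
    rw [← integral_indicator Metric.isClosed_closedBall.measurableSet,
      ← Complex.integral_comp_polarCoord_symm]
    have e1 : ∀ p ∈ polarCoord.target, p.1 • unitDisc.indicator f (Complex.polarCoord.symm p) =
        (Iic (1 : ℝ) ×ˢ (univ : Set ℝ)).indicator (fun p : ℝ × ℝ =>
          p.1 * f (p.1 * (Real.cos p.2 + Real.sin p.2 * Complex.I))) p := by
      rintro ⟨r, θ⟩ hp
      have hr : 0 < r := hp.1
      have hn : ‖Complex.polarCoord.symm (r, θ)‖ = r := by
        rw [Complex.norm_polarCoord_symm, abs_of_pos hr]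
      by_cases h : r ≤ 1
      · rw [indicator_of_mem (by rwa [mem_closedBall_zero_iff, hn]),
          indicator_of_mem (show (r, θ) ∈ Iic (1 : ℝ) ×ˢ univ from ⟨h, mem_univ _⟩),
          Complex.polarCoord_symm_apply]
        rfl
      · rw [indicator_of_notMem (by rwa [mem_closedBall_zero_iff, hn]),
          indicator_of_notMem (fun hm : (r, θ) ∈ Iic (1 : ℝ) ×ˢ univ => h hm.1), smul_zero]
    have hc : Continuous fun p : ℝ × ℝ =>
        p.1 * f (p.1 * (Real.cos p.2 + Real.sin p.2 * Complex.I)) := by fun_prop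
    have hm : MeasurableSet (Iic (1 : ℝ) ×ˢ (univ : Set ℝ)) := measurableSet_Iic.prod .univ
    rw [setIntegral_congr_fun polarCoord.open_target.measurableSet e1, setIntegral_indicator hm]
    have e2 : polarCoord.target ∩ Iic (1 : ℝ) ×ˢ (univ : Set ℝ) =
        Ioc (0 : ℝ) 1 ×ˢ Ioo (-Real.pi) Real.pi := by
      rw [polarCoord_target, prod_inter_prod, inter_univ]
      rfl
    have hint : IntegrableOn (fun p : ℝ × ℝ =>
        p.1 * f (p.1 * (Real.cos p.2 + Real.sin p.2 * Complex.I)))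
        (Ioc (0 : ℝ) 1 ×ˢ Ioo (-Real.pi) Real.pi) (volume.prod volume) :=
      (hc.continuousOn.integrableOn_compact (isCompact_Icc.prod isCompact_Icc)).mono_set
        (prod_mono Ioc_subset_Icc_self Ioo_subset_Icc_self)
    rw [IntegrableOn, ← Measure.prod_restrict] at hint
    rw [e2, Measure.volume_eq_prod, ← Measure.prod_restrict, integral_prod_symm _ hint,
      ← integral_Ioc_eq_integral_Ioo,
      ← intervalIntegral.integral_of_le (by linarith [Real.pi_pos])]
    refine intervalIntegral.integral_congr fun θ _ => ?_
    exact (intervalIntegral.integral_of_le zero_le_one).symm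
  have hper : Function.Periodic g (2 * Real.pi) := by
    intro θ
    simp only [g, Real.cos_add_two_pi, Real.sin_add_two_pi]
  have h2 : ∫ θ in (-Real.pi)..Real.pi, g θ = ∫ θ in (0 : ℝ)..2 * Real.pi, g θ := by
    have := hper.intervalIntegral_add_eq (-Real.pi) 0
    rwa [zero_add, show -Real.pi + 2 * Real.pi = Real.pi by ring] at this
  have h3 := intervalIntegral.integral_comp_mul_left (a := 0) (b := 1) g
    (c := 2 * Real.pi) (by positivity)
  rw [mul_zero, mul_one, smul_eq_mul] at h3
  have hpi : (2 * Real.pi) ≠ 0 := by positivity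
  rw [h1, h2, ← mul_inv_cancel_left₀ hpi (∫ θ in (0 : ℝ)..2 * Real.pi, g θ), ← h3,
    ← intervalIntegral.integral_const_mul]
  refine intervalIntegral.integral_congr fun t _ => ?_
  simp only [g]
  rw [← intervalIntegral.integral_const_mul]
  refine intervalIntegral.integral_congr fun r _ => ?_
  have : (circlePt t : ℂ) =
      Real.cos (2 * Real.pi * t) + Real.sin (2 * Real.pi * t) * Complex.I := by
    rw [circlePt, Complex.ofReal_cos, Complex.ofReal_sin, ← Complex.exp_mul_I]
    congr 1
    push_cast
    ring
  simp only [this, Complex.real_smul]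
  ring

end PolarIntegral

/-! ### Families of Lagrangian submanifolds moved by a Hamiltonian flow -/

section TimeIntegral

variable {EW HW : Type} [NormedAddCommGroup EW] [NormedSpace ℝ EW] [FiniteDimensional ℝ EW]
  [TopologicalSpace HW] {I : ModelWithCorners ℝ EW HW} [I.Boundaryless] {W : Type*}
  [TopologicalSpace W] [ChartedSpace HW W] [IsManifold I ∞ W]

/-- The integral of a smooth family of functions of time, as a function of its upper limit. -/
theorem contMDiff_integral_upper {f : ℝ × W → ℝ} (hf : ContMDiff (𝓘(ℝ, ℝ).prod I) 𝓘(ℝ, ℝ) ∞ f)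
    (s₀ : ℝ) :
    ContMDiff (𝓘(ℝ, ℝ).prod I) 𝓘(ℝ, ℝ) ∞ (fun x : ℝ × W => ∫ σ in s₀..x.1, f (σ, x.2)) := by
  have e : (fun x : ℝ × W => ∫ σ in s₀..x.1, f (σ, x.2)) = fun x : ℝ × W =>
      (x.1 - s₀) * ∫ τ in (0 : ℝ)..1, f ((x.1 - s₀) * τ + s₀, x.2) := by
    funext x
    have := intervalIntegral.mul_integral_comp_mul_add (a := 0) (b := 1)
      (f := fun σ => f (σ, x.2)) (x.1 - s₀) s₀
    rw [this]
    congr 1 <;> ring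
  rw [e]
  have h1 : ContMDiff ((𝓘(ℝ, ℝ).prod I).prod 𝓘(ℝ, ℝ)) (𝓘(ℝ, ℝ).prod I) ∞
      (fun y : (ℝ × W) × ℝ => ((y.1.1 - s₀) * y.2 + s₀, y.1.2)) :=
    ((((contMDiff_fst.comp contMDiff_fst).sub contMDiff_const).mul contMDiff_snd).add
      contMDiff_const).prodMk (contMDiff_snd.comp contMDiff_fst)
  exact (contMDiff_fst.sub contMDiff_const).mul
    (contMDiff_unitIntervalIntegral (F := fun y : (ℝ × W) × ℝ =>
      f ((y.1.1 - s₀) * y.2 + s₀, y.1.2)) (hf.comp h1))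

end TimeIntegral

section Flow

variable {n : ℕ} {M : Type*} [TopologicalSpace M]
  [ChartedSpace (EuclideanSpace ℝ (Fin (2 * n))) M] [IsManifold (𝓡 (2 * n)) ∞ M]
  (ω₀ : SymplecticForm n M)

/-- The flow of a smooth family of Hamiltonian functions which vanishes for parameters outside of
a compact set. -/
theorem SymplecticForm.exists_hamiltonian_flow [CompactSpace M] [T2Space M] [Nonempty M]
    {P : Type} [NormedAddCommGroup P] [NormedSpace ℝ P] [FiniteDimensional ℝ P]
    {K : (ℝ × P) × M → ℝ} (hK : ContMDiff (𝓘(ℝ, ℝ × P).prod (𝓡 (2 * n))) 𝓘(ℝ, ℝ) ∞ K)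
    {C : Set (ℝ × P)} (hC : IsCompact C) (hKC : ∀ a ∉ C, ∀ m, K (a, m) = 0) :
    ∃ Θ : (ℝ × ℝ × P) × M → M,
      ContMDiff (𝓘(ℝ, ℝ × ℝ × P).prod (𝓡 (2 * n))) (𝓡 (2 * n)) ∞ Θ ∧
      (∀ s p m, Θ ((s, s, p), m) = m) ∧
      (∀ s t p m, mfderiv 𝓘(ℝ, ℝ) (𝓡 (2 * n)) (fun t => Θ ((s, t, p), m)) t (1 : ℝ) =
        ω₀.hamVec (fun m => K ((t, p), m)) (Θ ((s, t, p), m))) ∧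
      (∀ s t t' p m, Θ ((t, t', p), Θ ((s, t, p), m)) = Θ ((s, t', p), m)) := by
  obtain ⟨Θ, h1, h2, h3, -, h5⟩ := exists_flow_of_compact (P := P) (J := 𝓡 (2 * n))
    (fun x : (ℝ × P) × M => ω₀.hamVec (fun m => K (x.1, m)) x.2)
    (fun N e he => ω₀.contMDiff_vectorDiff_hamVec (e := fun x : (ℝ × P) × M => e x.2)
      (he.comp contMDiff_snd) hK) hC (fun a ha m => ω₀.hamVec_eq_zero (hKC a ha))
  exact ⟨Θ, h1, h2, h3, h5⟩

theorem mfderiv_comp_real {EM HM : Type*} [NormedAddCommGroup EM] [NormedSpace ℝ EM]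
    [TopologicalSpace HM] {J : ModelWithCorners ℝ EM HM} {N : Type*}
    [TopologicalSpace N] [ChartedSpace HM N] {c : ℝ → N} {φ : ℝ → ℝ} {φ' s : ℝ}
    (hφ : HasDerivAt φ φ' s) (hc : MDifferentiableAt 𝓘(ℝ, ℝ) J c (φ s)) :
    mfderiv 𝓘(ℝ, ℝ) J (fun s => c (φ s)) s (1 : ℝ) = φ' • mfderiv 𝓘(ℝ, ℝ) J c (φ s) (1 : ℝ) := by
  have h := hc.hasMFDerivAt.comp s hφ.hasFDerivAt.hasMFDerivAt
  refine (congrArg (fun A => A (1 : ℝ)) h.mfderiv).trans ?_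
  refine Eq.trans ?_ (ContinuousLinearMap.map_smul (mfderiv 𝓘(ℝ, ℝ) J c (φ s)) φ' (1 : ℝ))
  refine congrArg (mfderiv 𝓘(ℝ, ℝ) J c (φ s)) ?_
  exact (one_mul φ').trans (mul_one φ').symm

variable {ω₀} {L : Type*} [TopologicalSpace L]
  [ChartedSpace (EuclideanSpace ℝ (Fin n)) L] [IsManifold (𝓡 n) ∞ L]

/-- A Lagrangian embedding stays one under a Hamiltonian flow; `g` is the map of the flow from the
time `s₀` to `s`, and `g'` the one back. -/
theorem isLagrangianEmbedding_evolve {u : ℝ → ℝ → L → M}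
    (hu : ContMDiff (𝓘(ℝ, ℝ).prod (𝓘(ℝ, ℝ).prod (𝓡 n))) (𝓡 (2 * n)) ∞
      (fun p : ℝ × ℝ × L => u p.1 p.2.1 p.2.2)) {K : (ℝ × ℝ) × M → ℝ}
    (hK : ContMDiff (𝓘(ℝ, ℝ × ℝ).prod (𝓡 (2 * n))) 𝓘(ℝ, ℝ) ∞ K)
    (hus : ∀ s t q, mfderiv 𝓘(ℝ, ℝ) (𝓡 (2 * n)) (fun s => u s t q) s (1 : ℝ) =
      ω₀.hamVec (fun m => K ((s, t), m)) (u s t q)) {s₀ s t : ℝ}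
    (h₀ : IsLagrangianEmbedding ω₀ (u s₀ t)) {g g' : M → M}
    (hg : ContMDiff (𝓡 (2 * n)) (𝓡 (2 * n)) ∞ g) (hg' : ContMDiff (𝓡 (2 * n)) (𝓡 (2 * n)) ∞ g')
    (hgg' : Function.LeftInverse g' g) (hug : ∀ q, u s t q = g (u s₀ t q)) :
    IsLagrangianEmbedding ω₀ (u s t) := by
  have e : u s t = g ∘ u s₀ t := funext hug
  refine ⟨?_, ?_, fun q => ?_, isotropic_evolve hu hK hus h₀.isotropic s⟩
  · rw [e]; exact hg.comp h₀.smooth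
  · rw [e]; exact (hgg'.isEmbedding hg'.continuous hg.continuous).comp h₀.isEmbedding
  · rw [e, mfderiv_comp q (hg.mdifferentiableAt (by simp)) (h₀.smooth.mdifferentiableAt (by simp))]
    have h1 : mfderiv (𝓡 (2 * n)) (𝓡 (2 * n)) g' (g (u s₀ t q)) ∘L
        mfderiv (𝓡 (2 * n)) (𝓡 (2 * n)) g (u s₀ t q) = ContinuousLinearMap.id ℝ _ := by
      rw [← mfderiv_comp (u s₀ t q) (hg'.mdifferentiableAt (by simp))
        (hg.mdifferentiableAt (by simp)), hgg'.comp_eq_id, mfderiv_id]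
    have h2 : Function.Injective (mfderiv (𝓡 (2 * n)) (𝓡 (2 * n)) g (u s₀ t q)) := by
      refine Function.LeftInverse.injective
        (g := mfderiv (𝓡 (2 * n)) (𝓡 (2 * n)) g' (g (u s₀ t q))) fun v => ?_
      exact congrArg (fun A => A v) h1
    exact h2.comp (h₀.immersive q)

/-- A family of Lagrangian embeddings moved by a Hamiltonian flow, together with the primitives of
its velocities in the second parameter. -/
theorem exists_primitives_evolve {u : ℝ → ℝ → L → M}
    (hu : ContMDiff (𝓘(ℝ, ℝ).prod (𝓘(ℝ, ℝ).prod (𝓡 n))) (𝓡 (2 * n)) ∞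
      (fun p : ℝ × ℝ × L => u p.1 p.2.1 p.2.2)) {K : (ℝ × ℝ) × M → ℝ}
    (hK : ContMDiff (𝓘(ℝ, ℝ × ℝ).prod (𝓡 (2 * n))) 𝓘(ℝ, ℝ) ∞ K)
    (hus : ∀ s t q, mfderiv 𝓘(ℝ, ℝ) (𝓡 (2 * n)) (fun s => u s t q) s (1 : ℝ) =
      ω₀.hamVec (fun m => K ((s, t), m)) (u s t q)) {s₀ : ℝ} {a₀ : ℝ × L → ℝ}
    (ha₀ : ContMDiff (𝓘(ℝ, ℝ).prod (𝓡 n)) 𝓘(ℝ, ℝ) ∞ a₀)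
    (h₀ : ∀ t, IsPrimitiveOfVelocity ω₀ (u s₀) t (fun q => a₀ (t, q))) :
    ∃ a : ℝ → ℝ → L → ℝ, ContMDiff (𝓘(ℝ, ℝ).prod (𝓘(ℝ, ℝ).prod (𝓡 n))) 𝓘(ℝ, ℝ) ∞
        (fun p : ℝ × ℝ × L => a p.1 p.2.1 p.2.2) ∧
      (∀ t q, a s₀ t q = a₀ (t, q)) ∧
      (∀ s t q, HasDerivAt (fun s => a s t q)
        (fderiv ℝ (fun z => K (z, u s t q)) (s, t) (0, 1)) s) ∧
      ∀ s t, IsPrimitiveOfVelocity ω₀ (u s) t (a s t) := by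
  let f : ℝ × ℝ × L → ℝ := fun x =>
    fderiv ℝ (fun z => K (z, u x.1 x.2.1 x.2.2)) (x.1, x.2.1) (0, 1)
  have hf : ContMDiff (𝓘(ℝ, ℝ).prod (𝓘(ℝ, ℝ).prod (𝓡 n))) 𝓘(ℝ, ℝ) ∞ f := by
    have h1 : ContMDiff (𝓘(ℝ, ℝ).prod (𝓘(ℝ, ℝ).prod (𝓡 n))) (𝓘(ℝ, ℝ × ℝ).prod (𝓡 (2 * n))) ∞
        (fun x : ℝ × ℝ × L => (((x.1, x.2.1) : ℝ × ℝ), u x.1 x.2.1 x.2.2)) :=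
      (contMDiff_fst.prodMk_space (contMDiff_fst.comp contMDiff_snd)).prodMk hu
    exact (hK.fderiv_fst.comp h1).clm_apply contMDiff_const
  let a : ℝ → ℝ → L → ℝ := fun s t q => a₀ (t, q) + ∫ σ in s₀..s, f (σ, t, q)
  have ha : ContMDiff (𝓘(ℝ, ℝ).prod (𝓘(ℝ, ℝ).prod (𝓡 n))) 𝓘(ℝ, ℝ) ∞
      (fun p : ℝ × ℝ × L => a p.1 p.2.1 p.2.2) :=
    (ha₀.comp contMDiff_snd).add (contMDiff_integral_upper (W := ℝ × L) hf s₀)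
  have has : ∀ s t q, HasDerivAt (fun s => a s t q)
      (fderiv ℝ (fun z => K (z, u s t q)) (s, t) (0, 1)) s := by
    intro s t q
    have hc : Continuous fun σ => f (σ, t, q) := hf.continuous.comp (by fun_prop)
    exact (intervalIntegral.integral_hasDerivAt_right (hc.intervalIntegrable _ _)
      (hc.stronglyMeasurableAtFilter _ _) hc.continuousAt).const_add _
  have has₀ : ∀ t q, a s₀ t q = a₀ (t, q) := fun t q => by
    simp only [a, intervalIntegral.integral_same, add_zero]
  refine ⟨a, ha, has₀, has, fun s t => IsPrimitiveOfVelocity.evolve hu hK hus ha has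
    (s₀ := s₀) ?_ s⟩
  have : a s₀ t = fun q => a₀ (t, q) := funext (has₀ t)
  rw [this]
  exact h₀ t

end Flow

/-! ### The length of a loop obtained by radial transport -/

section RadialTransport

variable {n : ℕ} {M : Type*} [TopologicalSpace M]
  [ChartedSpace (EuclideanSpace ℝ (Fin (2 * n))) M]
  {ω₀ : SymplecticForm n M} {L : Type*} [TopologicalSpace L]
  [ChartedSpace (EuclideanSpace ℝ (Fin n)) L]

theorem IsExactLagrangianLoop.nonempty [Nonempty L] {Λ : ℝ → Set M}
    (hΛ : IsExactLagrangianLoop ω₀ L Λ) : Nonempty M := by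
  obtain ⟨ι, -⟩ := hΛ.exists_exact_lift
  obtain ⟨q⟩ := ‹Nonempty L›
  exact ⟨ι 0 q⟩

/-- The velocity of a curve along which the first parameter runs backwards. -/
theorem isPrimitiveOfVelocity_reverse {u : ℝ → L → M}
    (hu : ContMDiff (𝓘(ℝ, ℝ).prod (𝓡 n)) (𝓡 (2 * n)) ∞ (fun p : ℝ × L => u p.1 p.2))
    {K : ℝ × M → ℝ} (hK : ContMDiff (𝓘(ℝ, ℝ).prod (𝓡 (2 * n))) 𝓘(ℝ, ℝ) ∞ K)
    (hus : ∀ s q, mfderiv 𝓘(ℝ, ℝ) (𝓡 (2 * n)) (fun s => u s q) s (1 : ℝ) =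
      ω₀.hamVec (fun m => K (s, m)) (u s q)) (s : ℝ) :
    IsPrimitiveOfVelocity ω₀ (fun s => u (1 - s)) s (fun q => -K (1 - s, u (1 - s) q)) := by
  have hus' : ContMDiff (𝓡 n) (𝓡 (2 * n)) ∞ (u (1 - s)) :=
    hu.comp (contMDiff_const.prodMk contMDiff_id)
  have hKs : ContMDiff (𝓡 (2 * n)) 𝓘(ℝ, ℝ) ∞ fun m => K (1 - s, m) :=
    hK.comp (contMDiff_const.prodMk contMDiff_id)
  refine ⟨(hKs.comp hus').neg, fun q v => ?_⟩
  have e1 : mfderiv 𝓘(ℝ, ℝ) (𝓡 (2 * n)) (fun s => u (1 - s) q) s (1 : ℝ) =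
      (-1 : ℝ) • ω₀.hamVec (fun m => K (1 - s, m)) (u (1 - s) q) := by
    rw [← hus]
    exact mfderiv_comp_real (c := fun s => u s q) ((hasDerivAt_id' s).const_sub 1)
      ((hu.comp (contMDiff_id.prodMk contMDiff_const)).mdifferentiableAt (by simp))
  have e2 : vectorDiff (𝓡 n) (fun q => -K (1 - s, u (1 - s) q)) q v =
      -vectorDiff (𝓡 (2 * n)) (fun m => K (1 - s, m)) (u (1 - s) q)
        (mfderiv (𝓡 n) (𝓡 (2 * n)) (u (1 - s)) q v) := by
    rw [← vectorDiff_comp (hKs.mdifferentiableAt (by simp)) (hus'.mdifferentiableAt (by simp))]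
    have h1 := ((hKs.comp hus').mdifferentiableAt (x := q) (by simp)).hasMFDerivAt.neg
    exact congrArg (fun A => (A v : ℝ)) h1.mfderiv
  refine e2.trans ?_
  rw [e1, ← ω₀.form_hamVec]
  refine Eq.trans ?_ ((ω₀.form (u (1 - s) q)).toMultilinearMap.cons_smul _ _ _).symm
  exact (neg_one_mul _).symm

variable [IsManifold (𝓡 (2 * n)) ∞ M] [IsManifold (𝓡 n) ∞ L] [CompactSpace M] [T2Space M]
  [CompactSpace L] [ConnectedSpace L] [MeasurableSpace M]

/-- The radial transport `u r t` of `Λ_t` from the unit circle to the radius `r`, by a connection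
that preserves `Λ`, and a primitive `a r t` of its velocity in `t`. At radius `1` the primitive is
the angular component, and it changes along the ray by the derivative `∂_t` of the radial
component. In particular the loop obtained at radius `0` is Hamiltonian isotopic to `Λ`. -/
theorem exists_radial_transport {Λ : ℝ → Set M} (hΛ : IsExactLagrangianLoop ω₀ L Λ)
    {τ : HamiltonianConnection ω₀} (hτ : τ ∈ connectionsPreserving ω₀ L Λ) :
    ∃ u : ℝ → ℝ → L → M, ∃ a : ℝ → ℝ → L → ℝ,
      AreHamiltonianIsotopic ω₀ L Λ (fun t => range (u 0 t)) ∧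
      IsLift ω₀ (fun t => range (u 0 t)) (u 0) ∧
      ContMDiff (𝓘(ℝ, ℝ).prod (𝓘(ℝ, ℝ).prod (𝓡 n))) (𝓡 (2 * n)) ∞
        (fun p : ℝ × ℝ × L => u p.1 p.2.1 p.2.2) ∧
      (∀ t, IsPrimitiveOfVelocity ω₀ (u 0) t (a 0 t)) ∧
      (∀ t q, a 1 t q = angularHam τ.F τ.G ((1, t), u 1 t q)) ∧
      (ContMDiff (𝓘(ℝ, ℝ).prod (𝓘(ℝ, ℝ).prod (𝓡 n))) 𝓘(ℝ, ℝ) ∞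
        (fun p : ℝ × ℝ × L => a p.1 p.2.1 p.2.2)) ∧
      (∀ r ∈ Icc (0 : ℝ) 1, ∀ t q, mfderiv 𝓘(ℝ, ℝ) (𝓡 (2 * n)) (fun r => u r t q) r (1 : ℝ) =
        ω₀.hamVec (fun m => radialHam τ.F τ.G ((r, t), m)) (u r t q)) ∧
      (∀ r ∈ Icc (0 : ℝ) 1, ∀ t q, HasDerivAt (fun r => a r t q)
        (fderiv ℝ (fun z => radialHam τ.F τ.G (z, u r t q)) (r, t) (0, 1)) r) := by
  have hM : Nonempty M := hΛ.nonempty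
  obtain ⟨ι, hι, -⟩ := hΛ.exists_exact_lift
  have hN := (τ.vanishesOn_iff hι).1 hτ
  -- the radial Hamiltonian, cut off outside of a neighbourhood of the parameters of interest
  let b : ContDiffBump (0 : ℝ × ℂ) := ⟨2, 3, by norm_num, by norm_num⟩
  let K : (ℝ × ℂ) × M → ℝ := fun x =>
    b x.1 * (x.1.2.re * τ.F (x.1.1 • x.1.2, x.2) + x.1.2.im * τ.G (x.1.1 • x.1.2, x.2))
  have hpt : ContMDiff (𝓘(ℝ, ℝ × ℂ).prod (𝓡 (2 * n))) (𝓘(ℝ, ℂ).prod (𝓡 (2 * n))) ∞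
      (fun x : (ℝ × ℂ) × M => (x.1.1 • x.1.2, x.2)) :=
    ((by fun_prop : ContDiff ℝ ∞ fun x : ℝ × ℂ => x.1 • x.2).contMDiff.comp
      contMDiff_fst).prodMk contMDiff_snd
  have hcoeff : ∀ {f : ℝ × ℂ → ℝ}, ContDiff ℝ ∞ f →
      ContMDiff (𝓘(ℝ, ℝ × ℂ).prod (𝓡 (2 * n))) 𝓘(ℝ, ℝ) ∞ (fun x : (ℝ × ℂ) × M => f x.1) :=
    fun hf => hf.contMDiff.comp contMDiff_fst
  have hK : ContMDiff (𝓘(ℝ, ℝ × ℂ).prod (𝓡 (2 * n))) 𝓘(ℝ, ℝ) ∞ K :=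
    (hcoeff b.contDiff).mul
      (((hcoeff (f := fun x => x.2.re) (Complex.reCLM.contDiff.comp contDiff_snd)).mul
        (τ.smooth_F.comp hpt)).add
      ((hcoeff (f := fun x => x.2.im) (Complex.imCLM.contDiff.comp contDiff_snd)).mul
        (τ.smooth_G.comp hpt)))
  obtain ⟨Θ, hΘ, hΘ0, hΘd, hΘc⟩ := ω₀.exists_hamiltonian_flow hK
    (isCompact_closedBall (0 : ℝ × ℂ) 3) (fun x hx m => by
      have : b x = 0 := b.zero_of_le_dist (le_of_lt (not_le.1 hx))
      simp only [K, this, zero_mul])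
  let K' : (ℝ × ℝ) × M → ℝ := fun x => K ((x.1.1, circlePt x.1.2), x.2)
  have hK' : ContMDiff (𝓘(ℝ, ℝ × ℝ).prod (𝓡 (2 * n))) 𝓘(ℝ, ℝ) ∞ K' := by
    have h1 : ContDiff ℝ ∞ fun p : ℝ × ℝ => (p.1, circlePt p.2) :=
      contDiff_fst.prodMk (contDiff_circlePt.comp contDiff_snd)
    exact hK.comp ((h1.contMDiff.comp contMDiff_fst).prodMk contMDiff_snd)
  have hKeq : ∀ r ∈ Ioo (-2 : ℝ) 2, ∀ t m, K' ((r, t), m) = radialHam τ.F τ.G ((r, t), m) := by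
    intro r hr t m
    have : b (r, circlePt t) = 1 := by
      refine b.one_of_mem_closedBall ?_
      rw [mem_closedBall_zero_iff, Prod.norm_def, norm_circlePt]
      exact max_le (abs_le.2 ⟨hr.1.le, hr.2.le⟩) (by norm_num [b])
    simp only [K', K, this, one_mul, radialHam]
  let u : ℝ → ℝ → L → M := fun r t q => Θ ((1, r, circlePt t), ι t q)
  have hu : ContMDiff (𝓘(ℝ, ℝ).prod (𝓘(ℝ, ℝ).prod (𝓡 n))) (𝓡 (2 * n)) ∞
      (fun p : ℝ × ℝ × L => u p.1 p.2.1 p.2.2) := by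
    have h1 : ContMDiff (𝓘(ℝ, ℝ).prod (𝓘(ℝ, ℝ).prod (𝓡 n))) 𝓘(ℝ, ℝ × ℝ × ℂ) ∞
        (fun p : ℝ × ℝ × L => ((1 : ℝ), p.1, circlePt p.2.1)) :=
      contMDiff_const.prodMk_space (contMDiff_fst.prodMk_space
        (contDiff_circlePt.contMDiff.comp (contMDiff_fst.comp contMDiff_snd)))
    exact hΘ.comp (h1.prodMk (hι.smooth.comp contMDiff_snd))
  have hu1 : ∀ t, u 1 t = ι t := fun t => funext fun q => hΘ0 _ _ _
  have hus : ∀ r t q, mfderiv 𝓘(ℝ, ℝ) (𝓡 (2 * n)) (fun r => u r t q) r (1 : ℝ) =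
      ω₀.hamVec (fun m => K' ((r, t), m)) (u r t q) := fun r t q => hΘd _ _ _ _
  have hΘs : ∀ x, ContMDiff (𝓡 (2 * n)) (𝓡 (2 * n)) ∞ fun m => Θ (x, m) := fun x =>
    hΘ.comp (contMDiff_const.prodMk contMDiff_id)
  have hlag : ∀ r t, IsLagrangianEmbedding ω₀ (u r t) := by
    intro r t
    refine isLagrangianEmbedding_evolve hu hK' hus (s₀ := 1)
      (g := fun m => Θ ((1, r, circlePt t), m))
      (g' := fun m => Θ ((r, 1, circlePt t), m)) ?_ (hΘs _) (hΘs _) (fun m => ?_) (fun q => ?_)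
    · rw [hu1]; exact hι.lagrangian t
    · exact (hΘc _ _ _ _ _).trans (hΘ0 _ _ _)
    · rw [hu1]
  have ha₀ : ContMDiff (𝓘(ℝ, ℝ).prod (𝓡 n)) 𝓘(ℝ, ℝ) ∞
      (fun x : ℝ × L => angularHam τ.F τ.G ((1, x.1), ι x.1 x.2)) := by
    have h1 : ContMDiff (𝓘(ℝ, ℝ).prod (𝓡 n)) (𝓘(ℝ, ℝ × ℝ).prod (𝓡 (2 * n))) ∞
        (fun x : ℝ × L => (((1, x.1) : ℝ × ℝ), ι x.1 x.2)) :=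
      (contMDiff_const.prodMk_space contMDiff_fst).prodMk hι.smooth
    exact (contMDiff_angularHam τ.smooth_F τ.smooth_G).comp h1
  obtain ⟨a, ha, ha1, has, hap⟩ := exists_primitives_evolve hu hK' hus (s₀ := 1) ha₀
    (fun t => by
      have := hN t
      rwa [show ι = u 1 from funext fun t => (hu1 t).symm] at this ⊢)
  have hlift : ∀ r, IsLift ω₀ (fun t => range (u r t)) (u r) := fun r =>
    ⟨hu.comp (contMDiff_const.prodMk contMDiff_id), hlag r, fun t => rfl⟩
  have hloop : ∀ r, IsExactLagrangianLoop ω₀ L (fun t => range (u r t)) := by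
    intro r
    refine ⟨fun t => ?_, u r, hlift r, fun t => ⟨_, hap r t⟩⟩
    have h1 : ∀ t, range (u r t) = (fun m => Θ ((1, r, circlePt t), m)) '' Λ t := by
      intro t
      rw [← hι.range_eq, ← range_comp]
      rfl
    rw [h1, h1, circlePt_add_one, hΛ.periodic]
  have hIoo : ∀ {r : ℝ}, r ∈ Icc (0 : ℝ) 1 → r ∈ Ioo (-2 : ℝ) 2 := fun hr =>
    ⟨by linarith [hr.1], by linarith [hr.2]⟩
  refine ⟨u, a, ⟨hΛ, hloop 0, fun s t q => u (1 - s) t q, ?_, fun s _ t => hlag _ t, fun t => ?_,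
    fun t => ?_, fun s _ => hloop _, fun s _ t => ?_⟩, hlift 0, hu, hap 0, fun t q => ?_, ha,
    fun r hr t q => ?_, fun r hr t q => ?_⟩
  · exact hu.comp ((contMDiff_const.sub contMDiff_fst).prodMk contMDiff_snd)
  · beta_reduce; rw [sub_zero]; exact (congrArg range (hu1 t)).trans (hι.range_eq t)
  · beta_reduce; rw [sub_self]
  · have hut : ContMDiff (𝓘(ℝ, ℝ).prod (𝓡 n)) (𝓡 (2 * n)) ∞ (fun p : ℝ × L => u p.1 t p.2) :=
      hu.comp (contMDiff_fst.prodMk (contMDiff_const.prodMk contMDiff_snd))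
    have hKt : ContMDiff (𝓘(ℝ, ℝ).prod (𝓡 (2 * n))) 𝓘(ℝ, ℝ) ∞
        (fun x : ℝ × M => K' ((x.1, t), x.2)) :=
      hK'.comp ((contMDiff_fst.prodMk_space contMDiff_const).prodMk contMDiff_snd)
    exact ⟨_, isPrimitiveOfVelocity_reverse (u := fun r => u r t) hut hKt (fun r q => hus r t q) s⟩
  · rw [ha1, hu1]
  · rw [hus]
    congr 1
    funext m
    exact hKeq r (hIoo hr) t m
  · have h1 := has r t q
    have h2 : (fun z => K' (z, u r t q)) =ᶠ[𝓝 (r, t)] fun z => radialHam τ.F τ.G (z, u r t q) := by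
      have : Ioo (-2 : ℝ) 2 ×ˢ (univ : Set ℝ) ∈ 𝓝 (r, t) :=
        (isOpen_Ioo.prod isOpen_univ).mem_nhds ⟨hIoo hr, mem_univ _⟩
      filter_upwards [this] with z hz
      exact hKeq z.1 hz.1 z.2 _
    rwa [h2.fderiv_eq] at h1

/-- The radial transport of `Λ` to the origin, by a connection that preserves `Λ`, is a loop whose
length is at most the Hofer norm of the curvature. Indeed the difference between the primitive of
the velocity and the angular component has the derivative `2πr Ω` along the rays. -/
theorem exists_isotopic_hoferLength_le {Λ : ℝ → Set M} (hΛ : IsExactLagrangianLoop ω₀ L Λ)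
    {τ : HamiltonianConnection ω₀} (hτ : τ ∈ connectionsPreserving ω₀ L Λ) :
    ∃ Λ' : ℝ → Set M, AreHamiltonianIsotopic ω₀ L Λ Λ' ∧
      hoferLength ω₀ L Λ' ≤ τ.curvatureNorm := by
  have hM : Nonempty M := hΛ.nonempty
  obtain ⟨u, a, hiso, hlift, hu, hap, ha1, ha, hus, has⟩ := exists_radial_transport hΛ hτ
  refine ⟨_, hiso, ?_⟩
  have hΩ : Continuous τ.curvature := τ.contMDiff_curvature.continuous
  have hosc : Continuous fun z => osc fun m => τ.curvature (z, m) := continuous_osc hΩ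
  have hcirc : Continuous circlePt := contDiff_circlePt.continuous
  have hfun : Continuous fun x : ℝ × ℝ =>
      2 * Real.pi * x.2 * osc fun m => τ.curvature (x.2 • circlePt x.1, m) :=
    (by fun_prop : Continuous fun x : ℝ × ℝ => 2 * Real.pi * x.2).mul
      (hosc.comp (continuous_snd.smul (hcirc.comp continuous_fst)))
  -- the derivative of the difference between the primitive and the angular Hamiltonian
  have hd : ∀ r ∈ Icc (0 : ℝ) 1, ∀ t q, HasDerivAt
      (fun r => a r t q - angularHam τ.F τ.G ((r, t), u r t q))
      (2 * Real.pi * r * τ.curvature (r • circlePt t, u r t q)) r := by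
    intro r hr t q
    have hN := contMDiff_angularHam τ.smooth_F τ.smooth_G
    have hut : ContMDiff 𝓘(ℝ, ℝ) (𝓡 (2 * n)) ∞ fun r => u r t q :=
      hu.comp (f := fun r : ℝ => (r, t, q)) (contMDiff_id.prodMk contMDiff_const)
    have hz : HasDerivAt (fun r : ℝ => (r, t)) ((1 : ℝ), (0 : ℝ)) r :=
      (hasDerivAt_id' r).prodMk (hasDerivAt_const r t)
    have h1 := vectorDiff_comp_prod (I := 𝓘(ℝ, ℝ)) (F := angularHam τ.F τ.G)
      (z := fun r : ℝ => (r, t)) (u := fun r => u r t q) (x := r)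
      (hN.mdifferentiableAt (by simp)) hz.differentiableAt.mdifferentiableAt
      (hut.mdifferentiableAt (by simp)) (1 : ℝ)
    rw [vectorDiff_eq_fderiv, vectorDiff_eq_fderiv, hus r hr] at h1
    have h2 : fderiv ℝ (fun r : ℝ => (r, t)) r (1 : ℝ) = ((1 : ℝ), (0 : ℝ)) := hz.deriv
    replace h1 := h1.trans (congrArg (fun v => fderiv ℝ (fun p => angularHam τ.F τ.G
      (p, u r t q)) (r, t) v + vectorDiff (𝓡 (2 * n)) (fun m => angularHam τ.F τ.G ((r, t), m))
        (u r t q) (ω₀.hamVec (fun m => radialHam τ.F τ.G ((r, t), m)) (u r t q))) h2)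
    have h3 : DifferentiableAt ℝ (fun r => angularHam τ.F τ.G ((r, t), u r t q)) r := by
      have : ContMDiff 𝓘(ℝ, ℝ) (𝓘(ℝ, ℝ × ℝ).prod (𝓡 (2 * n))) ∞
          (fun r : ℝ => (((r, t) : ℝ × ℝ), u r t q)) :=
        (contMDiff_id.prodMk_space contMDiff_const).prodMk hut
      exact (hN.comp this).contDiff.differentiable (by simp) r
    refine ((has r hr t q).sub h3.hasDerivAt).congr_deriv ?_
    have h4 : deriv (fun r => angularHam τ.F τ.G ((r, t), u r t q)) r = _ := h1
    rw [h4, HamiltonianConnection.curvature, ← polar_curvature ω₀ τ.smooth_F τ.smooth_G]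
    exact sub_add_eq_sub_sub _ _ _
  have hcont : ∀ t q, Continuous fun r : ℝ =>
      2 * Real.pi * r * τ.curvature (r • circlePt t, u r t q) := by
    intro t q
    have hut : Continuous fun r => u r t q :=
      (hu.continuous).comp (by fun_prop : Continuous fun r : ℝ => (r, t, q))
    exact (by fun_prop : Continuous fun r : ℝ => 2 * Real.pi * r).mul
      (hΩ.comp ((by fun_prop : Continuous fun r : ℝ => r • circlePt t).prodMk hut))
  have hval : ∀ t q, a 0 t q =
      -∫ r in (0 : ℝ)..1, 2 * Real.pi * r * τ.curvature (r • circlePt t, u r t q) := by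
    intro t q
    rw [intervalIntegral.integral_eq_sub_of_hasDerivAt (fun r hr => hd r
      (by rwa [uIcc_of_le zero_le_one] at hr) t q) ((hcont t q).intervalIntegrable _ _), ha1]
    simp [angularHam]
  have hle : ∀ t, osc (a 0 t) ≤
      ∫ r in (0 : ℝ)..1, 2 * Real.pi * r * osc fun m => τ.curvature (r • circlePt t, m) := by
    intro t
    refine osc_le fun q q' => ?_
    rw [hval, hval, neg_sub_neg, ← intervalIntegral.integral_sub
      ((hcont t q').intervalIntegrable _ _) ((hcont t q).intervalIntegrable _ _)]
    refine intervalIntegral.integral_mono_on zero_le_one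
      (((hcont t q').sub (hcont t q)).intervalIntegrable _ _)
      ((hfun.comp (by fun_prop : Continuous fun r : ℝ => (t, r))).intervalIntegrable _ _)
      fun r hr => ?_
    rw [← mul_sub]
    exact mul_le_mul_of_nonneg_left (sub_le_osc (f := fun m => τ.curvature (r • circlePt t, m))
      (hΩ.comp (by fun_prop)) _ _) (mul_nonneg (by positivity) hr.1)
  rw [hoferLength, HamiltonianConnection.curvatureNorm, integral_unitDisc_eq hosc]
  refine intervalIntegral.integral_mono_on zero_le_one ?_ ?_ fun t _ => ?_
  · have h1 : Continuous fun t => osc (a 0 t) :=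
      continuous_osc (h := fun x : ℝ × L => a 0 x.1 x.2)
        (ha.continuous.comp (by fun_prop : Continuous fun x : ℝ × L => ((0 : ℝ), x.1, x.2)))
    refine (h1.congr fun t => ?_).intervalIntegrable _ _
    exact (velocityNorm_eq hlift (hap t)).symm
  · refine Continuous.intervalIntegrable ?_ _ _
    exact intervalIntegral.continuous_parametric_intervalIntegral_of_continuous' hfun 0 1
  · rw [velocityNorm_eq hlift (hap t)]
    exact hle t

theorem minimalLength_le_relativeKArea {Λ : ℝ → Set M} (hΛ : IsExactLagrangianLoop ω₀ L Λ) :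
    minimalLength ω₀ L Λ ≤ relativeKArea ω₀ L Λ := by
  refine le_iInf₂ fun τ hτ => ?_
  obtain ⟨Λ', h, h'⟩ := exists_isotopic_hoferLength_le hΛ hτ
  exact iInf₂_le_of_le Λ' h (EReal.coe_le_coe_iff.2 h')

end RadialTransport

/-! ### Functions on the disc from periodic families -/

section Periodisation

theorem exists_int_of_circlePt_eq {s t : ℝ} (h : circlePt s = circlePt t) :
    ∃ k : ℤ, s = t + k := by
  obtain ⟨k, hk⟩ := Complex.exp_eq_exp_iff_exists_int.1 h
  refine ⟨k, ?_⟩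
  have h2 : (2 * Real.pi * Complex.I : ℂ) ≠ 0 := Complex.two_pi_I_ne_zero
  have h3 : (s : ℂ) = t + k := by
    apply mul_left_cancel₀ h2
    rw [hk]
    ring
  exact_mod_cast h3

theorem circlePt_arg {w : ℂ} (hw : ‖w‖ = 1) : circlePt (w.arg / (2 * Real.pi)) = w := by
  have h := Complex.norm_mul_exp_arg_mul_I w
  rw [hw, Complex.ofReal_one, one_mul] at h
  conv_rhs => rw [← h]
  rw [circlePt]
  congr 1
  have hpi : (Real.pi : ℂ) ≠ 0 := by exact_mod_cast Real.pi_ne_zero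
  push_cast
  field_simp

theorem circlePt_add_half (t : ℝ) : circlePt (t + 1 / 2) = -circlePt t := by
  simp only [circlePt]
  push_cast
  rw [mul_add, Complex.exp_add, show (2 * Real.pi * Complex.I * (1 / 2) : ℂ) =
    Real.pi * Complex.I by ring, Complex.exp_pi_mul_I]
  ring

theorem contDiffAt_arg {w : ℂ} (hw : w ∈ Complex.slitPlane) : ContDiffAt ℝ ∞ Complex.arg w :=
  (Complex.imCLM.contDiff.contDiffAt.comp w
    ((Complex.contDiffAt_log hw).restrict_scalars ℝ)).congr_of_eventuallyEq
      (Filter.Eventually.of_forall fun w => (Complex.log_im w).symm)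

variable {EM HM : Type*} [NormedAddCommGroup EM] [NormedSpace ℝ EM]
  [TopologicalSpace HM] {J : ModelWithCorners ℝ EM HM} {M : Type*}
  [TopologicalSpace M] [ChartedSpace HM M]

/-- Averaging over at most two translates turns a family depending on `t ∈ ℝ` into one depending
on the point `e^{2πit}` of the circle (and defined for all `w ∈ ℂ`). The two translates are the
values of `t` given by the principal branch of the argument and by the opposite branch. -/
theorem exists_circle_family {f : (ℝ × ℝ) × M → ℝ}
    (hf : ContMDiff (𝓘(ℝ, ℝ × ℝ).prod J) 𝓘(ℝ, ℝ) ∞ f) :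
    ∃ g : (ℝ × ℂ) × M → ℝ, ContMDiff (𝓘(ℝ, ℝ × ℂ).prod J) 𝓘(ℝ, ℝ) ∞ g ∧
      (∀ t, ∃ (k k' : ℤ) (c : ℝ), c ∈ Icc (0 : ℝ) 1 ∧ ∀ r m, g ((r, circlePt t), m) =
        c * f ((r, t + k), m) + (1 - c) * f ((r, t + k'), m)) ∧
      ∀ r, (∀ t m, f ((r, t), m) = 0) → ∀ w m, g ((r, w), m) = 0 := by
  let η : ℂ → ℝ := fun w => Real.smoothTransition (2 * ‖w‖ ^ 2 - 1)
  let S : ℂ → ℝ := fun w => Real.smoothTransition (2 * w.re + 1 / 2)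
  have hη : ContDiff ℝ ∞ η :=
    Real.smoothTransition.contDiff.comp (((contDiff_norm_sq ℝ).const_smul (2 : ℝ)).sub
      contDiff_const)
  have hS : ContDiff ℝ ∞ S :=
    Real.smoothTransition.contDiff.comp ((contDiff_const.mul Complex.reCLM.contDiff).add
      contDiff_const)
  -- a cut-off branch of the argument defines a smooth family
  have key : ∀ (χ : ℂ → ℝ) (a : ℂ → ℝ), ContDiff ℝ ∞ χ →
      (∀ w, χ =ᶠ[𝓝 w] 0 ∨ ContDiffAt ℝ ∞ a w) →
      ContMDiff (𝓘(ℝ, ℝ × ℂ).prod J) 𝓘(ℝ, ℝ) ∞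
        (fun x : (ℝ × ℂ) × M => χ x.1.2 * f ((x.1.1, a x.1.2), x.2)) := by
    rintro χ a hχ ha ⟨⟨r, w⟩, m⟩
    have hsnd : ContMDiff (𝓘(ℝ, ℝ × ℂ).prod J) 𝓘(ℝ, ℂ) ∞ fun x : (ℝ × ℂ) × M => x.1.2 :=
      contDiff_snd.contMDiff.comp contMDiff_fst
    have hfst : ContMDiff (𝓘(ℝ, ℝ × ℂ).prod J) 𝓘(ℝ, ℝ) ∞ fun x : (ℝ × ℂ) × M => x.1.1 :=
      contDiff_fst.contMDiff.comp contMDiff_fst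
    rcases ha w with h0 | ha
    · have h1 : ∀ᶠ x : (ℝ × ℂ) × M in 𝓝 ((r, w), m), χ x.1.2 = 0 :=
        (hsnd.continuous.tendsto ((r, w), m)).eventually h0
      have h2 : (fun x : (ℝ × ℂ) × M => χ x.1.2 * f ((x.1.1, a x.1.2), x.2)) =ᶠ[𝓝 ((r, w), m)]
          fun _ => 0 := h1.mono fun x hx => by simp only [hx, zero_mul]
      exact contMDiffAt_const.congr_of_eventuallyEq h2
    · have h1 : ContMDiffAt (𝓘(ℝ, ℝ × ℂ).prod J) 𝓘(ℝ, ℝ) ∞ (fun x : (ℝ × ℂ) × M => a x.1.2)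
          ((r, w), m) :=
        ContMDiffAt.comp ((r, w), m) (g := a) (I' := 𝓘(ℝ, ℂ))
          (f := fun x : (ℝ × ℂ) × M => x.1.2) ha.contMDiffAt hsnd.contMDiffAt
      exact ((hχ.contMDiff.comp hsnd).contMDiffAt).mul (ContMDiffAt.comp ((r, w), m) (g := f)
        (f := fun x : (ℝ × ℂ) × M => (((x.1.1, a x.1.2) : ℝ × ℝ), x.2)) hf.contMDiffAt
        ((hfst.contMDiffAt.prodMk_space h1).prodMk contMDiffAt_snd))
  have hη0 : ∀ w : ℂ, ‖w‖ ^ 2 < 1 / 2 → η =ᶠ[𝓝 w] 0 := by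
    intro w hw
    have : ∀ᶠ w in 𝓝 w, ‖w‖ ^ 2 < 1 / 2 := (by fun_prop : Continuous fun w : ℂ => ‖w‖ ^ 2).tendsto
      w |>.eventually (gt_mem_nhds hw)
    filter_upwards [this] with w hw
    exact Real.smoothTransition.zero_of_nonpos (by linarith)
  have hre : ∀ w : ℂ, w.im = 0 → ‖w‖ ^ 2 = w.re ^ 2 := by
    intro w hw
    rw [Complex.sq_norm, Complex.normSq_apply, hw]
    ring
  have h1 := key (fun w => η w * S w) (fun w => w.arg / (2 * Real.pi)) (hη.mul hS) fun w => by
    by_cases hw : w ∈ Complex.slitPlane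
    · exact Or.inr ((contDiffAt_arg hw).div_const _)
    · left
      rw [Complex.mem_slitPlane_iff, not_or, not_lt, not_not] at hw
      by_cases hr : ‖w‖ ^ 2 < 1 / 2
      · filter_upwards [hη0 w hr] with w hw
        simp only [hw, Pi.zero_apply, zero_mul]
      · have hlt : w.re < -1 / 4 := by
          rw [hre w hw.2] at hr
          nlinarith [hw.1]
        filter_upwards [(Complex.continuous_re.tendsto w).eventually (gt_mem_nhds hlt)] with w hw
        have : S w = 0 := Real.smoothTransition.zero_of_nonpos (by linarith)
        simp only [this, Pi.zero_apply, mul_zero]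
  have h2 := key (fun w => η w * (1 - S w)) (fun w => (-w).arg / (2 * Real.pi) + 1 / 2)
    (hη.mul (contDiff_const.sub hS)) fun w => by
    by_cases hw : -w ∈ Complex.slitPlane
    · exact Or.inr ((((contDiffAt_arg hw).comp w contDiffAt_id.neg).div_const _).add
        contDiffAt_const)
    · left
      rw [Complex.mem_slitPlane_iff, not_or, not_lt, not_not, Complex.neg_re, Complex.neg_im,
        neg_eq_zero] at hw
      by_cases hr : ‖w‖ ^ 2 < 1 / 2
      · filter_upwards [hη0 w hr] with w hw
        simp only [hw, Pi.zero_apply, zero_mul]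
      · have hlt : 1 / 4 < w.re := by
          rw [hre w hw.2] at hr
          nlinarith [hw.1]
        filter_upwards [(Complex.continuous_re.tendsto w).eventually (lt_mem_nhds hlt)] with w hw
        have : S w = 1 := Real.smoothTransition.one_of_one_le (by linarith)
        simp only [this, Pi.zero_apply, sub_self, mul_zero]
  refine ⟨_, h1.add h2, fun t => ?_, fun r hr w m => ?_⟩
  · have hw := norm_circlePt t
    obtain ⟨k, hk⟩ := exists_int_of_circlePt_eq (circlePt_arg hw)
    have hw' : ‖-circlePt t‖ = 1 := by rw [norm_neg, hw]
    obtain ⟨k', hk'⟩ := exists_int_of_circlePt_eq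
      (s := (-circlePt t).arg / (2 * Real.pi) + 1 / 2) (t := t)
      (by rw [circlePt_add_half, circlePt_arg hw', neg_neg])
    refine ⟨k, k', S (circlePt t), ⟨Real.smoothTransition.nonneg _, Real.smoothTransition.le_one _⟩,
      fun r m => ?_⟩
    have hη1 : η (circlePt t) = 1 := Real.smoothTransition.one_of_one_le (by rw [hw]; norm_num)
    simp only [Pi.add_apply, hη1, one_mul]
    rw [hk, hk']
  · simp only [Pi.add_apply, hr, mul_zero, add_zero]

/-- A family which depends on polar coordinates and vanishes near the origin is smooth on the
plane. -/
theorem contMDiff_of_polar {f : (ℝ × ℂ) × M → ℝ}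
    (hf : ContMDiff (𝓘(ℝ, ℝ × ℂ).prod J) 𝓘(ℝ, ℝ) ∞ f) {δ : ℝ} (hδ : 0 < δ)
    (hf0 : ∀ r < δ, ∀ w m, f ((r, w), m) = 0) {c : ℂ → ℝ} (hc : ∀ z ≠ 0, ContDiffAt ℝ ∞ c z) :
    ContMDiff (𝓘(ℝ, ℂ).prod J) 𝓘(ℝ, ℝ) ∞
      (fun x : ℂ × M => c x.1 * f ((‖x.1‖, ‖x.1‖⁻¹ • x.1), x.2)) := by
  rintro ⟨z, m⟩
  have hfst : ContMDiff (𝓘(ℝ, ℂ).prod J) 𝓘(ℝ, ℂ) ∞ fun x : ℂ × M => x.1 := contMDiff_fst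
  by_cases hz : z = 0
  · have h1 : ∀ᶠ x : ℂ × M in 𝓝 (z, m), ‖x.1‖ < δ :=
      (hfst.continuous.norm.tendsto (z, m)).eventually (gt_mem_nhds (by simpa [hz] using hδ))
    have h2 : (fun x : ℂ × M => c x.1 * f ((‖x.1‖, ‖x.1‖⁻¹ • x.1), x.2)) =ᶠ[𝓝 (z, m)]
        fun _ => 0 := h1.mono fun x hx => by simp only [hf0 _ hx, mul_zero]
    exact contMDiffAt_const.congr_of_eventuallyEq h2
  · have hn : ContDiffAt ℝ ∞ (fun z : ℂ => ‖z‖) z := contDiffAt_norm ℝ hz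
    have h1 : ContDiffAt ℝ ∞ (fun z : ℂ => (‖z‖, ‖z‖⁻¹ • z)) z :=
      hn.prodMk ((hn.inv (norm_ne_zero_iff.2 hz)).smul contDiffAt_id)
    have h2 : ContMDiffAt (𝓘(ℝ, ℂ).prod J) 𝓘(ℝ, ℝ × ℂ) ∞
        (fun x : ℂ × M => (‖x.1‖, ‖x.1‖⁻¹ • x.1)) (z, m) :=
      ContMDiffAt.comp (z, m) (g := fun z : ℂ => (‖z‖, ‖z‖⁻¹ • z)) (I' := 𝓘(ℝ, ℂ))
        (f := fun x : ℂ × M => x.1) h1.contMDiffAt hfst.contMDiffAt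
    have h3 : ContMDiffAt (𝓘(ℝ, ℂ).prod J) 𝓘(ℝ, ℝ) ∞ (fun x : ℂ × M => c x.1) (z, m) :=
      ContMDiffAt.comp (z, m) (g := c) (I' := 𝓘(ℝ, ℂ))
        (f := fun x : ℂ × M => x.1) (hc z hz).contMDiffAt hfst.contMDiffAt
    exact h3.mul (ContMDiffAt.comp (z, m) (g := f)
      (f := fun x : ℂ × M => (((‖x.1‖, ‖x.1‖⁻¹ • x.1) : ℝ × ℂ), x.2)) hf.contMDiffAt
      (h2.prodMk contMDiffAt_snd))

end Periodisation

section LagrangianComplement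

/-- A vector which is orthogonal to a Lagrangian subspace lies in that subspace. -/
theorem exists_of_forall_form_eq_zero {n : ℕ} {V W : Type*} [AddCommGroup V] [Module ℝ V]
    [TopologicalSpace V] [FiniteDimensional ℝ V] [AddCommGroup W] [Module ℝ W]
    [FiniteDimensional ℝ W] (hV : Module.finrank ℝ V = 2 * n) (hW : Module.finrank ℝ W = n)
    (θ : V [⋀^Fin 2]→L[ℝ] ℝ) (hθ : ∀ u, (∀ v, θ ![u, v] = 0) → u = 0) (A : W →ₗ[ℝ] V)
    (hA : Function.Injective A) (hiso : ∀ v w, θ ![A v, A w] = 0) {u : V}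
    (hu : ∀ w, θ ![u, A w] = 0) : ∃ w, A w = u := by
  have swap : ∀ u v, θ ![u, v] = -θ ![v, u] := by
    intro u v
    have h := θ.toAlternatingMap.map_swap ![v, u] (show (0 : Fin 2) ≠ 1 by decide)
    have e : (![v, u] ∘ Equiv.swap (0 : Fin 2) 1) = ![u, v] := by
      funext i
      fin_cases i <;> simp
    rw [e] at h
    exact h
  have add0 : ∀ u u' v, θ ![u + u', v] = θ ![u, v] + θ ![u', v] := fun u u' v =>
    θ.toMultilinearMap.cons_add ![v] u u'
  have smul0 : ∀ (c : ℝ) u v, θ ![c • u, v] = c * θ ![u, v] := fun c u v =>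
    θ.toMultilinearMap.cons_smul ![v] c u
  let B : LinearMap.BilinForm ℝ V := LinearMap.mk₂ ℝ (fun u v => θ ![u, v]) add0 smul0
    (fun u v v' => by rw [swap u, add0, swap u v, swap u v']; ring)
    (fun c u v => by rw [swap u, smul0, swap u v, smul_eq_mul]; ring)
  have hBr : B.IsRefl := fun u v h => by
    change θ ![v, u] = 0
    rw [swap]
    exact neg_eq_zero.2 h
  have hBn : B.Nondegenerate :=
    (LinearMap.IsRefl.nondegenerate_iff_separatingLeft (B := B) hBr).2 fun u h => hθ u h
  have hle : LinearMap.range A ≤ B.orthogonal (LinearMap.range A) := by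
    rintro _ ⟨w, rfl⟩
    rw [LinearMap.BilinForm.mem_orthogonal_iff]
    rintro _ ⟨v, rfl⟩
    exact hiso v w
  have heq : LinearMap.range A = B.orthogonal (LinearMap.range A) := by
    refine Submodule.eq_of_le_of_finrank_eq hle ?_
    rw [LinearMap.BilinForm.finrank_orthogonal hBn, LinearMap.finrank_range_of_inj hA, hV, hW]
    omega
  have hmem : u ∈ B.orthogonal (LinearMap.range A) := by
    rw [LinearMap.BilinForm.mem_orthogonal_iff]
    rintro _ ⟨v, rfl⟩
    exact hBr _ _ (hu v)
  rw [← heq] at hmem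
  exact hmem

end LagrangianComplement

/-! ### Hamiltonian isotopies of loops are generated by ambient flows -/

section IsotopyFlow

variable {n : ℕ} {M : Type*} [TopologicalSpace M]
  [ChartedSpace (EuclideanSpace ℝ (Fin (2 * n))) M]
  {ω₀ : SymplecticForm n M} {L : Type*} [TopologicalSpace L]
  [ChartedSpace (EuclideanSpace ℝ (Fin n)) L]

theorem IsPrimitiveOfVelocity.comp_time {ι : ℝ → L → M}
    (hι : ContMDiff (𝓘(ℝ, ℝ).prod (𝓡 n)) (𝓡 (2 * n)) ∞ (fun p : ℝ × L => ι p.1 p.2))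
    {φ : ℝ → ℝ} {φ' r : ℝ} (hφ : HasDerivAt φ φ' r) {h : L → ℝ}
    (hh : IsPrimitiveOfVelocity ω₀ ι (φ r) h) :
    IsPrimitiveOfVelocity ω₀ (fun r => ι (φ r)) r (fun q => φ' * h q) := by
  refine ⟨contMDiff_const.mul hh.1, fun q v => ?_⟩
  have e1 : mfderiv 𝓘(ℝ, ℝ) (𝓡 (2 * n)) (fun r => ι (φ r) q) r (1 : ℝ) =
      φ' • mfderiv 𝓘(ℝ, ℝ) (𝓡 (2 * n)) (fun s => ι s q) (φ r) (1 : ℝ) :=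
    mfderiv_comp_real (c := fun s => ι s q) hφ
      ((hι.comp (f := fun s : ℝ => (s, q)) (contMDiff_id.prodMk contMDiff_const)).mdifferentiableAt
        (by simp))
  have e2 : vectorDiff (𝓡 n) (fun q => φ' * h q) q v = φ' * vectorDiff (𝓡 n) h q v := by
    have h1 := ((hh.1.mdifferentiableAt (x := q) (by simp)).hasMFDerivAt).const_smul φ'
    exact congrArg (fun A => (A v : ℝ)) h1.mfderiv
  refine e2.trans ?_
  rw [e1]
  refine Eq.trans ?_ ((ω₀.form (ι (φ r) q)).toMultilinearMap.cons_smul _ _ _).symm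
  exact congrArg (φ' * ·) (hh.2 q v)

theorem IsPrimitiveOfVelocity.convex_combination {ι : ℝ → L → M} {t : ℝ} {h h' : L → ℝ}
    (hh : IsPrimitiveOfVelocity ω₀ ι t h) (hh' : IsPrimitiveOfVelocity ω₀ ι t h') (c : ℝ) :
    IsPrimitiveOfVelocity ω₀ ι t (fun q => c * h q + (1 - c) * h' q) := by
  refine ⟨(contMDiff_const.mul hh.1).add (contMDiff_const.mul hh'.1), fun q v => ?_⟩
  have h1 := ((hh.1.mdifferentiableAt (x := q) (by simp)).hasMFDerivAt).const_smul c
  have h2 := ((hh'.1.mdifferentiableAt (x := q) (by simp)).hasMFDerivAt).const_smul (1 - c)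
  refine (congrArg (fun A => (A v : ℝ)) (h1.add h2).mfderiv).trans ?_
  refine (congrArg₂ (fun a b => c * a + (1 - c) * b) (hh.2 q v) (hh'.2 q v)).trans ?_
  ring

/-- A Hamiltonian which restricts to a primitive of the velocity of a Lagrangian family generates
a vector field which is tangent to the trace of the family. -/
theorem exists_tangent_eq {ι : ℝ → L → M} (hlag : ∀ t, IsLagrangianEmbedding ω₀ (ι t))
    {f : M → ℝ} (hf : ContMDiff (𝓡 (2 * n)) 𝓘(ℝ, ℝ) ∞ f) {s : ℝ}
    (hp : IsPrimitiveOfVelocity ω₀ ι s (fun q => f (ι s q))) (q : L) :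
    ∃ v : TangentSpace (𝓡 n) q, ω₀.hamVec f (ι s q) =
      mfderiv 𝓘(ℝ, ℝ) (𝓡 (2 * n)) (fun s => ι s q) s (1 : ℝ) +
        mfderiv (𝓡 n) (𝓡 (2 * n)) (ι s) q v := by
  set Y := mfderiv 𝓘(ℝ, ℝ) (𝓡 (2 * n)) (fun s => ι s q) s (1 : ℝ) with hY
  have : FiniteDimensional ℝ (TangentSpace (𝓡 (2 * n)) (ι s q)) :=
    inferInstanceAs (FiniteDimensional ℝ (EuclideanSpace ℝ (Fin (2 * n))))
  have : FiniteDimensional ℝ (TangentSpace (𝓡 n) q) :=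
    inferInstanceAs (FiniteDimensional ℝ (EuclideanSpace ℝ (Fin n)))
  have hV : Module.finrank ℝ (TangentSpace (𝓡 (2 * n)) (ι s q)) = 2 * n :=
    finrank_euclideanSpace_fin
  have hW : Module.finrank ℝ (TangentSpace (𝓡 n) q) = n := finrank_euclideanSpace_fin
  obtain ⟨v, hv⟩ := exists_of_forall_form_eq_zero hV hW (ω₀.form (ι s q))
    (ω₀.nondegenerate (ι s q)) (mfderiv (𝓡 n) (𝓡 (2 * n)) (ι s) q).toLinearMap
    ((hlag s).immersive q) (fun v w => (congrArg (ω₀.form (ι s q)) (comp_cons_two _ v w).symm).trans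
      (congrArg (fun θ : DForm (𝓡 n) L 2 => θ q ![v, w]) (hlag s).isotropic))
    (u := ω₀.hamVec f (ι s q) - Y) (fun w => by
      have h1 := (ω₀.form (ι s q)).toMultilinearMap.cons_add
        ![mfderiv (𝓡 n) (𝓡 (2 * n)) (ι s) q w] (ω₀.hamVec f (ι s q) - Y) Y
      rw [sub_add_cancel] at h1
      have h2 := (ω₀.form_hamVec f (ι s q) (mfderiv (𝓡 n) (𝓡 (2 * n)) (ι s) q w)).symm.trans h1
      rw [← vectorDiff_comp (hf.mdifferentiableAt (by simp))
        ((hlag s).smooth.mdifferentiableAt (by simp))] at h2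
      exact left_eq_add.1 ((hp.2 q w).symm.trans (h2.trans (add_comm _ _))))
  exact ⟨v, (add_eq_of_eq_sub' hv).symm⟩

/-- A Hamiltonian isotopy can be reparametrised such that it is defined for all times, stationary
near the ends, and runs from the second loop to the first. -/
theorem AreHamiltonianIsotopic.exists_family {Λ Λ' : ℝ → Set M}
    (h : AreHamiltonianIsotopic ω₀ L Λ Λ') :
    ∃ u : ℝ → ℝ → L → M, ContMDiff (𝓘(ℝ, ℝ).prod (𝓘(ℝ, ℝ).prod (𝓡 n))) (𝓡 (2 * n)) ∞
        (fun p : ℝ × ℝ × L => u p.1 p.2.1 p.2.2) ∧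
      (∀ r t, IsLagrangianEmbedding ω₀ (u r t)) ∧
      (∀ t, range (u 0 t) = Λ' t) ∧ (∀ t, range (u 1 t) = Λ t) ∧
      (∀ r t (k : ℤ), range (u r (t + k)) = range (u r t)) ∧
      (∀ r t, ∃ h, IsPrimitiveOfVelocity ω₀ (fun r => u r t) r h) ∧
      ∀ r, r ≤ 1 / 2 ∨ 1 ≤ r → ∀ t, IsPrimitiveOfVelocity ω₀ (fun r => u r t) r (fun _ => 0) := by
  obtain ⟨ι, hι, hlag, h0, h1, hloop, hex⟩ := h.exists_isotopy
  let σ : ℝ → ℝ := fun r => Real.smoothTransition (2 - 2 * r)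
  have hσ : ContDiff ℝ ∞ σ := Real.smoothTransition.contDiff.comp (by fun_prop)
  have hσmem : ∀ r, σ r ∈ Icc (0 : ℝ) 1 := fun r =>
    ⟨Real.smoothTransition.nonneg _, Real.smoothTransition.le_one _⟩
  have hσ1 : ∀ r ≤ 1 / 2, σ r = 1 := fun r hr =>
    Real.smoothTransition.one_of_one_le (by linarith)
  have hσ0 : ∀ r, 1 ≤ r → σ r = 0 := fun r hr =>
    Real.smoothTransition.zero_of_nonpos (by linarith)
  have hσd : ∀ r, HasDerivAt σ (deriv σ r) r := fun r =>
    (hσ.differentiable (by simp) r).hasDerivAt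
  have hιt : ∀ t, ContMDiff (𝓘(ℝ, ℝ).prod (𝓡 n)) (𝓡 (2 * n)) ∞ (fun p : ℝ × L => ι p.1 t p.2) :=
    fun t => hι.comp (contMDiff_fst.prodMk (contMDiff_const.prodMk contMDiff_snd))
  refine ⟨fun r => ι (σ r), hι.comp ((hσ.contMDiff.comp contMDiff_fst).prodMk contMDiff_snd),
    fun r t => hlag _ (hσmem r) t, fun t => ?_, fun t => ?_, fun r t k => ?_, fun r t => ?_,
    fun r hr t => ?_⟩
  · beta_reduce; rw [hσ1 0 (by norm_num), h1]
  · beta_reduce; rw [hσ0 1 le_rfl, h0]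
  · have hp : Function.Periodic (fun t => range (ι (σ r) t)) 1 := (hloop _ (hσmem r)).periodic
    have := hp.int_mul k t
    rwa [mul_one] at this
  · obtain ⟨f, hf⟩ := hex _ (hσmem r) t
    exact ⟨_, hf.comp_time (hιt t) (hσd r)⟩
  · obtain ⟨f, hf⟩ := hex _ (hσmem r) t
    have h1 := hf.comp_time (hιt t) (hσd r)
    have h2 : deriv σ r = 0 := by
      rcases hr with hr | hr
      · refine IsLocalMax.deriv_eq_zero (Filter.Eventually.of_forall fun x => ?_)
        rw [hσ1 r hr]; exact (hσmem x).2
      · refine IsLocalMin.deriv_eq_zero (Filter.Eventually.of_forall fun x => ?_)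
        rw [hσ0 r hr]; exact (hσmem x).1
    simpa only [h2, zero_mul] using h1

variable [IsManifold (𝓡 (2 * n)) ∞ M] [IsManifold (𝓡 n) ∞ L]

/-- Whether a function on `M` restricts to a primitive of the velocity does not depend on the
lift. -/
theorem IsPrimitiveOfVelocity.of_isLift [CompactSpace L] [T2Space M] {Λ : ℝ → Set M}
    {ι ι' : ℝ → L → M} (h : IsLift ω₀ Λ ι) (h' : IsLift ω₀ Λ ι') {t : ℝ} {f : M → ℝ}
    (hf : IsPrimitiveOfVelocity ω₀ ι t (fun q => f (ι t q))) :
    IsPrimitiveOfVelocity ω₀ ι' t (fun q => f (ι' t q)) := by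
  obtain ⟨φ, hφ, hφι, -⟩ := h.exists_reparametrization h'
  have h1 := hf.reparametrize h.smooth (h.lagrangian t).isotropic hφ
  simp only [hφι] at h1
  exact h1

variable [CompactSpace M] [T2Space M] [CompactSpace L] [ConnectedSpace L]

/-- A Hamiltonian isotopy of loops extends to a Hamiltonian flow on `M`, parametrised by the
circle. -/
theorem AreHamiltonianIsotopic.exists_flow {Λ Λ' : ℝ → Set M}
    (h : AreHamiltonianIsotopic ω₀ L Λ Λ') :
    ∃ (K : (ℝ × ℂ) × M → ℝ) (Θ : (ℝ × ℝ × ℂ) × M → M),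
      ContMDiff (𝓘(ℝ, ℝ × ℂ).prod (𝓡 (2 * n))) 𝓘(ℝ, ℝ) ∞ K ∧
      (∀ r ≤ 1 / 2, ∀ w m, K ((r, w), m) = 0) ∧
      ContMDiff (𝓘(ℝ, ℝ × ℝ × ℂ).prod (𝓡 (2 * n))) (𝓡 (2 * n)) ∞ Θ ∧
      (∀ s p m, Θ ((s, s, p), m) = m) ∧
      (∀ s t p m, mfderiv 𝓘(ℝ, ℝ) (𝓡 (2 * n)) (fun t => Θ ((s, t, p), m)) t (1 : ℝ) =
        ω₀.hamVec (fun m => K ((t, p), m)) (Θ ((s, t, p), m))) ∧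
      (∀ s t t' p m, Θ ((t, t', p), Θ ((s, t, p), m)) = Θ ((s, t', p), m)) ∧
      ∀ t, (fun m => Θ ((0, 1, circlePt t), m)) '' Λ' t = Λ t := by
  have hM : Nonempty M := h.left.nonempty
  obtain ⟨u, hu, hlag, hu0, hu1, hper, hex, hstat⟩ := h.exists_family
  obtain ⟨q₀⟩ := (inferInstance : Nonempty L)
  have : Nonempty L := ⟨q₀⟩
  obtain ⟨H, hH, hHp⟩ := exists_smooth_primitives hu hex q₀
  have hH0 : ∀ r, r ≤ 1 / 2 ∨ 1 ≤ r → ∀ t q, H ((r, t), q) = 0 := by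
    intro r hr t q
    have := (hHp r t).1.exists_eq_add_const (hstat r hr t) q₀ q
    rw [(hHp r t).2, sub_zero, add_zero] at this
    exact this.symm
  obtain ⟨f, hf, hfu, hfc⟩ := exists_extension_family (P := ℝ × ℝ) (I := 𝓡 n) (J := 𝓡 (2 * n))
    (f := fun x : (ℝ × ℝ) × L => u x.1.1 x.1.2 x.2)
    (hu.comp (f := fun x : (ℝ × ℝ) × L => (x.1.1, x.1.2, x.2))
      ((contDiff_fst.contMDiff.comp contMDiff_fst).prodMk
        ((contDiff_snd.contMDiff.comp contMDiff_fst).prodMk contMDiff_snd)))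
    (fun p => (hlag p.1 p.2).isEmbedding.injective) (fun p => (hlag p.1 p.2).immersive) hH
  have hf0 : ∀ r, r ≤ 1 / 2 ∨ 1 ≤ r → ∀ t m, f ((r, t), m) = 0 := by
    intro r hr t m
    have h1 := hfc (r, t) m
    have h2 : (range fun q => H ((r, t), q)) = {0} := by
      rw [show (fun q => H ((r, t), q)) = fun _ => 0 from funext fun q => hH0 r hr t q,
        range_const]
    rwa [h2, convexHull_singleton] at h1
  obtain ⟨g, hg, hgc, hg0⟩ := exists_circle_family hf
  let b : ContDiffBump (0 : ℝ × ℂ) := ⟨1, 2, by norm_num, by norm_num⟩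
  let K : (ℝ × ℂ) × M → ℝ := fun x => b x.1 * g x
  have hK : ContMDiff (𝓘(ℝ, ℝ × ℂ).prod (𝓡 (2 * n))) 𝓘(ℝ, ℝ) ∞ K :=
    (b.contDiff.contMDiff.comp contMDiff_fst).mul hg
  have hK0 : ∀ r, r ≤ 1 / 2 ∨ 1 ≤ r → ∀ w m, K ((r, w), m) = 0 := fun r hr w m => by
    simp only [K, hg0 r (hf0 r hr), mul_zero]
  have hlift : ∀ t (k : ℤ), IsLift ω₀ (fun r => range (u r t)) (fun r => u r (t + k)) := fun t k =>
    ⟨hu.comp (f := fun x : ℝ × L => (x.1, t + k, x.2))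
      (contMDiff_fst.prodMk (contMDiff_const.prodMk contMDiff_snd)), fun r => hlag r _,
      fun r => hper r t k⟩
  have hlift0 : ∀ t, IsLift ω₀ (fun r => range (u r t)) (fun r => u r t) := fun t => by
    simpa using hlift t 0
  have hKp : ∀ r t, IsPrimitiveOfVelocity ω₀ (fun r => u r t) r
      (fun q => K ((r, circlePt t), u r t q)) := by
    intro r t
    by_cases hr : r ≤ 1 / 2 ∨ 1 ≤ r
    · simp only [hK0 r hr]
      exact hstat r hr t
    · rw [not_or, not_le, not_le] at hr
      have hb : b (r, circlePt t) = 1 := by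
        refine b.one_of_mem_closedBall ?_
        rw [mem_closedBall_zero_iff, Prod.norm_def, norm_circlePt]
        exact max_le (abs_le.2 ⟨by linarith [hr.1], hr.2.le⟩) (by norm_num [b])
      obtain ⟨k, k', c, -, hc⟩ := hgc t
      simp only [K, hb, one_mul, hc]
      have key : ∀ k : ℤ, IsPrimitiveOfVelocity ω₀ (fun r => u r t) r
          (fun q => f ((r, t + k), u r t q)) := fun k => by
        refine IsPrimitiveOfVelocity.of_isLift (hlift t k) (hlift0 t)
          (f := fun m => f ((r, t + k), m)) ?_
        have h1 := (hHp r (t + k)).1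
        simp only [← hfu] at h1
        exact h1
      exact (key k).convex_combination (key k') c
  obtain ⟨Θ, hΘ, hΘ0, hΘd, hΘc⟩ := ω₀.exists_hamiltonian_flow hK
    (isCompact_closedBall (0 : ℝ × ℂ) 2) (fun x hx m => by
      have : b x = 0 := b.zero_of_le_dist (le_of_lt (not_le.1 hx))
      simp only [K, this, zero_mul])
  refine ⟨K, Θ, hK, fun r hr => hK0 r (Or.inl hr), hΘ, hΘ0, hΘd, hΘc, fun t => ?_⟩
  -- the flow preserves the trace of the family, since its vector field is tangent to it
  have hinv : ∀ s₀ m, m ∈ range (u s₀ t) → ∀ s, Θ ((s₀, s, circlePt t), m) ∈ range (u s t) := by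
    rintro s₀ m hm s
    have hcurve : ContMDiff 𝓘(ℝ, ℝ) (𝓡 (2 * n)) ∞ fun s => Θ ((s₀, s, circlePt t), m) :=
      hΘ.comp (f := fun s : ℝ => ((s₀, s, circlePt t), m))
        ((contMDiff_const.prodMk_space (contMDiff_id.prodMk_space contMDiff_const)).prodMk
          contMDiff_const)
    have hKt : ContMDiff (𝓘(ℝ, ℝ).prod (𝓡 (2 * n))) 𝓘(ℝ, ℝ) ∞
        (fun x : ℝ × M => K ((x.1, circlePt t), x.2)) :=
      hK.comp (f := fun x : ℝ × M => ((x.1, circlePt t), x.2))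
        ((contMDiff_fst.prodMk_space contMDiff_const).prodMk contMDiff_snd)
    exact mem_range_of_integralCurve_manifold (I := 𝓡 n) (J := 𝓡 (2 * n))
      (j := fun x : ℝ × L => u x.1 t x.2) (hlift0 t).smooth
      (fun s => (hlag s t).isEmbedding.injective) (fun s => (hlag s t).immersive)
      (fun x => ω₀.hamVec (fun m => K ((x.1, circlePt t), m)) x.2)
      (fun N e he => ω₀.contMDiff_vectorDiff_hamVec (e := fun x : ℝ × M => e x.2)
        (he.comp contMDiff_snd) hKt)
      (fun s q => exists_tangent_eq (ι := fun s => u s t) (fun s => hlag s t)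
        (hKt.comp (f := fun m => (s, m)) (contMDiff_const.prodMk contMDiff_id)) (hKp s t) q)
      (hcurve.mdifferentiable (by simp)) (fun s => hΘd _ _ _ _) (s₀ := s₀)
      (by rw [hΘ0]; exact hm) s
  rw [← hu0, ← hu1]
  refine Subset.antisymm ?_ fun m hm => ?_
  · rintro _ ⟨m, hm, rfl⟩
    exact hinv 0 m hm 1
  · exact ⟨_, hinv 1 m hm 0, (hΘc _ _ _ _ _).trans (hΘ0 _ _ _)⟩

end IsotopyFlow

/-! ### A connection with prescribed boundary loop -/

section GeneratingFunction

variable {n : ℕ} {M : Type*} [TopologicalSpace M]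
  [ChartedSpace (EuclideanSpace ℝ (Fin (2 * n))) M] [IsManifold (𝓡 (2 * n)) ∞ M]
  {ω₀ : SymplecticForm n M} {L : Type*} [TopologicalSpace L]
  [ChartedSpace (EuclideanSpace ℝ (Fin n)) L] [IsManifold (𝓡 n) ∞ L]
  [CompactSpace M] [T2Space M] [CompactSpace L] [ConnectedSpace L]

theorem sub_le_osc_of_mem_convexHull {X : Type*} [TopologicalSpace X] [CompactSpace X] {f : X → ℝ}
    (hf : Continuous f) {v v' : ℝ} (hv : v ∈ convexHull ℝ (range f))
    (hv' : v' ∈ convexHull ℝ (range f)) : v - v' ≤ osc f := by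
  have h : convexHull ℝ (range f) ⊆ Icc (⨅ x, f x) (⨆ x, f x) :=
    convexHull_min (range_subset_iff.2 fun x => ⟨ciInf_le (isCompact_range hf).bddBelow x,
      le_ciSup (isCompact_range hf).bddAbove x⟩) (convex_Icc _ _)
  exact sub_le_sub (h hv).2 (h hv').1

/-- An exact loop is generated by functions on `M`, parametrised by the circle, whose oscillation
is bounded by the norm of the velocity. -/
theorem IsExactLagrangianLoop.exists_generating_function {Λ : ℝ → Set M}
    (hΛ : IsExactLagrangianLoop ω₀ L Λ) :
    ∃ (ι : ℝ → L → M) (h : ℂ × M → ℝ), IsLift ω₀ Λ ι ∧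
      ContMDiff (𝓘(ℝ, ℂ).prod (𝓡 (2 * n))) 𝓘(ℝ, ℝ) ∞ h ∧
      (∀ t, IsPrimitiveOfVelocity ω₀ ι t (fun q => h (circlePt t, ι t q))) ∧
      (∀ t, osc (fun m => h (circlePt t, m)) ≤ velocityNorm ω₀ L Λ t) ∧
      Continuous (velocityNorm ω₀ L Λ) := by
  have hM : Nonempty M := hΛ.nonempty
  obtain ⟨ι, hι, hex⟩ := hΛ.exists_exact_lift
  obtain ⟨q₀⟩ := (inferInstance : Nonempty L)
  have : Nonempty L := ⟨q₀⟩
  obtain ⟨H, hH, hHp⟩ := exists_smooth_primitive_path hι.smooth hex q₀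
  obtain ⟨f, hf, hfι, hfc⟩ := exists_extension_family (P := ℝ) (I := 𝓡 n) (J := 𝓡 (2 * n))
    (f := fun x : ℝ × L => ι x.1 x.2) hι.smooth (fun t => (hι.lagrangian t).isEmbedding.injective)
    (fun t => (hι.lagrangian t).immersive) hH
  obtain ⟨g, hg, hgc, -⟩ := exists_circle_family (J := 𝓡 (2 * n))
    (f := fun x : (ℝ × ℝ) × M => f (x.1.2, x.2))
    (hf.comp ((contDiff_snd.contMDiff.comp contMDiff_fst).prodMk contMDiff_snd))
  have hper : ∀ t (k : ℤ), Λ (t + k) = Λ t := fun t k => by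
    have hp : Function.Periodic Λ 1 := hΛ.periodic
    have := hp.int_mul k t
    rwa [mul_one] at this
  have hlift : ∀ k : ℤ, IsLift ω₀ Λ (fun t => ι (t + k)) := fun k =>
    ⟨hι.smooth.comp (f := fun x : ℝ × L => (x.1 + k, x.2))
      ((contMDiff_fst.add contMDiff_const).prodMk contMDiff_snd), fun t => hι.lagrangian _,
      fun t => (hι.range_eq _).trans (hper t k)⟩
  have hprim : ∀ t (k : ℤ), IsPrimitiveOfVelocity ω₀ (fun t => ι (t + k)) t
      (fun q => H (t + k, q)) := fun t k => by
    have := (hHp (t + k)).comp_time hι.smooth (φ := fun t => t + k) ((hasDerivAt_id' t).add_const _)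
    simpa only [one_mul] using this
  have hH' : ∀ t, Continuous fun q => H (t, q) := fun t => hH.continuous.comp (by fun_prop)
  have hosc : ∀ t (k : ℤ) m m', f (t + k, m) - f (t + k, m') ≤ velocityNorm ω₀ L Λ t := by
    intro t k m m'
    rw [velocityNorm_eq (hlift k) (hprim t k)]
    exact sub_le_osc_of_mem_convexHull (hH' _) (hfc _ m) (hfc _ m')
  refine ⟨ι, fun x => g ((0, x.1), x.2), hι, hg.comp (f := fun x : ℂ × M => (((0 : ℝ), x.1), x.2))
    ((contMDiff_const.prodMk_space contMDiff_fst).prodMk contMDiff_snd), fun t => ?_, fun t => ?_,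
    ?_⟩
  · obtain ⟨k, k', c, -, hc⟩ := hgc t
    simp only [hc]
    have key : ∀ k : ℤ, IsPrimitiveOfVelocity ω₀ ι t (fun q => f (t + k, ι t q)) := fun k => by
      refine IsPrimitiveOfVelocity.of_isLift (hlift k) hι (f := fun m => f (t + k, m)) ?_
      have h1 := hprim t k
      simp only [← hfι] at h1
      exact h1
    exact (key k).convex_combination (key k') c
  · obtain ⟨k, k', c, hc01, hc⟩ := hgc t
    refine osc_le fun m m' => ?_
    beta_reduce
    rw [hc, hc]
    have h1 := mul_le_mul_of_nonneg_left (hosc t k m m') hc01.1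
    have h2 := mul_le_mul_of_nonneg_left (hosc t k' m m') (sub_nonneg.2 hc01.2)
    linarith
  · exact (continuous_osc hH.continuous).congr fun t => (velocityNorm_eq hι (hHp t)).symm

end GeneratingFunction

section Construction

variable {n : ℕ} {M : Type*} [TopologicalSpace M]
  [ChartedSpace (EuclideanSpace ℝ (Fin (2 * n))) M]

/-- The component in the direction `∂_x` of the connection with the radial component `K` and the
angular component `N`. -/
def cartesianF (K N : (ℝ × ℂ) × M → ℝ) (x : ℂ × M) : ℝ :=
  x.1.re / ‖x.1‖ * K ((‖x.1‖, ‖x.1‖⁻¹ • x.1), x.2) +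
    -(x.1.im / (2 * Real.pi * ‖x.1‖ ^ 2)) * N ((‖x.1‖, ‖x.1‖⁻¹ • x.1), x.2)

/-- The component in the direction `∂_y` of the connection with the radial component `K` and the
angular component `N`. -/
def cartesianG (K N : (ℝ × ℂ) × M → ℝ) (x : ℂ × M) : ℝ :=
  x.1.im / ‖x.1‖ * K ((‖x.1‖, ‖x.1‖⁻¹ • x.1), x.2) +
    x.1.re / (2 * Real.pi * ‖x.1‖ ^ 2) * N ((‖x.1‖, ‖x.1‖⁻¹ • x.1), x.2)

variable {K N : (ℝ × ℂ) × M → ℝ}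

theorem contMDiff_cartesian (hK : ContMDiff (𝓘(ℝ, ℝ × ℂ).prod (𝓡 (2 * n))) 𝓘(ℝ, ℝ) ∞ K)
    (hN : ContMDiff (𝓘(ℝ, ℝ × ℂ).prod (𝓡 (2 * n))) 𝓘(ℝ, ℝ) ∞ N) {δ : ℝ} (hδ : 0 < δ)
    (hK0 : ∀ r < δ, ∀ w m, K ((r, w), m) = 0) (hN0 : ∀ r < δ, ∀ w m, N ((r, w), m) = 0) :
    ContMDiff (𝓘(ℝ, ℂ).prod (𝓡 (2 * n))) 𝓘(ℝ, ℝ) ∞ (cartesianF K N) ∧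
      ContMDiff (𝓘(ℝ, ℂ).prod (𝓡 (2 * n))) 𝓘(ℝ, ℝ) ∞ (cartesianG K N) := by
  have hre : ∀ z, ContDiffAt ℝ ∞ Complex.re z := fun z => Complex.reCLM.contDiff.contDiffAt
  have him : ∀ z, ContDiffAt ℝ ∞ Complex.im z := fun z => Complex.imCLM.contDiff.contDiffAt
  have hn : ∀ z : ℂ, z ≠ 0 → ContDiffAt ℝ ∞ (fun z : ℂ => ‖z‖) z := fun z hz => contDiffAt_norm ℝ hz
  have hn' : ∀ z : ℂ, z ≠ 0 → ‖z‖ ≠ 0 := fun z hz => norm_ne_zero_iff.2 hz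
  have hn2 : ∀ z : ℂ, z ≠ 0 → 2 * Real.pi * ‖z‖ ^ 2 ≠ 0 := fun z hz => by
    have := hn' z hz
    positivity
  have hn3 : ∀ z : ℂ, z ≠ 0 → ContDiffAt ℝ ∞ (fun z : ℂ => 2 * Real.pi * ‖z‖ ^ 2) z := fun z hz =>
    contDiffAt_const.mul ((hn z hz).pow 2)
  constructor
  · exact (contMDiff_of_polar hK hδ hK0 (c := fun z => z.re / ‖z‖)
      fun z hz => (hre z).div (hn z hz) (hn' z hz)).add
      (contMDiff_of_polar hN hδ hN0 (c := fun z => -(z.im / (2 * Real.pi * ‖z‖ ^ 2)))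
      fun z hz => ((him z).div (hn3 z hz) (hn2 z hz)).neg)
  · exact (contMDiff_of_polar hK hδ hK0 (c := fun z => z.im / ‖z‖)
      fun z hz => (him z).div (hn z hz) (hn' z hz)).add
      (contMDiff_of_polar hN hδ hN0 (c := fun z => z.re / (2 * Real.pi * ‖z‖ ^ 2))
      fun z hz => (hre z).div (hn3 z hz) (hn2 z hz))

theorem cartesian_polar {M : Type*} {K N : (ℝ × ℂ) × M → ℝ} {r : ℝ} (hr : 0 < r) (t : ℝ) (m : M) :
    radialHam (cartesianF K N) (cartesianG K N) ((r, t), m) = K ((r, circlePt t), m) ∧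
      angularHam (cartesianF K N) (cartesianG K N) ((r, t), m) = N ((r, circlePt t), m) := by
  have h1 : ‖r • circlePt t‖ = r := by
    rw [norm_smul, norm_circlePt, mul_one, Real.norm_of_nonneg hr.le]
  have h2 : r⁻¹ • r • circlePt t = circlePt t := inv_smul_smul₀ hr.ne' _
  have h3 := circlePt_re_sq_add_im_sq t
  have hpi := Real.pi_ne_zero
  have hr' := hr.ne'
  simp only [radialHam, angularHam, cartesianF, cartesianG, h1, h2, Complex.smul_re,
    Complex.smul_im, smul_eq_mul]
  constructor
  · field_simp
    linear_combination (2 * Real.pi * r * K ((r, circlePt t), m)) * h3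
  · field_simp
    linear_combination (N ((r, circlePt t), m)) * h3

/-- The curvature in polar coordinates, for components that are given as functions of the radius
and of the point of the circle. -/
theorem hamCurvature_cartesian (ω₀ : SymplecticForm n M)
    (hK : ContMDiff (𝓘(ℝ, ℝ × ℂ).prod (𝓡 (2 * n))) 𝓘(ℝ, ℝ) ∞ K)
    (hN : ContMDiff (𝓘(ℝ, ℝ × ℂ).prod (𝓡 (2 * n))) 𝓘(ℝ, ℝ) ∞ N)
    (hF : ContMDiff (𝓘(ℝ, ℂ).prod (𝓡 (2 * n))) 𝓘(ℝ, ℝ) ∞ (cartesianF K N))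
    (hG : ContMDiff (𝓘(ℝ, ℂ).prod (𝓡 (2 * n))) 𝓘(ℝ, ℝ) ∞ (cartesianG K N)) {r : ℝ} (hr : 0 < r)
    (t : ℝ) (m : M) :
    2 * Real.pi * r * hamCurvature ω₀ (cartesianF K N) (cartesianG K N) (r • circlePt t, m) =
      fderiv ℝ (fun y => K (y, m)) (r, circlePt t) (0, 2 * Real.pi * Complex.I * circlePt t) -
      fderiv ℝ (fun y => N (y, m)) (r, circlePt t) (1, 0) -
      vectorDiff (𝓡 (2 * n)) (fun m => N ((r, circlePt t), m)) m
        (ω₀.hamVec (fun m => K ((r, circlePt t), m)) m) := by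
  have h := polar_curvature ω₀ hF hG r t m
  refine Eq.trans h.symm ?_
  have hnhds : ∀ᶠ p : ℝ × ℝ in 𝓝 (r, t), 0 < p.1 :=
    (continuous_fst.tendsto (r, t)).eventually (lt_mem_nhds hr)
  have e1 : (fun p => radialHam (cartesianF K N) (cartesianG K N) (p, m)) =ᶠ[𝓝 (r, t)]
      fun p => K ((p.1, circlePt p.2), m) := hnhds.mono fun p hp => (cartesian_polar hp p.2 m).1
  have e2 : (fun p => angularHam (cartesianF K N) (cartesianG K N) (p, m)) =ᶠ[𝓝 (r, t)]
      fun p => N ((p.1, circlePt p.2), m) := hnhds.mono fun p hp => (cartesian_polar hp p.2 m).2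
  have e3 : (fun m => radialHam (cartesianF K N) (cartesianG K N) ((r, t), m)) =
      fun m => K ((r, circlePt t), m) := funext fun m => (cartesian_polar hr t m).1
  have e4 : (fun m => angularHam (cartesianF K N) (cartesianG K N) ((r, t), m)) =
      fun m => N ((r, circlePt t), m) := funext fun m => (cartesian_polar hr t m).2
  rw [e1.fderiv_eq, e2.fderiv_eq, e3, e4]
  have key : ∀ {K : (ℝ × ℂ) × M → ℝ}, ContMDiff (𝓘(ℝ, ℝ × ℂ).prod (𝓡 (2 * n))) 𝓘(ℝ, ℝ) ∞ K →
      ∀ a b : ℝ, fderiv ℝ (fun p : ℝ × ℝ => K ((p.1, circlePt p.2), m)) (r, t) (a, b) =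
        fderiv ℝ (fun y => K (y, m)) (r, circlePt t)
          (a, b • (2 * Real.pi * Complex.I * circlePt t)) := by
    intro K hK a b
    have d0 : HasFDerivAt (fun p : ℝ × ℝ => circlePt p.2) _ (r, t) :=
      HasFDerivAt.comp (g := circlePt) (f := Prod.snd) (r, t) (hasDerivAt_circlePt t).hasFDerivAt
        hasFDerivAt_snd
    have d1 : HasFDerivAt (fun p : ℝ × ℝ => (p.1, circlePt p.2)) _ (r, t) :=
      hasFDerivAt_fst.prodMk d0
    have d2 : DifferentiableAt ℝ (fun y => K (y, m)) (r, circlePt t) :=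
      ((hK ((r, circlePt t), m)).slice_fst).differentiableAt (by simp)
    have d3 := d2.hasFDerivAt.comp (r, t) d1
    exact congrArg (fun A => A (a, b)) d3.fderiv
  rw [key hK, key hN, one_smul, zero_smul]

end Construction

/-! ### The connection of a Hamiltonian isotopy -/

section AngularComponent

variable {n : ℕ} {M : Type*} [TopologicalSpace M]
  [ChartedSpace (EuclideanSpace ℝ (Fin (2 * n))) M] [IsManifold (𝓡 (2 * n)) ∞ M]
  {ω₀ : SymplecticForm n M}

/-- The derivative of `K` along the circles around the origin. -/
def angularDeriv (K : (ℝ × ℂ) × M → ℝ) (x : (ℝ × ℂ) × M) : ℝ :=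
  fderiv ℝ (fun y => K (y, x.2)) x.1 (0, 2 * Real.pi * Complex.I * x.1.2)

/-- For a flow `Θ` of a family `K` of Hamiltonians, there is an angular component `N`, with value
`β(r) h` at the radius `r` up to the change caused by the rotation of `K`, such that the curvature
of the connection with components `K` and `N` is transported by the flow and given by `-β' h`. -/
theorem exists_angular_component {K : (ℝ × ℂ) × M → ℝ} {Θ : (ℝ × ℝ × ℂ) × M → M}
    (hK : ContMDiff (𝓘(ℝ, ℝ × ℂ).prod (𝓡 (2 * n))) 𝓘(ℝ, ℝ) ∞ K)
    (hK0 : ∀ r ≤ 1 / 2, ∀ w m, K ((r, w), m) = 0)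
    (hΘ : ContMDiff (𝓘(ℝ, ℝ × ℝ × ℂ).prod (𝓡 (2 * n))) (𝓡 (2 * n)) ∞ Θ)
    (hΘ0 : ∀ s p m, Θ ((s, s, p), m) = m)
    (hΘd : ∀ s t p m, mfderiv 𝓘(ℝ, ℝ) (𝓡 (2 * n)) (fun t => Θ ((s, t, p), m)) t (1 : ℝ) =
        ω₀.hamVec (fun m => K ((t, p), m)) (Θ ((s, t, p), m)))
    (hΘc : ∀ s t t' p m, Θ ((t, t', p), Θ ((s, t, p), m)) = Θ ((s, t', p), m))
    {h : ℂ × M → ℝ} (hh : ContMDiff (𝓘(ℝ, ℂ).prod (𝓡 (2 * n))) 𝓘(ℝ, ℝ) ∞ h) {β : ℝ → ℝ}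
    (hβ : ContDiff ℝ ∞ β) (hβ0 : ∀ r ≤ 1 / 4, β r = 0) :
    ∃ N : (ℝ × ℂ) × M → ℝ, ContMDiff (𝓘(ℝ, ℝ × ℂ).prod (𝓡 (2 * n))) 𝓘(ℝ, ℝ) ∞ N ∧
      (∀ r ≤ 1 / 4, ∀ w m, N ((r, w), m) = 0) ∧
      (∀ r w m, N ((r, w), Θ ((0, r, w), m)) =
        (∫ s in (0 : ℝ)..r, angularDeriv K ((s, w), Θ ((0, s, w), m))) + β r * h (w, m)) ∧
      ∀ r w m, fderiv ℝ (fun y => N (y, Θ ((0, r, w), m))) (r, w) (1, 0) +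
        vectorDiff (𝓡 (2 * n)) (fun m => N ((r, w), m)) (Θ ((0, r, w), m))
          (ω₀.hamVec (fun m => K ((r, w), m)) (Θ ((0, r, w), m))) =
        angularDeriv K ((r, w), Θ ((0, r, w), m)) + deriv β r * h (w, m) := by
  have hfst : ContMDiff (𝓘(ℝ, ℝ × ℂ).prod (𝓡 (2 * n))) 𝓘(ℝ, ℝ) ∞
      fun x : (ℝ × ℂ) × M => x.1.1 := contDiff_fst.contMDiff.comp contMDiff_fst
  have hsnd : ContMDiff (𝓘(ℝ, ℝ × ℂ).prod (𝓡 (2 * n))) 𝓘(ℝ, ℂ) ∞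
      fun x : (ℝ × ℂ) × M => x.1.2 := contDiff_snd.contMDiff.comp contMDiff_fst
  have hE : ContMDiff (𝓘(ℝ, ℝ × ℂ).prod (𝓡 (2 * n))) 𝓘(ℝ, ℝ) ∞ (angularDeriv K) := by
    have h1 : ContDiff ℝ ∞ fun y : ℝ × ℂ => ((0 : ℝ), 2 * Real.pi * Complex.I * y.2) :=
      contDiff_const.prodMk (contDiff_const.mul contDiff_snd)
    exact hK.fderiv_fst.clm_apply (h1.contMDiff.comp contMDiff_fst)
  have hE0 : ∀ r ≤ 1 / 4, ∀ w m, angularDeriv K ((r, w), m) = 0 := by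
    intro r hr w m
    have h1 : (fun y => K (y, m)) =ᶠ[𝓝 (r, w)] fun _ => 0 := by
      have : ∀ᶠ y : ℝ × ℂ in 𝓝 (r, w), y.1 < 1 / 2 :=
        (continuous_fst.tendsto (r, w)).eventually (gt_mem_nhds (by change r < _; linarith))
      exact this.mono fun y hy => hK0 y.1 hy.le y.2 m
    rw [angularDeriv]
    change fderiv ℝ (fun y => K (y, m)) (r, w) _ = 0
    rw [h1.fderiv_eq]
    simp
  let nn : (ℝ × ℂ) × M → ℝ := fun x =>
    ∫ s in (0 : ℝ)..x.1.1, angularDeriv K ((s, x.1.2), Θ ((0, s, x.1.2), x.2))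
  have hflow : ContMDiff (𝓘(ℝ, ℝ).prod (𝓘(ℝ, ℂ).prod (𝓡 (2 * n))))
      (𝓘(ℝ, ℝ × ℂ).prod (𝓡 (2 * n))) ∞
      (fun x : ℝ × ℂ × M => (((x.1, x.2.1) : ℝ × ℂ), Θ ((0, x.1, x.2.1), x.2.2))) :=
    (contMDiff_fst.prodMk_space (contMDiff_fst.comp contMDiff_snd)).prodMk
      (hΘ.comp ((contMDiff_const.prodMk_space (contMDiff_fst.prodMk_space
        (contMDiff_fst.comp contMDiff_snd))).prodMk (contMDiff_snd.comp contMDiff_snd)))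
  have hnn : ContMDiff (𝓘(ℝ, ℝ × ℂ).prod (𝓡 (2 * n))) 𝓘(ℝ, ℝ) ∞ nn := by
    have h1 := contMDiff_integral_upper (W := ℂ × M) (I := 𝓘(ℝ, ℂ).prod (𝓡 (2 * n)))
      (f := fun x : ℝ × ℂ × M => angularDeriv K ((x.1, x.2.1), Θ ((0, x.1, x.2.1), x.2.2)))
      (hE.comp hflow) 0
    exact h1.comp (f := fun x : (ℝ × ℂ) × M => (x.1.1, x.1.2, x.2))
      (hfst.prodMk (hsnd.prodMk contMDiff_snd))
  have hback : ContMDiff (𝓘(ℝ, ℝ × ℂ).prod (𝓡 (2 * n))) (𝓡 (2 * n)) ∞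
      (fun x : (ℝ × ℂ) × M => Θ ((x.1.1, 0, x.1.2), x.2)) :=
    hΘ.comp ((hfst.prodMk_space (contMDiff_const.prodMk_space hsnd)).prodMk contMDiff_snd)
  let N : (ℝ × ℂ) × M → ℝ := fun x => nn (x.1, Θ ((x.1.1, 0, x.1.2), x.2)) +
    β x.1.1 * h (x.1.2, Θ ((x.1.1, 0, x.1.2), x.2))
  have hN : ContMDiff (𝓘(ℝ, ℝ × ℂ).prod (𝓡 (2 * n))) 𝓘(ℝ, ℝ) ∞ N :=
    (hnn.comp (contMDiff_fst.prodMk hback)).add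
      ((hβ.contMDiff.comp hfst).mul (hh.comp (hsnd.prodMk hback)))
  have hNΘ : ∀ r w m, N ((r, w), Θ ((0, r, w), m)) =
      (∫ s in (0 : ℝ)..r, angularDeriv K ((s, w), Θ ((0, s, w), m))) + β r * h (w, m) := by
    intro r w m
    simp only [N, nn, hΘc, hΘ0]
  refine ⟨N, hN, fun r hr w m => ?_, hNΘ, fun r w m => ?_⟩
  · have h1 : nn ((r, w), Θ ((r, 0, w), m)) = 0 := by
      refine (intervalIntegral.integral_congr (g := fun _ => (0 : ℝ)) fun s hs => ?_).trans
        intervalIntegral.integral_zero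
      exact hE0 s (hs.2.trans (max_le (by norm_num) hr)) _ _
    simp only [N, h1, hβ0 r hr, zero_mul, add_zero]
  · have hcurve : ContMDiff 𝓘(ℝ, ℝ) (𝓡 (2 * n)) ∞ fun r => Θ ((0, r, w), m) :=
      hΘ.comp (f := fun r : ℝ => ((0, r, w), m))
        ((contMDiff_const.prodMk_space (contMDiff_id.prodMk_space contMDiff_const)).prodMk
          contMDiff_const)
    have hz : HasDerivAt (fun r : ℝ => (r, w)) ((1 : ℝ), (0 : ℂ)) r :=
      (hasDerivAt_id' r).prodMk (hasDerivAt_const r w)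
    have h1 := vectorDiff_comp_prod (I := 𝓘(ℝ, ℝ)) (F := N)
      (z := fun r : ℝ => (r, w)) (u := fun r => Θ ((0, r, w), m)) (x := r)
      (hN.mdifferentiableAt (by simp)) hz.differentiableAt.mdifferentiableAt
      (hcurve.mdifferentiableAt (by simp)) (1 : ℝ)
    rw [vectorDiff_eq_fderiv, vectorDiff_eq_fderiv, hΘd] at h1
    have h2 : fderiv ℝ (fun r : ℝ => (r, w)) r (1 : ℝ) = ((1 : ℝ), (0 : ℂ)) := hz.deriv
    replace h1 := h1.trans (congrArg (fun v => fderiv ℝ (fun y => N (y, Θ ((0, r, w), m))) (r, w) v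
      + vectorDiff (𝓡 (2 * n)) (fun m => N ((r, w), m)) (Θ ((0, r, w), m))
        (ω₀.hamVec (fun m => K ((r, w), m)) (Θ ((0, r, w), m)))) h2)
    refine Eq.trans h1.symm ?_
    have hc : Continuous fun s => angularDeriv K ((s, w), Θ ((0, s, w), m)) :=
      hE.continuous.comp (hflow.continuous.comp (by fun_prop : Continuous fun s : ℝ => (s, w, m)))
    have h3 : HasDerivAt (fun r => N ((r, w), Θ ((0, r, w), m)))
        (angularDeriv K ((r, w), Θ ((0, r, w), m)) + deriv β r * h (w, m)) r := by
      simp only [hNΘ]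
      exact (intervalIntegral.integral_hasDerivAt_right (hc.intervalIntegrable _ _)
        (hc.stronglyMeasurableAtFilter _ _) hc.continuousAt).add
        (((hβ.differentiable (by simp) r).hasDerivAt).mul_const _)
    exact h3.deriv

end AngularComponent

section BoundaryLoop

variable {n : ℕ} {M : Type*} [TopologicalSpace M]
  [ChartedSpace (EuclideanSpace ℝ (Fin (2 * n))) M] [IsManifold (𝓡 (2 * n)) ∞ M]
  {ω₀ : SymplecticForm n M} {L : Type*} [TopologicalSpace L]
  [ChartedSpace (EuclideanSpace ℝ (Fin n)) L] [IsManifold (𝓡 n) ∞ L]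
  [CompactSpace M] [T2Space M] [CompactSpace L] [ConnectedSpace L]

/-- A loop `Λ` which is isotopic to `Λ'` is the boundary condition of a connection whose curvature
has the Hofer norm of at most the length of `Λ'`. The isotopy takes place in the annulus between
the radii `1/2` and `1`; the curvature is given by a generating function of `Λ'`. -/
theorem AreHamiltonianIsotopic.exists_connection {Λ Λ' : ℝ → Set M}
    (h : AreHamiltonianIsotopic ω₀ L Λ Λ') :
    ∃ (F G : ℂ × M → ℝ) (ι : ℝ → L → M), ContMDiff (𝓘(ℝ, ℂ).prod (𝓡 (2 * n))) 𝓘(ℝ, ℝ) ∞ F ∧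
      ContMDiff (𝓘(ℝ, ℂ).prod (𝓡 (2 * n))) 𝓘(ℝ, ℝ) ∞ G ∧ IsLift ω₀ Λ ι ∧
      (∀ t, IsPrimitiveOfVelocity ω₀ ι t (fun q => angularHam F G ((1, t), ι t q))) ∧
      ∫ z in unitDisc, osc (fun m => hamCurvature ω₀ F G (z, m)) ≤ hoferLength ω₀ L Λ' := by
  have hM : Nonempty M := h.left.nonempty
  obtain ⟨K, Θ, hK, hK0, hΘ, hΘ0, hΘd, hΘc, himg⟩ := h.exists_flow
  obtain ⟨ι', g, hι', hg, hgp, hgosc, hvel⟩ := h.right.exists_generating_function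
  let β : ℝ → ℝ := fun r => Real.smoothTransition (4 * r - 1)
  have hβ : ContDiff ℝ ∞ β := Real.smoothTransition.contDiff.comp (by fun_prop)
  have hβ0 : ∀ r ≤ 1 / 4, β r = 0 := fun r hr =>
    Real.smoothTransition.zero_of_nonpos (by linarith)
  have hβ1 : β 1 = 1 := Real.smoothTransition.one_of_one_le (by norm_num)
  have hβmono : Monotone β := fun a b hab => Real.smoothTransition.monotone (by linarith)
  obtain ⟨N, hN, hN0, hNΘ, hNd⟩ := exists_angular_component hK hK0 hΘ hΘ0 hΘd hΘc hg hβ hβ0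
  obtain ⟨hF, hG⟩ := contMDiff_cartesian hK hN (δ := 1 / 4) (by norm_num)
    (fun r hr => hK0 r (by linarith)) (fun r hr => hN0 r hr.le)
  -- the boundary loop, moved by the flow
  let K' : (ℝ × ℝ) × M → ℝ := fun x => K ((x.1.1, circlePt x.1.2), x.2)
  have hK' : ContMDiff (𝓘(ℝ, ℝ × ℝ).prod (𝓡 (2 * n))) 𝓘(ℝ, ℝ) ∞ K' := by
    have h1 : ContDiff ℝ ∞ fun p : ℝ × ℝ => (p.1, circlePt p.2) :=
      contDiff_fst.prodMk (contDiff_circlePt.comp contDiff_snd)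
    exact hK.comp ((h1.contMDiff.comp contMDiff_fst).prodMk contMDiff_snd)
  let u : ℝ → ℝ → L → M := fun r t q => Θ ((0, r, circlePt t), ι' t q)
  have hu : ContMDiff (𝓘(ℝ, ℝ).prod (𝓘(ℝ, ℝ).prod (𝓡 n))) (𝓡 (2 * n)) ∞
      (fun p : ℝ × ℝ × L => u p.1 p.2.1 p.2.2) := by
    have h1 : ContMDiff (𝓘(ℝ, ℝ).prod (𝓘(ℝ, ℝ).prod (𝓡 n))) 𝓘(ℝ, ℝ × ℝ × ℂ) ∞
        (fun p : ℝ × ℝ × L => ((0 : ℝ), p.1, circlePt p.2.1)) :=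
      contMDiff_const.prodMk_space (contMDiff_fst.prodMk_space
        (contDiff_circlePt.contMDiff.comp (contMDiff_fst.comp contMDiff_snd)))
    exact hΘ.comp (h1.prodMk (hι'.smooth.comp contMDiff_snd))
  have hu0 : ∀ t, u 0 t = ι' t := fun t => funext fun q => hΘ0 _ _ _
  have hus : ∀ r t q, mfderiv 𝓘(ℝ, ℝ) (𝓡 (2 * n)) (fun r => u r t q) r (1 : ℝ) =
      ω₀.hamVec (fun m => K' ((r, t), m)) (u r t q) := fun r t q => hΘd _ _ _ _
  have hΘs : ∀ x, ContMDiff (𝓡 (2 * n)) (𝓡 (2 * n)) ∞ fun m => Θ (x, m) := fun x =>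
    hΘ.comp (contMDiff_const.prodMk contMDiff_id)
  have hlag : ∀ r t, IsLagrangianEmbedding ω₀ (u r t) := by
    intro r t
    refine isLagrangianEmbedding_evolve hu hK' hus (s₀ := 0)
      (g := fun m => Θ ((0, r, circlePt t), m))
      (g' := fun m => Θ ((r, 0, circlePt t), m)) ?_ (hΘs _) (hΘs _) (fun m => ?_) (fun q => ?_)
    · rw [hu0]; exact hι'.lagrangian t
    · exact (hΘc _ _ _ _ _).trans (hΘ0 _ _ _)
    · rw [hu0]
  have ha₀ : ContMDiff (𝓘(ℝ, ℝ).prod (𝓡 n)) 𝓘(ℝ, ℝ) ∞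
      (fun x : ℝ × L => g (circlePt x.1, ι' x.1 x.2)) :=
    hg.comp ((contDiff_circlePt.contMDiff.comp contMDiff_fst).prodMk hι'.smooth)
  obtain ⟨a, ha, ha0, has, hap⟩ := exists_primitives_evolve hu hK' hus (s₀ := 0) ha₀
    (fun t => by
      have := hgp t
      rwa [show ι' = u 0 from funext fun t => (hu0 t).symm] at this ⊢)
  have hderiv : ∀ r t m, fderiv ℝ (fun z => K' (z, m)) (r, t) (0, 1) =
      angularDeriv K ((r, circlePt t), m) := by
    intro r t m
    have d0 : HasFDerivAt (fun p : ℝ × ℝ => circlePt p.2) _ (r, t) :=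
      HasFDerivAt.comp (g := circlePt) (f := Prod.snd) (r, t) (hasDerivAt_circlePt t).hasFDerivAt
        hasFDerivAt_snd
    have d1 : HasFDerivAt (fun p : ℝ × ℝ => (p.1, circlePt p.2)) _ (r, t) :=
      hasFDerivAt_fst.prodMk d0
    have d2 : DifferentiableAt ℝ (fun y => K (y, m)) (r, circlePt t) :=
      ((hK ((r, circlePt t), m)).slice_fst).differentiableAt (by simp)
    refine (congrArg (fun A => A (0, 1)) (d2.hasFDerivAt.comp (r, t) d1).fderiv).trans ?_
    refine congrArg (fderiv ℝ (fun y => K (y, m)) (r, circlePt t)) ?_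
    exact Prod.ext rfl (one_smul ℝ _)
  have hcE : ∀ t q, Continuous fun s => angularDeriv K ((s, circlePt t), u s t q) := by
    intro t q
    have h1 : Continuous fun s => fderiv ℝ (fun z => K' (z, u s t q)) (s, t) (0, 1) :=
      (hK'.fderiv_fst.continuous.comp ((by fun_prop : Continuous fun s : ℝ => (s, t)).prodMk
        (hu.continuous.comp (by fun_prop : Continuous fun s : ℝ => (s, t, q))))).clm_apply
          continuous_const
    simpa only [hderiv] using h1
  have ha1 : ∀ t q, a 1 t q = angularHam (cartesianF K N) (cartesianG K N) ((1, t), u 1 t q) := by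
    intro t q
    rw [(cartesian_polar one_pos t (u 1 t q)).2]
    change _ = N ((1, circlePt t), Θ ((0, 1, circlePt t), ι' t q))
    have h1 := intervalIntegral.integral_eq_sub_of_hasDerivAt (a := 0) (b := 1)
      (f := fun s => a s t q) (f' := fun s => angularDeriv K ((s, circlePt t), u s t q))
      (fun s _ => by rw [← hderiv]; exact has s t q) ((hcE t q).intervalIntegrable _ _)
    rw [ha0] at h1
    rw [hNΘ, hβ1, one_mul]
    exact (sub_eq_iff_eq_add.1 h1.symm)
  refine ⟨cartesianF K N, cartesianG K N, u 1, hF, hG,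
    ⟨hu.comp (contMDiff_const.prodMk contMDiff_id), hlag 1, fun t => ?_⟩, fun t => ?_, ?_⟩
  · rw [← himg, ← hι'.range_eq, ← range_comp]
    rfl
  · have := hap 1 t
    rwa [show a 1 t = _ from funext (ha1 t)] at this
  · have hΩ := (contMDiff_hamCurvature ω₀ hF hG).continuous
    have hosc : Continuous fun z =>
        osc fun m => hamCurvature ω₀ (cartesianF K N) (cartesianG K N) (z, m) :=
      continuous_osc hΩ
    have hcurv : ∀ r, 0 < r → ∀ t m, 2 * Real.pi * r *
        hamCurvature ω₀ (cartesianF K N) (cartesianG K N)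
          (r • circlePt t, Θ ((0, r, circlePt t), m)) = -(deriv β r) * g (circlePt t, m) := by
      intro r hr t m
      rw [hamCurvature_cartesian ω₀ hK hN hF hG hr, sub_sub, hNd]
      simp only [angularDeriv]
      ring
    have hβd : ∀ r, 0 ≤ deriv β r := fun r => hβmono.deriv_nonneg
    have hval : ∀ r ∈ Icc (0 : ℝ) 1, ∀ t, 2 * Real.pi * r *
        (osc fun m => hamCurvature ω₀ (cartesianF K N) (cartesianG K N) (r • circlePt t, m)) =
        deriv β r * osc fun m => g (circlePt t, m) := by
      intro r hr t
      rcases hr.1.eq_or_lt with rfl | hr0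
      · have h1 : β =ᶠ[𝓝 0] fun _ => 0 := by
          filter_upwards [gt_mem_nhds (by norm_num : (0 : ℝ) < 1 / 4)] with r hr
          exact hβ0 r hr.le
        rw [h1.deriv_eq, deriv_const, mul_zero, zero_mul, zero_mul]
      · have hsurj : Function.Surjective fun m => Θ ((0, r, circlePt t), m) := fun m =>
          ⟨Θ ((r, 0, circlePt t), m), (hΘc _ _ _ _ _).trans (hΘ0 _ _ _)⟩
        have hc1 : Continuous fun m =>
            hamCurvature ω₀ (cartesianF K N) (cartesianG K N) (r • circlePt t, m) :=
          hΩ.comp (by fun_prop)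
        have hc2 : Continuous fun m => g (circlePt t, m) := hg.continuous.comp (by fun_prop)
        have e1 := osc_const_mul (hc1.comp (hΘs (0, r, circlePt t)).continuous) (2 * Real.pi * r)
        have e2 := osc_const_mul hc2 (-deriv β r)
        rw [abs_neg, abs_of_nonneg (hβd r)] at e2
        rw [abs_of_pos (by positivity)] at e1
        rw [← osc_comp_surjective _ hsurj, ← e2]
        refine e1.symm.trans ?_
        simp only [Function.comp_def, hcurv r hr0]
    have hβint : ∫ r in (0 : ℝ)..1, deriv β r = 1 := by
      rw [intervalIntegral.integral_deriv_eq_sub (fun r _ => hβ.differentiable (by simp) r)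
        ((hβ.continuous_deriv (by simp)).intervalIntegrable _ _), hβ1, hβ0 0 (by norm_num),
        sub_zero]
    rw [integral_unitDisc_eq hosc, hoferLength]
    refine intervalIntegral.integral_mono_on zero_le_one ?_ (hvel.intervalIntegrable _ _)
      fun t _ => ?_
    · refine Continuous.intervalIntegrable ?_ _ _
      refine intervalIntegral.continuous_parametric_intervalIntegral_of_continuous' ?_ 0 1
      exact (by fun_prop : Continuous fun x : ℝ × ℝ => 2 * Real.pi * x.2).mul
        (hosc.comp (continuous_snd.smul (contDiff_circlePt.continuous.comp continuous_fst)))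
    · rw [intervalIntegral.integral_congr (g := fun r => deriv β r *
        osc fun m => g (circlePt t, m)) fun r hr =>
        hval r (by rwa [uIcc_of_le zero_le_one] at hr) t,
        intervalIntegral.integral_mul_const, hβint, one_mul]
      exact hgosc t

end BoundaryLoop

/-! ### Wedge powers and finiteness of the Liouville measure -/

section WedgePower

variable {V : Type*} [AddCommGroup V] [Module ℝ V] [TopologicalSpace V]

/-- The product `θ(v₀, v₁) θ(v₂, v₃) ⋯`, whose alternation is the wedge power of `θ`. -/
def pairProduct (k : ℕ) (θ : V [⋀^Fin 2]→L[ℝ] ℝ) : MultilinearMap ℝ (fun _ : Fin (2 * k) => V) ℝ :=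
  MultilinearMap.mk' (fun v => ∏ i : Fin k, θ ![v ⟨2 * i, by omega⟩, v ⟨2 * i + 1, by omega⟩])
    (by
      intro v j x y
      rw [← Finset.mul_prod_erase _ _ (Finset.mem_univ (⟨j / 2, by omega⟩ : Fin k)),
        ← Finset.mul_prod_erase _ _ (Finset.mem_univ (⟨j / 2, by omega⟩ : Fin k)),
        ← Finset.mul_prod_erase _ _ (Finset.mem_univ (⟨j / 2, by omega⟩ : Fin k))]
      have hne : ∀ z : V, ∀ i ∈ Finset.univ.erase (⟨j / 2, by omega⟩ : Fin k),
          θ ![Function.update v j z ⟨2 * i, by omega⟩,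
            Function.update v j z ⟨2 * i + 1, by omega⟩] =
          θ ![v ⟨2 * i, by omega⟩, v ⟨2 * i + 1, by omega⟩] := by
        intro z i hi
        have hi' : (i : ℕ) ≠ j / 2 := fun h => (Finset.ne_of_mem_erase hi) (Fin.ext h)
        rw [Function.update_of_ne (by intro h; have := congrArg Fin.val h; simp at this; omega),
          Function.update_of_ne (by intro h; have := congrArg Fin.val h; simp at this; omega)]
      rw [Finset.prod_congr rfl (hne _), Finset.prod_congr rfl (hne _),
        Finset.prod_congr rfl (hne _), ← add_mul]
      congr 1
      rcases Nat.even_or_odd' (j : ℕ) with ⟨a, ha | ha⟩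
      · obtain ⟨j, hj⟩ := j
        simp only at ha
        subst ha
        have e : (2 * a) / 2 = a := by omega
        simp only [e, Function.update_self]
        rw [Function.update_of_ne (by simp), Function.update_of_ne (by simp),
          Function.update_of_ne (by simp)]
        exact θ.toMultilinearMap.cons_add ![v ⟨2 * a + 1, by omega⟩] x y
      · obtain ⟨j, hj⟩ := j
        simp only at ha
        subst ha
        have e : (2 * a + 1) / 2 = a := by omega
        simp only [e, Function.update_self]
        rw [Function.update_of_ne (by simp), Function.update_of_ne (by simp),
          Function.update_of_ne (by simp)]
        have h := θ.map_update_add ![v ⟨2 * a, by omega⟩, 0] 1 x y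
        have h1 : ∀ z, Function.update ![v ⟨2 * a, by omega⟩, 0] 1 z =
            ![v ⟨2 * a, by omega⟩, z] := by
          intro z; funext i; fin_cases i <;> simp
        rwa [h1, h1, h1] at h)
    (by
      intro v j c x
      rw [← Finset.mul_prod_erase _ _ (Finset.mem_univ (⟨j / 2, by omega⟩ : Fin k)),
        ← Finset.mul_prod_erase _ _ (Finset.mem_univ (⟨j / 2, by omega⟩ : Fin k))]
      have hne : ∀ z : V, ∀ i ∈ Finset.univ.erase (⟨j / 2, by omega⟩ : Fin k),
          θ ![Function.update v j z ⟨2 * i, by omega⟩,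
            Function.update v j z ⟨2 * i + 1, by omega⟩] =
          θ ![v ⟨2 * i, by omega⟩, v ⟨2 * i + 1, by omega⟩] := by
        intro z i hi
        have hi' : (i : ℕ) ≠ j / 2 := fun h => (Finset.ne_of_mem_erase hi) (Fin.ext h)
        rw [Function.update_of_ne (by intro h; have := congrArg Fin.val h; simp at this; omega),
          Function.update_of_ne (by intro h; have := congrArg Fin.val h; simp at this; omega)]
      rw [Finset.prod_congr rfl (hne _), Finset.prod_congr rfl (hne _), smul_eq_mul, ← mul_assoc]
      congr 1
      rcases Nat.even_or_odd' (j : ℕ) with ⟨a, ha | ha⟩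
      · obtain ⟨j, hj⟩ := j
        simp only at ha
        subst ha
        have e : (2 * a) / 2 = a := by omega
        simp only [e, Function.update_self]
        rw [Function.update_of_ne (by simp), Function.update_of_ne (by simp)]
        exact θ.toMultilinearMap.cons_smul ![v ⟨2 * a + 1, by omega⟩] c x
      · obtain ⟨j, hj⟩ := j
        simp only at ha
        subst ha
        have e : (2 * a + 1) / 2 = a := by omega
        simp only [e, Function.update_self]
        rw [Function.update_of_ne (by simp), Function.update_of_ne (by simp)]
        have h := θ.map_update_smul ![v ⟨2 * a, by omega⟩, 0] 1 c x
        have h1 : ∀ z, Function.update ![v ⟨2 * a, by omega⟩, 0] 1 z =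
            ![v ⟨2 * a, by omega⟩, z] := by
          intro z; funext i; fin_cases i <;> simp
        rwa [h1, h1] at h)

/-- The wedge power of a 2-form as an alternating map. -/
def wedgePowAlternating (k : ℕ) (θ : V [⋀^Fin 2]→L[ℝ] ℝ) : V [⋀^Fin (2 * k)]→ₗ[ℝ] ℝ :=
  (1 / 2 ^ k : ℝ) • MultilinearMap.alternatization (pairProduct k θ)

theorem wedgePowAlternating_apply (k : ℕ) (θ : V [⋀^Fin 2]→L[ℝ] ℝ) (v : Fin (2 * k) → V) :
    wedgePowAlternating k θ v = wedgePow k θ v := by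
  rw [wedgePow, wedgePowAlternating, AlternatingMap.smul_apply,
    MultilinearMap.alternatization_apply,
    smul_eq_mul]
  congr 1
  refine Finset.sum_congr rfl fun π _ => ?_
  rw [Units.smul_def, zsmul_eq_mul]
  rfl

/-- A linear map scales the wedge power of top degree by its determinant. -/
theorem wedgePow_comp {k : ℕ} (b : Module.Basis (Fin (2 * k)) ℝ V) (θ : V [⋀^Fin 2]→L[ℝ] ℝ)
    (A : V →ₗ[ℝ] V) (v : Fin (2 * k) → V) :
    wedgePow k θ (A ∘ v) = LinearMap.det A * wedgePow k θ v := by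
  have h := (wedgePowAlternating k θ).eq_smul_basis_det b
  rw [← wedgePowAlternating_apply, ← wedgePowAlternating_apply, h, AlternatingMap.smul_apply,
    AlternatingMap.smul_apply, b.det_comp]
  simp only [smul_eq_mul]
  ring

end WedgePower

section Liouville

variable {n : ℕ} {M : Type*} [TopologicalSpace M]
  [ChartedSpace (EuclideanSpace ℝ (Fin (2 * n))) M]
  (ω₀ : SymplecticForm n M)

/-- The density of the Liouville measure in the chart at `x`. -/
def SymplecticForm.chartDensity (x : M) (y : EuclideanSpace ℝ (Fin (2 * n))) : ENNReal :=
  ENNReal.ofReal |wedgePow n (ω₀.form.inChart x y)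
        (fun i => EuclideanSpace.basisFun (Fin (2 * n)) ℝ i)|

theorem SymplecticForm.continuousOn_chartDensity (x : M) :
    ContinuousOn (ω₀.chartDensity x) (extChartAt (𝓡 (2 * n)) x).target := by
  refine ENNReal.continuous_ofReal.comp_continuousOn (ContinuousOn.abs ?_)
  refine continuousOn_const.mul (continuousOn_finsetSum _ fun π _ => continuousOn_const.mul
    (continuousOn_finsetProd _ fun i _ => ?_))
  exact ((ω₀.contDiffOn_bilinear x).continuousOn.clm_apply continuousOn_const).clm_apply
    continuousOn_const

/-- The derivative of the change of charts. -/
def chartChange (x x' : M) (y : EuclideanSpace ℝ (Fin (2 * n))) :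
    EuclideanSpace ℝ (Fin (2 * n)) →L[ℝ] EuclideanSpace ℝ (Fin (2 * n)) :=
  mfderiv (𝓡 (2 * n)) 𝓘(ℝ, EuclideanSpace ℝ (Fin (2 * n))) (extChartAt (𝓡 (2 * n)) x')
      ((extChartAt (𝓡 (2 * n)) x).symm y) ∘L
    mfderiv 𝓘(ℝ, EuclideanSpace ℝ (Fin (2 * n))) (𝓡 (2 * n)) (extChartAt (𝓡 (2 * n)) x).symm y

/-- The Liouville measure in the domain of the chart at `x`. -/
def SymplecticForm.chartMeasure [MeasurableSpace M] (x : M) : Measure M :=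
  Measure.map (extChartAt (𝓡 (2 * n)) x).symm
    ((volume.restrict (extChartAt (𝓡 (2 * n)) x).target).withDensity (ω₀.chartDensity x))

theorem measurableSet_chart_preimage [MeasurableSpace M] [BorelSpace M] (x : M)
    {B : Set M} (hB : MeasurableSet B) :
    MeasurableSet ((extChartAt (𝓡 (2 * n)) x).target ∩ (extChartAt (𝓡 (2 * n)) x).symm ⁻¹' B) := by
  have h1 : Measurable ((extChartAt (𝓡 (2 * n)) x).target.domRestrict
      (extChartAt (𝓡 (2 * n)) x).symm) :=
    (continuousOn_iff_continuous_domRestrict.1 (continuousOn_extChartAt_symm x)).measurable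
  have h2 := (isOpen_extChartAt_target (I := 𝓡 (2 * n)) x).measurableSet.subtype_image (h1 hB)
  convert h2 using 1
  ext y
  simp [and_comm]

theorem SymplecticForm.chartMeasure_apply [MeasurableSpace M] [BorelSpace M] (x : M)
    {B : Set M} (hB : MeasurableSet B) :
    ω₀.chartMeasure x B = ∫⁻ y in (extChartAt (𝓡 (2 * n)) x).target ∩
      (extChartAt (𝓡 (2 * n)) x).symm ⁻¹' B, ω₀.chartDensity x y := by
  have hto : MeasurableSet (extChartAt (𝓡 (2 * n)) x).target :=
    (isOpen_extChartAt_target (I := 𝓡 (2 * n)) x).measurableSet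
  have h1 : AEMeasurable (extChartAt (𝓡 (2 * n)) x).symm
      ((volume.restrict (extChartAt (𝓡 (2 * n)) x).target).withDensity (ω₀.chartDensity x)) :=
    ((continuousOn_extChartAt_symm x).aemeasurable hto).mono_ac
        (withDensity_absolutelyContinuous _ _)
  rw [chartMeasure, Measure.map_apply_of_aemeasurable h1 hB, withDensity_apply' _,
    Measure.restrict_restrict' hto, inter_comm]

variable [IsManifold (𝓡 (2 * n)) ∞ M]

theorem hasFDerivAt_chartChange {x x' : M} {y : EuclideanSpace ℝ (Fin (2 * n))}
    (hy : y ∈ (extChartAt (𝓡 (2 * n)) x).target)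
    (hy' : (extChartAt (𝓡 (2 * n)) x).symm y ∈ (extChartAt (𝓡 (2 * n)) x').source) :
    HasFDerivAt (fun y => extChartAt (𝓡 (2 * n)) x' ((extChartAt (𝓡 (2 * n)) x).symm y))
      (chartChange x x' y) y := by
  have h1 : MDifferentiableAt (𝓡 (2 * n)) 𝓘(ℝ, EuclideanSpace ℝ (Fin (2 * n)))
      (extChartAt (𝓡 (2 * n)) x') ((extChartAt (𝓡 (2 * n)) x).symm y) :=
    mdifferentiableAt_extChartAt (by rwa [extChartAt_source] at hy')
  exact hasMFDerivAt_iff_hasFDerivAt.1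
    (h1.hasMFDerivAt.comp y (mdifferentiableAt_extChartAt_symm hy).hasMFDerivAt)

theorem SymplecticForm.chartDensity_eq {x x' : M} {y : EuclideanSpace ℝ (Fin (2 * n))}
    (hy' : (extChartAt (𝓡 (2 * n)) x).symm y ∈ (extChartAt (𝓡 (2 * n)) x').source) :
    ω₀.chartDensity x y = ENNReal.ofReal |(chartChange x x' y).det| *
      ω₀.chartDensity x' (extChartAt (𝓡 (2 * n)) x' ((extChartAt (𝓡 (2 * n)) x).symm y)) := by
  rw [chartDensity, chartDensity, ← ENNReal.ofReal_mul (abs_nonneg _), ← abs_mul]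
  congr 2
  set m := (extChartAt (𝓡 (2 * n)) x).symm y with hm
  have h1 := wedgePow_comp (EuclideanSpace.basisFun (Fin (2 * n)) ℝ).toBasis
    (ω₀.form.inChart x' (extChartAt (𝓡 (2 * n)) x' m)) (chartChange x x' y).toLinearMap
    (fun i => EuclideanSpace.basisFun (Fin (2 * n)) ℝ i)
  refine Eq.trans ?_ h1
  have h2 : ∀ (m' : M) (hm' : m' = m) (a b : EuclideanSpace ℝ (Fin (2 * n))),
      ω₀.form m ![mfderiv 𝓘(ℝ, EuclideanSpace ℝ (Fin (2 * n))) (𝓡 (2 * n))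
          (extChartAt (𝓡 (2 * n)) x).symm y a,
        mfderiv 𝓘(ℝ, EuclideanSpace ℝ (Fin (2 * n))) (𝓡 (2 * n))
          (extChartAt (𝓡 (2 * n)) x).symm y b] =
      ω₀.form m' ![mfderiv 𝓘(ℝ, EuclideanSpace ℝ (Fin (2 * n))) (𝓡 (2 * n))
          (extChartAt (𝓡 (2 * n)) x').symm (extChartAt (𝓡 (2 * n)) x' m)
            (chartChange x x' y a),
        mfderiv 𝓘(ℝ, EuclideanSpace ℝ (Fin (2 * n))) (𝓡 (2 * n))
          (extChartAt (𝓡 (2 * n)) x').symm (extChartAt (𝓡 (2 * n)) x' m)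
            (chartChange x x' y b)] := by
    rintro m' rfl a b
    have h3 := mfderiv_extChartAt_symm_comp (J := 𝓡 (2 * n)) hy'
    have h4 : ∀ v, mfderiv 𝓘(ℝ, EuclideanSpace ℝ (Fin (2 * n))) (𝓡 (2 * n))
          (extChartAt (𝓡 (2 * n)) x).symm y v =
        mfderiv 𝓘(ℝ, EuclideanSpace ℝ (Fin (2 * n))) (𝓡 (2 * n))
          (extChartAt (𝓡 (2 * n)) x').symm (extChartAt (𝓡 (2 * n)) x' m)
          (chartChange x x' y v) := fun v =>
      (congrArg (fun A => A (mfderiv 𝓘(ℝ, EuclideanSpace ℝ (Fin (2 * n))) (𝓡 (2 * n))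
          (extChartAt (𝓡 (2 * n)) x).symm y v)) h3).symm
    exact congrArg₂ (fun a b => ω₀.form m ![a, b]) (h4 a) (h4 b)
  simp only [wedgePow]
  congr 1
  refine Finset.sum_congr rfl fun π _ => ?_
  congr 1
  refine Finset.prod_congr rfl fun i _ => ?_
  refine (congrArg (ω₀.form m) (comp_cons_two _ _ _)).trans ((h2 _ ((extChartAt (𝓡 (2 * n))
    x').left_inv hy') _ _).trans ?_)
  exact (congrArg (ω₀.form _) (comp_cons_two _ _ _)).symm

variable [MeasurableSpace M] [BorelSpace M]

/-- The chart measures are compatible. -/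
theorem SymplecticForm.chartMeasure_le (x x' : M) {B : Set M} (hB : MeasurableSet B)
    (hBx' : B ⊆ (extChartAt (𝓡 (2 * n)) x').source) :
    ω₀.chartMeasure x B ≤ ω₀.chartMeasure x' B := by
  rw [chartMeasure_apply _ _ hB, chartMeasure_apply _ _ hB]
  set S := (extChartAt (𝓡 (2 * n)) x).target ∩ (extChartAt (𝓡 (2 * n)) x).symm ⁻¹' B with hS
  set T := fun y => extChartAt (𝓡 (2 * n)) x' ((extChartAt (𝓡 (2 * n)) x).symm y) with hT
  have hinj : InjOn T S := by
    intro y hy z hz h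
    exact (extChartAt (𝓡 (2 * n)) x).symm.injOn hy.1 hz.1
      ((extChartAt (𝓡 (2 * n)) x').injOn (hBx' hy.2) (hBx' hz.2) h)
  have h1 := lintegral_image_eq_lintegral_abs_det_fderiv_mul volume
    (measurableSet_chart_preimage x hB) (f := T) (f' := chartChange x x')
    (fun y hy => (hasFDerivAt_chartChange hy.1 (hBx' hy.2)).hasFDerivWithinAt) hinj
    (ω₀.chartDensity x')
  rw [setLIntegral_congr_fun (measurableSet_chart_preimage x hB)
    (fun y hy => ω₀.chartDensity_eq (hBx' hy.2)), ← h1]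
  refine lintegral_mono_set ?_
  rintro _ ⟨y, hy, rfl⟩
  refine ⟨(extChartAt (𝓡 (2 * n)) x').map_source (hBx' hy.2), ?_⟩
  change (extChartAt (𝓡 (2 * n)) x').symm (T y) ∈ B
  rw [hT, (extChartAt (𝓡 (2 * n)) x').left_inv (hBx' hy.2)]
  exact hy.2

theorem SymplecticForm.isFiniteMeasure_liouville [CompactSpace M] :
    IsFiniteMeasure ω₀.liouville := by
  have hV : ∀ x : M, ∃ V : Set M, IsOpen V ∧ x ∈ V ∧ V ⊆ (extChartAt (𝓡 (2 * n)) x).source ∧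
      ω₀.chartMeasure x V < ⊤ := by
    intro x
    set φ := extChartAt (𝓡 (2 * n)) x with hφ
    obtain ⟨ε, hε, hball⟩ := Metric.nhds_basis_closedBall.mem_iff.1
      (extChartAt_target_mem_nhds (I := 𝓡 (2 * n)) x)
    refine ⟨φ.source ∩ φ ⁻¹' Metric.ball (φ x) ε, (continuousOn_extChartAt x).isOpen_inter_preimage
      (isOpen_extChartAt_source x) Metric.isOpen_ball,
      ⟨mem_extChartAt_source x, Metric.mem_ball_self hε⟩, inter_subset_left, ?_⟩
    have hVo : IsOpen (φ.source ∩ φ ⁻¹' Metric.ball (φ x) ε) :=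
      (continuousOn_extChartAt x).isOpen_inter_preimage
        (isOpen_extChartAt_source x) Metric.isOpen_ball
    rw [chartMeasure_apply _ _ hVo.measurableSet]
    have hcomp : IsCompact (Metric.closedBall (φ x) ε) := isCompact_closedBall _ _
    have hle : ∀ y ∈ Metric.closedBall (φ x) ε, ω₀.chartDensity x y < ⊤ := fun y _ =>
      ENNReal.ofReal_lt_top
    obtain ⟨y₀, hy₀, hmax⟩ := hcomp.exists_isMaxOn ⟨φ x, Metric.mem_closedBall_self hε.le⟩
      ((ω₀.continuousOn_chartDensity x).mono hball)
    refine (lintegral_mono_set (t := Metric.closedBall (φ x) ε) ?_).trans_lt ?_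
    · rintro y ⟨hy, -, hy'⟩
      have hy'' : φ (φ.symm y) ∈ Metric.ball (φ x) ε := hy'
      rw [φ.right_inv hy] at hy''
      exact Metric.ball_subset_closedBall hy''
    · refine (setLIntegral_mono measurable_const fun y hy => hmax hy).trans_lt ?_
      rw [setLIntegral_const]
      exact ENNReal.mul_lt_top (hle y₀ hy₀) hcomp.measure_lt_top
  choose V hVo hVx hVs hVf using hV
  obtain ⟨t, ht⟩ := isCompact_univ.elim_finite_subcover V hVo fun x _ => mem_iUnion.2 ⟨x, hVx x⟩
  let ν : Measure M := ∑ x ∈ t, (ω₀.chartMeasure x).restrict (V x)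
  have hle : ω₀.liouville ≤ ν := by
    refine iSup_le fun x => Measure.le_iff.2 fun B hB => ?_
    change ω₀.chartMeasure x B ≤ ν B
    have h1 : B ⊆ ⋃ x' ∈ t, B ∩ V x' := by
      intro m hm
      obtain ⟨x', hx', hm'⟩ := mem_iUnion₂.1 (ht (mem_univ m))
      exact mem_iUnion₂.2 ⟨x', hx', hm, hm'⟩
    refine (measure_mono h1).trans ((measure_biUnion_finset_le t _).trans ?_)
    rw [Measure.finsetSum_apply]
    refine Finset.sum_le_sum fun x' _ => ?_
    rw [Measure.restrict_apply hB]
    exact ω₀.chartMeasure_le x x' (hB.inter (hVo x').measurableSet)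
      (inter_subset_right.trans (hVs x'))
  refine ⟨(hle univ).trans_lt ?_⟩
  rw [Measure.finsetSum_apply]
  refine ENNReal.sum_lt_top.2 fun x _ => ?_
  rw [Measure.restrict_apply_univ]
  exact hVf x

end Liouville

/-! ### Normalised connections -/

section Normalise

variable {n : ℕ} {M : Type*} [TopologicalSpace M]
  [ChartedSpace (EuclideanSpace ℝ (Fin (2 * n))) M]
  (ω₀ : SymplecticForm n M)

theorem vectorDiff_sub_const {f : M → ℝ} {m : M}
    (hf : MDifferentiableAt (𝓡 (2 * n)) 𝓘(ℝ, ℝ) f m) (c : ℝ) :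
    vectorDiff (𝓡 (2 * n)) (fun m => f m - c) m = vectorDiff (𝓡 (2 * n)) f m := by
  have h1 := hf.hasMFDerivAt.sub (hasMFDerivAt_const (I := 𝓡 (2 * n)) (I' := 𝓘(ℝ, ℝ)) c m)
  exact h1.mfderiv.trans (sub_zero _)

/-- Subtracting functions of the base from the components changes the curvature by a function of
the base. -/
theorem hamCurvature_sub {F G : ℂ × M → ℝ}
    (hF : ContMDiff (𝓘(ℝ, ℂ).prod (𝓡 (2 * n))) 𝓘(ℝ, ℝ) ∞ F)
    (hG : ContMDiff (𝓘(ℝ, ℂ).prod (𝓡 (2 * n))) 𝓘(ℝ, ℝ) ∞ G) {f g : ℂ → ℝ}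
    (hf : ContDiff ℝ ∞ f) (hg : ContDiff ℝ ∞ g) (z : ℂ) (m : M) :
    hamCurvature ω₀ (fun x => F x - f x.1) (fun x => G x - g x.1) (z, m) =
      hamCurvature ω₀ F G (z, m) + (fderiv ℝ g z 1 - fderiv ℝ f z Complex.I) := by
  have hb : ∀ {F : ℂ × M → ℝ} {f : ℂ → ℝ},
      ContMDiff (𝓘(ℝ, ℂ).prod (𝓡 (2 * n))) 𝓘(ℝ, ℝ) ∞ F → ContDiff ℝ ∞ f → ∀ w,
      baseDeriv (fun x => F x - f x.1) w (z, m) = baseDeriv F w (z, m) - fderiv ℝ f z w := by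
    intro F f hF hf w
    have h1 := (differentiable_slice hF m z).hasFDerivAt.sub
      (hf.differentiable (by simp) z).hasFDerivAt
    exact congrArg (fun A => A w) h1.fderiv
  have hv : ∀ {F : ℂ × M → ℝ} (c : ℝ), ContMDiff (𝓘(ℝ, ℂ).prod (𝓡 (2 * n))) 𝓘(ℝ, ℝ) ∞ F →
      ω₀.hamVec (fun m => F (z, m) - c) m = ω₀.hamVec (fun m => F (z, m)) m := by
    intro F c hF
    refine ω₀.hamVec_eq fun v => ?_
    rw [ω₀.form_hamVec, vectorDiff_sub_const (mdifferentiable_fibre hF z m)]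
  have hp : ω₀.poisson (fun m => F (z, m) - f z) (fun m => G (z, m) - g z) m =
      ω₀.poisson (fun m => F (z, m)) (fun m => G (z, m)) m := by
    rw [SymplecticForm.poisson, hv _ hF, hv _ hG]
    rfl
  simp only [hamCurvature]
  rw [hb hF hf, hb hG hg]
  refine (congrArg (fun a => a + _ - _) hp).trans ?_
  ring

variable [IsManifold (𝓡 (2 * n)) ∞ M] [CompactSpace M] [MeasurableSpace M] [BorelSpace M]

/-- The mean values on the fibres of a smooth function depend smoothly on the base point. -/
theorem exists_mean {F : ℂ × M → ℝ} (hF : ContMDiff (𝓘(ℝ, ℂ).prod (𝓡 (2 * n))) 𝓘(ℝ, ℝ) ∞ F) :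
    ∃ f : ℂ → ℝ, ContDiff ℝ ∞ f ∧ ∀ z, ∫ m, (F (z, m) - f z) ∂ω₀.liouville = 0 := by
  have hfin := ω₀.isFiniteMeasure_liouville
  have h1 := contDiffOn_setIntegral (I := 𝓡 (2 * n)) (μ := ω₀.liouville) isCompact_univ
    MeasurableSet.univ (measure_ne_top _ _) isOpen_univ subset_rfl isOpen_univ hF.contMDiffOn
  simp only [Measure.restrict_univ] at h1
  refine ⟨fun z => (∫ m, F (z, m) ∂ω₀.liouville) / ω₀.liouville.real univ,
    (contDiffOn_univ.1 h1).div_const _, fun z => ?_⟩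
  have hint : Integrable (fun m => F (z, m)) ω₀.liouville := by
    have hc : Continuous fun m => F (z, m) := hF.continuous.comp (by fun_prop)
    exact hc.integrable_of_hasCompactSupport (HasCompactSupport.of_compactSpace _)
  rw [integral_sub hint (integrable_const _), integral_const, smul_eq_mul]
  by_cases h0 : ω₀.liouville.real univ = 0
  · have : ω₀.liouville = 0 := by
      rwa [measureReal_def, ENNReal.toReal_eq_zero_iff, or_iff_left (measure_ne_top _ _),
        Measure.measure_univ_eq_zero] at h0
    simp [this]
  · rw [mul_div_cancel₀ _ h0, sub_self]

/-- The connection with given components, normalised to have mean value zero on the fibres. -/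
theorem exists_normalized_connection {F G : ℂ × M → ℝ}
    (hF : ContMDiff (𝓘(ℝ, ℂ).prod (𝓡 (2 * n))) 𝓘(ℝ, ℝ) ∞ F)
    (hG : ContMDiff (𝓘(ℝ, ℂ).prod (𝓡 (2 * n))) 𝓘(ℝ, ℝ) ∞ G) :
    ∃ (τ : HamiltonianConnection ω₀) (f g : ℂ → ℝ), ContDiff ℝ ∞ f ∧ ContDiff ℝ ∞ g ∧
      τ.F = (fun x => F x - f x.1) ∧ τ.G = fun x => G x - g x.1 := by
  obtain ⟨f, hf, hfF⟩ := exists_mean ω₀ hF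
  obtain ⟨g, hg, hgG⟩ := exists_mean ω₀ hG
  exact ⟨⟨fun x => F x - f x.1, fun x => G x - g x.1, fun _ => 0,
    hF.sub (hf.contMDiff.comp contMDiff_fst), hG.sub (hg.contMDiff.comp contMDiff_fst),
    contDiff_const, fun z _ => hfF z, fun z _ => hgG z⟩, f, g, hf, hg, rfl, rfl⟩

variable {ω₀} {L : Type*} [TopologicalSpace L]
  [ChartedSpace (EuclideanSpace ℝ (Fin n)) L] [IsManifold (𝓡 n) ∞ L]
  [CompactSpace L] [ConnectedSpace L] [T2Space M]

theorem relativeKArea_le_minimalLength (Λ : ℝ → Set M) :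
    relativeKArea ω₀ L Λ ≤ minimalLength ω₀ L Λ := by
  refine le_iInf₂ fun Λ' h => ?_
  have hM : Nonempty M := h.left.nonempty
  obtain ⟨F, G, ι, hF, hG, hι, hp, hle⟩ := h.exists_connection
  obtain ⟨τ, f, g, hf, hg, hτF, hτG⟩ := exists_normalized_connection ω₀ hF hG
  have hτ : τ ∈ connectionsPreserving ω₀ L Λ := by
    refine (τ.vanishesOn_iff hι).2 fun t => ?_
    have e : (fun q => angularHam τ.F τ.G ((1, t), ι t q)) = fun q =>
        angularHam F G ((1, t), ι t q) - 2 * Real.pi * (-((circlePt t).im * f (circlePt t)) +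
          (circlePt t).re * g (circlePt t)) := by
      funext q
      simp only [angularHam, hτF, hτG, one_smul]
      ring
    rw [e]
    refine ⟨(hp t).1.sub contMDiff_const, fun q v => ?_⟩
    have h1 := ((hp t).1.mdifferentiableAt (x := q) (by simp)).hasMFDerivAt.sub
      (hasMFDerivAt_const (I := 𝓡 n) (I' := 𝓘(ℝ, ℝ)) (2 * Real.pi *
        (-((circlePt t).im * f (circlePt t)) + (circlePt t).re * g (circlePt t))) q)
    refine (congrArg (fun A => (A v : ℝ)) (h1.mfderiv.trans (sub_zero _))).trans ((hp t).2 q v)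
  refine iInf₂_le_of_le τ hτ (EReal.coe_le_coe_iff.2 ?_)
  refine le_trans (le_of_eq ?_) hle
  refine integral_congr_ae (Filter.Eventually.of_forall fun z => ?_)
  have hc : Continuous fun m => hamCurvature ω₀ F G (z, m) :=
    (contMDiff_hamCurvature ω₀ hF hG).continuous.comp (by fun_prop)
  refine Eq.trans ?_ (osc_add_const hc (fderiv ℝ g z 1 - fderiv ℝ f z Complex.I))
  refine congrArg osc (funext fun m => ?_)
  rw [← hamCurvature_sub ω₀ hF hG hf hg, ← hτF, ← hτG]
  rfl

end Normalise

/-! ### The top power of a connection form -/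

section TopDensity

variable {n : ℕ} {M : Type*} [TopologicalSpace M]
  [ChartedSpace (EuclideanSpace ℝ (Fin (2 * n))) M] [MeasurableSpace M] {ω₀ : SymplecticForm n M}

/-- The shear `(x + iy, u) ↦ (x + iκy, u - x X - y Y)`, in real coordinates on the first factor. -/
def shear {E : Type*} [AddCommGroup E] [Module ℝ E] (κ : ℝ) (X Y : E) :
    (ℂ × E) →ₗ[ℝ] (ℂ × E) :=
  LinearMap.transvection (Complex.imLm ∘ₗ LinearMap.fst ℝ ℂ E)
      (((κ - 1) • Complex.I, -Y) : ℂ × E) ∘ₗ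
    LinearMap.transvection (Complex.reLm ∘ₗ LinearMap.fst ℝ ℂ E) ((0, -X) : ℂ × E)

theorem det_shear {E : Type*} [AddCommGroup E] [Module ℝ E] [FiniteDimensional ℝ E] (κ : ℝ)
    (X Y : E) : LinearMap.det (shear κ X Y) = κ := by
  rw [shear, LinearMap.det_comp, LinearMap.transvection.det, LinearMap.transvection.det]
  simp

theorem shear_apply {E : Type*} [AddCommGroup E] [Module ℝ E] (κ : ℝ) (X Y : E) (ζ : ℂ) (u : E) :
    shear κ X Y (ζ, u) = (ζ + (ζ.im * (κ - 1)) • Complex.I, u - ζ.re • X - ζ.im • Y) := by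
  simp only [shear, LinearMap.transvection.apply, LinearMap.comp_apply]
  refine Prod.ext ?_ ?_
  · simp [mul_smul]
  · simp [sub_eq_add_neg]

theorem form_sub_linear_combination {V : Type*} [AddCommGroup V] [Module ℝ V] [TopologicalSpace V]
    (θ : V [⋀^Fin 2]→L[ℝ] ℝ) (u u' X Y : V) (x y x' y' : ℝ) :
    θ ![u - x • X - y • Y, u' - x' • X - y' • Y] = θ ![u, u'] + x' * θ ![X, u] + y' * θ ![Y, u] -
      x * θ ![X, u'] - y * θ ![Y, u'] + (x * y' - x' * y) * θ ![X, Y] := by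
  have add0 : ∀ u u' v, θ ![u + u', v] = θ ![u, v] + θ ![u', v] := fun u u' v =>
    θ.toMultilinearMap.cons_add ![v] u u'
  have smul0 : ∀ (c : ℝ) u v, θ ![c • u, v] = c * θ ![u, v] := fun c u v =>
    θ.toMultilinearMap.cons_smul ![v] c u
  have expand : ∀ u v x y, θ ![u - x • X - y • Y, v] =
      θ ![u, v] - x * θ ![X, v] - y * θ ![Y, v] := by
    intro u v x y
    rw [sub_sub, sub_eq_add_neg, ← neg_one_smul ℝ (x • X + y • Y), add0, smul0, add0, smul0, smul0]
    ring
  rw [expand, form_swap θ u, form_swap θ X, form_swap θ Y, expand, expand, expand,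
    form_self, form_self, form_swap θ Y X, form_swap θ u' u, form_swap θ u' X, form_swap θ u' Y]
  ring

/-- The connection form is the pullback of `ω₀ + dx ∧ dy` under a shear that maps the horizontal
subspace of the connection to the base direction and scales the area of the base by `c - Ω`. -/
theorem HamiltonianConnection.form_eq_shear (τ : HamiltonianConnection ω₀) (p : ℂ × M)
    (ζ ζ' : ℂ) (u u' : TangentSpace (𝓡 (2 * n)) p.2)
    {A : (ℂ × EuclideanSpace ℝ (Fin (2 * n))) →ₗ[ℝ] (ℂ × EuclideanSpace ℝ (Fin (2 * n)))}
    (hA : A = shear (τ.c p.1 - τ.curvature p) (ω₀.hamVec (fun m => τ.F (p.1, m)) p.2)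
          (ω₀.hamVec (fun m => τ.G (p.1, m)) p.2)) :
    τ.form p ![(ζ, u), (ζ', u')] = fibreForm ω₀ p ![A (ζ, u), A (ζ', u')] +
      baseAreaForm p ![A (ζ, u), A (ζ', u')] := by
  have hw := shear_apply (τ.c p.1 - τ.curvature p) (ω₀.hamVec (fun m => τ.F (p.1, m)) p.2)
    (ω₀.hamVec (fun m => τ.G (p.1, m)) p.2)
  rw [← hA] at hw
  refine Eq.trans ?_ (congrArg₂ (fun a b => fibreForm ω₀ p ![a, b] + baseAreaForm p ![a, b])
    (hw ζ u) (hw ζ' u')).symm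
  refine (τ.form_apply p ζ ζ' u u').trans ?_
  refine Eq.trans ?_ (congrArg₂ (· + ·) (fibreForm_apply ω₀ p _ _ _ _).symm
    (baseAreaForm_apply p _ _ _ _).symm)
  refine Eq.trans ?_ (congrArg₂ (· + ·) (form_sub_linear_combination (ω₀.form p.2) u u'
    (ω₀.hamVec (fun m => τ.F (p.1, m)) p.2) (ω₀.hamVec (fun m => τ.G (p.1, m)) p.2)
    ζ.re ζ.im ζ'.re ζ'.im).symm rfl)
  rw [ω₀.form_hamVec, ω₀.form_hamVec, ω₀.form_hamVec, ω₀.form_hamVec]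
  have hc : τ.curvature p = ω₀.form p.2 ![ω₀.hamVec (fun m => τ.F (p.1, m)) p.2,
      ω₀.hamVec (fun m => τ.G (p.1, m)) p.2] + baseDeriv τ.F Complex.I p - baseDeriv τ.G 1 p := rfl
  rw [hc]
  simp only [Complex.add_re, Complex.add_im, Complex.smul_re, Complex.smul_im, Complex.I_re,
    Complex.I_im, smul_eq_mul]
  ring

/-- The top power of a connection form has the density `c - Ω`, the determinant of the shear in
`HamiltonianConnection.form_eq_shear`. -/
theorem HamiltonianConnection.hasTopDensity (τ : HamiltonianConnection ω₀) :
    τ.HasTopDensity fun p => τ.c p.1 - τ.curvature p := by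
  intro p _ v
  have hdim : Module.finrank ℝ (ℂ × EuclideanSpace ℝ (Fin (2 * n))) = 2 * (n + 1) := by
    rw [Module.finrank_prod, Complex.finrank_real_complex, finrank_euclideanSpace_fin]
    ring
  set A := shear (τ.c p.1 - τ.curvature p) (ω₀.hamVec (fun m => τ.F (p.1, m)) p.2)
          (ω₀.hamVec (fun m => τ.G (p.1, m)) p.2) with hA
  have h := wedgePow_comp (V := ℂ × EuclideanSpace ℝ (Fin (2 * n)))
    (Module.finBasisOfFinrankEq ℝ _ hdim) (fibreForm ω₀ p + baseAreaForm p) A v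
  refine Eq.trans ?_ (h.trans (congrArg (· * _) (det_shear _ _ _)))
  rw [wedgePow, wedgePow]
  congr 1
  refine Finset.sum_congr rfl fun π _ => ?_
  congr 1
  refine Finset.prod_congr rfl fun i _ => ?_
  exact τ.form_eq_shear p _ _ _ _ hA

end TopDensity

/-! ### Primitives of area forms on the disc with prescribed boundary values -/

section Potential

/-- The integral of `b` over the segment from `0` to `z`, parametrised by `[0, 1]`,
with weight `σ`. -/
def radialMean (b : ℂ → ℝ) (z : ℂ) : ℝ := ∫ σ in (0 : ℝ)..1, σ * b (σ • z)

variable {b : ℂ → ℝ}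

theorem contDiff_radialMean (hb : ContDiff ℝ ∞ b) : ContDiff ℝ ∞ (radialMean b) := by
  have h : ContDiff ℝ ∞ fun x : ℂ × ℝ => x.2 * b (x.2 • x.1) :=
    contDiff_snd.mul (hb.comp (contDiff_snd.smul contDiff_fst))
  have h1 := contMDiff_unitIntervalIntegral (I := 𝓘(ℝ, ℂ)) (W := ℂ)
    (F := fun x : ℂ × ℝ => x.2 * b (x.2 • x.1)) (by
      rw [← modelWithCornersSelf_prod, chartedSpaceSelf_prod]
      exact h.contMDiff)
  exact h1.contDiff

/-- The 1-form `radialMean b * (x dy - y dx)` is a primitive of `b dx ∧ dy`. -/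
theorem fderiv_radialMean (hb : ContDiff ℝ ∞ b) (z : ℂ) :
    2 * radialMean b z + fderiv ℝ (radialMean b) z z = b z := by
  have h1 : ∀ r : ℝ, r ^ 2 * radialMean b (r • z) = ∫ s in (0 : ℝ)..r, s * b (s • z) := by
    intro r
    have h := intervalIntegral.smul_integral_comp_mul_left (a := 0) (b := 1)
      (fun s => s * b (s • z)) r
    rw [mul_zero, mul_one] at h
    rw [← h, radialMean, smul_eq_mul, ← intervalIntegral.integral_const_mul,
      ← intervalIntegral.integral_const_mul]
    refine intervalIntegral.integral_congr fun σ _ => ?_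
    simp only [smul_smul]
    rw [mul_comm σ r]
    ring
  have hc : Continuous fun s : ℝ => s * b (s • z) := by
    have := hb.continuous
    fun_prop
  have h2 : HasDerivAt (fun r : ℝ => r ^ 2 * radialMean b (r • z)) (b z) 1 := by
    rw [funext h1]
    have := intervalIntegral.integral_hasDerivAt_right (hc.intervalIntegrable 0 1)
      (hc.stronglyMeasurableAtFilter _ _) hc.continuousAt
    simpa using this
  have h3 : HasDerivAt (fun r : ℝ => radialMean b (r • z)) (fderiv ℝ (radialMean b) z z) 1 := by
    have h4 : HasFDerivAt (radialMean b) (fderiv ℝ (radialMean b) z) ((1 : ℝ) • z) := by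
      rw [one_smul]
      exact ((contDiff_radialMean hb).differentiable (by simp) z).hasFDerivAt
    have h5 : HasDerivAt (fun r : ℝ => r • z) z 1 := by
      simpa using (hasDerivAt_id' (1 : ℝ)).smul_const z
    exact h4.comp_hasDerivAt (1 : ℝ) h5
  have h4 := ((hasDerivAt_pow 2 (1 : ℝ)).mul h3).unique h2
  rw [one_smul] at h4
  rw [← h4]
  norm_num

/-- A smooth 1-periodic function is the boundary value of a smooth function on `ℂ`. -/
theorem exists_extend_periodic {g : ℝ → ℝ} (hg : ContDiff ℝ ∞ g) (hper : ∀ t, g (t + 1) = g t) :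
    ∃ f : ℂ → ℝ, ContDiff ℝ ∞ f ∧ ∀ t, f (circlePt t) = g t := by
  have hper' : ∀ t (k : ℤ), g (t + k) = g t := fun t k => by
    have h := (show Function.Periodic g 1 from hper).int_mul k t
    rwa [mul_one] at h
  have h1 : ContMDiff (𝓘(ℝ, ℝ × ℝ).prod 𝓘(ℝ, ℝ)) 𝓘(ℝ, ℝ) ∞
      (fun x : (ℝ × ℝ) × ℝ => g x.1.2) :=
    (hg.comp contDiff_snd).contMDiff.comp contMDiff_fst
  obtain ⟨G, hG, hGg, -⟩ := exists_circle_family h1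
  refine ⟨fun w => G ((0, w), 0), ?_, fun t => ?_⟩
  · have h2 : ContMDiff 𝓘(ℝ, ℂ) (𝓘(ℝ, ℝ × ℂ).prod 𝓘(ℝ, ℝ)) ∞
        (fun w : ℂ => (((0 : ℝ), w), (0 : ℝ))) :=
      (contMDiff_const.prodMk_space contMDiff_id).prodMk contMDiff_const
    exact (hG.comp h2).contDiff
  · obtain ⟨k, k', c, -, hc⟩ := hGg t
    beta_reduce
    rw [hc, hper', hper']
    ring

/-- If the total area of `b dx ∧ dy` over the disc cancels the integral of `k dt` over the circle,
then `b dx ∧ dy` has a primitive `P dx + Q dy` on `ℂ` that restricts to `-k dt` on the circle. -/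
theorem exists_primitive_with_boundary_value (hb : ContDiff ℝ ∞ b) {k : ℝ → ℝ}
    (hk : ContDiff ℝ ∞ k) (hper : ∀ t, k (t + 1) = k t)
    (hbk : (∫ z in unitDisc, b z) + ∫ t in (0 : ℝ)..1, k t = 0) :
    ∃ P Q : ℂ → ℝ, ContDiff ℝ ∞ P ∧ ContDiff ℝ ∞ Q ∧
      (∀ z, fderiv ℝ Q z 1 - fderiv ℝ P z Complex.I = b z) ∧
      ∀ t, 2 * Real.pi * (-((circlePt t).im * P (circlePt t)) +
        (circlePt t).re * Q (circlePt t)) = -k t := by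
  have hρ := contDiff_radialMean hb
  let g : ℝ → ℝ := fun t => -k t - 2 * Real.pi * radialMean b (circlePt t)
  have hg : ContDiff ℝ ∞ g :=
    hk.neg.sub (contDiff_const.mul (hρ.comp contDiff_circlePt))
  have hgper : Function.Periodic g 1 := fun t => by
    simp only [g, hper, circlePt_add_one]
  have hg0 : ∫ t in (0 : ℝ)..1, g t = 0 := by
    have h1 : ∫ z in unitDisc, b z =
        ∫ t in (0 : ℝ)..1, 2 * Real.pi * radialMean b (circlePt t) := by
      rw [integral_unitDisc_eq hb.continuous]
      refine intervalIntegral.integral_congr fun t _ => ?_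
      simp only [radialMean]
      rw [← intervalIntegral.integral_const_mul]
      refine intervalIntegral.integral_congr fun r _ => ?_
      simp only [mul_assoc]
    have c1 : Continuous fun t => -k t := hk.continuous.neg
    have c2 : Continuous fun t => 2 * Real.pi * radialMean b (circlePt t) :=
      continuous_const.mul (hρ.continuous.comp contDiff_circlePt.continuous)
    simp only [g]
    rw [intervalIntegral.integral_sub (c1.intervalIntegrable _ _)
      (c2.intervalIntegrable _ _), intervalIntegral.integral_neg, ← h1]
    linarith
  let g₁ : ℝ → ℝ := fun t => ∫ s in (0 : ℝ)..t, g s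
  have hg₁d : ∀ t, HasDerivAt g₁ (g t) t := fun t =>
    intervalIntegral.integral_hasDerivAt_right (hg.continuous.intervalIntegrable _ _)
      (hg.continuous.stronglyMeasurableAtFilter _ _) hg.continuous.continuousAt
  have hg₁ : ContDiff ℝ ∞ g₁ := by
    rw [contDiff_infty_iff_deriv]
    exact ⟨fun t => (hg₁d t).differentiableAt, by rwa [funext fun t => (hg₁d t).deriv]⟩
  have hg₁per : ∀ t, g₁ (t + 1) = g₁ t := by
    intro t
    have h1 := intervalIntegral.integral_add_adjacent_intervals
      (hg.continuous.intervalIntegrable (μ := volume) 0 t)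
      (hg.continuous.intervalIntegrable t (t + 1))
    have h2 := hgper.intervalIntegral_add_eq t 0
    rw [zero_add, hg0] at h2
    simp only [g₁]
    rw [← h1, h2, add_zero]
  obtain ⟨f, hf, hfg⟩ := exists_extend_periodic hg₁ hg₁per
  have hf' : ContDiff ℝ ∞ (fderiv ℝ f) := hf.fderiv_right (by simp)
  have hf1 : ∀ w : ℂ, ContDiff ℝ ∞ fun z => fderiv ℝ f z w := fun w =>
    hf'.clm_apply contDiff_const
  have hre : ContDiff ℝ ∞ Complex.re := Complex.reCLM.contDiff
  have him : ContDiff ℝ ∞ Complex.im := Complex.imCLM.contDiff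
  refine ⟨fun z => fderiv ℝ f z 1 - z.im * radialMean b z,
    fun z => fderiv ℝ f z Complex.I + z.re * radialMean b z,
    (hf1 1).sub (him.mul hρ), (hf1 Complex.I).add (hre.mul hρ), fun z => ?_, fun t => ?_⟩
  · have hd : ∀ w v : ℂ, fderiv ℝ (fun z => fderiv ℝ f z w) z v = fderiv ℝ (fderiv ℝ f) z v w := by
      intro w v
      have := (hf'.differentiable (by simp) z).hasFDerivAt.clm_apply (hasFDerivAt_const w z)
      rw [this.fderiv]
      simp
    have hsym : fderiv ℝ (fderiv ℝ f) z 1 Complex.I = fderiv ℝ (fderiv ℝ f) z Complex.I 1 :=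
      (hf.contDiffAt.isSymmSndFDerivAt (by
        rw [minSmoothness_of_isRCLikeNormedField]
        exact WithTop.coe_le_coe.2 (le_top : (2 : ℕ∞) ≤ ⊤))).eq 1 Complex.I
    have hρz := (hρ.differentiable (by simp) z).hasFDerivAt
    have e1 := ((Complex.reCLM.hasFDerivAt (x := z)).mul hρz).fderiv
    have e2 := ((Complex.imCLM.hasFDerivAt (x := z)).mul hρz).fderiv
    have d1 : DifferentiableAt ℝ (fun z : ℂ => z.re * radialMean b z) z :=
      (hre.mul hρ).differentiable (by simp) z
    have d2 : DifferentiableAt ℝ (fun z : ℂ => z.im * radialMean b z) z :=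
      (him.mul hρ).differentiable (by simp) z
    have e1' : fderiv ℝ (fun z : ℂ => z.re * radialMean b z) z = _ := e1
    have e2' : fderiv ℝ (fun z : ℂ => z.im * radialMean b z) z = _ := e2
    have hlin : fderiv ℝ (radialMean b) z z = z.re * fderiv ℝ (radialMean b) z 1 +
        z.im * fderiv ℝ (radialMean b) z Complex.I := by
      have hz : z = z.re • (1 : ℂ) + z.im • Complex.I := by
        simp [Complex.re_add_im]
      conv_lhs => rw [show fderiv ℝ (radialMean b) z z =
        fderiv ℝ (radialMean b) z (z.re • (1 : ℂ) + z.im • Complex.I) from congrArg _ hz]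
      rw [map_add, map_smul, map_smul, smul_eq_mul, smul_eq_mul]
    rw [fderiv_fun_add ((hf1 Complex.I).differentiable (by simp) z) d1,
      fderiv_fun_sub ((hf1 1).differentiable (by simp) z) d2, e1', e2',
      ← fderiv_radialMean hb z, hlin]
    simp only [add_apply, sub_apply, hd, hsym,
      smul_apply, Complex.reCLM_apply, Complex.imCLM_apply, smul_eq_mul,
      Complex.one_re, Complex.I_im]
    ring
  · have h1 : HasDerivAt (fun t => f (circlePt t))
        (fderiv ℝ f (circlePt t) (2 * Real.pi * Complex.I * circlePt t)) t :=
      (hf.differentiable (by simp) _).hasFDerivAt.comp_hasDerivAt t (hasDerivAt_circlePt t)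
    rw [funext hfg] at h1
    have h2 := h1.unique (hg₁d t)
    have h3 : 2 * Real.pi * Complex.I * circlePt t = (-(2 * Real.pi * (circlePt t).im)) • (1 : ℂ) +
        (2 * Real.pi * (circlePt t).re) • Complex.I := by
      apply Complex.ext <;> simp [mul_assoc]
    rw [h3, map_add, map_smul, map_smul, smul_eq_mul, smul_eq_mul] at h2
    have h4 := circlePt_re_sq_add_im_sq t
    simp only [g] at h2
    linear_combination h2 + 2 * Real.pi * radialMean b (circlePt t) * h4

end Potential

/-! ### Horizontal 1-forms on `ℂ × M` -/

section HorizontalForm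

variable {n : ℕ} {M : Type*} [TopologicalSpace M]
  [ChartedSpace (EuclideanSpace ℝ (Fin (2 * n))) M]

/-- The 1-form `A dx + B dy` on `ℂ × M`. -/
def horizontalForm (A B : ℂ × M → ℝ) : DForm (𝓘(ℝ, ℂ).prod (𝓡 (2 * n))) (ℂ × M) 1 :=
  fun p => ContinuousAlternatingMap.ofSubsingleton ℝ _ ℝ (0 : Fin 1)
    ((A p • Complex.reCLM + B p • Complex.imCLM) ∘L
      mfderiv (𝓘(ℝ, ℂ).prod (𝓡 (2 * n))) 𝓘(ℝ, ℂ) Prod.fst p)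

theorem horizontalForm_apply (A B : ℂ × M → ℝ) (p : ℂ × M)
    (v : Fin 1 → TangentSpace (𝓘(ℝ, ℂ).prod (𝓡 (2 * n))) p) :
    horizontalForm A B p v = A p * (v 0).1.re + B p * (v 0).1.im := by
  rw [horizontalForm, mfderiv_fst]
  rfl

/-- The covector `dx` or `dy` on `ℂ × E`, as an alternating form of degree one. -/
def horizontalCovector (n : ℕ) (a : ℂ →L[ℝ] ℝ) :
    (ℂ × EuclideanSpace ℝ (Fin (2 * n))) [⋀^Fin 1]→L[ℝ] ℝ :=
  ContinuousAlternatingMap.ofSubsingleton ℝ _ ℝ (0 : Fin 1)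
    (a ∘L ContinuousLinearMap.fst ℝ ℂ (EuclideanSpace ℝ (Fin (2 * n))))

theorem horizontalCovector_apply (a : ℂ →L[ℝ] ℝ)
    (v : Fin 1 → ℂ × EuclideanSpace ℝ (Fin (2 * n))) :
    horizontalCovector n a v = a (v 0).1 := rfl

theorem extDeriv_smul_horizontalCovector {f g : ℂ × EuclideanSpace ℝ (Fin (2 * n)) → ℝ}
    {y : ℂ × EuclideanSpace ℝ (Fin (2 * n))} (hf : DifferentiableAt ℝ f y)
    (hg : DifferentiableAt ℝ g y) (w w' : ℂ × EuclideanSpace ℝ (Fin (2 * n))) :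
    extDeriv (fun y => f y • horizontalCovector n Complex.reCLM +
      g y • horizontalCovector n Complex.imCLM) y ![w, w'] =
      (fderiv ℝ f y w * w'.1.re + fderiv ℝ g y w * w'.1.im) -
      (fderiv ℝ f y w' * w.1.re + fderiv ℝ g y w' * w.1.im) := by
  have hF := (hf.hasFDerivAt.smul_const (horizontalCovector n Complex.reCLM)).fun_add
    (hg.hasFDerivAt.smul_const (horizontalCovector n Complex.imCLM))
  rw [extDeriv, hF.fderiv, ContinuousAlternatingMap.alternatizeUncurryFin_apply, Fin.sum_univ_two]
  simp [horizontalCovector_apply, Fin.removeNth]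
  ring

variable [IsManifold (𝓡 (2 * n)) ∞ M]

theorem mfderiv_chart_symm_fst (x₀ : ℂ × M) {y : ℂ × EuclideanSpace ℝ (Fin (2 * n))}
    (hy : y ∈ (extChartAt (𝓘(ℝ, ℂ).prod (𝓡 (2 * n))) x₀).target)
    (w : ℂ × EuclideanSpace ℝ (Fin (2 * n))) :
    (mfderiv 𝓘(ℝ, ℂ × EuclideanSpace ℝ (Fin (2 * n))) (𝓘(ℝ, ℂ).prod (𝓡 (2 * n)))
      (extChartAt (𝓘(ℝ, ℂ).prod (𝓡 (2 * n))) x₀).symm y w).1 = w.1 := by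
  have : IsManifold (𝓘(ℝ, ℂ).prod (𝓡 (2 * n))) 1 (ℂ × M) := IsManifold.of_le (n := ∞) (by simp)
  have h1 := mdifferentiableAt_extChartAt_symm hy
  have h2 := mfderiv_comp y (mdifferentiableAt_fst (I := 𝓘(ℝ, ℂ)) (I' := 𝓡 (2 * n))) h1
  rw [mfderiv_fst] at h2
  have h3 : (Prod.fst ∘ (extChartAt (𝓘(ℝ, ℂ).prod (𝓡 (2 * n))) x₀).symm) = Prod.fst := by
    funext y
    rfl
  rw [h3, mfderiv_eq_fderiv, fderiv_fst] at h2
  exact (congrArg (fun A => A w) h2).symm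

theorem mfderiv_chart_fst (p : ℂ × M)
    (w : TangentSpace (𝓘(ℝ, ℂ).prod (𝓡 (2 * n))) p) :
    (mfderiv (𝓘(ℝ, ℂ).prod (𝓡 (2 * n))) 𝓘(ℝ, ℂ × EuclideanSpace ℝ (Fin (2 * n)))
      (extChartAt (𝓘(ℝ, ℂ).prod (𝓡 (2 * n))) p) p w).1 = w.1 := by
  have : IsManifold (𝓘(ℝ, ℂ).prod (𝓡 (2 * n))) 1 (ℂ × M) := IsManifold.of_le (n := ∞) (by simp)
  have h1 := mfderiv_chart_symm_fst p (mem_extChartAt_target p)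
    (mfderiv (𝓘(ℝ, ℂ).prod (𝓡 (2 * n))) 𝓘(ℝ, ℂ × EuclideanSpace ℝ (Fin (2 * n)))
      (extChartAt (𝓘(ℝ, ℂ).prod (𝓡 (2 * n))) p) p w)
  have h2 := mfderiv_extChartAt_symm_comp (J := 𝓘(ℝ, ℂ).prod (𝓡 (2 * n)))
    (mem_extChartAt_source (I := 𝓘(ℝ, ℂ).prod (𝓡 (2 * n))) p)
  exact h1.symm.trans (congrArg (fun A => (A w).1) h2)

theorem horizontalForm_inChart (A B : ℂ × M → ℝ) (x₀ : ℂ × M)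
    {y : ℂ × EuclideanSpace ℝ (Fin (2 * n))}
    (hy : y ∈ (extChartAt (𝓘(ℝ, ℂ).prod (𝓡 (2 * n))) x₀).target) :
    (horizontalForm A B).inChart x₀ y =
      A ((extChartAt (𝓘(ℝ, ℂ).prod (𝓡 (2 * n))) x₀).symm y) • horizontalCovector n Complex.reCLM +
      B ((extChartAt (𝓘(ℝ, ℂ).prod (𝓡 (2 * n))) x₀).symm y) •
        horizontalCovector n Complex.imCLM := by
  ext v
  refine (horizontalForm_apply A B ((extChartAt (𝓘(ℝ, ℂ).prod (𝓡 (2 * n))) x₀).symm y)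
    (fun i => mfderiv 𝓘(ℝ, ℂ × EuclideanSpace ℝ (Fin (2 * n))) (𝓘(ℝ, ℂ).prod (𝓡 (2 * n)))
      (extChartAt (𝓘(ℝ, ℂ).prod (𝓡 (2 * n))) x₀).symm y (v i))).trans ?_
  exact congrArg (fun ζ : ℂ => A ((extChartAt (𝓘(ℝ, ℂ).prod (𝓡 (2 * n))) x₀).symm y) * ζ.re +
    B ((extChartAt (𝓘(ℝ, ℂ).prod (𝓡 (2 * n))) x₀).symm y) * ζ.im)
    (mfderiv_chart_symm_fst x₀ hy (v 0))

theorem contDiffOn_chart_symm {A : ℂ × M → ℝ}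
    (hA : ContMDiff (𝓘(ℝ, ℂ).prod (𝓡 (2 * n))) 𝓘(ℝ, ℝ) ∞ A) (x₀ : ℂ × M) :
    ContDiffOn ℝ ∞ (fun y => A ((extChartAt (𝓘(ℝ, ℂ).prod (𝓡 (2 * n))) x₀).symm y))
      (extChartAt (𝓘(ℝ, ℂ).prod (𝓡 (2 * n))) x₀).target :=
  (hA.comp_contMDiffOn (contMDiffOn_extChartAt_symm x₀)).contDiffOn

variable {A B : ℂ × M → ℝ}

theorem isSmooth_horizontalForm (hA : ContMDiff (𝓘(ℝ, ℂ).prod (𝓡 (2 * n))) 𝓘(ℝ, ℝ) ∞ A)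
    (hB : ContMDiff (𝓘(ℝ, ℂ).prod (𝓡 (2 * n))) 𝓘(ℝ, ℝ) ∞ B) :
    (horizontalForm (n := n) A B).IsSmooth := by
  intro x₀
  refine ContDiffOn.congr ?_ fun y hy => horizontalForm_inChart A B x₀ hy
  exact ((contDiffOn_chart_symm hA x₀).smul contDiffOn_const).add
    ((contDiffOn_chart_symm hB x₀).smul contDiffOn_const)

theorem extd_horizontalForm_apply (hA : ContMDiff (𝓘(ℝ, ℂ).prod (𝓡 (2 * n))) 𝓘(ℝ, ℝ) ∞ A)
    (hB : ContMDiff (𝓘(ℝ, ℂ).prod (𝓡 (2 * n))) 𝓘(ℝ, ℝ) ∞ B) (p : ℂ × M)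
    (w w' : TangentSpace (𝓘(ℝ, ℂ).prod (𝓡 (2 * n))) p) :
    (horizontalForm A B).extd p ![w, w'] =
      (vectorDiff (𝓘(ℝ, ℂ).prod (𝓡 (2 * n))) A p w * w'.1.re +
        vectorDiff (𝓘(ℝ, ℂ).prod (𝓡 (2 * n))) B p w * w'.1.im) -
      (vectorDiff (𝓘(ℝ, ℂ).prod (𝓡 (2 * n))) A p w' * w.1.re +
        vectorDiff (𝓘(ℝ, ℂ).prod (𝓡 (2 * n))) B p w' * w.1.im) := by
  have : IsManifold (𝓘(ℝ, ℂ).prod (𝓡 (2 * n))) 1 (ℂ × M) := IsManifold.of_le (n := ∞) (by simp)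
  set φ := extChartAt (𝓘(ℝ, ℂ).prod (𝓡 (2 * n))) p with hφ
  have hnhds : φ.target ∈ 𝓝 (φ p) := extChartAt_target_mem_nhds p
  have d : ∀ {A : ℂ × M → ℝ}, ContMDiff (𝓘(ℝ, ℂ).prod (𝓡 (2 * n))) 𝓘(ℝ, ℝ) ∞ A →
      DifferentiableAt ℝ (fun y => A (φ.symm y)) (φ p) := fun hA =>
    ((contDiffOn_chart_symm hA p).contDiffAt hnhds).differentiableAt (by simp)
  have hdA : ∀ {A : ℂ × M → ℝ}, ContMDiff (𝓘(ℝ, ℂ).prod (𝓡 (2 * n))) 𝓘(ℝ, ℝ) ∞ A → ∀ w,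
      fderiv ℝ (fun y => A (φ.symm y)) (φ p)
        (mfderiv (𝓘(ℝ, ℂ).prod (𝓡 (2 * n))) 𝓘(ℝ, ℂ × EuclideanSpace ℝ (Fin (2 * n))) φ p w) =
      vectorDiff (𝓘(ℝ, ℂ).prod (𝓡 (2 * n))) A p w := by
    intro A hA w
    have h1 := vectorDiff_comp (I := 𝓘(ℝ, ℂ × EuclideanSpace ℝ (Fin (2 * n)))) (e := A)
      (c := φ.symm) (q := φ p) (hA.mdifferentiableAt (by simp))
      (mdifferentiableAt_extChartAt_symm (mem_extChartAt_target p))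
      (mfderiv (𝓘(ℝ, ℂ).prod (𝓡 (2 * n))) 𝓘(ℝ, ℂ × EuclideanSpace ℝ (Fin (2 * n))) φ p w)
    have h2 := mfderiv_extChartAt_symm_comp (J := 𝓘(ℝ, ℂ).prod (𝓡 (2 * n)))
      (mem_extChartAt_source (I := 𝓘(ℝ, ℂ).prod (𝓡 (2 * n))) p)
    rw [vectorDiff_eq_fderiv] at h1
    have h3 : φ.symm (φ p) = p := extChartAt_to_inv p
    rw [h3] at h1
    exact h1.trans (congrArg (fun T => vectorDiff (𝓘(ℝ, ℂ).prod (𝓡 (2 * n))) A p (T w)) h2)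
  have hE : (horizontalForm A B).inChart p =ᶠ[𝓝 (φ p)] fun y =>
      A (φ.symm y) • horizontalCovector n Complex.reCLM +
        B (φ.symm y) • horizontalCovector n Complex.imCLM := by
    filter_upwards [hnhds] with y hy
    exact horizontalForm_inChart A B p hy
  have h1 : extDeriv ((horizontalForm A B).inChart p) (φ p) = _ := hE.extDeriv_eq
  have h2 : (horizontalForm A B).extd p ![w, w'] =
      extDeriv ((horizontalForm A B).inChart p) (φ p)
        ![mfderiv (𝓘(ℝ, ℂ).prod (𝓡 (2 * n))) 𝓘(ℝ, ℂ × EuclideanSpace ℝ (Fin (2 * n))) φ p w,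
          mfderiv (𝓘(ℝ, ℂ).prod (𝓡 (2 * n))) 𝓘(ℝ, ℂ × EuclideanSpace ℝ (Fin (2 * n))) φ p w'] :=
    congrArg (extDeriv ((horizontalForm A B).inChart p) (φ p)) (comp_cons_two _ w w')
  refine h2.trans ?_
  refine (DFunLike.congr_fun h1 _).trans ?_
  refine (extDeriv_smul_horizontalCovector (d hA) (d hB) _ _).trans ?_
  rw [hdA hA, hdA hA, hdA hB, hdA hB]
  exact congrArg₂ (fun ζ ζ' : ℂ => (vectorDiff (𝓘(ℝ, ℂ).prod (𝓡 (2 * n))) A p w * ζ'.re +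
        vectorDiff (𝓘(ℝ, ℂ).prod (𝓡 (2 * n))) B p w * ζ'.im) -
      (vectorDiff (𝓘(ℝ, ℂ).prod (𝓡 (2 * n))) A p w' * ζ.re +
        vectorDiff (𝓘(ℝ, ℂ).prod (𝓡 (2 * n))) B p w' * ζ.im))
    (mfderiv_chart_fst p w) (mfderiv_chart_fst p w')

end HorizontalForm

/-! ### Cohomology classes of connection forms -/

section Classes

variable {n : ℕ} {M : Type*} [TopologicalSpace M]
  [ChartedSpace (EuclideanSpace ℝ (Fin (2 * n))) M] {ω₀ : SymplecticForm n M}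
  {L : Type*} [TopologicalSpace L] [ChartedSpace (EuclideanSpace ℝ (Fin n)) L]
  {Λ : ℝ → Set M} {A B : ℂ × M → ℝ}

theorem vanishesOn_horizontalForm
    (h : ∀ t, ∀ m ∈ Λ t, angularHam A B ((1, t), m) = 0) :
    VanishesOn ω₀ L Λ (horizontalForm A B) := by
  intro ι hι
  funext x
  obtain ⟨t, q⟩ := x
  ext ξ
  refine (horizontalForm_apply A B (traceMap ι (t, q)) (fun i =>
    mfderiv (𝓘(ℝ, ℝ).prod (𝓡 n)) (𝓘(ℝ, ℂ).prod (𝓡 (2 * n))) (traceMap ι) (t, q) (ξ i))).trans ?_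
  have h1 : (mfderiv (𝓘(ℝ, ℝ).prod (𝓡 n)) (𝓘(ℝ, ℂ).prod (𝓡 (2 * n))) (traceMap ι) (t, q)
      (ξ 0)).1 = (ξ 0).1 • (2 * Real.pi * Complex.I * circlePt t) :=
    congrArg Prod.fst (mfderiv_traceMap hι.smooth t q (ξ 0).1 (ξ 0).2)
  refine (congrArg (fun ζ : ℂ => A (circlePt t, ι t q) * ζ.re + B (circlePt t, ι t q) * ζ.im)
    h1).trans ?_
  have h2 := h t (ι t q) (hι.range_eq t ▸ mem_range_self q)
  rw [angularHam, one_smul] at h2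
  change _ = (0 : ℝ)
  simp
  linear_combination (ξ 0).1 * h2

variable [IsManifold (𝓡 (2 * n)) ∞ M]

/-- The exterior derivative of `A dx + B dy` in terms of partial derivatives. -/
theorem extd_horizontalForm_apply' (hA : ContMDiff (𝓘(ℝ, ℂ).prod (𝓡 (2 * n))) 𝓘(ℝ, ℝ) ∞ A)
    (hB : ContMDiff (𝓘(ℝ, ℂ).prod (𝓡 (2 * n))) 𝓘(ℝ, ℝ) ∞ B) (p : ℂ × M) (ζ ζ' : ℂ)
    (u u' : TangentSpace (𝓡 (2 * n)) p.2) :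
    (horizontalForm A B).extd p ![(ζ, u), (ζ', u')] =
      (vectorDiff (𝓡 (2 * n)) (fun m => A (p.1, m)) p.2 u * ζ'.re -
        vectorDiff (𝓡 (2 * n)) (fun m => A (p.1, m)) p.2 u' * ζ.re) +
      (vectorDiff (𝓡 (2 * n)) (fun m => B (p.1, m)) p.2 u * ζ'.im -
        vectorDiff (𝓡 (2 * n)) (fun m => B (p.1, m)) p.2 u' * ζ.im) +
      (baseDeriv B 1 p - baseDeriv A Complex.I p) * (ζ.re * ζ'.im - ζ'.re * ζ.im) := by
  have d : ∀ {A : ℂ × M → ℝ}, ContMDiff (𝓘(ℝ, ℂ).prod (𝓡 (2 * n))) 𝓘(ℝ, ℝ) ∞ A → ∀ (ζ : ℂ)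
      (u : TangentSpace (𝓡 (2 * n)) p.2), vectorDiff (𝓘(ℝ, ℂ).prod (𝓡 (2 * n))) A p (ζ, u) =
        ζ.re * baseDeriv A 1 p + ζ.im * baseDeriv A Complex.I p +
          vectorDiff (𝓡 (2 * n)) (fun m => A (p.1, m)) p.2 u := by
    intro A hA ζ u
    have h1 : vectorDiff (𝓘(ℝ, ℂ).prod (𝓡 (2 * n))) A p (ζ, u) =
        vectorDiff 𝓘(ℝ, ℂ) (fun z => A (z, p.2)) p.1 ζ +
          vectorDiff (𝓡 (2 * n)) (fun m => A (p.1, m)) p.2 u :=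
      mfderiv_prod_eq_add_apply (hA.mdifferentiableAt (by simp))
    rw [vectorDiff_eq_fderiv] at h1
    have h2 : fderiv ℝ (fun z => A (z, p.2)) p.1 ζ =
        ζ.re * baseDeriv A 1 p + ζ.im * baseDeriv A Complex.I p := by
      have hz : ζ = ζ.re • (1 : ℂ) + ζ.im • Complex.I := by simp [Complex.re_add_im]
      conv_lhs => rw [hz]
      rw [map_add, map_smul, map_smul, smul_eq_mul, smul_eq_mul, baseDeriv, baseDeriv]
    exact h1.trans (congrArg (· + _) h2)
  refine (extd_horizontalForm_apply hA hB p _ _).trans ?_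
  rw [d hA, d hA, d hB, d hB]
  ring

variable [MeasurableSpace M]

/-- If the angular components of two connection forms differ along `Λ_t` by a function `k` of `t`,
their classes relative to `Λ` differ by the multiple `∫ c - ∫ c₀ + ∫ k` of the class `σ`. -/
theorem classesDifferBy_of_angularHam_sub {τ τ₀ : HamiltonianConnection ω₀} {k : ℝ → ℝ}
    (hk : ContDiff ℝ ∞ k) (hper : ∀ t, k (t + 1) = k t)
    (hkΛ : ∀ t, ∀ m ∈ Λ t,
      angularHam τ.F τ.G ((1, t), m) - angularHam τ₀.F τ₀.G ((1, t), m) = k t) :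
    ClassesDifferBy ω₀ L Λ τ τ₀
      ((∫ z in unitDisc, τ.c z) - (∫ z in unitDisc, τ₀.c z) + ∫ t in (0 : ℝ)..1, k t) := by
  set s := (∫ z in unitDisc, τ.c z) - (∫ z in unitDisc, τ₀.c z) + ∫ t in (0 : ℝ)..1, k t with hs
  have hint : ∀ {c : ℂ → ℝ}, ContDiff ℝ ∞ c → IntegrableOn c unitDisc := fun hc =>
    hc.continuous.continuousOn.integrableOn_compact (isCompact_closedBall 0 1)
  have hb : ContDiff ℝ ∞ fun z => τ.c z - τ₀.c z - s * Real.pi⁻¹ :=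
    (τ.smooth_c.sub τ₀.smooth_c).sub contDiff_const
  have hbk : (∫ z in unitDisc, (τ.c z - τ₀.c z - s * Real.pi⁻¹)) + ∫ t in (0 : ℝ)..1, k t = 0 := by
    have h1 : ∫ z in unitDisc, (s * Real.pi⁻¹) = s := by
      rw [setIntegral_const]
      simp [Measure.real]
      field_simp
    have h2 : ∫ z in unitDisc, (τ.c z - τ₀.c z - s * Real.pi⁻¹) =
        (∫ z in unitDisc, (τ.c z - τ₀.c z)) - ∫ z in unitDisc, (s * Real.pi⁻¹) :=
      integral_sub (hint (τ.smooth_c.sub τ₀.smooth_c)) (hint contDiff_const)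
    rw [h2, h1, integral_sub (hint τ.smooth_c) (hint τ₀.smooth_c)]
    linarith
  obtain ⟨P, Q, hP, hQ, hPQ, hPQk⟩ := exists_primitive_with_boundary_value hb hk hper hbk
  have hfst : ∀ {P : ℂ → ℝ}, ContDiff ℝ ∞ P →
      ContMDiff (𝓘(ℝ, ℂ).prod (𝓡 (2 * n))) 𝓘(ℝ, ℝ) ∞ fun x : ℂ × M => P x.1 := fun hP =>
    hP.contMDiff.comp contMDiff_fst
  have hA : ContMDiff (𝓘(ℝ, ℂ).prod (𝓡 (2 * n))) 𝓘(ℝ, ℝ) ∞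
      fun x => τ.F x - τ₀.F x + P x.1 := (τ.smooth_F.sub τ₀.smooth_F).add (hfst hP)
  have hB : ContMDiff (𝓘(ℝ, ℂ).prod (𝓡 (2 * n))) 𝓘(ℝ, ℝ) ∞
      fun x => τ.G x - τ₀.G x + Q x.1 := (τ.smooth_G.sub τ₀.smooth_G).add (hfst hQ)
  refine ⟨_, isSmooth_horizontalForm hA hB, vanishesOn_horizontalForm fun t m hm => ?_,
    fun p _ => ?_⟩
  · have h1 := hkΛ t m hm
    have h2 := hPQk t
    simp only [angularHam, one_smul] at h1 ⊢
    linear_combination h1 + h2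
  · have dv : ∀ {F F₀ : ℂ × M → ℝ}, ContMDiff (𝓘(ℝ, ℂ).prod (𝓡 (2 * n))) 𝓘(ℝ, ℝ) ∞ F →
        ContMDiff (𝓘(ℝ, ℂ).prod (𝓡 (2 * n))) 𝓘(ℝ, ℝ) ∞ F₀ → ∀ (P : ℂ → ℝ)
        (u : TangentSpace (𝓡 (2 * n)) p.2),
        vectorDiff (𝓡 (2 * n)) (fun m => F (p.1, m) - F₀ (p.1, m) + P (p.1, m).1) p.2 u =
          vectorDiff (𝓡 (2 * n)) (fun m => F (p.1, m)) p.2 u -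
            vectorDiff (𝓡 (2 * n)) (fun m => F₀ (p.1, m)) p.2 u := by
      intro F F₀ hF hF₀ P u
      have h1 := ((mdifferentiable_fibre hF p.1 p.2).hasMFDerivAt.sub
        (mdifferentiable_fibre hF₀ p.1 p.2).hasMFDerivAt).add
        (hasMFDerivAt_const (I := 𝓡 (2 * n)) (I' := 𝓘(ℝ, ℝ)) (P p.1) p.2)
      refine (congrArg (fun T => T u) h1.mfderiv).trans ?_
      exact add_zero _
    have db : ∀ {F F₀ : ℂ × M → ℝ}, ContMDiff (𝓘(ℝ, ℂ).prod (𝓡 (2 * n))) 𝓘(ℝ, ℝ) ∞ F →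
        ContMDiff (𝓘(ℝ, ℂ).prod (𝓡 (2 * n))) 𝓘(ℝ, ℝ) ∞ F₀ → ∀ {P : ℂ → ℝ},
        ContDiff ℝ ∞ P → ∀ w, baseDeriv (fun x => F x - F₀ x + P x.1) w p =
          baseDeriv F w p - baseDeriv F₀ w p + fderiv ℝ P p.1 w := by
      intro F F₀ hF hF₀ P hP w
      have e := (((differentiable_slice hF p.2 p.1).hasFDerivAt.fun_sub
        (differentiable_slice hF₀ p.2 p.1).hasFDerivAt).fun_add
        (hP.differentiable (by simp) p.1).hasFDerivAt).fderiv
      rw [baseDeriv, e]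
      rfl
    have key : ∀ (ζ ζ' : ℂ) (u u' : TangentSpace (𝓡 (2 * n)) p.2),
        τ.form p ![(ζ, u), (ζ', u')] - (τ₀.form p ![(ζ, u), (ζ', u')] +
          s * (Real.pi⁻¹ * baseAreaForm p ![(ζ, u), (ζ', u')])) =
        (horizontalForm (fun x : ℂ × M => τ.F x - τ₀.F x + P x.1)
          fun x => τ.G x - τ₀.G x + Q x.1).extd p ![(ζ, u), (ζ', u')] := by
      intro ζ ζ' u u'
      refine Eq.trans ?_ (extd_horizontalForm_apply' hA hB p _ _ _ _).symm
      rw [dv τ.smooth_F τ₀.smooth_F P, dv τ.smooth_F τ₀.smooth_F P, dv τ.smooth_G τ₀.smooth_G Q,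
        dv τ.smooth_G τ₀.smooth_G Q, db τ.smooth_F τ₀.smooth_F hP, db τ.smooth_G τ₀.smooth_G hQ]
      refine (congrArg₂ (· - ·) (τ.form_apply p ζ ζ' u u') (congrArg₂ (· + ·)
        (τ₀.form_apply p ζ ζ' u u') (congrArg (fun x => s * (Real.pi⁻¹ * x))
          (baseAreaForm_apply p ζ ζ' u u')))).trans ?_
      have h4 := hPQ p.1
      linear_combination -(ζ.re * ζ'.im - ζ'.re * ζ.im) * h4
    ext ξ
    have hξ : ξ = ![((ξ 0).1, (ξ 0).2), ((ξ 1).1, (ξ 1).2)] := by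
      funext i; fin_cases i <;> rfl
    rw [hξ]
    exact key _ _ _ _

end Classes

/-! ### The width of the nonsymplectic interval -/

/-- A continuous function on the plane has smooth strict upper approximations. -/
theorem exists_contDiff_between {u : ℂ → ℝ} (hu : Continuous u) {δ : ℝ} (hδ : 0 < δ) :
    ∃ c : ℂ → ℝ, ContDiff ℝ ∞ c ∧ ∀ z, u z < c z ∧ c z < u z + δ := by
  have h := exists_contMDiffMap_forall_mem_convex_of_local_const 𝓘(ℝ, ℂ) (n := ⊤)
    (t := fun z => Ioo (u z) (u z + δ)) (fun z => convex_Ioo _ _) fun z => by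
      refine ⟨u z + δ / 2, ?_⟩
      have h1 : ∀ᶠ y in 𝓝 z, u y < u z + δ / 2 :=
        hu.continuousAt.eventually (gt_mem_nhds (by linarith))
      have h2 : ∀ᶠ y in 𝓝 z, u z - δ / 2 < u y :=
        hu.continuousAt.eventually (lt_mem_nhds (by linarith))
      filter_upwards [h1, h2] with y hy hy'
      exact ⟨hy, by linarith⟩
  obtain ⟨g, hg⟩ := h
  exact ⟨g, g.contMDiff.contDiff, fun z => hg z⟩

section Width

variable {n : ℕ} {M : Type*} [TopologicalSpace M]
  [ChartedSpace (EuclideanSpace ℝ (Fin (2 * n))) M] [MeasurableSpace M] {ω₀ : SymplecticForm n M}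
  {L : Type*} [TopologicalSpace L] [ChartedSpace (EuclideanSpace ℝ (Fin n)) L]
  {Λ : ℝ → Set M}

/-- The connection form with the same components `F`, `G` and another function `c`. -/
def HamiltonianConnection.withArea (τ : HamiltonianConnection ω₀) {c : ℂ → ℝ}
    (hc : ContDiff ℝ ∞ c) : HamiltonianConnection ω₀ :=
  { τ with c := c, smooth_c := hc }

theorem HamiltonianConnection.isPositive_withArea (τ : HamiltonianConnection ω₀) {c : ℂ → ℝ}
    (hc : ContDiff ℝ ∞ c) (h : ∀ z m, τ.curvature (z, m) < c z) : (τ.withArea hc).IsPositive :=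
  ⟨_, (τ.withArea hc).hasTopDensity, fun p _ => sub_pos.2 (h p.1 p.2)⟩

theorem HamiltonianConnection.isNegative_withArea (τ : HamiltonianConnection ω₀) {c : ℂ → ℝ}
    (hc : ContDiff ℝ ∞ c) (h : ∀ z m, c z < τ.curvature (z, m)) : (τ.withArea hc).IsNegative :=
  ⟨_, (τ.withArea hc).hasTopDensity, fun p _ => sub_neg.2 (h p.1 p.2)⟩

variable [IsManifold (𝓡 (2 * n)) ∞ M]

/-- Smooth functions `c⁺ > max Ω` and `c⁻ < min Ω` on the base whose integrals differ by little
more than the Hofer norm of the curvature. -/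
theorem HamiltonianConnection.exists_area_bounds [CompactSpace M] [Nonempty M]
    (τ : HamiltonianConnection ω₀) {δ : ℝ} (hδ : 0 < δ) :
    ∃ c c' : ℂ → ℝ, ContDiff ℝ ∞ c ∧ ContDiff ℝ ∞ c' ∧ (∀ z m, τ.curvature (z, m) < c z) ∧
      (∀ z m, c' z < τ.curvature (z, m)) ∧
      (∫ z in unitDisc, c z) - ∫ z in unitDisc, c' z ≤ τ.curvatureNorm + δ := by
  have hΩ : Continuous τ.curvature := τ.contMDiff_curvature.continuous
  have h1 := isCompact_univ.continuous_sSup (K := (univ : Set M))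
    (f := fun z m => τ.curvature (z, m)) hΩ
  have h2 := isCompact_univ.continuous_sInf (K := (univ : Set M))
    (f := fun z m => τ.curvature (z, m)) hΩ
  simp only [image_univ] at h1 h2
  have hz : ∀ z, Continuous fun m => τ.curvature (z, m) := fun z => by fun_prop
  have hle : ∀ z m, τ.curvature (z, m) ≤ sSup (range fun m => τ.curvature (z, m)) := fun z m =>
    le_csSup (isCompact_range (hz z)).bddAbove (mem_range_self m)
  have hge : ∀ z m, sInf (range fun m => τ.curvature (z, m)) ≤ τ.curvature (z, m) := fun z m =>
    csInf_le (isCompact_range (hz z)).bddBelow (mem_range_self m)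
  -- the disc has area `π`
  have hδ' : 0 < δ / (2 * Real.pi) := by positivity
  obtain ⟨c, hc, hcu⟩ := exists_contDiff_between h1 hδ'
  obtain ⟨c', hc', hcu'⟩ := exists_contDiff_between
    (u := fun z => sInf (range fun m => τ.curvature (z, m)) - δ / (2 * Real.pi))
    (h2.sub continuous_const) hδ'
  have hcu₂ : ∀ z, c' z < sInf (range fun m => τ.curvature (z, m)) := fun z =>
    (hcu' z).2.trans_eq (sub_add_cancel _ _)
  refine ⟨c, c', hc, hc', fun z m => (hle z m).trans_lt (hcu z).1,
    fun z m => (hcu₂ z).trans_le (hge z m), ?_⟩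
  have hint : ∀ {c : ℂ → ℝ}, Continuous c → IntegrableOn c unitDisc := fun hc =>
    hc.continuousOn.integrableOn_compact (isCompact_closedBall 0 1)
  have hosc : Continuous fun z => osc fun m => τ.curvature (z, m) := continuous_osc hΩ
  have h3 : ∫ z in unitDisc, (δ / Real.pi) = δ := by
    rw [setIntegral_const]
    simp [Measure.real]
    field_simp
  have h4 : ∫ z in unitDisc, (c z - c' z) ≤
      ∫ z in unitDisc, ((osc fun m => τ.curvature (z, m)) + δ / Real.pi) := by
    refine integral_mono (hint (hc.continuous.sub hc'.continuous))
      (hint (hosc.add continuous_const)) fun z => ?_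
    have e : δ / Real.pi = δ / (2 * Real.pi) + δ / (2 * Real.pi) := by field_simp; ring
    have := (hcu z).2
    have := (hcu' z).1
    have h5 : osc (fun m => τ.curvature (z, m)) = sSup (range fun m => τ.curvature (z, m)) -
      sInf (range fun m => τ.curvature (z, m)) := rfl
    beta_reduce
    rw [h5, e]
    linarith
  rw [integral_sub (hint hc.continuous) (hint hc'.continuous),
    integral_add (hint hosc) (hint continuous_const), h3] at h4
  exact h4

variable [IsManifold (𝓡 n) ∞ L] [CompactSpace L] [ConnectedSpace L] [T2Space M]

/-- Along the boundary, the angular Hamiltonians of two connections preserving `Λ` generate the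
same loop, so their difference depends on `t` only. -/
theorem exists_boundary_difference (hΛ : IsExactLagrangianLoop ω₀ L Λ)
    {τ τ₀ : HamiltonianConnection ω₀} (hτ : τ ∈ connectionsPreserving ω₀ L Λ)
    (hτ₀ : τ₀ ∈ connectionsPreserving ω₀ L Λ) :
    ∃ k : ℝ → ℝ, ContDiff ℝ ∞ k ∧ (∀ t, k (t + 1) = k t) ∧ ∀ t, ∀ m ∈ Λ t,
      angularHam τ.F τ.G ((1, t), m) - angularHam τ₀.F τ₀.G ((1, t), m) = k t := by
  obtain ⟨ι, hι, -⟩ := hΛ.exists_exact_lift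
  obtain ⟨q₀⟩ : Nonempty L := inferInstance
  have h := (τ.vanishesOn_iff hι).1 hτ
  have h₀ := (τ₀.vanishesOn_iff hι).1 hτ₀
  have hconst : ∀ t, ∀ m ∈ Λ t, ∀ m' ∈ Λ t,
      angularHam τ.F τ.G ((1, t), m) - angularHam τ₀.F τ₀.G ((1, t), m) =
      angularHam τ.F τ.G ((1, t), m') - angularHam τ₀.F τ₀.G ((1, t), m') := by
    intro t m hm m' hm'
    rw [← hι.range_eq t] at hm hm'
    obtain ⟨q, rfl⟩ := hm
    obtain ⟨q', rfl⟩ := hm'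
    have := (h₀ t).exists_eq_add_const (h t) q' q
    linarith
  have hmem : ∀ t, ι t q₀ ∈ Λ t := fun t => hι.range_eq t ▸ mem_range_self q₀
  refine ⟨fun t => angularHam τ.F τ.G ((1, t), ι t q₀) - angularHam τ₀.F τ₀.G ((1, t), ι t q₀),
    ?_, fun t => ?_, fun t m hm => hconst t m hm _ (hmem t)⟩
  · have h1 : ContMDiff 𝓘(ℝ, ℝ) (𝓘(ℝ, ℝ × ℝ).prod (𝓡 (2 * n))) ∞
        (fun t : ℝ => (((1 : ℝ), t), ι t q₀)) :=
      (contMDiff_const.prodMk_space contMDiff_id).prodMk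
        (hι.smooth.comp (contMDiff_id.prodMk contMDiff_const))
    exact (((contMDiff_angularHam τ.smooth_F τ.smooth_G).comp h1).sub
      ((contMDiff_angularHam τ₀.smooth_F τ₀.smooth_G).comp h1)).contDiff
  · have h1 : ∀ (τ : HamiltonianConnection ω₀) m,
        angularHam τ.F τ.G ((1, t + 1), m) = angularHam τ.F τ.G ((1, t), m) := fun τ m => by
      simp only [angularHam, circlePt_add_one]
    beta_reduce
    rw [h1, h1]
    exact hconst t _ (hΛ.periodic t ▸ hmem (t + 1)) _ (hmem t)

/-- Replacing the function `c` of a connection form by functions slightly above `max Ω` and slightly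
below `min Ω` gives forms with positive and negative top power. Their classes bound the
nonsymplectic interval, whose length is thus at most the Hofer norm of the curvature. -/
theorem exists_eps_bounds [CompactSpace M] (hΛ : IsExactLagrangianLoop ω₀ L Λ)
    {τ τ₀ : HamiltonianConnection ω₀} (hτ : τ ∈ connectionsPreserving ω₀ L Λ)
    (hτ₀ : τ₀ ∈ connectionsPreserving ω₀ L Λ) {δ : ℝ} (hδ : 0 < δ) :
    ∃ a b : ℝ, epsPlus ω₀ L Λ τ₀ ≤ a ∧ (b : EReal) ≤ epsMinus ω₀ L Λ τ₀ ∧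
      a - b ≤ τ.curvatureNorm + δ := by
  have : Nonempty M := hΛ.nonempty
  obtain ⟨k, hk, hper, hkΛ⟩ := exists_boundary_difference hΛ hτ hτ₀
  obtain ⟨c, c', hc, hc', hcΩ, hcΩ', hcc⟩ := τ.exists_area_bounds hδ
  obtain ⟨ι, hι, -⟩ := hΛ.exists_exact_lift
  have hmem : ∀ {c : ℂ → ℝ} (hc : ContDiff ℝ ∞ c), τ.withArea hc ∈ connectionsPreserving ω₀ L Λ :=
    fun hc => ((τ.withArea hc).vanishesOn_iff hι).2 ((τ.vanishesOn_iff hι).1 hτ)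
  refine ⟨_, _, iInf₂_le _ ⟨τ.withArea hc, hmem hc, τ.isPositive_withArea hc hcΩ,
      classesDifferBy_of_angularHam_sub (τ := τ.withArea hc) hk hper hkΛ⟩,
    le_iSup₂ (f := fun (s : ℝ) (_ : _) => (s : EReal)) _
      ⟨τ.withArea hc', hmem hc', τ.isNegative_withArea hc' hcΩ',
      classesDifferBy_of_angularHam_sub (τ := τ.withArea hc') hk hper hkΛ⟩, ?_⟩
  have e1 : (τ.withArea hc).c = c := rfl
  have e2 : (τ.withArea hc').c = c' := rfl
  rw [e1, e2]
  linarith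

theorem epsPlus_ne_top [CompactSpace M] (hΛ : IsExactLagrangianLoop ω₀ L Λ)
    {τ₀ : HamiltonianConnection ω₀} (hτ₀ : τ₀ ∈ connectionsPreserving ω₀ L Λ) :
    epsPlus ω₀ L Λ τ₀ ≠ ⊤ := by
  obtain ⟨a, b, h, -⟩ := exists_eps_bounds hΛ hτ₀ hτ₀ one_pos
  exact ne_top_of_le_ne_top (EReal.coe_ne_top a) h

theorem epsMinus_ne_bot [CompactSpace M] (hΛ : IsExactLagrangianLoop ω₀ L Λ)
    {τ₀ : HamiltonianConnection ω₀} (hτ₀ : τ₀ ∈ connectionsPreserving ω₀ L Λ) :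
    epsMinus ω₀ L Λ τ₀ ≠ ⊥ := by
  obtain ⟨a, b, -, h, -⟩ := exists_eps_bounds hΛ hτ₀ hτ₀ one_pos
  exact ne_bot_of_le_ne_bot (EReal.coe_ne_bot b) h

theorem nonsymplecticWidth_le_relativeKArea [CompactSpace M] (hΛ : IsExactLagrangianLoop ω₀ L Λ)
    {τ₀ : HamiltonianConnection ω₀} (hτ₀ : τ₀ ∈ connectionsPreserving ω₀ L Λ) :
    nonsymplecticWidth ω₀ L Λ τ₀ ≤ relativeKArea ω₀ L Λ := by
  refine le_iInf₂ fun τ hτ => ?_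
  refine EReal.le_of_forall_lt_iff_le.1 fun r hr => ?_
  have hr' : 0 < r - τ.curvatureNorm := sub_pos.2 (EReal.coe_lt_coe_iff.1 hr)
  obtain ⟨a, b, ha, hb, hab⟩ := exists_eps_bounds hΛ hτ hτ₀ hr'
  refine (EReal.sub_le_sub ha hb).trans ?_
  rw [← EReal.coe_sub]
  exact EReal.coe_le_coe_iff.2 (by linarith)

end Width

end

theorem theoremB {n : ℕ}
    {M : Type*} [TopologicalSpace M] [T2Space M] [CompactSpace M]
    [ChartedSpace (EuclideanSpace ℝ (Fin (2 * n))) M] [IsManifold (𝓡 (2 * n)) ∞ M]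
    [MeasurableSpace M] [BorelSpace M] (ω₀ : SymplecticForm n M)
    (L : Type*) [TopologicalSpace L] [T2Space L] [CompactSpace L] [ConnectedSpace L]
    [ChartedSpace (EuclideanSpace ℝ (Fin n)) L] [IsManifold (𝓡 n) ∞ L]
    (Λ : ℝ → Set M) (hΛ : IsExactLagrangianLoop ω₀ L Λ) :
    relativeKArea ω₀ L Λ = minimalLength ω₀ L Λ ∧
      ∀ τ₀ ∈ connectionsPreserving ω₀ L Λ,
        epsPlus ω₀ L Λ τ₀ ≠ ⊤ ∧ epsMinus ω₀ L Λ τ₀ ≠ ⊥ ∧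
          nonsymplecticWidth ω₀ L Λ τ₀ ≤ relativeKArea ω₀ L Λ := by
  exact ⟨le_antisymm (relativeKArea_le_minimalLength Λ) (minimalLength_le_relativeKArea hΛ),
    fun τ₀ hτ₀ => ⟨epsPlus_ne_top hΛ hτ₀, epsMinus_ne_bot hΛ hτ₀,
      nonsymplecticWidth_le_relativeKArea hΛ hτ₀⟩⟩
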